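/- **Conventions.** C*-algebras need not be unital; functors are endofunctors of the category of C*-algebras and $*$-homomorphisms. Put - $IB=C([0,1],B)$ with evaluations $\mathrm{ev}_t\colon IB\to B$; - $\mathfrak A B=C_b([0,\infty),B)/C_0([0,\infty),B)$, and let $\alpha\colon \mathrm{Id}\Rightarrow\mathfrak A$ be given by the classes of constant functions; - $\mathbb K B$ = the norm closure, in the algebra $\mathcal L_B(l_2(\mathbb N,B))$ of adjointable operators on the standard Hilbert module, of the matrices over $B$ with finitely many non-zero entries. For a functor $F$, $[A,F,B]$ denotes the set of $*$-homomorphisms $A\to FB$ modulo $F$-homotopy: $\varphi_0\sim\varphi_1$ if there is a $*$-homomorphism $\Phi\colon A\to F(IB)$ with $F(\mathrm{ev}_j)\circ\Phi=\varphi_j$ for $j=0,1$. For $G=\mathfrak A^k$ and for $G=\mathfrak N\mathfrak A^k$ with $\mathfrak N$ as below, $[A,G\mathbb K,B]$ carries the sum $[\varphi]+[\psi]=[G(j_0)\varphi+G(j_1)\psi]$, where $j_i\colon\mathbb K\Rightarrow\mathbb K$ is conjugation by the isometry $e_n\mapsto e_{2n+i}$, $i=0,1$; the neutral element is the class of $0$.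 The colimits $\operatorname{colim}_k[A,F\mathfrak A^k\mathbb K,B]$ are taken over $k\ge1$ along the maps induced by the transformations $F\alpha\mathfrak A^k\mathbb K\colon F\mathfrak A^k\mathbb K\Rightarrow F\mathfrak A^{k+1}\mathbb K$, for $F=\mathrm{Id}$ and $F=\mathfrak N$. **The spaces.** Let $\mathsf X$ be a proper metric space and $\mathsf X_0\subset\mathsf X$ a closed, possibly empty, subset such that the pair $(\mathsf X,\mathsf X_0)$ is *scalable*: there are a continuous map $\mathsf X\times[0,\infty)\to\mathsf X$, $(x,t)\mapsto \mathrm{sc}_t x$, with $\mathrm{sc}_t(\mathsf X_0)\subset\mathsf X_0$ for all $t$, and functions $\rho_t\colon[0,\infty)\to[0,\infty)$, $t\ge0$, such that (1) $\mathrm{sc}_0=\mathrm{id}$; (2) $\bigcup_{t\in[0,T]}\mathrm{sc}_t^{-1}(S)$ is bounded for every bounded $S\subset\mathsf X$ and every $T>0$; (3) $\mathrm{dist}(\mathrm{sc}_tx,\mathrm{sc}_ty)\le\rho_t(\mathrm{dist}(x,y))$; (4) every $\rho_t$ is non-decreasing; (5) for every $r$, the function $t\mapsto\rho_t(r)$ is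 bounded and tends to $0$ as $t\to\infty$. Let $\Delta>0$ and let $(X,X_0)$ be a $\Delta$-discretization of $(\mathsf X,\mathsf X_0)$: a subset $X\subset\mathsf X$ with $\mathrm{dist}(x,x')\ge\Delta$ for distinct $x,x'\in X$ and $\mathrm{dist}(y,X)<\Delta$ for all $y\in\mathsf X$, and $X_0=\{x\in X:\mathrm{dist}(x,\mathsf X_0)<\Delta\}$, where $\mathrm{dist}(x,\emptyset)=\infty$. Suppose that $X$ has bounded geometry: for each $R$, the cardinalities of the $R$-balls of $X$ are uniformly bounded. **The functors.** Let $C_0(\mathsf X,\mathsf X_0,A)$ be the C*-algebra of continuous functions $\mathsf X\to A$ that vanish at infinity and on $\mathsf X_0$ (it is $C_0(\mathsf X,\mathsf X_0)\otimes A$). Let $\mathfrak M^u_XB$ be the norm closure in $\mathcal L_B(l_2(X,B))$ of the $X\times X$-matrices of finite propagation with uniformly bounded entries in $B$; let $\mathfrak M^u_{X\supset X_0}B\subset\mathfrak M^u_XB$ be the ideal that is the norm closure of the set of $m\in\mathfrak M^u_XB$ whose support is contained in $N_R(X_0)\times N_R(X_0)$ for some $R$; and let $\mathfrak N B=\mathfrak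 M^u_XB/\mathfrak M^u_{X\supset X_0}B$. **Theorem.** For all C*-algebras $A,B$ and all $k\ge1$, the sets $[C_0(\mathsf X,\mathsf X_0,A),\mathfrak A^k\mathbb K,B]$ and $[A,\mathfrak N\mathfrak A^k\mathbb K,B]$ and their colimits over $k$ are commutative monoids, and there is an isomorphism of commutative monoids $$\operatorname{colim}_k\,[C_0(\mathsf X,\mathsf X_0,A),\mathfrak A^k\mathbb K,B]\;\cong\;\operatorname{colim}_k\,[A,\mathfrak N\mathfrak A^k\mathbb K,B]$$ that is natural in $A$ and $B$. If $A$ is separable, the canonical maps from the terms with $k=1$ to the two colimits are bijective, so that the isomorphism comes from an isomorphism of commutative monoids $$[C_0(\mathsf X,\mathsf X_0,A),\mathfrak A\mathbb K,B]\;\cong\;[A,\mathfrak N\mathfrak A\mathbb K,B].$$ -/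

import Mathlib

open Filter Topology CategoryTheory
open scoped NNReal

universe u

set_option linter.unusedVariables false

namespace AsympAdj

noncomputable section

/-! ### The standard Hilbert module -/

section L2
variable {X : Type*} {B : Type*} [NonUnitalCStarAlgebra B]

/-- The norm `‖∑_{x ∈ s} f(x)^* f(x)‖^{1/2}` of the restriction of `f` to the finite set `s`. -/
def finNorm (s : Finset X) (f : X → B) : ℝ := √‖∑ x ∈ s, star (f x) * f x‖

lemma finNorm_nonneg (s : Finset X) (f : X → B) : 0 ≤ finNorm s f := Real.sqrt_nonneg _

lemma finNorm_sq (s : Finset X) (f : X → B) :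
    finNorm s f ^ 2 = ‖∑ x ∈ s, star (f x) * f x‖ := Real.sq_sqrt (norm_nonneg _)

/-- Auxiliary: a finite column as an element of Mathlib's finite Hilbert module. -/
def finVec (s : Finset X) (f : X → B) : WithCStarModule B (s → B) :=
  (WithCStarModule.equiv B (s → B)).symm fun i => star (f i)

lemma finVec_norm [PartialOrder B] [StarOrderedRing B] (s : Finset X) (f : X → B) :
    ‖finVec s f‖ = finNorm s f := by
  rw [WithCStarModule.pi_norm, finNorm, ← Finset.sum_coe_sort s]
  simp [finVec, WithCStarModule.inner_def]

open scoped InnerProductSpace in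
lemma finVec_inner [PartialOrder B] [StarOrderedRing B] (s : Finset X) (f g : X → B) :
    inner B (finVec s g) (finVec s f) = ∑ x ∈ s, star (f x) * g x := by
  rw [WithCStarModule.pi_inner, ← Finset.sum_coe_sort s]
  simp [finVec, WithCStarModule.inner_def]

lemma finVec_add (s : Finset X) (f g : X → B) :
    finVec s (f + g) = finVec s f + finVec s g := by
  ext i; simp [finVec]

lemma finNorm_add_le (s : Finset X) (f g : X → B) :
    finNorm s (f + g) ≤ finNorm s f + finNorm s g := by
  let _ := CStarAlgebra.spectralOrder B
  have _ := CStarAlgebra.spectralOrderedRing B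
  rw [← finVec_norm, ← finVec_norm, ← finVec_norm, finVec_add]
  exact norm_add_le _ _

lemma norm_sum_star_mul_le (s : Finset X) (f g : X → B) :
    ‖∑ x ∈ s, star (f x) * g x‖ ≤ finNorm s f * finNorm s g := by
  let _ := CStarAlgebra.spectralOrder B
  have _ := CStarAlgebra.spectralOrderedRing B
  rw [← finVec_norm, ← finVec_norm, ← finVec_inner, mul_comm]
  exact CStarModule.norm_inner_le _

lemma finNorm_smul (s : Finset X) (c : ℂ) (f : X → B) :
    finNorm s (c • f) = ‖c‖ * finNorm s f := by
  have : ∑ x ∈ s, star ((c • f) x) * (c • f) x = (star c * c) • ∑ x ∈ s, star (f x) * f x := by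
    simp [Finset.smul_sum, smul_smul, mul_comm, smul_mul_assoc, mul_smul_comm]
  rw [finNorm, this, norm_smul, finNorm, Real.sqrt_mul (norm_nonneg _)]
  simp

lemma finNorm_mono {s t : Finset X} (h : s ⊆ t) (f : X → B) : finNorm s f ≤ finNorm t f := by
  let _ := CStarAlgebra.spectralOrder B
  have _ := CStarAlgebra.spectralOrderedRing B
  apply Real.sqrt_le_sqrt
  apply CStarAlgebra.norm_le_norm_of_nonneg_of_le
  · exact Finset.sum_nonneg fun i _ => star_mul_self_nonneg _
  · exact Finset.sum_le_sum_of_subset_of_nonneg h fun i _ _ => star_mul_self_nonneg _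

lemma norm_apply_le_finNorm {s : Finset X} {x : X} (h : x ∈ s) (f : X → B) :
    ‖f x‖ ≤ finNorm s f := by
  have := finNorm_mono (Finset.singleton_subset_iff.2 h) f
  simpa [finNorm, CStarRing.norm_star_mul_self] using this

lemma finNorm_le_add {s : Finset X} (f g : X → B) :
    finNorm s f ≤ finNorm s (f - g) + finNorm s g := by
  simpa using finNorm_add_le s (f - g) g

lemma summable_iff_finNorm (f : X → B) :
    (Summable fun x => star (f x) * f x) ↔
      ∀ ε > 0, ∃ s : Finset X, ∀ t, Disjoint t s → finNorm t f < ε := by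
  rw [summable_iff_vanishing_norm]
  constructor
  · intro h ε hε
    obtain ⟨s, hs⟩ := h (ε ^ 2) (by positivity)
    refine ⟨s, fun t ht => ?_⟩
    have := hs t ht
    rw [← finNorm_sq] at this
    exact lt_of_pow_lt_pow_left₀ 2 hε.le this
  · intro h ε hε
    obtain ⟨s, hs⟩ := h (√ε) (by positivity)
    refine ⟨s, fun t ht => ?_⟩
    rw [← finNorm_sq, ← Real.sq_sqrt hε.le]
    exact pow_lt_pow_left₀ (hs t ht) (finNorm_nonneg _ _) (by norm_num)

variable (X B) in
/-- The functions `f : X → B` for which `∑ₓ f(x)^* f(x)` is norm convergent. -/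
def l2Submodule : Submodule ℂ (X → B) where
  carrier := {f | Summable fun x => star (f x) * f x}
  zero_mem' := by simp [summable_zero]
  add_mem' := by
    intro f g hf hg
    change Summable _ at hf hg
    change Summable _
    rw [summable_iff_finNorm] at *
    intro ε hε
    classical
    obtain ⟨s, hs⟩ := hf (ε / 2) (by positivity)
    obtain ⟨t, ht⟩ := hg (ε / 2) (by positivity)
    refine ⟨s ∪ t, fun r hr => ?_⟩
    rw [Finset.disjoint_union_right] at hr
    linarith [hs r hr.1, ht r hr.2, finNorm_add_le r f g]
  smul_mem' := by
    intro c f hf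
    have : (fun x => star ((c • f) x) * (c • f) x) = fun x => (star c * c) • (star (f x) * f x) := by
      ext x; simp [smul_smul, mul_comm, smul_mul_assoc, mul_smul_comm]
    change Summable _
    rw [this]
    exact Summable.const_smul _ hf

variable (X B) in
/-- The standard Hilbert `B`-module `l₂(X, B)`. -/
@[ext] structure L2 where
  toFun : X → B
  mem : toFun ∈ l2Submodule X B

instance : CoeFun (L2 X B) fun _ => X → B := ⟨L2.toFun⟩

lemma L2.coe_injective : Function.Injective (L2.toFun : L2 X B → X → B) := fun _ _ => L2.ext

lemma L2.ext_apply {f g : L2 X B} (h : ∀ x, f x = g x) : f = g := L2.ext (funext h)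

lemma L2.summable (f : L2 X B) : Summable fun x => star (f x) * f x := f.mem

instance : Zero (L2 X B) := ⟨⟨0, zero_mem _⟩⟩
instance : Add (L2 X B) := ⟨fun f g => ⟨f.toFun + g.toFun, add_mem f.mem g.mem⟩⟩
instance : Neg (L2 X B) := ⟨fun f => ⟨-f.toFun, neg_mem f.mem⟩⟩
instance : Sub (L2 X B) := ⟨fun f g => ⟨f.toFun - g.toFun, sub_mem f.mem g.mem⟩⟩
instance : SMul ℕ (L2 X B) := ⟨fun n f => ⟨n • f.toFun, nsmul_mem f.mem n⟩⟩
instance : SMul ℤ (L2 X B) := ⟨fun n f => ⟨n • f.toFun, zsmul_mem f.mem n⟩⟩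
instance : SMul ℂ (L2 X B) := ⟨fun c f => ⟨c • f.toFun, Submodule.smul_mem _ c f.mem⟩⟩

@[simp] lemma L2.coe_add (f g : L2 X B) : (f + g).toFun = f.toFun + g.toFun := rfl
@[simp] lemma L2.coe_sub (f g : L2 X B) : (f - g).toFun = f.toFun - g.toFun := rfl
@[simp] lemma L2.coe_neg (f : L2 X B) : (-f).toFun = -f.toFun := rfl
@[simp] lemma L2.coe_zero : (0 : L2 X B).toFun = 0 := rfl
@[simp] lemma L2.coe_smul (c : ℂ) (f : L2 X B) : (c • f).toFun = c • f.toFun := rfl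

instance : AddCommGroup (L2 X B) :=
  L2.coe_injective.addCommGroup _ rfl (fun _ _ => rfl) (fun _ => rfl) (fun _ _ => rfl)
    (fun _ _ => rfl) (fun _ _ => rfl)

/-- The inclusion of `l₂(X, B)` into all functions, as an additive map. -/
def L2.coeHom : L2 X B →+ (X → B) where
  toFun := L2.toFun
  map_zero' := rfl
  map_add' _ _ := rfl

instance : Module ℂ (L2 X B) := L2.coe_injective.module ℂ L2.coeHom (fun _ _ => rfl)

/-- The `B`-valued inner product `⟨f, g⟩ = ∑ₓ f(x)^* g(x)`. -/
def L2.inner (f g : L2 X B) : B := ∑' x, star (f x) * g x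

lemma L2.tendsto_finNorm (f : L2 X B) :
    Tendsto (fun s => finNorm s f.toFun) atTop (𝓝 (√‖L2.inner f f‖)) :=
  (Real.continuous_sqrt.tendsto _).comp (f.summable.hasSum.norm)

instance : Norm (L2 X B) := ⟨fun f => √‖L2.inner f f‖⟩

lemma L2.norm_def (f : L2 X B) : ‖f‖ = √‖L2.inner f f‖ := rfl

lemma L2.finNorm_le (f : L2 X B) (s : Finset X) : finNorm s f.toFun ≤ ‖f‖ := by
  refine ge_of_tendsto f.tendsto_finNorm ?_
  filter_upwards [eventually_ge_atTop s] with t ht using finNorm_mono ht _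

lemma L2.norm_le_of_finNorm {f : L2 X B} {C : ℝ} (h : ∀ s, finNorm s f.toFun ≤ C) : ‖f‖ ≤ C :=
  le_of_tendsto' f.tendsto_finNorm h

lemma L2.norm_apply_le (f : L2 X B) (x : X) : ‖f x‖ ≤ ‖f‖ :=
  (norm_apply_le_finNorm (Finset.mem_singleton_self x) _).trans (f.finNorm_le _)

lemma L2.core : NormedSpace.Core ℂ (L2 X B) where
  norm_nonneg f := Real.sqrt_nonneg _
  norm_eq_zero_iff f := by
    constructor
    · intro h
      refine L2.ext_apply fun x => ?_
      exact norm_le_zero_iff.1 ((f.norm_apply_le x).trans h.le)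
    · rintro rfl
      simp [L2.norm_def, L2.inner]
  norm_smul c f := by
    refine tendsto_nhds_unique (c • f).tendsto_finNorm ?_
    simp_rw [L2.coe_smul, finNorm_smul]
    exact f.tendsto_finNorm.const_mul _
  norm_triangle f g := L2.norm_le_of_finNorm fun s =>
    (finNorm_add_le s f.toFun g.toFun).trans (add_le_add (f.finNorm_le s) (g.finNorm_le s))

instance : NormedAddCommGroup (L2 X B) := NormedAddCommGroup.ofCore L2.core
instance : NormedSpace ℂ (L2 X B) := NormedSpace.ofCore L2.core

lemma L2.norm_sq (f : L2 X B) : ‖f‖ ^ 2 = ‖L2.inner f f‖ := Real.sq_sqrt (norm_nonneg _)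

lemma L2.summable_inner (f g : L2 X B) : Summable fun x => star (f x) * g x := by
  rw [summable_iff_vanishing_norm]
  intro ε hε
  obtain ⟨s, hs⟩ := (summable_iff_finNorm f.toFun).1 f.mem (ε / (‖g‖ + 1)) (by positivity)
  refine ⟨s, fun t ht => ?_⟩
  calc _ ≤ finNorm t f.toFun * finNorm t g.toFun := norm_sum_star_mul_le t _ _
    _ ≤ ε / (‖g‖ + 1) * ‖g‖ := by
        gcongr
        · exact finNorm_nonneg _ _
        · exact (hs t ht).le
        · exact g.finNorm_le t
    _ < ε := by
        rw [div_mul_eq_mul_div, div_lt_iff₀ (by positivity)]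
        nlinarith [norm_nonneg g]

lemma L2.norm_inner_le (f g : L2 X B) : ‖L2.inner f g‖ ≤ ‖f‖ * ‖g‖ := by
  refine le_of_tendsto' (L2.summable_inner f g).hasSum.norm fun s => ?_
  exact (norm_sum_star_mul_le s _ _).trans (by gcongr <;> first | exact finNorm_nonneg _ _ | exact L2.finNorm_le _ _)

lemma L2.star_inner (f g : L2 X B) : star (L2.inner f g) = L2.inner g f := by
  have h := (L2.summable_inner f g).hasSum.star
  simp only [star_mul, star_star] at h
  exact h.tsum_eq.symm

lemma L2.inner_add_right (f g h : L2 X B) :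
    L2.inner f (g + h) = L2.inner f g + L2.inner f h := by
  rw [L2.inner, L2.inner, L2.inner, ← (L2.summable_inner f g).tsum_add (L2.summable_inner f h)]
  simp [mul_add]

lemma L2.inner_smul_right (c : ℂ) (f g : L2 X B) : L2.inner f (c • g) = c • L2.inner f g := by
  rw [L2.inner, L2.inner, ← (L2.summable_inner f g).tsum_const_smul]
  simp [mul_smul_comm]

lemma L2.inner_self_eq_zero {f : L2 X B} (h : L2.inner f f = 0) : f = 0 := by
  rw [← norm_eq_zero, L2.norm_def, h]; simp

/-- The inner product as a continuous linear functional of the second variable. -/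
def L2.innerL (f : L2 X B) : L2 X B →L[ℂ] B :=
  LinearMap.mkContinuous
    { toFun := L2.inner f
      map_add' := L2.inner_add_right f
      map_smul' := fun c g => L2.inner_smul_right c f g } ‖f‖ fun g => L2.norm_inner_le f g

@[simp] lemma L2.innerL_apply (f g : L2 X B) : L2.innerL f g = L2.inner f g := rfl

lemma L2.inner_sub_right (f g h : L2 X B) :
    L2.inner f (g - h) = L2.inner f g - L2.inner f h := map_sub (L2.innerL f) g h

lemma L2.inner_left_injective {f g : L2 X B} (h : ∀ k, L2.inner k f = L2.inner k g) : f = g := by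
  rw [← sub_eq_zero]
  apply L2.inner_self_eq_zero
  rw [L2.inner_sub_right, h, sub_self]

/-- Evaluation at a point, as a continuous linear map. -/
def L2.evalL (x : X) : L2 X B →L[ℂ] B :=
  LinearMap.mkContinuous
    { toFun := fun f => f x
      map_add' := fun _ _ => rfl
      map_smul' := fun _ _ => rfl } 1 fun f => by rw [one_mul]; exact f.norm_apply_le x

@[simp] lemma L2.evalL_apply (x : X) (f : L2 X B) : L2.evalL x f = f x := rfl

instance : CompleteSpace (L2 X B) := by
  refine Metric.complete_of_cauchySeq_tendsto fun u hu => ?_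
  have hpt : ∀ x, ∃ b, Tendsto (fun n => u n x) atTop (𝓝 b) := fun x =>
    cauchySeq_tendsto_of_complete (hu.map (L2.evalL x).uniformContinuous)
  choose f hf using hpt
  have hlim : ∀ ε > 0, ∃ N, ∀ n ≥ N, ∀ s, finNorm s ((u n).toFun - f) ≤ ε := by
    intro ε hε
    obtain ⟨N, hN⟩ := Metric.cauchySeq_iff.1 hu ε hε
    refine ⟨N, fun n hn s => ?_⟩
    have ht : Tendsto (fun m => finNorm s ((u n).toFun - (u m).toFun)) atTop
        (𝓝 (finNorm s ((u n).toFun - f))) := by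
      unfold finNorm
      refine (Real.continuous_sqrt.tendsto _).comp (Tendsto.norm (tendsto_finsetSum _ fun x _ => ?_))
      have h1 : Tendsto (fun m => (u n).toFun x - (u m).toFun x) atTop (𝓝 ((u n).toFun x - f x)) :=
        tendsto_const_nhds.sub (hf x)
      exact h1.star.mul h1
    refine le_of_tendsto ht ?_
    filter_upwards [eventually_ge_atTop N] with m hm
    have := hN n hn m hm
    rw [dist_eq_norm] at this
    exact ((u n - u m).finNorm_le s).trans this.le
  have hmem : Summable fun x => star (f x) * f x := by
    rw [summable_iff_finNorm]
    intro ε hε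
    obtain ⟨N, hN⟩ := hlim (ε / 2) (by positivity)
    obtain ⟨s, hs⟩ := (summable_iff_finNorm (u N).toFun).1 (u N).mem (ε / 2) (by positivity)
    refine ⟨s, fun t ht => ?_⟩
    have h1 := hN N le_rfl t
    have h2 := hs t ht
    have h3 := finNorm_add_le t (f - (u N).toFun) (u N).toFun
    have h4 : finNorm t (f - (u N).toFun) = finNorm t ((u N).toFun - f) := by
      have : f - (u N).toFun = (-1 : ℂ) • ((u N).toFun - f) := by simp
      rw [this, finNorm_smul]; simp
    simp only [sub_add_cancel] at h3
    linarith
  refine ⟨⟨f, hmem⟩, ?_⟩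
  rw [Metric.tendsto_atTop]
  intro ε hε
  obtain ⟨N, hN⟩ := hlim (ε / 2) (by positivity)
  refine ⟨N, fun n hn => ?_⟩
  rw [dist_eq_norm]
  have : ‖u n - ⟨f, hmem⟩‖ ≤ ε / 2 := L2.norm_le_of_finNorm fun s => hN n hn s
  linarith

end L2

section Adjointable
variable {X : Type*} {B : Type*} [NonUnitalCStarAlgebra B]

/-- The right action `ξ ↦ ξ b` of `B` on `l₂(X, B)`. -/
def L2.rmul (f : L2 X B) (b : B) : L2 X B where
  toFun x := f x * b
  mem := by
    have h := (f.summable.mul_right b).mul_left (star b)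
    change Summable _
    simpa only [star_mul, mul_assoc] using h

@[simp] lemma L2.rmul_apply (f : L2 X B) (b : B) (x : X) : (f.rmul b) x = f x * b := rfl

lemma L2.rmul_add (f : L2 X B) (a b : B) : f.rmul (a + b) = f.rmul a + f.rmul b :=
  L2.ext_apply fun x => mul_add _ _ _

lemma L2.add_rmul (f g : L2 X B) (b : B) : (f + g).rmul b = f.rmul b + g.rmul b :=
  L2.ext_apply fun x => add_mul _ _ _

lemma L2.sub_rmul (f g : L2 X B) (b : B) : (f - g).rmul b = f.rmul b - g.rmul b :=
  L2.ext_apply fun x => sub_mul _ _ _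

lemma L2.smul_rmul (c : ℂ) (f : L2 X B) (b : B) : (c • f).rmul b = c • f.rmul b :=
  L2.ext_apply fun x => smul_mul_assoc _ _ _

lemma L2.rmul_smul (c : ℂ) (f : L2 X B) (b : B) : f.rmul (c • b) = c • f.rmul b :=
  L2.ext_apply fun x => mul_smul_comm _ _ _

lemma L2.rmul_rmul (f : L2 X B) (a b : B) : (f.rmul a).rmul b = f.rmul (a * b) :=
  L2.ext_apply fun x => mul_assoc _ _ _

lemma L2.inner_rmul_right (f g : L2 X B) (b : B) :
    L2.inner f (g.rmul b) = L2.inner f g * b := by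
  rw [L2.inner, L2.inner, ← (L2.summable_inner f g).tsum_mul_right]
  simp [mul_assoc]

lemma L2.inner_rmul_left (f g : L2 X B) (b : B) :
    L2.inner (f.rmul b) g = star b * L2.inner f g := by
  rw [← L2.star_inner, L2.inner_rmul_right, star_mul, L2.star_inner]

lemma L2.norm_rmul_sq (f : L2 X B) (b : B) :
    ‖f.rmul b‖ ^ 2 = ‖star b * L2.inner f f * b‖ := by
  rw [L2.norm_sq, L2.inner_rmul_right, L2.inner_rmul_left]

lemma L2.norm_rmul_le (f : L2 X B) (b : B) : ‖f.rmul b‖ ≤ ‖f‖ * ‖b‖ := by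
  refine le_of_sq_le_sq ?_ (by positivity)
  rw [L2.norm_rmul_sq, mul_pow, L2.norm_sq]
  refine (norm_mul_le _ _).trans ?_
  refine (mul_le_mul_of_nonneg_right (norm_mul_le _ _) (norm_nonneg _)).trans ?_
  rw [norm_star]; apply le_of_eq; ring

lemma L2.eq_of_rmul {f g : L2 X B} (h : ∀ b, f.rmul b = g.rmul b) : f = g := by
  refine L2.ext_apply fun x => ?_
  have h1 : (f x - g x) * star (f x - g x) = 0 := by
    have := congrArg (fun k : L2 X B => k x) (h (star (f x - g x)))
    simp only [L2.rmul_apply] at this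
    rw [sub_mul, this, sub_self]
  exact sub_eq_zero.1 ((CStarRing.mul_star_self_eq_zero_iff _).1 h1)

/-- Right multiplication by `b` as a continuous linear map. -/
def L2.rmulL (b : B) : L2 X B →L[ℂ] L2 X B :=
  LinearMap.mkContinuous
    { toFun := fun f => f.rmul b
      map_add' := fun f g => L2.add_rmul f g b
      map_smul' := fun c f => L2.smul_rmul c f b } ‖b‖ fun f => by
        rw [mul_comm]; exact f.norm_rmul_le b

@[simp] lemma L2.rmulL_apply (b : B) (f : L2 X B) : L2.rmulL b f = f.rmul b := rfl

open Classical in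
/-- The vector `e_y b` of `l₂(X, B)`. -/
def L2.single (y : X) (b : B) : L2 X B where
  toFun := Pi.single y b
  mem := by
    change Summable _
    refine summable_of_ne_finset_zero (s := {y}) fun x hx => ?_
    rw [Finset.mem_singleton] at hx
    simp [Pi.single_eq_of_ne hx]

@[simp] lemma L2.single_same (y : X) (b : B) : (L2.single y b) y = b := by
  simp [L2.single]

lemma L2.single_of_ne {x y : X} (h : x ≠ y) (b : B) : (L2.single y b) x = 0 := by
  classical
  exact Pi.single_eq_of_ne h _

lemma L2.rmul_single (y : X) (a b : B) : (L2.single y a).rmul b = L2.single y (a * b) := by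
  refine L2.ext_apply fun x => ?_
  by_cases h : x = y
  · subst h; simp
  · simp [L2.single_of_ne h]

lemma L2.inner_single_left (y : X) (b : B) (f : L2 X B) :
    L2.inner (L2.single y b) f = star b * f y := by
  rw [L2.inner, tsum_eq_single y]
  · simp
  · intro x hx; simp [L2.single_of_ne hx]

lemma L2.finNorm_sum_single [DecidableEq X] (f : X → B) (s t : Finset X) :
    finNorm t (∑ y ∈ s, L2.single y (f y)).toFun = finNorm (t ∩ s) f := by
  have key : ∀ x, (∑ y ∈ s, L2.single y (f y)).toFun x = if x ∈ s then f x else 0 := by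
    intro x
    have : (∑ y ∈ s, L2.single y (f y)).toFun x = ∑ y ∈ s, (L2.single y (f y)) x :=
      map_sum (L2.evalL x) _ _
    rw [this]
    split_ifs with h
    · rw [Finset.sum_eq_single_of_mem x h fun y _ hy => L2.single_of_ne hy.symm _]
      simp
    · refine Finset.sum_eq_zero fun y hy => L2.single_of_ne ?_ _
      rintro rfl; exact h hy
  unfold finNorm
  congr 2
  rw [Finset.sum_congr rfl fun x _ => by rw [key x]]
  rw [← Finset.filter_mem_eq_inter, Finset.sum_filter]
  refine Finset.sum_congr rfl fun x _ => ?_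
  split_ifs <;> simp

lemma L2.norm_sum_single (f : X → B) (s : Finset X) :
    ‖∑ y ∈ s, L2.single y (f y)‖ = finNorm s f := by
  classical
  apply le_antisymm
  · refine L2.norm_le_of_finNorm fun t => ?_
    rw [L2.finNorm_sum_single]
    exact finNorm_mono Finset.inter_subset_right _
  · refine le_trans (le_of_eq ?_) (L2.finNorm_le _ s)
    rw [L2.finNorm_sum_single, Finset.inter_self]

lemma L2.hasSum_single (f : L2 X B) : HasSum (fun y => L2.single y (f y)) f := by
  have hs : Summable fun y => L2.single y (f y) := by
    rw [summable_iff_vanishing_norm]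
    intro ε hε
    obtain ⟨s, hs⟩ := (summable_iff_finNorm f.toFun).1 f.mem ε hε
    exact ⟨s, fun t ht => by rw [L2.norm_sum_single]; exact hs t ht⟩
  convert hs.hasSum
  refine L2.ext_apply fun x => ?_
  have h1 := hs.hasSum.mapL (L2.evalL x)
  have h2 : HasSum (fun y => L2.evalL x (L2.single y (f y))) (f x) := by
    have h3 := _root_.hasSum_single (f := fun y => L2.evalL x (L2.single y (f y))) x
      (fun y hy => L2.single_of_ne (Ne.symm hy) _)
    simpa using h3
  exact h2.unique h1

variable (X B) in
/-- The algebra of adjointable operators on `l₂(X, B)`: bounded linear operators `T` that have an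
adjoint `S` for the `B`-valued inner product. -/
def adjointable : Subalgebra ℂ (L2 X B →L[ℂ] L2 X B) where
  carrier := {T | ∃ S : L2 X B →L[ℂ] L2 X B, ∀ ξ ζ, L2.inner (S ξ) ζ = L2.inner ξ (T ζ)}
  mul_mem' := by
    rintro T T' ⟨S, hS⟩ ⟨S', hS'⟩
    exact ⟨S' * S, fun ξ ζ => by simp [hS, hS']⟩
  add_mem' := by
    rintro T T' ⟨S, hS⟩ ⟨S', hS'⟩
    refine ⟨S + S', fun ξ ζ => ?_⟩
    rw [← L2.star_inner]
    simp only [add_apply, L2.inner_add_right, star_add, L2.star_inner, hS, hS']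
  algebraMap_mem' c := by
    refine ⟨algebraMap ℂ _ (star c), fun ξ ζ => ?_⟩
    rw [← L2.star_inner]
    simp [Algebra.algebraMap_eq_smul_one, L2.inner_smul_right, L2.star_inner]

variable (X B) in
/-- Auxiliary: the underlying type of the algebra of adjointable operators. -/
abbrev PreAdj : Type _ := adjointable X B

lemma PreAdj.exists_adjoint (T : PreAdj X B) : ∃ S : PreAdj X B,
    ∀ ξ ζ, L2.inner (S.1 ξ) ζ = L2.inner ξ (T.1 ζ) := by
  obtain ⟨S, hS⟩ := T.2
  refine ⟨⟨S, T.1, fun ξ ζ => ?_⟩, hS⟩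
  rw [← L2.star_inner, ← hS, L2.star_inner]

instance : Star (PreAdj X B) := ⟨fun T => T.exists_adjoint.choose⟩

lemma PreAdj.star_inner_left (T : PreAdj X B) (ξ ζ : L2 X B) :
    L2.inner ((star T).1 ξ) ζ = L2.inner ξ (T.1 ζ) := T.exists_adjoint.choose_spec ξ ζ

lemma PreAdj.inner_left (T : PreAdj X B) (ξ ζ : L2 X B) :
    L2.inner (T.1 ξ) ζ = L2.inner ξ ((star T).1 ζ) := by
  rw [← L2.star_inner, ← T.star_inner_left, L2.star_inner]

lemma PreAdj.ext_apply {S T : PreAdj X B} (h : ∀ ξ, S.1 ξ = T.1 ξ) : S = T :=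
  Subtype.ext (ContinuousLinearMap.ext h)

lemma PreAdj.star_eq_of {S T : PreAdj X B} (h : ∀ ξ ζ, L2.inner (S.1 ξ) ζ = L2.inner ξ (T.1 ζ)) :
    star S = T :=
  PreAdj.ext_apply fun ζ => L2.inner_left_injective fun ξ => by rw [← S.inner_left, h]

instance : StarRing (PreAdj X B) where
  star_involutive T := PreAdj.star_eq_of fun ξ ζ => T.star_inner_left ξ ζ
  star_mul S T := PreAdj.star_eq_of fun ξ ζ => by
    change L2.inner (S.1 (T.1 ξ)) ζ = L2.inner ξ ((star T).1 ((star S).1 ζ))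
    rw [S.inner_left, T.inner_left]
  star_add S T := PreAdj.star_eq_of fun ξ ζ => by
    change L2.inner (S.1 ξ + T.1 ξ) ζ = L2.inner ξ ((star S).1 ζ + (star T).1 ζ)
    rw [L2.inner_add_right, ← S.inner_left, ← T.inner_left, ← L2.star_inner, L2.inner_add_right,
      star_add, L2.star_inner, L2.star_inner]

instance : StarModule ℂ (PreAdj X B) where
  star_smul c T := PreAdj.star_eq_of fun ξ ζ => by
    change L2.inner (c • T.1 ξ) ζ = L2.inner ξ (star c • (star T).1 ζ)
    rw [L2.inner_smul_right, ← T.inner_left, ← L2.star_inner, L2.inner_smul_right, star_smul,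
      L2.star_inner]

instance : CStarRing (PreAdj X B) where
  norm_mul_self_le T := by
    have h : ‖T‖ ≤ √‖star T * T‖ := by
      refine ContinuousLinearMap.opNorm_le_bound T.1 (Real.sqrt_nonneg _) fun ξ => ?_
      refine le_of_sq_le_sq ?_ (by positivity)
      have e := Real.sq_sqrt (norm_nonneg (star T * T))
      rw [mul_pow, e, L2.norm_sq, T.inner_left]
      change ‖L2.inner ξ ((star T * T).1 ξ)‖ ≤ _
      refine (L2.norm_inner_le _ _).trans ?_
      have := (star T * T).1.le_opNorm ξ
      calc _ ≤ ‖ξ‖ * (‖star T * T‖ * ‖ξ‖) := by gcongr; exact this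
        _ = _ := by ring
    calc ‖T‖ * ‖T‖ ≤ √‖star T * T‖ * √‖star T * T‖ := by gcongr
      _ = _ := Real.mul_self_sqrt (norm_nonneg _)

instance : CompleteSpace (PreAdj X B) := by
  refine Metric.complete_of_cauchySeq_tendsto fun u hu => ?_
  have hu' : CauchySeq fun n => star (u n) := by
    rw [Metric.cauchySeq_iff] at hu ⊢
    intro ε hε
    obtain ⟨N, hN⟩ := hu ε hε
    refine ⟨N, fun m hm n hn => ?_⟩
    have := hN m hm n hn
    rw [dist_eq_norm] at this ⊢
    have e : ‖star (u m - u n)‖ < ε := (norm_star (u m - u n)).trans_lt this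
    rw [star_sub] at e
    exact e
  have h1 : CauchySeq fun n => (u n).1 := hu.map uniformContinuous_subtype_val
  have h2 : CauchySeq fun n => (star (u n)).1 := hu'.map uniformContinuous_subtype_val
  obtain ⟨T, hT⟩ := cauchySeq_tendsto_of_complete h1
  obtain ⟨S, hS⟩ := cauchySeq_tendsto_of_complete h2
  refine ⟨⟨T, S, fun ξ ζ => ?_⟩, tendsto_subtype_rng.2 hT⟩
  have hTζ : Tendsto (fun n => (u n).1 ζ) atTop (𝓝 (T ζ)) :=
    ((ContinuousLinearMap.apply ℂ _ ζ).continuous.tendsto T).comp hT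
  have hSξ : Tendsto (fun n => (star (u n)).1 ξ) atTop (𝓝 (S ξ)) :=
    ((ContinuousLinearMap.apply ℂ _ ξ).continuous.tendsto S).comp hS
  have e1 := ((L2.innerL ξ).continuous.tendsto _).comp hTζ
  have e2 := (((L2.innerL ζ).continuous.tendsto _).comp hSξ).star
  simp only [L2.innerL_apply, L2.star_inner] at e1 e2
  refine tendsto_nhds_unique e2 (e1.congr fun n => ?_)
  simp only [Function.comp_apply, L2.innerL_apply, L2.star_inner]
  exact ((u n).star_inner_left ξ ζ).symm

instance : CStarAlgebra (PreAdj X B) where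

lemma PreAdj.map_rmul (T : PreAdj X B) (ξ : L2 X B) (b : B) : T.1 (ξ.rmul b) = (T.1 ξ).rmul b :=
  L2.inner_left_injective fun k => by
    rw [← T.star_inner_left, L2.inner_rmul_right, L2.inner_rmul_right, T.star_inner_left]

variable (X B) in
/-- The C*-algebra `𝓛_B(l₂(X, B))` of adjointable operators. -/
def Adj : Type _ := adjointable X B

instance : CStarAlgebra (Adj X B) := inferInstanceAs (CStarAlgebra (PreAdj X B))

/-- The bounded operator underlying an adjointable operator. -/
def Adj.op (T : Adj X B) : L2 X B →L[ℂ] L2 X B := T.1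

/-- An operator with an adjoint, as an element of `Adj`. -/
def Adj.mk (T S : L2 X B →L[ℂ] L2 X B) (h : ∀ ξ ζ, L2.inner (S ξ) ζ = L2.inner ξ (T ζ)) :
    Adj X B := ⟨T, S, h⟩

@[simp] lemma Adj.mk_op (T S : L2 X B →L[ℂ] L2 X B)
    (h : ∀ ξ ζ, L2.inner (S ξ) ζ = L2.inner ξ (T ζ)) : (Adj.mk T S h).op = T := rfl

lemma Adj.add_op (S T : Adj X B) (ξ : L2 X B) : (S + T).op ξ = S.op ξ + T.op ξ := rfl
lemma Adj.sub_op (S T : Adj X B) (ξ : L2 X B) : (S - T).op ξ = S.op ξ - T.op ξ := rfl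
lemma Adj.zero_op (ξ : L2 X B) : (0 : Adj X B).op ξ = 0 := rfl
lemma Adj.smul_op (c : ℂ) (T : Adj X B) (ξ : L2 X B) : (c • T).op ξ = c • T.op ξ := rfl
lemma Adj.mul_op (S T : Adj X B) (ξ : L2 X B) : (S * T).op ξ = S.op (T.op ξ) := rfl

lemma Adj.norm_op (T : Adj X B) : ‖T.op‖ = ‖T‖ := rfl

lemma Adj.le_norm (T : Adj X B) (ξ : L2 X B) : ‖T.op ξ‖ ≤ ‖T‖ * ‖ξ‖ := T.op.le_opNorm ξ

lemma Adj.continuous_op : Continuous (Adj.op : Adj X B → _) :=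
  (continuous_subtype_val : Continuous (fun T : PreAdj X B => T.1))

lemma Adj.star_inner_left (T : Adj X B) (ξ ζ : L2 X B) :
    L2.inner ((star T).op ξ) ζ = L2.inner ξ (T.op ζ) := PreAdj.star_inner_left T ξ ζ

lemma Adj.inner_left (T : Adj X B) (ξ ζ : L2 X B) :
    L2.inner (T.op ξ) ζ = L2.inner ξ ((star T).op ζ) := PreAdj.inner_left T ξ ζ

lemma Adj.ext_apply {S T : Adj X B} (h : ∀ ξ, S.op ξ = T.op ξ) : S = T := PreAdj.ext_apply h

lemma Adj.star_eq_of {S T : Adj X B} (h : ∀ ξ ζ, L2.inner (S.op ξ) ζ = L2.inner ξ (T.op ζ)) :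
    star S = T := PreAdj.star_eq_of h

lemma Adj.map_rmul (T : Adj X B) (ξ : L2 X B) (b : B) : T.op (ξ.rmul b) = (T.op ξ).rmul b :=
  PreAdj.map_rmul T ξ b

end Adjointable

section Columns
variable {X : Type*} {A B C : Type*} [NonUnitalCStarAlgebra A] [NonUnitalCStarAlgebra B]
  [NonUnitalCStarAlgebra C]

/-- The operator `T` has the vectors `c y ∈ l₂(X, B)` as its columns: `T (e_y b) = c_y b`. -/
def HasCols (T : Adj X B) (c : X → L2 X B) : Prop :=
  ∀ y b, T.op (L2.single y b) = (c y).rmul b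

lemma HasCols.unique {T : Adj X B} {c c' : X → L2 X B} (h : HasCols T c) (h' : HasCols T c') :
    c = c' :=
  funext fun y => L2.eq_of_rmul fun b => by rw [← h, ← h']

lemma HasCols.hasSum {T : Adj X B} {c : X → L2 X B} (h : HasCols T c) (ξ : L2 X B) :
    HasSum (fun y => (c y).rmul (ξ y)) (T.op ξ) := by
  simpa only [h _ _] using ξ.hasSum_single.mapL T.op

lemma HasCols.ext {S T : Adj X B} {c : X → L2 X B} (hS : HasCols S c) (hT : HasCols T c) :
    S = T :=
  Adj.ext_apply fun ξ => (hS.hasSum ξ).unique (hT.hasSum ξ)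

lemma HasCols.add {S T : Adj X B} {c d : X → L2 X B} (hS : HasCols S c) (hT : HasCols T d) :
    HasCols (S + T) fun y => c y + d y := fun y b => by
  change S.op _ + T.op _ = _
  rw [hS, hT, L2.add_rmul]

lemma HasCols.sub {S T : Adj X B} {c d : X → L2 X B} (hS : HasCols S c) (hT : HasCols T d) :
    HasCols (S - T) fun y => c y - d y := fun y b => by
  change S.op _ - T.op _ = _
  rw [hS, hT, L2.sub_rmul]

lemma HasCols.smul {S : Adj X B} {c : X → L2 X B} (z : ℂ) (hS : HasCols S c) :
    HasCols (z • S) fun y => z • c y := fun y b => by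
  change z • S.op _ = _
  rw [hS, L2.smul_rmul]

lemma HasCols.zero : HasCols (0 : Adj X B) 0 := fun y b =>
  L2.ext_apply fun x => by simp [Adj.zero_op]

lemma HasCols.mul {S T : Adj X B} {d : X → L2 X B} (hT : HasCols T d) :
    HasCols (S * T) fun y => S.op (d y) := fun y b => by
  change S.op (T.op _) = _
  rw [hT, S.map_rmul]

lemma HasCols.star_apply {T : Adj X B} {c d : X → L2 X B} (hT : HasCols T c)
    (hT' : HasCols (star T) d) (x y : X) : (d x) y = star ((c y) x) := by
  have key : ∀ a b : B, star a * (d x y - star (c y x)) * b = 0 := by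
    intro a b
    have h := T.inner_left (L2.single y a) (L2.single x b)
    rw [hT, hT', ← L2.star_inner, L2.inner_single_left, L2.inner_single_left] at h
    simp only [L2.rmul_apply, star_mul, star_star] at h
    rw [mul_sub, sub_mul, mul_assoc, ← h, mul_assoc, sub_self]
  have h1 := key (d x y - star (c y x)) (star (d x y - star (c y x)) * (d x y - star (c y x)))
  have h2 : star (d x y - star (c y x)) * (d x y - star (c y x)) = 0 := by
    rw [← CStarRing.star_mul_self_eq_zero_iff]
    simpa using h1
  exact sub_eq_zero.1 ((CStarRing.star_mul_self_eq_zero_iff _).1 h2)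

lemma HasCols.norm_le {T : Adj X B} {c : X → L2 X B} (hT : HasCols T c) (y : X) :
    ‖c y‖ ≤ ‖T‖ := by
  set g := L2.inner (c y) (c y) with hg
  have hsa : star g = g := L2.star_inner _ _
  have hsingle : ‖L2.single y g‖ = ‖g‖ := by
    have := L2.norm_sum_single (fun _ : X => g) {y}
    simpa [finNorm, CStarRing.norm_star_mul_self] using this
  have h1 : ‖(c y).rmul g‖ ≤ ‖T‖ * ‖g‖ := by
    rw [← hT, ← hsingle]
    exact T.le_norm _
  have h2 : ‖g * g * g‖ ≤ (‖T‖ * ‖g‖) ^ 2 := by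
    have := L2.norm_rmul_sq (c y) g
    rw [← hg, hsa] at this
    rw [← this]
    exact pow_le_pow_left₀ (norm_nonneg _) h1 2
  have h3 : ‖g‖ ^ 2 = ‖g * g‖ := by
    rw [sq, ← CStarRing.norm_star_mul_self, hsa]
  have h4 : ‖g‖ ^ 4 ≤ ‖g * g * g‖ * ‖g‖ := by
    have h5 : ‖g * g‖ ^ 2 = ‖(g * g) * (g * g)‖ := by
      rw [sq, ← CStarRing.norm_star_mul_self, star_mul, hsa]
    calc ‖g‖ ^ 4 = (‖g‖ ^ 2) ^ 2 := by ring
      _ = ‖(g * g * g) * g‖ := by rw [h3, h5, mul_assoc, mul_assoc, mul_assoc]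
      _ ≤ _ := norm_mul_le _ _
  have hcg : ‖c y‖ ^ 2 = ‖g‖ := L2.norm_sq _
  refine le_of_sq_le_sq ?_ (norm_nonneg T)
  rw [hcg]
  by_contra hlt
  push Not at hlt
  have hpos : 0 < ‖g‖ := lt_of_le_of_lt (by positivity) hlt
  have h6 : ‖g‖ ^ 4 ≤ ‖T‖ ^ 2 * ‖g‖ ^ 3 := by
    calc _ ≤ _ := h4
      _ ≤ (‖T‖ * ‖g‖) ^ 2 * ‖g‖ := by gcongr
      _ = _ := by ring
  have h7 : ‖T‖ ^ 2 * ‖g‖ ^ 3 < ‖g‖ * ‖g‖ ^ 3 := by gcongr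
  nlinarith

variable (X B) in
/-- The operators such that they and their adjoints have columns in `l₂(X, B)`; in particular
all their matrix entries lie in `B`. -/
def colAlg : NonUnitalStarSubalgebra ℂ (Adj X B) where
  carrier := {T | (∃ c, HasCols T c) ∧ ∃ d, HasCols (star T) d}
  zero_mem' := ⟨⟨_, .zero⟩, ⟨0, by rw [star_zero]; exact .zero⟩⟩
  add_mem' := by
    rintro S T ⟨⟨c, hc⟩, d, hd⟩ ⟨⟨c', hc'⟩, d', hd'⟩
    exact ⟨⟨_, hc.add hc'⟩, ⟨_, by rw [star_add]; exact hd.add hd'⟩⟩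
  mul_mem' := by
    rintro S T ⟨⟨c, hc⟩, d, hd⟩ ⟨⟨c', hc'⟩, d', hd'⟩
    exact ⟨⟨_, hc'.mul⟩, ⟨_, by rw [star_mul]; exact hd.mul⟩⟩
  smul_mem' := by
    rintro z T ⟨⟨c, hc⟩, d, hd⟩
    exact ⟨⟨_, hc.smul z⟩, ⟨_, by rw [star_smul]; exact hd.smul _⟩⟩
  star_mem' := by
    rintro T ⟨⟨c, hc⟩, d, hd⟩
    exact ⟨⟨d, hd⟩, ⟨c, by rw [star_star]; exact hc⟩⟩

lemma exists_hasCols_of_tendsto {u : ℕ → Adj X B} {T : Adj X B} (h : Tendsto u atTop (𝓝 T))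
    (hu : ∀ n, ∃ c, HasCols (u n) c) : ∃ c, HasCols T c := by
  choose c hc using hu
  have hC : ∀ y, CauchySeq fun n => c n y := by
    intro y
    rw [Metric.cauchySeq_iff]
    intro ε hε
    obtain ⟨N, hN⟩ := Metric.cauchySeq_iff.1 h.cauchySeq ε hε
    refine ⟨N, fun m hm n hn => ?_⟩
    have h1 := hN m hm n hn
    rw [dist_eq_norm] at h1 ⊢
    exact lt_of_le_of_lt (((hc m).sub (hc n)).norm_le y) h1
  choose d hd using fun y => cauchySeq_tendsto_of_complete (hC y)
  refine ⟨d, fun y b => ?_⟩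
  have h1 : Tendsto (fun n => (u n).1 (L2.single y b)) atTop (𝓝 (T.op (L2.single y b))) :=
    ((ContinuousLinearMap.apply ℂ _ (L2.single y b)).continuous.tendsto T.1).comp
      ((continuous_subtype_val.tendsto T).comp h)
  have h2 : Tendsto (fun n => (u n).1 (L2.single y b)) atTop (𝓝 ((d y).rmul b)) := by
    refine Tendsto.congr (fun n => (hc n y b).symm) ?_
    exact ((L2.rmulL b).continuous.tendsto _).comp (hd y)
  exact tendsto_nhds_unique h1 h2

instance colAlg_isClosed : IsClosed (colAlg X B : Set (Adj X B)) := by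
  refine IsSeqClosed.isClosed fun u T hu h => ?_
  exact ⟨exists_hasCols_of_tendsto h fun n => (hu n).1,
    exists_hasCols_of_tendsto h.star fun n => (hu n).2⟩

variable (X B) in
/-- The C*-algebra of the operators in `colAlg`. -/
def ColOp : Type _ := colAlg X B

instance : NonUnitalCStarAlgebra (ColOp X B) :=
  NonUnitalStarSubalgebra.nonUnitalCStarAlgebra (colAlg X B)

/-- The adjointable operator underlying an element of `ColOp`. -/
def ColOp.adj (T : ColOp X B) : Adj X B := T.1

lemma ColOp.adj_injective : Function.Injective (ColOp.adj : ColOp X B → Adj X B) :=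
  Subtype.val_injective

lemma ColOp.norm_adj (T : ColOp X B) : ‖T.adj‖ = ‖T‖ := rfl

lemma ColOp.add_adj (S T : ColOp X B) : (S + T).adj = S.adj + T.adj := rfl
lemma ColOp.mul_adj (S T : ColOp X B) : (S * T).adj = S.adj * T.adj := rfl
lemma ColOp.smul_adj (c : ℂ) (T : ColOp X B) : (c • T).adj = c • T.adj := rfl
lemma ColOp.zero_adj : (0 : ColOp X B).adj = 0 := rfl
lemma ColOp.star_adj (T : ColOp X B) : (star T).adj = star T.adj := rfl

/-- A `*`-homomorphism of C*-algebras is continuous. -/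
lemma hom_continuous (φ : A →⋆ₙₐ[ℂ] B) : Continuous φ :=
  AddMonoidHomClass.continuous_of_bound φ 1
    (fun a => by simpa using NonUnitalStarAlgHom.norm_apply_le φ a)

/-- The columns of an operator in `ColOp`. -/
def col (T : ColOp X B) : X → L2 X B := T.2.1.choose

lemma hasCols_col (T : ColOp X B) : HasCols T.adj (col T) := T.2.1.choose_spec

lemma HasCols.col_eq {T : ColOp X B} {c : X → L2 X B} (h : HasCols T.adj c) : col T = c :=
  (hasCols_col T).unique h

/-- The matrix entry `m_{x,y} ∈ B` of an operator `m`. -/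
def entry (T : ColOp X B) (x y : X) : B := (col T y) x

lemma col_ext {S T : ColOp X B} (h : ∀ y, col S y = col T y) : S = T :=
  ColOp.adj_injective ((hasCols_col S).ext (by rw [funext h]; exact hasCols_col T))

lemma entry_ext {S T : ColOp X B} (h : ∀ x y, entry S x y = entry T x y) : S = T :=
  col_ext fun y => L2.ext_apply fun x => h x y

lemma entry_add (S T : ColOp X B) (x y : X) : entry (S + T) x y = entry S x y + entry T x y := by
  rw [entry, HasCols.col_eq (T := S + T) ((hasCols_col S).add (hasCols_col T))]; rfl

lemma entry_smul (z : ℂ) (T : ColOp X B) (x y : X) : entry (z • T) x y = z • entry T x y := by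
  rw [entry, HasCols.col_eq (T := z • T) ((hasCols_col T).smul z)]; rfl

lemma entry_zero (x y : X) : entry (0 : ColOp X B) x y = 0 := by
  rw [entry, HasCols.col_eq (T := 0) HasCols.zero]; rfl

lemma entry_star (T : ColOp X B) (x y : X) : entry (star T) x y = star (entry T y x) :=
  HasCols.star_apply (hasCols_col T) (hasCols_col (star T)) y x

lemma col_mul (S T : ColOp X B) (y : X) : col (S * T) y = S.adj.op (col T y) :=
  congrFun (HasCols.col_eq (T := S * T) (hasCols_col T).mul) y

lemma hasSum_entry_mul (S T : ColOp X B) (x y : X) :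
    HasSum (fun z => entry S x z * entry T z y) (entry (S * T) x y) := by
  rw [entry, col_mul]
  exact ((hasCols_col S).hasSum (col T y)).mapL (L2.evalL x)

/-- The map `l₂(X, A) → l₂(X, B)` induced by a `*`-homomorphism `A → B`. -/
def L2.map (φ : A →⋆ₙₐ[ℂ] B) : L2 X A →L[ℂ] L2 X B :=
  LinearMap.mkContinuous
    { toFun := fun f => ⟨fun x => φ (f x), by
        have hφ : Continuous φ := hom_continuous φ
        have := f.summable.map φ hφ
        change Summable _
        simpa only [Function.comp_def, map_mul, map_star] using this⟩
      map_add' := fun f g => L2.ext_apply fun x => map_add φ _ _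
      map_smul' := fun c f => L2.ext_apply fun x => map_smul φ _ _ } 1 fun f => by
    rw [one_mul]
    refine L2.norm_le_of_finNorm fun s => le_trans ?_ (f.finNorm_le s)
    refine Real.sqrt_le_sqrt ?_
    have : ∑ x ∈ s, star (φ (f x)) * φ (f x) = φ (∑ x ∈ s, star (f x) * f x) := by
      simp [map_sum, map_star]
    change ‖∑ x ∈ s, star (φ (f x)) * φ (f x)‖ ≤ _
    rw [this]
    exact NonUnitalStarAlgHom.norm_apply_le φ _

@[simp] lemma L2.map_apply (φ : A →⋆ₙₐ[ℂ] B) (f : L2 X A) (x : X) : L2.map φ f x = φ (f x) := rfl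

lemma L2.map_rmul (φ : A →⋆ₙₐ[ℂ] B) (f : L2 X A) (a : A) :
    L2.map φ (f.rmul a) = (L2.map φ f).rmul (φ a) := L2.ext_apply fun x => map_mul φ _ _

lemma L2.inner_map (φ : A →⋆ₙₐ[ℂ] B) (f g : L2 X A) :
    L2.inner (L2.map φ f) (L2.map φ g) = φ (L2.inner f g) := by
  have hφ : Continuous φ := hom_continuous φ
  have := (L2.summable_inner f g).hasSum.map φ hφ
  rw [L2.inner, L2.inner, ← this.tsum_eq]
  simp [map_star]

lemma L2.sum_inner_sum (s : Finset X) (c : X → L2 X B) (ξ ζ : X → B) :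
    L2.inner (∑ y ∈ s, (c y).rmul (ξ y)) (∑ y ∈ s, (c y).rmul (ζ y)) =
      ∑ y ∈ s, ∑ z ∈ s, star (ξ y) * L2.inner (c y) (c z) * ζ z := by
  have h1 : ∀ (f : L2 X B) (g : X → L2 X B), L2.inner f (∑ z ∈ s, g z) = ∑ z ∈ s, L2.inner f (g z) :=
    fun f g => map_sum (L2.innerL f) _ _
  have h2 : ∀ (f : L2 X B) (g : X → L2 X B), L2.inner (∑ z ∈ s, g z) f = ∑ z ∈ s, L2.inner (g z) f := by
    intro f g
    rw [← L2.star_inner, h1, star_sum]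
    simp only [L2.star_inner]
  rw [h2]
  refine Finset.sum_congr rfl fun y _ => ?_
  rw [h1]
  refine Finset.sum_congr rfl fun z _ => ?_
  rw [L2.inner_rmul_right, L2.inner_rmul_left]

/-- Entrywise application of a `*`-homomorphism does not increase the norm. -/
lemma HasCols.norm_sum_map_le (φ : A →⋆ₙₐ[ℂ] B) {T : Adj X A} {c : X → L2 X A} (hT : HasCols T c)
    (s : Finset X) (ξ : X → B) :
    ‖∑ y ∈ s, (L2.map φ (c y)).rmul (ξ y)‖ ≤ ‖T‖ * finNorm s ξ := by
  let _ := CStarAlgebra.spectralOrder A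
  have _ := CStarAlgebra.spectralOrderedRing A
  let _ := CStarAlgebra.spectralOrder B
  have _ := CStarAlgebra.spectralOrderedRing B
  let g : CStarMatrix s s A := CStarMatrix.ofMatrix fun i j => L2.inner (c i) (c j)
  have hg : ‖g‖ ≤ ‖T‖ ^ 2 := by
    have := CStarMatrix.norm_le_of_forall_inner_le (M := g) (C := ‖T‖₊ ^ 2) fun v w => ?_
    · simpa using this
    obtain ⟨ξ, rfl⟩ : ∃ ξ : X → A, v = finVec s ξ := by
      classical
      refine ⟨fun x => if h : x ∈ s then star (v ⟨x, h⟩) else 0, ?_⟩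
      ext i; simp [finVec]
    obtain ⟨ζ, rfl⟩ : ∃ ζ : X → A, w = finVec s ζ := by
      classical
      refine ⟨fun x => if h : x ∈ s then star (w ⟨x, h⟩) else 0, ?_⟩
      ext i; simp [finVec]
    have e : inner A (finVec s ζ) (CStarMatrix.toCLM g (finVec s ξ)) =
        L2.inner (∑ y ∈ s, (c y).rmul (ξ y)) (∑ y ∈ s, (c y).rmul (ζ y)) := by
      rw [L2.sum_inner_sum, CStarMatrix.toCLM_apply_eq_sum, WithCStarModule.pi_inner,
        Finset.sum_comm, ← Finset.sum_coe_sort s]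
      refine Finset.sum_congr rfl fun j _ => ?_
      rw [← Finset.sum_coe_sort s]
      simp [finVec, WithCStarModule.inner_def, Finset.sum_mul]
      rfl
    have hT' : ∀ ξ : X → A, ‖∑ y ∈ s, (c y).rmul (ξ y)‖ ≤ ‖T‖ * finNorm s ξ := by
      intro ξ
      have : ∑ y ∈ s, (c y).rmul (ξ y) = T.op (∑ y ∈ s, L2.single y (ξ y)) := by
        rw [map_sum]
        exact Finset.sum_congr rfl fun y _ => (hT _ _).symm
      rw [this, ← L2.norm_sum_single]
      exact T.le_norm _
    rw [e, finVec_norm, finVec_norm]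
    refine (L2.norm_inner_le _ _).trans ?_
    calc _ ≤ (‖T‖ * finNorm s ξ) * (‖T‖ * finNorm s ζ) := by
            gcongr <;> first | exact hT' _ | exact mul_nonneg (norm_nonneg T) (finNorm_nonneg _ _)
      _ = _ := by simp; ring
  let h : CStarMatrix s s B := g.map φ
  have hh : ‖h‖ ≤ ‖T‖ ^ 2 := by
    refine le_trans ?_ hg
    exact NonUnitalStarAlgHom.norm_apply_le (CStarMatrix.mapₙₐ φ) g
  refine le_of_sq_le_sq ?_ (mul_nonneg (norm_nonneg T) (finNorm_nonneg _ _))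
  rw [L2.norm_sq]
  have e : inner B (finVec s ξ) (CStarMatrix.toCLM h (finVec s ξ)) =
      L2.inner (∑ y ∈ s, (L2.map φ (c y)).rmul (ξ y)) (∑ y ∈ s, (L2.map φ (c y)).rmul (ξ y)) := by
    rw [L2.sum_inner_sum, CStarMatrix.toCLM_apply_eq_sum, WithCStarModule.pi_inner,
      Finset.sum_comm, ← Finset.sum_coe_sort s]
    refine Finset.sum_congr rfl fun j _ => ?_
    rw [← Finset.sum_coe_sort s]
    simp [finVec, h, WithCStarModule.inner_def, Finset.sum_mul, L2.inner_map]
    rfl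
  rw [← e]
  refine (CStarModule.norm_inner_le _).trans ?_
  have h1 := (CStarMatrix.toCLM h).le_opNorm (finVec s ξ)
  rw [← CStarMatrix.norm_def, finVec_norm] at h1
  rw [finVec_norm]
  calc _ ≤ finNorm s ξ * (‖T‖ ^ 2 * finNorm s ξ) := by
        gcongr
        · exact finNorm_nonneg _ _
        · exact h1.trans (mul_le_mul_of_nonneg_right hh (finNorm_nonneg _ _))
    _ = _ := by ring

/-- A bounded family of prospective columns defines a bounded operator. -/
lemma exists_clm_of_cols (c : X → L2 X B) (K : ℝ)
    (hc : ∀ (s : Finset X) (ξ : X → B), ‖∑ y ∈ s, (c y).rmul (ξ y)‖ ≤ K * finNorm s ξ) :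
    ∃ T : L2 X B →L[ℂ] L2 X B, ∀ ξ, HasSum (fun y => (c y).rmul (ξ y)) (T ξ) := by
  have hs : ∀ ξ : L2 X B, Summable fun y => (c y).rmul (ξ y) := by
    intro ξ
    rw [summable_iff_vanishing_norm]
    intro ε hε
    obtain ⟨s, hs⟩ := (summable_iff_finNorm ξ.toFun).1 ξ.mem (ε / (|K| + 1)) (by positivity)
    refine ⟨s, fun t ht => ?_⟩
    calc _ ≤ K * finNorm t ξ.toFun := hc t _
      _ ≤ |K| * (ε / (|K| + 1)) := by
        gcongr
        · exact finNorm_nonneg _ _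
        · exact le_abs_self K
        · exact (hs t ht).le
      _ < ε := by
        rw [mul_div_assoc', div_lt_iff₀ (by positivity)]
        nlinarith [abs_nonneg K]
  refine ⟨LinearMap.mkContinuous
    { toFun := fun ξ => ∑' y, (c y).rmul (ξ y)
      map_add' := fun ξ ζ => ?_
      map_smul' := fun z ξ => ?_ } |K| fun ξ => ?_, fun ξ => (hs ξ).hasSum⟩
  · rw [← (hs ξ).tsum_add (hs ζ)]
    simp [L2.rmul_add]
  · rw [RingHom.id_apply, ← (hs ξ).tsum_const_smul]
    simp [L2.rmul_smul]
  · refine le_of_tendsto' (hs ξ).hasSum.norm fun s => (hc s _).trans ?_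
    gcongr
    · exact finNorm_nonneg _ _
    · exact le_abs_self K
    · exact ξ.finNorm_le s

lemma exists_adj_of_cols (c d : X → L2 X B) (hcd : ∀ x y, d x y = star (c y x)) (K : ℝ)
    (hc : ∀ (s : Finset X) (ξ : X → B), ‖∑ y ∈ s, (c y).rmul (ξ y)‖ ≤ K * finNorm s ξ)
    (hd : ∀ (s : Finset X) (ξ : X → B), ‖∑ y ∈ s, (d y).rmul (ξ y)‖ ≤ K * finNorm s ξ) :
    ∃ T : ColOp X B, col T = c := by
  obtain ⟨T, hT⟩ := exists_clm_of_cols c K hc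
  obtain ⟨S, hS⟩ := exists_clm_of_cols d K hd
  have hTS : ∀ ξ ζ, L2.inner (T ξ) ζ = L2.inner ξ (S ζ) := by
    intro ξ ζ
    have h1 : HasSum (fun y => star (ξ y) * (S ζ) y) (L2.inner (T ξ) ζ) := by
      have h := ((hT ξ).mapL (L2.innerL ζ)).star
      simp only [L2.innerL_apply, L2.star_inner, L2.inner_rmul_left] at h
      convert h using 3 with y
      refine ((hS ζ).mapL (L2.evalL y)).unique ?_
      have h' := (L2.summable_inner (c y) ζ).hasSum
      simp only [L2.evalL_apply, L2.rmul_apply, hcd]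
      exact h'
    exact h1.unique (L2.summable_inner ξ (S ζ)).hasSum
  have hTS' : ∀ ξ ζ, L2.inner (S ξ) ζ = L2.inner ξ (T ζ) := fun ξ ζ => by
    rw [← L2.star_inner, ← hTS, L2.star_inner]
  have hcols : ∀ (R : L2 X B →L[ℂ] L2 X B) (e : X → L2 X B),
      (∀ ξ, HasSum (fun y => (e y).rmul (ξ y)) (R ξ)) → ∀ y b, R (L2.single y b) = (e y).rmul b := by
    intro R e hR y b
    refine (hR _).unique ?_
    have h3 := hasSum_single (f := fun z => (e z).rmul ((L2.single y b) z)) y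
      (fun z hz => by rw [L2.single_of_ne hz]; exact L2.ext_apply fun x => by simp)
    simpa using h3
  have hstar : star (Adj.mk T S hTS') = Adj.mk S T hTS := Adj.star_eq_of fun ξ ζ => hTS ξ ζ
  have hTc : HasCols (Adj.mk T S hTS') c := hcols T c hT
  have hSd : HasCols (star (Adj.mk T S hTS')) d := by
    rw [hstar]
    exact hcols S d hS
  exact ⟨⟨Adj.mk T S hTS', ⟨c, hTc⟩, d, hSd⟩, HasCols.col_eq hTc⟩

lemma exists_colMap (φ : A →⋆ₙₐ[ℂ] B) (T : ColOp X A) :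
    ∃ S : ColOp X B, ∀ y, col S y = L2.map φ (col T y) := by
  obtain ⟨S, hS⟩ := exists_adj_of_cols (fun y => L2.map φ (col T y))
    (fun y => L2.map φ (col (star T) y)) (fun x y => by
      have := entry_star T y x
      simp only [entry] at this
      simp [this, map_star]) ‖T‖
    (fun s ξ => (hasCols_col T).norm_sum_map_le φ s ξ)
    (fun s ξ => by
      rw [← norm_star T]
      exact (hasCols_col (star T)).norm_sum_map_le φ s ξ)
  exact ⟨S, fun y => congrFun hS y⟩

lemma exists_colMap_choose (φ : A →⋆ₙₐ[ℂ] B) (T : ColOp X A) (x y : X) :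
    entry (exists_colMap φ T).choose x y = φ (entry T x y) := by
  rw [entry, (exists_colMap φ T).choose_spec]; rfl

/-- Entrywise application `mat m_{x,y} ↦ mat φ(m_{x,y})` of a `*`-homomorphism. -/
def colMap (φ : A →⋆ₙₐ[ℂ] B) : ColOp X A →⋆ₙₐ[ℂ] ColOp X B where
  toFun T := (exists_colMap φ T).choose
  map_smul' z T := entry_ext fun x y => by
    simp [exists_colMap_choose, entry_smul]
  map_zero' := entry_ext fun x y => by simp [exists_colMap_choose, entry_zero]
  map_add' S T := entry_ext fun x y => by simp [exists_colMap_choose, entry_add]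
  map_star' T := entry_ext fun x y => by simp [exists_colMap_choose, entry_star, map_star]
  map_mul' S T := entry_ext fun x y => by
    rw [exists_colMap_choose]
    have hφ : Continuous φ := hom_continuous φ
    refine ((hasSum_entry_mul S T x y).map φ hφ).unique ?_
    convert hasSum_entry_mul (exists_colMap φ S).choose (exists_colMap φ T).choose x y using 2 with z
    simp [exists_colMap_choose]

@[simp] lemma entry_colMap (φ : A →⋆ₙₐ[ℂ] B) (T : ColOp X A) (x y : X) :
    entry (colMap φ T) x y = φ (entry T x y) := exists_colMap_choose φ T x y

lemma colMap_id (T : ColOp X A) : colMap (NonUnitalStarAlgHom.id ℂ A) T = T :=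
  entry_ext fun x y => by simp

lemma colMap_comp (ψ : B →⋆ₙₐ[ℂ] C) (φ : A →⋆ₙₐ[ℂ] B) (T : ColOp X A) :
    colMap (ψ.comp φ) T = colMap ψ (colMap φ T) :=
  entry_ext fun x y => by simp

end Columns

/-! ### Quotient C*-algebras -/

section Quotient
variable {A B : Type*} [NonUnitalCStarAlgebra A] [NonUnitalCStarAlgebra B]

variable (A) in
/-- A closed two-sided `*`-ideal of a C*-algebra. -/
structure ClosedIdeal where
  alg : NonUnitalStarSubalgebra ℂ A
  mul_mem_left : ∀ a j : A, j ∈ alg → a * j ∈ alg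
  mul_mem_right : ∀ a j : A, j ∈ alg → j * a ∈ alg
  isClosed : IsClosed (alg : Set A)

/-- The underlying linear subspace of an ideal. -/
def ClosedIdeal.sub (J : ClosedIdeal A) : Submodule ℂ A :=
  J.alg.toNonUnitalSubalgebra.toSubmodule

instance (J : ClosedIdeal A) : IsClosed (J.sub : Set A) := J.isClosed

instance (J : ClosedIdeal A) : IsClosed (J.alg : Set A) := J.isClosed

/-- The quotient C*-algebra `A / J`. -/
def CQuot (J : ClosedIdeal A) : Type _ := A ⧸ J.sub

namespace CQuot
variable {J : ClosedIdeal A}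

instance : NormedAddCommGroup (CQuot J) := inferInstanceAs (NormedAddCommGroup (A ⧸ J.sub))
instance : NormedSpace ℂ (CQuot J) := inferInstanceAs (NormedSpace ℂ (A ⧸ J.sub))
instance : CompleteSpace (CQuot J) := inferInstanceAs (CompleteSpace (A ⧸ J.sub))

variable (J) in
/-- The class of an element in the quotient. -/
def mk (a : A) : CQuot J := Submodule.Quotient.mk a

lemma mk_surjective : Function.Surjective (mk J) := Submodule.Quotient.mk_surjective _

lemma mk_eq {a b : A} : mk J a = mk J b ↔ a - b ∈ J.alg := Submodule.Quotient.eq _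

lemma mk_add (a b : A) : mk J (a + b) = mk J a + mk J b := rfl
lemma mk_smul (c : ℂ) (a : A) : mk J (c • a) = c • mk J a := rfl
lemma mk_zero : mk J 0 = 0 := rfl
lemma mk_sub (a b : A) : mk J (a - b) = mk J a - mk J b := rfl
lemma mk_neg (a : A) : mk J (-a) = - mk J a := rfl
lemma mk_eq_zero {a : A} : mk J a = 0 ↔ a ∈ J.alg := by
  rw [← mk_zero, mk_eq, sub_zero]

lemma norm_mk_le (a : A) : ‖mk J a‖ ≤ ‖a‖ := Submodule.Quotient.norm_mk_le _ a

lemma exists_norm_lt (x : CQuot J) {ε : ℝ} (hε : 0 < ε) : ∃ a, mk J a = x ∧ ‖a‖ < ‖x‖ + ε :=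
  Submodule.Quotient.norm_mk_lt (S := J.sub) x hε

instance : Mul (CQuot J) :=
  ⟨Quotient.map₂ (· * ·) fun a a' ha b b' hb => by
    replace ha : mk J a = mk J a' := Quotient.sound ha
    replace hb : mk J b = mk J b' := Quotient.sound hb
    refine Quotient.exact (?_ : mk J (a * b) = mk J (a' * b'))
    rw [mk_eq] at *
    have : a * b - a' * b' = (a - a') * b + a' * (b - b') := by
      rw [sub_mul, mul_sub]; abel
    rw [this]
    exact add_mem (J.mul_mem_right _ _ ha) (J.mul_mem_left _ _ hb)⟩

instance : Star (CQuot J) :=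
  ⟨Quotient.map star fun a a' ha => by
    replace ha : mk J a = mk J a' := Quotient.sound ha
    refine Quotient.exact (?_ : mk J (star a) = mk J (star a'))
    rw [mk_eq] at *
    rw [← star_sub]
    exact star_mem ha⟩

lemma mk_mul (a b : A) : mk J (a * b) = mk J a * mk J b := rfl
lemma mk_star (a : A) : mk J (star a) = star (mk J a) := rfl

instance : NonUnitalNormedRing (CQuot J) where
  __ := (inferInstance : NormedAddCommGroup (CQuot J))
  mul_assoc x y z := by
    obtain ⟨a, rfl⟩ := mk_surjective x
    obtain ⟨b, rfl⟩ := mk_surjective y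
    obtain ⟨c, rfl⟩ := mk_surjective z
    exact congrArg (mk J) (mul_assoc a b c)
  left_distrib x y z := by
    obtain ⟨a, rfl⟩ := mk_surjective x
    obtain ⟨b, rfl⟩ := mk_surjective y
    obtain ⟨c, rfl⟩ := mk_surjective z
    exact congrArg (mk J) (mul_add a b c)
  right_distrib x y z := by
    obtain ⟨a, rfl⟩ := mk_surjective x
    obtain ⟨b, rfl⟩ := mk_surjective y
    obtain ⟨c, rfl⟩ := mk_surjective z
    exact congrArg (mk J) (add_mul a b c)
  zero_mul x := by
    obtain ⟨a, rfl⟩ := mk_surjective x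
    exact congrArg (mk J) (zero_mul a)
  mul_zero x := by
    obtain ⟨a, rfl⟩ := mk_surjective x
    exact congrArg (mk J) (mul_zero a)
  norm_mul_le x y := by
    have h : ∀ ε > 0, ‖x * y‖ ≤ (‖x‖ + ε) * (‖y‖ + ε) := by
      intro ε hε
      obtain ⟨a, rfl, ha⟩ := exists_norm_lt x hε
      obtain ⟨b, rfl, hb⟩ := exists_norm_lt y hε
      calc _ ≤ ‖a * b‖ := by rw [← mk_mul]; exact norm_mk_le _
        _ ≤ ‖a‖ * ‖b‖ := norm_mul_le _ _
        _ ≤ _ := by gcongr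
    have ht : Tendsto (fun ε : ℝ => (‖x‖ + ε) * (‖y‖ + ε)) (𝓝[>] 0) (𝓝 (‖x‖ * ‖y‖)) := by
      have : Continuous fun ε : ℝ => (‖x‖ + ε) * (‖y‖ + ε) := by fun_prop
      simpa using (this.tendsto 0).mono_left nhdsWithin_le_nhds
    exact ge_of_tendsto ht (eventually_nhdsWithin_of_forall h)

instance : StarRing (CQuot J) where
  star_involutive x := by
    obtain ⟨a, rfl⟩ := mk_surjective x
    exact congrArg (mk J) (star_star a)
  star_mul x y := by
    obtain ⟨a, rfl⟩ := mk_surjective x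
    obtain ⟨b, rfl⟩ := mk_surjective y
    exact congrArg (mk J) (star_mul a b)
  star_add x y := by
    obtain ⟨a, rfl⟩ := mk_surjective x
    obtain ⟨b, rfl⟩ := mk_surjective y
    exact congrArg (mk J) (star_add a b)

instance : StarModule ℂ (CQuot J) where
  star_smul c x := by
    obtain ⟨a, rfl⟩ := mk_surjective x
    exact congrArg (mk J) (star_smul c a)

instance : IsScalarTower ℂ (CQuot J) (CQuot J) where
  smul_assoc c x y := by
    obtain ⟨a, rfl⟩ := mk_surjective x
    obtain ⟨b, rfl⟩ := mk_surjective y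
    exact congrArg (mk J) (smul_mul_assoc c a b)

instance : SMulCommClass ℂ (CQuot J) (CQuot J) where
  smul_comm c x y := by
    obtain ⟨a, rfl⟩ := mk_surjective x
    obtain ⟨b, rfl⟩ := mk_surjective y
    exact congrArg (mk J) (mul_smul_comm c a b).symm

/-- An ideal contains, for each of its elements, a contractive positive almost unit. -/
lemma exists_almost_unit (J : ClosedIdeal A) {j : A} (hj : j ∈ J.alg) {ε : ℝ} (hε : 0 < ε) :
    ∃ u ∈ J.alg, ‖j - j * u‖ < ε ∧
      (∀ c : A, ‖c - c * u‖ ≤ ‖c‖) ∧ star u = u := by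
  let _ := CStarAlgebra.spectralOrder J.alg
  have _ := CStarAlgebra.spectralOrderedRing J.alg
  have h := CStarAlgebra.increasingApproximateUnit J.alg
  have h1 := h.tendsto_mul_left ⟨j, hj⟩
  have h2 := (Metric.tendsto_nhds.1 h1 ε hε)
  have := h.neBot
  obtain ⟨u, hu1, hu0, hun⟩ := (h2.and (h.eventually_nonneg.and h.eventually_norm)).exists
  have hsa : star u = u := (IsSelfAdjoint.of_nonneg hu0)
  refine ⟨u, u.2, ?_, fun c => ?_, congrArg Subtype.val hsa⟩
  · rw [dist_eq_norm, ← norm_neg, neg_sub] at hu1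
    exact hu1
  · let _ := CStarAlgebra.spectralOrder A
    have _ := CStarAlgebra.spectralOrderedRing A
    let _ := CStarAlgebra.spectralOrder (Unitization ℂ A)
    have _ := CStarAlgebra.spectralOrderedRing (Unitization ℂ A)
    obtain ⟨v, hv⟩ := CStarAlgebra.nonneg_iff_eq_star_mul_self.1 hu0
    have hU0 : (0 : Unitization ℂ A) ≤ ((u : A) : Unitization ℂ A) := by
      have : ((u : A) : Unitization ℂ A) = star ((v : A) : Unitization ℂ A) * ((v : A) : Unitization ℂ A) := by
        rw [← Unitization.inr_star, ← Unitization.inr_mul]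
        exact congrArg (fun w : J.alg => ((w : A) : Unitization ℂ A)) hv
      rw [this]
      exact star_mul_self_nonneg _
    have hU1 : ‖((u : A) : Unitization ℂ A)‖ ≤ 1 := by
      rw [Unitization.norm_inr]; exact hun
    have hle : ((u : A) : Unitization ℂ A) ≤ 1 := (CStarAlgebra.norm_le_one_iff_of_nonneg _ hU0).1 hU1
    have h0 : (0 : Unitization ℂ A) ≤ 1 - ((u : A) : Unitization ℂ A) := sub_nonneg.2 hle
    have h1 : ‖1 - ((u : A) : Unitization ℂ A)‖ ≤ 1 :=
      (CStarAlgebra.norm_le_one_iff_of_nonneg _ h0).2 (sub_le_self _ hU0)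
    calc ‖c - c * u‖ = ‖((c - c * u : A) : Unitization ℂ A)‖ := (Unitization.norm_inr _).symm
      _ = ‖(c : Unitization ℂ A) * (1 - ((u : A) : Unitization ℂ A))‖ := by
        rw [mul_sub, mul_one, Unitization.inr_sub, Unitization.inr_mul]
      _ ≤ ‖(c : Unitization ℂ A)‖ * 1 := (norm_mul_le _ _).trans (by gcongr)
      _ = ‖c‖ := by rw [mul_one, Unitization.norm_inr]

instance : CStarRing (CQuot J) where
  norm_mul_self_le x := by
    refine le_of_forall_pos_le_add fun ε hε => ?_
    obtain ⟨a, rfl⟩ := mk_surjective x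
    obtain ⟨b, hb, hbn⟩ := exists_norm_lt (star (mk J a) * mk J a) (half_pos hε)
    have hj : star a * a - b ∈ J.alg := by rw [← mk_eq, hb]; rfl
    obtain ⟨u, huJ, hu1, hu2, hus⟩ := exists_almost_unit J hj (half_pos hε)
    have e1 : mk J a = mk J (a - a * u) := by
      rw [mk_eq, sub_sub_cancel]; exact J.mul_mem_left _ _ huJ
    have hstar : ∀ c : A, ‖c - u * c‖ ≤ ‖c‖ := fun c => by
      have := hu2 (star c)
      rw [← norm_star, star_sub, star_mul, star_star, hus, norm_star] at this
      exact this
    have key : ‖a - a * u‖ * ‖a - a * u‖ ≤ ‖star (mk J a) * mk J a‖ + ε := by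
      rw [← CStarRing.norm_star_mul_self]
      have e2 : star (a - a * u) * (a - a * u) =
          (star a * a - star a * a * u) - u * (star a * a - star a * a * u) := by
        rw [star_sub, star_mul, hus]; simp only [mul_sub, sub_mul, mul_assoc]; abel
      rw [e2]
      refine (hstar _).trans ?_
      have e3 : star a * a - star a * a * u =
          (b - b * u) + ((star a * a - b) - (star a * a - b) * u) := by
        simp only [sub_mul]; abel
      rw [e3]
      calc _ ≤ ‖b - b * u‖ + _ := norm_add_le _ _
        _ ≤ ‖b‖ + ε / 2 := by gcongr; exact hu2 b
        _ ≤ _ := by linarith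
    calc ‖mk J a‖ * ‖mk J a‖ = ‖mk J (a - a * u)‖ * ‖mk J (a - a * u)‖ := by rw [← e1]
      _ ≤ ‖a - a * u‖ * ‖a - a * u‖ := by gcongr <;> exact norm_mk_le _
      _ ≤ _ := key

instance : NonUnitalCStarAlgebra (CQuot J) where

variable (J) in
/-- The quotient map. -/
def proj : A →⋆ₙₐ[ℂ] CQuot J where
  toFun := mk J
  map_smul' _ _ := rfl
  map_zero' := rfl
  map_add' _ _ := rfl
  map_mul' _ _ := rfl
  map_star' _ := rfl

@[simp] lemma proj_apply (a : A) : proj J a = mk J a := rfl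

/-- The map of quotients induced by a `*`-homomorphism that maps `J` to `J'`. -/
def map {J' : ClosedIdeal B} (φ : A →⋆ₙₐ[ℂ] B) (h : ∀ a ∈ J.alg, φ a ∈ J'.alg) :
    CQuot J →⋆ₙₐ[ℂ] CQuot J' where
  toFun := Quotient.map φ fun a a' ha => by
    replace ha : mk J a = mk J a' := Quotient.sound ha
    refine Quotient.exact (?_ : mk J' (φ a) = mk J' (φ a'))
    rw [mk_eq] at *
    rw [← map_sub]
    exact h _ ha
  map_smul' c x := by
    obtain ⟨a, rfl⟩ := mk_surjective x
    exact congrArg (mk J') (map_smul φ c a)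
  map_zero' := congrArg (mk J') (map_zero φ)
  map_add' x y := by
    obtain ⟨a, rfl⟩ := mk_surjective x
    obtain ⟨b, rfl⟩ := mk_surjective y
    exact congrArg (mk J') (map_add φ a b)
  map_mul' x y := by
    obtain ⟨a, rfl⟩ := mk_surjective x
    obtain ⟨b, rfl⟩ := mk_surjective y
    exact congrArg (mk J') (map_mul φ a b)
  map_star' x := by
    obtain ⟨a, rfl⟩ := mk_surjective x
    exact congrArg (mk J') (map_star φ a)

@[simp] lemma map_mk {J' : ClosedIdeal B} (φ : A →⋆ₙₐ[ℂ] B) (h : ∀ a ∈ J.alg, φ a ∈ J'.alg)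
    (a : A) : map φ h (mk J a) = mk J' (φ a) := rfl

end CQuot
end Quotient

/-! ### Norm closures of algebras of matrices with controlled support -/

section Controlled
variable {X : Type*} {A B C : Type*} [NonUnitalCStarAlgebra A] [NonUnitalCStarAlgebra B]
  [NonUnitalCStarAlgebra C]

lemma exists_entry_ne_zero {S T : ColOp X B} {x y : X} (h : entry (S * T) x y ≠ 0) :
    ∃ z, entry S x z ≠ 0 ∧ entry T z y ≠ 0 := by
  by_contra hne
  push Not at hne
  refine h ((hasSum_entry_mul S T x y).unique ?_)
  convert hasSum_zero with z
  by_cases hz : entry S x z = 0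
  · rw [hz, zero_mul]
  · rw [hne z hz, mul_zero]

lemma entry_add_ne_zero {S T : ColOp X B} {x y : X} (h : entry (S + T) x y ≠ 0) :
    entry S x y ≠ 0 ∨ entry T x y ≠ 0 := by
  by_contra hne
  push Not at hne
  exact h (by rw [entry_add, hne.1, hne.2, add_zero])

lemma entry_smul_ne_zero {c : ℂ} {T : ColOp X B} {x y : X} (h : entry (c • T) x y ≠ 0) :
    entry T x y ≠ 0 := fun h' => h (by rw [entry_smul, h', smul_zero])

lemma entry_star_ne_zero {T : ColOp X B} {x y : X} (h : entry (star T) x y ≠ 0) :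
    entry T y x ≠ 0 := fun h' => h (by rw [entry_star, h', star_zero])

lemma entry_colMap_ne_zero {φ : A →⋆ₙₐ[ℂ] B} {T : ColOp X A} {x y : X}
    (h : entry (colMap φ T) x y ≠ 0) : entry T x y ≠ 0 :=
  fun h' => h (by rw [entry_colMap, h', map_zero])

variable (X) in
/-- A family of subsets of `X × X` closed under unions, compositions and inverses. -/
structure ControlFamily where
  sets : Set (Set (X × X))
  empty_mem : ∅ ∈ sets
  union_mem : ∀ E ∈ sets, ∀ F ∈ sets, E ∪ F ∈ sets
  comp_mem : ∀ E ∈ sets, ∀ F ∈ sets, {p : X × X | ∃ z, (p.1, z) ∈ E ∧ (z, p.2) ∈ F} ∈ sets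
  inv_mem : ∀ E ∈ sets, Prod.swap ⁻¹' E ∈ sets

variable (X) in
/-- The finite subsets of `X × X`. -/
def finiteFamily : ControlFamily X where
  sets := {E | E.Finite}
  empty_mem := Set.finite_empty
  union_mem E hE F hF := Set.Finite.union hE hF
  comp_mem E hE F hF := by
    refine ((Set.Finite.image Prod.fst hE).prod (Set.Finite.image Prod.snd hF)).subset ?_
    rintro ⟨x, y⟩ ⟨z, h1, h2⟩
    exact ⟨⟨_, h1, rfl⟩, ⟨_, h2, rfl⟩⟩
  inv_mem E hE := Set.Finite.preimage Prod.swap_injective.injOn hE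

variable (X) in
/-- The subsets of `X × X` of finite propagation. -/
def metricFamily [PseudoMetricSpace X] : ControlFamily X where
  sets := {E | ∃ R : ℝ, ∀ p ∈ E, dist p.1 p.2 ≤ R}
  empty_mem := ⟨0, by simp⟩
  union_mem := by
    rintro E ⟨R, hR⟩ F ⟨S, hS⟩
    refine ⟨max R S, ?_⟩
    rintro p (hp | hp)
    · exact (hR p hp).trans (le_max_left _ _)
    · exact (hS p hp).trans (le_max_right _ _)
  comp_mem := by
    rintro E ⟨R, hR⟩ F ⟨S, hS⟩
    refine ⟨R + S, ?_⟩
    rintro p ⟨z, h1, h2⟩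
    exact (dist_triangle _ z _).trans (add_le_add (hR _ h1) (hS _ h2))
  inv_mem := by
    rintro E ⟨R, hR⟩
    refine ⟨R, fun p hp => ?_⟩
    rw [dist_comm]
    exact hR _ hp

variable (B) in
/-- The `*`-algebra of all operators on `l₂(X, B)` that are given by an `X × X`-matrix with entries
in `B` whose support is contained in a member of the family `E`. -/
def ctrl (E : ControlFamily X) : NonUnitalStarSubalgebra ℂ (ColOp X B) where
  carrier := {T | ∃ F ∈ E.sets, ∀ x y, entry T x y ≠ 0 → (x, y) ∈ F}
  zero_mem' := ⟨∅, E.empty_mem, fun x y h => absurd (entry_zero x y) h⟩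
  add_mem' := by
    rintro S T ⟨F, hF, hS⟩ ⟨G, hG, hT⟩
    exact ⟨F ∪ G, E.union_mem F hF G hG, fun x y h =>
      (entry_add_ne_zero h).imp (hS x y) (hT x y)⟩
  mul_mem' := by
    rintro S T ⟨F, hF, hS⟩ ⟨G, hG, hT⟩
    refine ⟨_, E.comp_mem F hF G hG, fun x y h => ?_⟩
    obtain ⟨z, h1, h2⟩ := exists_entry_ne_zero h
    exact ⟨z, hS _ _ h1, hT _ _ h2⟩
  smul_mem' := by
    rintro c T ⟨F, hF, hT⟩
    exact ⟨F, hF, fun x y h => hT x y (entry_smul_ne_zero h)⟩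
  star_mem' := by
    rintro T ⟨F, hF, hT⟩
    exact ⟨_, E.inv_mem F hF, fun x y h => hT y x (entry_star_ne_zero h)⟩

variable (B) in
/-- The C*-algebra generated by the matrices with support controlled by `E`, i.e. the norm closure
of `ctrl B E` in the adjointable operators on `l₂(X, B)`. -/
def CtrlAlg (E : ControlFamily X) : Type _ := (ctrl B E).topologicalClosure

namespace CtrlAlg
variable {E : ControlFamily X}

instance : NonUnitalCStarAlgebra (CtrlAlg B E) :=
  NonUnitalStarSubalgebra.nonUnitalCStarAlgebra (h_closed :=
    NonUnitalStarSubalgebra.isClosed_topologicalClosure (ctrl B E)) (ctrl B E).topologicalClosure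

/-- The underlying operator. -/
def op (T : CtrlAlg B E) : ColOp X B := T.1

lemma op_injective : Function.Injective (op : CtrlAlg B E → ColOp X B) := Subtype.val_injective

lemma op_add (S T : CtrlAlg B E) : (S + T).op = S.op + T.op := rfl
lemma op_smul (c : ℂ) (T : CtrlAlg B E) : (c • T).op = c • T.op := rfl
lemma op_mul (S T : CtrlAlg B E) : (S * T).op = S.op * T.op := rfl
lemma op_star (T : CtrlAlg B E) : (star T).op = star T.op := rfl
lemma op_zero : (0 : CtrlAlg B E).op = 0 := rfl

lemma norm_op (T : CtrlAlg B E) : ‖T.op‖ = ‖T‖ := rfl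

lemma mem_closure (T : CtrlAlg B E) : T.op ∈ closure (ctrl B E : Set (ColOp X B)) := T.2

/-- A `*`-homomorphism between algebras of operators that maps controlled operators to controlled
operators extends to the closures. -/
def lift {Y : Type*} {F : ControlFamily Y} (f : ColOp X A →⋆ₙₐ[ℂ] ColOp Y B)
    (hf : ∀ T ∈ ctrl A E, f T ∈ ctrl B F) : CtrlAlg A E →⋆ₙₐ[ℂ] CtrlAlg B F where
  toFun T := ⟨f T.op, map_mem_closure (hom_continuous f) T.mem_closure hf⟩
  map_smul' c T := op_injective (map_smul f c T.op)
  map_zero' := op_injective (map_zero f)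
  map_add' S T := op_injective (map_add f S.op T.op)
  map_mul' S T := op_injective (map_mul f S.op T.op)
  map_star' T := op_injective (map_star f T.op)

@[simp] lemma op_lift {Y : Type*} {F : ControlFamily Y} (f : ColOp X A →⋆ₙₐ[ℂ] ColOp Y B)
    (hf : ∀ T ∈ ctrl A E, f T ∈ ctrl B F) (T : CtrlAlg A E) : (lift f hf T).op = f T.op := rfl

variable (E) in
/-- Functoriality: entrywise application of a `*`-homomorphism. -/
def map (φ : A →⋆ₙₐ[ℂ] B) : CtrlAlg A E →⋆ₙₐ[ℂ] CtrlAlg B E :=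
  lift (colMap φ) (by
    rintro T ⟨F, hF, hT⟩
    exact ⟨F, hF, fun x y h => hT x y (entry_colMap_ne_zero h)⟩)

@[simp] lemma op_map (φ : A →⋆ₙₐ[ℂ] B) (T : CtrlAlg A E) : (map E φ T).op = colMap φ T.op := rfl

lemma map_id (T : CtrlAlg A E) : map E (NonUnitalStarAlgHom.id ℂ A) T = T :=
  op_injective (colMap_id _)

lemma map_comp (ψ : B →⋆ₙₐ[ℂ] C) (φ : A →⋆ₙₐ[ℂ] B) (T : CtrlAlg A E) :
    map E (ψ.comp φ) T = map E ψ (map E φ T) :=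
  op_injective (colMap_comp _ _ _)

end CtrlAlg

/-! ### The ideal of operators supported near a subspace -/

section Ideal
variable [PseudoMetricSpace X]

variable (B) in
/-- The operators `m` in the uniform Roe algebra whose support is contained in
`N_R(X₀) × N_R(X₀)` for some `R`. -/
def nearAlg (X₀ : Set X) : NonUnitalStarSubalgebra ℂ (CtrlAlg B (metricFamily X)) where
  carrier := {T | ∃ R : ℝ, ∀ x y, entry T.op x y ≠ 0 →
    x ∈ Metric.thickening R X₀ ∧ y ∈ Metric.thickening R X₀}
  zero_mem' := ⟨0, fun x y h => absurd (entry_zero x y) h⟩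
  add_mem' := by
    rintro S T ⟨R, hS⟩ ⟨R', hT⟩
    refine ⟨max R R', fun x y h => ?_⟩
    rw [CtrlAlg.op_add] at h
    rcases entry_add_ne_zero h with h | h
    · exact (hS x y h).imp (fun h => Metric.thickening_mono (le_max_left _ _) _ h)
        (fun h => Metric.thickening_mono (le_max_left _ _) _ h)
    · exact (hT x y h).imp (fun h => Metric.thickening_mono (le_max_right _ _) _ h)
        (fun h => Metric.thickening_mono (le_max_right _ _) _ h)
  mul_mem' := by
    rintro S T ⟨R, hS⟩ ⟨R', hT⟩
    refine ⟨max R R', fun x y h => ?_⟩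
    rw [CtrlAlg.op_mul] at h
    obtain ⟨z, h1, h2⟩ := exists_entry_ne_zero h
    exact ⟨Metric.thickening_mono (le_max_left _ _) _ (hS _ _ h1).1,
      Metric.thickening_mono (le_max_right _ _) _ (hT _ _ h2).2⟩
  smul_mem' := by
    rintro c T ⟨R, hT⟩
    exact ⟨R, fun x y h => hT x y (entry_smul_ne_zero h)⟩
  star_mem' := by
    rintro T ⟨R, hT⟩
    exact ⟨R, fun x y h => (hT y x (entry_star_ne_zero h)).symm⟩

lemma nearAlg_mul_mem (X₀ : Set X) (a j : CtrlAlg B (metricFamily X))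
    (hj : j ∈ nearAlg B X₀) : a * j ∈ (nearAlg B X₀).topologicalClosure := by
  obtain ⟨R, hR⟩ := hj
  refine Metric.mem_closure_iff.2 fun ε hε => ?_
  obtain ⟨b, hb, hab⟩ := Metric.mem_closure_iff.1 a.mem_closure (ε / (‖j‖ + 1)) (by positivity)
  let b' : CtrlAlg B (metricFamily X) := ⟨b, subset_closure hb⟩
  have hab' : ‖a - b'‖ < ε / (‖j‖ + 1) := by
    rw [dist_eq_norm] at hab; exact hab
  refine ⟨b' * j, ?_, ?_⟩
  · obtain ⟨F, ⟨S, hS⟩, hF⟩ := hb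
    refine ⟨|S| + 1 + |R|, fun x y h => ?_⟩
    rw [CtrlAlg.op_mul] at h
    obtain ⟨z, h1, h2⟩ := exists_entry_ne_zero h
    obtain ⟨hz, hy⟩ := hR _ _ h2
    have hd := hS _ (hF _ _ h1)
    constructor
    · rw [Metric.mem_thickening_iff] at hz ⊢
      obtain ⟨w, hw, hzw⟩ := hz
      refine ⟨w, hw, ?_⟩
      have := dist_triangle x z w
      simp only at hd
      linarith [le_abs_self S, le_abs_self R]
    · exact Metric.thickening_mono (by linarith [le_abs_self R, abs_nonneg S]) _ hy
  · rw [dist_eq_norm, ← sub_mul]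
    calc _ ≤ ‖a - b'‖ * ‖j‖ := norm_mul_le _ _
      _ ≤ ε / (‖j‖ + 1) * ‖j‖ := by gcongr
      _ < ε := by
        rw [div_mul_eq_mul_div, div_lt_iff₀ (by positivity)]
        nlinarith [norm_nonneg j]

lemma nearAlg_mul_mem_closure (X₀ : Set X) (a j : CtrlAlg B (metricFamily X))
    (hj : j ∈ (nearAlg B X₀).topologicalClosure) : a * j ∈ (nearAlg B X₀).topologicalClosure := by
  have hc : IsClosed ((nearAlg B X₀).topologicalClosure : Set (CtrlAlg B (metricFamily X))) :=
    NonUnitalStarSubalgebra.isClosed_topologicalClosure _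
  have := map_mem_closure (f := fun j => a * j) (continuous_const.mul continuous_id) hj
    (fun i hi => nearAlg_mul_mem X₀ a i hi)
  rwa [hc.closure_eq] at this

variable (B) in
/-- The ideal `𝔐ᵘ_{X ⊃ X₀} B` of the uniform Roe algebra: the norm closure of the operators with
support in `N_R(X₀) × N_R(X₀)` for some `R`. -/
def roeIdeal (X₀ : Set X) : ClosedIdeal (CtrlAlg B (metricFamily X)) where
  alg := (nearAlg B X₀).topologicalClosure
  mul_mem_left := nearAlg_mul_mem_closure X₀
  mul_mem_right a j hj := by
    have := star_mem (nearAlg_mul_mem_closure X₀ (star a) (star j) (star_mem hj))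
    simpa using this
  isClosed := NonUnitalStarSubalgebra.isClosed_topologicalClosure _

lemma map_roeIdeal (X₀ : Set X) (φ : A →⋆ₙₐ[ℂ] B) (T : CtrlAlg A (metricFamily X))
    (hT : T ∈ (roeIdeal A X₀).alg) : CtrlAlg.map _ φ T ∈ (roeIdeal B X₀).alg := by
  refine map_mem_closure (hom_continuous (CtrlAlg.map _ φ)) hT ?_
  rintro S ⟨R, hS⟩
  exact ⟨R, fun x y h => hS x y (entry_colMap_ne_zero h)⟩

end Ideal

/-! ### Conjugation by the isometries of `l₂(X, B)` given by injections `X → X` -/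

section Push
variable {f : X → X} (hf : Function.Injective f)

/-- The isometry `V` with `V e_x = e_{f x}`. -/
def L2.push : L2 X B →L[ℂ] L2 X B :=
  LinearMap.mkContinuous
    { toFun := fun ξ => ⟨Function.extend f ξ.toFun 0, by
        change Summable _
        rw [← hf.summable_iff]
        · convert ξ.summable using 1
          ext x; simp [hf.extend_apply]
        · intro x hx
          rw [Function.extend_apply' _ _ _ hx]; simp⟩
      map_add' := fun ξ ζ => L2.ext_apply fun x => by
        by_cases hx : ∃ y, f y = x
        · obtain ⟨y, rfl⟩ := hx
          simp [hf.extend_apply]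
        · simp [Function.extend_apply' _ _ _ hx]
      map_smul' := fun c ξ => L2.ext_apply fun x => by
        by_cases hx : ∃ y, f y = x
        · obtain ⟨y, rfl⟩ := hx
          simp [hf.extend_apply]
        · simp [Function.extend_apply' _ _ _ hx] } 1 fun ξ => by
    rw [one_mul, L2.norm_def, L2.norm_def]
    apply le_of_eq
    congr 2
    rw [L2.inner, L2.inner, ← hf.tsum_eq]
    · simp [hf.extend_apply]
    · intro x hx
      by_contra hne
      exact hx (by simp [Function.extend_apply' _ _ _ hne])

@[simp] lemma L2.push_apply (ξ : L2 X B) (x : X) : L2.push hf ξ (f x) = ξ x :=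
  hf.extend_apply _ _ _

lemma L2.push_of_notMem (ξ : L2 X B) {x : X} (hx : ¬ ∃ y, f y = x) : L2.push hf ξ x = 0 :=
  Function.extend_apply' _ _ _ hx

/-- The coisometry adjoint to `L2.push`. -/
def L2.pull : L2 X B →L[ℂ] L2 X B :=
  LinearMap.mkContinuous
    { toFun := fun ξ => ⟨fun x => ξ (f x), ξ.summable.comp_injective hf⟩
      map_add' := fun ξ ζ => rfl
      map_smul' := fun c ξ => rfl } 1 fun ξ => by
    rw [one_mul]
    refine L2.norm_le_of_finNorm fun s => le_trans (le_of_eq ?_) (ξ.finNorm_le (s.map ⟨f, hf⟩))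
    simp [finNorm]

@[simp] lemma L2.pull_apply (ξ : L2 X B) (x : X) : L2.pull hf ξ x = ξ (f x) := rfl

lemma L2.inner_pull (ξ ζ : L2 X B) :
    L2.inner (L2.pull hf ξ) ζ = L2.inner ξ (L2.push hf ζ) := by
  rw [L2.inner, L2.inner, ← hf.tsum_eq (f := fun x => star (ξ x) * (L2.push hf ζ) x)]
  · simp
  · intro x hx
    by_contra hne
    exact hx (by beta_reduce; rw [L2.push_of_notMem hf _ hne, mul_zero])

variable (B) in
/-- The isometry `L2.push` as an adjointable operator. -/
def isom : Adj X B := Adj.mk (L2.push hf) (L2.pull hf) (L2.inner_pull hf)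

lemma isom_op (ξ : L2 X B) : (isom B hf).op ξ = L2.push hf ξ := rfl

lemma star_isom_op (ξ : L2 X B) : (star (isom B hf)).op ξ = L2.pull hf ξ :=
  L2.inner_left_injective fun k => by
    rw [← (isom B hf).inner_left, ← L2.star_inner _ k, L2.inner_pull, L2.star_inner]
    rfl

lemma star_isom_mul_isom : star (isom B hf) * isom B hf = 1 :=
  Adj.ext_apply fun ξ => by
    rw [Adj.mul_op, star_isom_op, isom_op]
    exact L2.ext_apply fun x => by simp; rfl

lemma star_isom_mul_isom_of_disjoint {g : X → X} (hg : Function.Injective g)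
    (h : ∀ x y, f x ≠ g y) : star (isom B hf) * isom B hg = 0 :=
  Adj.ext_apply fun ξ => by
    rw [Adj.mul_op, star_isom_op, isom_op, Adj.zero_op]
    refine L2.ext_apply fun x => ?_
    rw [L2.pull_apply, L2.push_of_notMem hg _ (by rintro ⟨y, hy⟩; exact h x y hy.symm)]
    rfl

/-- Columns of `V T V^*`. -/
lemma HasCols.push {T : Adj X B} {c : X → L2 X B} (hT : HasCols T c) :
    HasCols (isom B hf * T * star (isom B hf)) (Function.extend f (fun y => L2.push hf (c y)) 0) := by
  intro y b
  rw [Adj.mul_op, Adj.mul_op, star_isom_op]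
  by_cases hy : ∃ z, f z = y
  · obtain ⟨z, rfl⟩ := hy
    have : L2.pull hf (L2.single (f z) b) = L2.single z b := L2.ext_apply fun x => by
      rw [L2.pull_apply]
      by_cases hx : x = z
      · subst hx; simp
      · rw [L2.single_of_ne hx, L2.single_of_ne (hf.ne hx)]
    rw [this, hT, hf.extend_apply, Adj.map_rmul, isom_op]
  · have : L2.pull hf (L2.single y b) = 0 := L2.ext_apply fun x => by
      rw [L2.pull_apply, L2.single_of_ne fun h => hy ⟨x, h⟩]
      rfl
    rw [this, Function.extend_apply' _ _ _ hy, map_zero, map_zero]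
    exact L2.ext_apply fun x => by simp

lemma push_mem (T : ColOp X B) :
    isom B hf * T.adj * star (isom B hf) ∈ colAlg X B := by
  refine ⟨⟨_, (hasCols_col T).push hf⟩,
    ⟨Function.extend f (fun y => L2.push hf (col (star T) y)) 0, ?_⟩⟩
  have := (hasCols_col (star T)).push hf
  rw [ColOp.star_adj] at this
  simpa only [star_mul, star_star, mul_assoc] using this

lemma isom_aux (S T : Adj X B) :
    (isom B hf * S * star (isom B hf)) * (isom B hf * T * star (isom B hf)) =
      isom B hf * (S * T) * star (isom B hf) := by
  calc _ = isom B hf * S * (star (isom B hf) * isom B hf) * T * star (isom B hf) := by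
        simp only [mul_assoc]
    _ = _ := by rw [star_isom_mul_isom, mul_one]; simp only [mul_assoc]

variable (B) in
/-- Conjugation `T ↦ V T V^*` by the isometry `V e_x = e_{f x}`. -/
def pushOp : ColOp X B →⋆ₙₐ[ℂ] ColOp X B where
  toFun T := ⟨isom B hf * T.adj * star (isom B hf), push_mem hf T⟩
  map_smul' c T := ColOp.adj_injective (by
    change isom B hf * (c • T.adj) * _ = c • (isom B hf * T.adj * _)
    simp)
  map_zero' := ColOp.adj_injective (by
    change isom B hf * 0 * _ = 0
    simp)
  map_add' S T := ColOp.adj_injective (by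
    change isom B hf * (S.adj + T.adj) * _ = isom B hf * S.adj * _ + isom B hf * T.adj * _
    rw [mul_add, add_mul])
  map_mul' S T := ColOp.adj_injective (isom_aux hf S.adj T.adj).symm
  map_star' T := ColOp.adj_injective (by
    change isom B hf * star T.adj * _ = star (isom B hf * T.adj * _)
    simp [mul_assoc])

lemma pushOp_adj (T : ColOp X B) :
    (pushOp B hf T).adj = isom B hf * T.adj * star (isom B hf) := rfl

lemma entry_pushOp (T : ColOp X B) (x y : X) :
    entry (pushOp B hf T) (f x) (f y) = entry T x y := by
  rw [entry, HasCols.col_eq (T := pushOp B hf T) ((hasCols_col T).push hf), hf.extend_apply,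
    L2.push_apply]
  rfl

lemma entry_pushOp_ne_zero {T : ColOp X B} {x y : X} (h : entry (pushOp B hf T) x y ≠ 0) :
    ∃ x' y', f x' = x ∧ f y' = y := by
  rw [entry, HasCols.col_eq (T := pushOp B hf T) ((hasCols_col T).push hf)] at h
  by_cases hy : ∃ z, f z = y
  · obtain ⟨z, rfl⟩ := hy
    rw [hf.extend_apply] at h
    by_cases hx : ∃ z, f z = x
    · obtain ⟨w, rfl⟩ := hx
      exact ⟨w, z, rfl, rfl⟩
    · exact absurd (L2.push_of_notMem hf _ hx) h
  · rw [Function.extend_apply' _ _ _ hy] at h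
    exact absurd rfl h

lemma colMap_pushOp (φ : A →⋆ₙₐ[ℂ] B) (T : ColOp X A) :
    colMap φ (pushOp A hf T) = pushOp B hf (colMap φ T) := by
  refine entry_ext fun x y => ?_
  by_cases h : ∃ x' y', f x' = x ∧ f y' = y
  · obtain ⟨x', y', rfl, rfl⟩ := h
    rw [entry_colMap, entry_pushOp, entry_pushOp, entry_colMap]
  · have h1 : entry (pushOp A hf T) x y = 0 := by
      by_contra hne; exact h (entry_pushOp_ne_zero hf hne)
    have h2 : entry (pushOp B hf (colMap φ T)) x y = 0 := by
      by_contra hne; exact h (entry_pushOp_ne_zero hf hne)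
    rw [entry_colMap, h1, h2, map_zero]

lemma pushOp_mul_pushOp {g : X → X} (hg : Function.Injective g) (h : ∀ x y, f x ≠ g y)
    (S T : ColOp X B) : pushOp B hf S * pushOp B hg T = 0 := by
  refine ColOp.adj_injective ?_
  rw [ColOp.mul_adj, ColOp.zero_adj, pushOp_adj, pushOp_adj]
  calc _ = isom B hf * S.adj * (star (isom B hf) * isom B hg) * T.adj * star (isom B hg) := by
        simp only [mul_assoc]
    _ = 0 := by rw [star_isom_mul_isom_of_disjoint hf hg h]; simp

variable (B) in
/-- Conjugation by the isometry `V e_x = e_{f x}` on the algebra of compact operators. -/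
def pushK : CtrlAlg B (finiteFamily X) →⋆ₙₐ[ℂ] CtrlAlg B (finiteFamily X) :=
  CtrlAlg.lift (pushOp B hf) (by
    rintro T ⟨F, hF, hT⟩
    refine ⟨Prod.map f f '' F, Set.Finite.image _ hF, fun x y h => ?_⟩
    obtain ⟨x', y', rfl, rfl⟩ := entry_pushOp_ne_zero hf h
    rw [entry_pushOp] at h
    exact ⟨(x', y'), hT _ _ h, rfl⟩)

@[simp] lemma op_pushK (T : CtrlAlg B (finiteFamily X)) : (pushK B hf T).op = pushOp B hf T.op :=
  rfl

lemma map_pushK (φ : A →⋆ₙₐ[ℂ] B) (T : CtrlAlg A (finiteFamily X)) :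
    CtrlAlg.map _ φ (pushK A hf T) = pushK B hf (CtrlAlg.map _ φ T) :=
  CtrlAlg.op_injective (colMap_pushOp hf φ T.op)

lemma pushK_mul_pushK {g : X → X} (hg : Function.Injective g) (h : ∀ x y, f x ≠ g y)
    (S T : CtrlAlg B (finiteFamily X)) : pushK B hf S * pushK B hg T = 0 :=
  CtrlAlg.op_injective (pushOp_mul_pushOp hf hg h S.op T.op)

end Push
end Controlled

/-! ### The category of C*-algebras -/

/-- The objects of the category of (possibly non-unital) C*-algebras. -/
structure CStarAlg : Type (u + 1) where
  carrier : Type u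
  [str : NonUnitalCStarAlgebra carrier]

attribute [instance] CStarAlg.str

instance : CoeSort CStarAlg.{u} (Type u) := ⟨CStarAlg.carrier⟩

/-- The morphisms are the `*`-homomorphisms. -/
instance : Category CStarAlg.{u} where
  Hom A B := A →⋆ₙₐ[ℂ] B
  id A := NonUnitalStarAlgHom.id ℂ A
  comp f g := g.comp f

instance : ConcreteCategory CStarAlg.{u} (fun A B => A →⋆ₙₐ[ℂ] B) where
  hom f := f
  ofHom f := f

/-- A `*`-homomorphism as a morphism of the category. -/
def ofHom {A B : CStarAlg.{u}} (φ : A →⋆ₙₐ[ℂ] B) : A ⟶ B := φ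

/-- A morphism of the category as a `*`-homomorphism. -/
def toHom {A B : CStarAlg.{u}} (φ : A ⟶ B) : A →⋆ₙₐ[ℂ] B := φ

@[simp] lemma ofHom_apply {A B : CStarAlg.{u}} (φ : A →⋆ₙₐ[ℂ] B) (a : A) : ofHom φ a = φ a := rfl

@[simp] lemma toHom_apply {A B : CStarAlg.{u}} (φ : A ⟶ B) (a : A) : toHom φ a = φ a := rfl

lemma toHom_id (A : CStarAlg.{u}) : toHom (𝟙 A) = NonUnitalStarAlgHom.id ℂ A := rfl

lemma toHom_comp {A B C : CStarAlg.{u}} (f : A ⟶ B) (g : B ⟶ C) :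
    toHom (f ≫ g) = (toHom g).comp (toHom f) := rfl

lemma hom_ext' {A B : CStarAlg.{u}} {f g : A ⟶ B} (h : ∀ a : A, f a = g a) : f = g :=
  NonUnitalStarAlgHom.ext h

/-! ### Functors -/

/-- Postcomposition of continuous functions with a `*`-homomorphism. -/
def contMap (Y : Type*) [TopologicalSpace Y] [CompactSpace Y] {A B : Type*}
    [NonUnitalCStarAlgebra A] [NonUnitalCStarAlgebra B] (φ : A →⋆ₙₐ[ℂ] B) :
    C(Y, A) →⋆ₙₐ[ℂ] C(Y, B) where
  toFun f := ⟨fun t => φ (f t), (hom_continuous φ).comp f.continuous⟩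
  map_smul' c f := ContinuousMap.ext fun t => map_smul φ c (f t)
  map_zero' := ContinuousMap.ext fun t => map_zero φ
  map_add' f g := ContinuousMap.ext fun t => map_add φ (f t) (g t)
  map_mul' f g := ContinuousMap.ext fun t => map_mul φ (f t) (g t)
  map_star' f := ContinuousMap.ext fun t => map_star φ (f t)

/-- The cylinder functor `I B = C([0,1], B)`. -/
def cyl : CStarAlg.{u} ⥤ CStarAlg.{u} where
  obj B := ⟨C(unitInterval, B)⟩
  map f := ofHom (contMap unitInterval (toHom f))
  map_id A := hom_ext' fun a => rfl
  map_comp f g := hom_ext' fun a => rfl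

/-- Evaluation at `t`, as a natural transformation from `I` to the identity. -/
def ev (t : unitInterval) : cyl.{u} ⟶ 𝟭 CStarAlg.{u} where
  app B := ofHom (A := cyl.obj B) (B := B)
    { toFun := fun f : C(unitInterval, B) => f t
      map_smul' := fun _ _ => rfl
      map_zero' := rfl
      map_add' := fun _ _ => rfl
      map_mul' := fun _ _ => rfl
      map_star' := fun _ => rfl }
  naturality A B f := hom_ext' fun a => rfl

/-- The inclusion as constant functions, from the identity to `I`. -/
def const : 𝟭 CStarAlg.{u} ⟶ cyl.{u} where
  app B := ofHom (A := B) (B := cyl.obj B)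
    { toFun := fun b => ContinuousMap.const _ b
      map_smul' := fun _ _ => rfl
      map_zero' := rfl
      map_add' := fun _ _ => rfl
      map_mul' := fun _ _ => rfl
      map_star' := fun _ => rfl }
  naturality A B f := hom_ext' fun a => rfl

lemma const_ev (t : unitInterval) (B : CStarAlg.{u}) : const.app B ≫ (ev t).app B = 𝟙 B := rfl

section C0
open scoped ZeroAtInfty
variable (Y : Type*) [TopologicalSpace Y] (Y₀ : Set Y)

/-- The functions in `C₀(Y, A)` that vanish on `Y₀`. -/
def vanishing (A : Type*) [NonUnitalCStarAlgebra A] : NonUnitalStarSubalgebra ℂ C₀(Y, A) where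
  carrier := {f | ∀ y ∈ Y₀, f y = 0}
  zero_mem' y hy := rfl
  add_mem' {f g} hf hg y hy := by simp [hf y hy, hg y hy]
  mul_mem' {f g} hf hg y hy := by simp [hf y hy]
  smul_mem' c f hf y hy := by simp [hf y hy]
  star_mem' {f} hf y hy := by simp [hf y hy]

lemma isClosed_vanishing (A : Type*) [NonUnitalCStarAlgebra A] :
    IsClosed (vanishing Y Y₀ A : Set C₀(Y, A)) := by
  have : (vanishing Y Y₀ A : Set C₀(Y, A)) = ⋂ y ∈ Y₀, {f : C₀(Y, A) | f y = 0} := by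
    ext f
    simp only [Set.mem_iInter]
    rfl
  rw [this]
  refine isClosed_biInter fun y _ => isClosed_eq ?_ continuous_const
  have h1 : Continuous fun f : C₀(Y, A) => f.toBCF :=
    ZeroAtInftyContinuousMap.isometry_toBCF.continuous
  exact (BoundedContinuousFunction.lipschitz_eval_const y).continuous.comp h1

/-- The C*-algebra `C₀(Y, Y₀, A) ≅ C₀(Y, Y₀) ⊗ A` of continuous functions from `Y` to `A` that
vanish at infinity and on `Y₀`. -/
def C0Pair (A : Type*) [NonUnitalCStarAlgebra A] : Type _ := vanishing Y Y₀ A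

instance (A : Type*) [NonUnitalCStarAlgebra A] : NonUnitalCStarAlgebra (C0Pair Y Y₀ A) :=
  NonUnitalStarSubalgebra.nonUnitalCStarAlgebra (h_closed := isClosed_vanishing Y Y₀ A)
    (vanishing Y Y₀ A)

variable {Y Y₀} in
/-- The underlying function. -/
def C0Pair.fn {A : Type*} [NonUnitalCStarAlgebra A] (f : C0Pair Y Y₀ A) : C₀(Y, A) := f.1

variable {Y Y₀} in
lemma C0Pair.ext' {A : Type*} [NonUnitalCStarAlgebra A] {f g : C0Pair Y Y₀ A}
    (h : ∀ y, f.fn y = g.fn y) : f = g :=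
  Subtype.ext (ZeroAtInftyContinuousMap.ext h)

/-- Postcomposition with a `*`-homomorphism. -/
def C0Pair.map {A B : Type*} [NonUnitalCStarAlgebra A] [NonUnitalCStarAlgebra B]
    (φ : A →⋆ₙₐ[ℂ] B) : C0Pair Y Y₀ A →⋆ₙₐ[ℂ] C0Pair Y Y₀ B where
  toFun f := ⟨⟨⟨fun t => φ (f.fn t), (hom_continuous φ).comp f.fn.continuous⟩, by
      have := ((hom_continuous φ).tendsto 0).comp f.fn.zero_at_infty'
      rw [map_zero] at this
      exact this⟩, fun y hy => by
      change φ (f.1 y) = 0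
      rw [f.2 y hy, map_zero]⟩
  map_smul' c f := C0Pair.ext' fun t => map_smul φ c (f.fn t)
  map_zero' := C0Pair.ext' fun t => map_zero φ
  map_add' f g := C0Pair.ext' fun t => map_add φ (f.fn t) (g.fn t)
  map_mul' f g := C0Pair.ext' fun t => map_mul φ (f.fn t) (g.fn t)
  map_star' f := C0Pair.ext' fun t => map_star φ (f.fn t)

end C0

/-- The functor `A ↦ C₀(Y, Y₀, A)`. -/
def c0Pair (Y : Type u) [TopologicalSpace Y] (Y₀ : Set Y) : CStarAlg.{u} ⥤ CStarAlg.{u} where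
  obj A := ⟨C0Pair Y Y₀ A⟩
  map f := ofHom (C0Pair.map Y Y₀ (toHom f))
  map_id A := hom_ext' fun a => rfl
  map_comp f g := hom_ext' fun a => rfl

section Asymptotic
open scoped BoundedContinuousFunction
variable {A B : Type*} [NonUnitalCStarAlgebra A] [NonUnitalCStarAlgebra B]

/-- The ideal `C₀([0,∞), B)` in `C_b([0,∞), B)`. -/
def asymIdeal (B : Type*) [NonUnitalCStarAlgebra B] : ClosedIdeal (ℝ≥0 →ᵇ B) where
  alg :=
    { carrier := {f | Tendsto f atTop (𝓝 0)}
      zero_mem' := tendsto_const_nhds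
      add_mem' := fun {f g} hf hg => by
        have h := Tendsto.add hf hg
        rwa [add_zero] at h
      mul_mem' := fun {f g} hf hg => by
        have h := Tendsto.mul hf hg
        rwa [mul_zero] at h
      smul_mem' := fun c f hf => by
        have h := Tendsto.const_smul hf c
        rwa [smul_zero] at h
      star_mem' := fun {f} hf => by
        have h := Tendsto.star hf
        rwa [star_zero] at h }
  mul_mem_left a j hj := by
    change Tendsto _ _ _ at hj
    change Tendsto _ _ _
    rw [tendsto_zero_iff_norm_tendsto_zero] at hj ⊢
    have h2 := hj.const_mul ‖a‖
    rw [mul_zero] at h2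
    refine squeeze_zero (fun _ => norm_nonneg _) (fun t => ?_) h2
    exact (norm_mul_le _ _).trans (by gcongr; exact a.norm_coe_le_norm t)
  mul_mem_right a j hj := by
    change Tendsto _ _ _ at hj
    change Tendsto _ _ _
    rw [tendsto_zero_iff_norm_tendsto_zero] at hj ⊢
    have h2 := hj.mul_const ‖a‖
    rw [zero_mul] at h2
    refine squeeze_zero (fun _ => norm_nonneg _) (fun t => ?_) h2
    exact (norm_mul_le _ _).trans (by gcongr; exact a.norm_coe_le_norm t)
  isClosed := by
    refine isClosed_of_closure_subset fun f hf => ?_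
    change Tendsto f atTop (𝓝 0)
    rw [Metric.tendsto_nhds]
    intro ε hε
    obtain ⟨g, hg, hfg⟩ := Metric.mem_closure_iff.1 hf (ε / 2) (half_pos hε)
    filter_upwards [Metric.tendsto_nhds.1 (show Tendsto g atTop (𝓝 0) from hg) (ε / 2) (half_pos hε)]
      with t ht
    have := BoundedContinuousFunction.dist_coe_le_dist (f := f) (g := g) t
    linarith [dist_triangle (f t) (g t) 0]

/-- Postcomposition of bounded continuous functions with a `*`-homomorphism. -/
def bcfMap (φ : A →⋆ₙₐ[ℂ] B) : (ℝ≥0 →ᵇ A) →⋆ₙₐ[ℂ] (ℝ≥0 →ᵇ B) where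
  toFun f := BoundedContinuousFunction.ofNormedAddCommGroup (fun t => φ (f t))
    ((hom_continuous φ).comp f.continuous) ‖f‖
    fun t => (NonUnitalStarAlgHom.norm_apply_le φ _).trans (f.norm_coe_le_norm t)
  map_smul' c f := BoundedContinuousFunction.ext fun t => map_smul φ c (f t)
  map_zero' := BoundedContinuousFunction.ext fun t => map_zero φ
  map_add' f g := BoundedContinuousFunction.ext fun t => map_add φ (f t) (g t)
  map_mul' f g := BoundedContinuousFunction.ext fun t => map_mul φ (f t) (g t)
  map_star' f := BoundedContinuousFunction.ext fun t => map_star φ (f t)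

lemma bcfMap_mem (φ : A →⋆ₙₐ[ℂ] B) (f : ℝ≥0 →ᵇ A) (hf : f ∈ (asymIdeal A).alg) :
    bcfMap φ f ∈ (asymIdeal B).alg := by
  have := ((hom_continuous φ).tendsto 0).comp (show Tendsto f atTop (𝓝 0) from hf)
  rw [map_zero] at this
  exact this

/-- The map `𝔄 φ` induced on asymptotic algebras. -/
def asymMap (φ : A →⋆ₙₐ[ℂ] B) : CQuot (asymIdeal A) →⋆ₙₐ[ℂ] CQuot (asymIdeal B) :=
  CQuot.map (bcfMap φ) (bcfMap_mem φ)

lemma asymMap_mk (φ : A →⋆ₙₐ[ℂ] B) (f : ℝ≥0 →ᵇ A) :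
    asymMap φ (CQuot.mk _ f) = CQuot.mk _ (bcfMap φ f) := rfl

/-- The class of constant functions. -/
def asymConst (B : Type*) [NonUnitalCStarAlgebra B] : B →⋆ₙₐ[ℂ] CQuot (asymIdeal B) where
  toFun b := CQuot.mk _ (BoundedContinuousFunction.const _ b)
  map_smul' _ _ := rfl
  map_zero' := rfl
  map_add' _ _ := rfl
  map_mul' _ _ := rfl
  map_star' _ := rfl

end Asymptotic

/-- The asymptotic algebra functor `𝔄 B = C_b([0,∞), B) / C₀([0,∞), B)`. -/
def asym : CStarAlg.{u} ⥤ CStarAlg.{u} where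
  obj B := ⟨CQuot (asymIdeal B)⟩
  map f := ofHom (asymMap (toHom f))
  map_id A := hom_ext' fun a => by
    obtain ⟨a, rfl⟩ := CQuot.mk_surjective a
    rfl
  map_comp f g := hom_ext' fun a => by
    obtain ⟨a, rfl⟩ := CQuot.mk_surjective a
    rfl

/-- The natural transformation `α : Id → 𝔄` given by constant functions. -/
def alpha : 𝟭 CStarAlg.{u} ⟶ asym.{u} where
  app B := ofHom (A := B) (B := asym.obj B) (asymConst B)
  naturality A B f := hom_ext' fun a => rfl

/-- The functor `𝕂`: the closure, in the adjointable operators on `l₂(ℕ, B)`, of the matrices with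
finitely many non-zero entries, which all lie in `B`. -/
def compact : CStarAlg.{u} ⥤ CStarAlg.{u} where
  obj B := ⟨CtrlAlg B (finiteFamily ℕ)⟩
  map f := ofHom (CtrlAlg.map _ (toHom f))
  map_id A := hom_ext' fun a => CtrlAlg.map_id a
  map_comp f g := hom_ext' fun a => CtrlAlg.map_comp (toHom g) (toHom f) a

/-- The uniform Roe functor `𝔐ᵘ_X`: the closure, in the adjointable operators on `l₂(X, B)`, of the
operators given by matrices with entries in `B` of finite propagation. (The entries of such a matrix
are bounded by its norm, and if `X` has bounded geometry, each matrix of finite propagation with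
bounded entries defines such an operator.) -/
def roe (X : Type u) [PseudoMetricSpace X] : CStarAlg.{u} ⥤ CStarAlg.{u} where
  obj B := ⟨CtrlAlg B (metricFamily X)⟩
  map f := ofHom (CtrlAlg.map _ (toHom f))
  map_id A := hom_ext' fun a => CtrlAlg.map_id a
  map_comp f g := hom_ext' fun a => CtrlAlg.map_comp (toHom g) (toHom f) a

/-- The functor `𝔑ᵘ_{X,X₀} = 𝔐ᵘ_X / 𝔐ᵘ_{X ⊃ X₀}`. -/
def roeQuot (X : Type u) [PseudoMetricSpace X] (X₀ : Set X) : CStarAlg.{u} ⥤ CStarAlg.{u} where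
  obj B := ⟨CQuot (roeIdeal B X₀)⟩
  map f := ofHom (CQuot.map (toHom ((roe X).map f)) (map_roeIdeal X₀ (toHom f)))
  map_id A := hom_ext' fun a => by
    obtain ⟨a, rfl⟩ := CQuot.mk_surjective a
    exact congrArg (CQuot.mk _) (CtrlAlg.map_id a)
  map_comp f g := hom_ext' fun a => by
    obtain ⟨a, rfl⟩ := CQuot.mk_surjective a
    exact congrArg (CQuot.mk _) (CtrlAlg.map_comp (toHom g) (toHom f) a)

/-! ### Orthogonality -/

/-- Two morphisms with the same target have orthogonal images. -/
def Orth {A A' B : CStarAlg.{u}} (f : A ⟶ B) (g : A' ⟶ B) : Prop := ∀ a a', f a * g a' = 0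

lemma Orth.symm {A A' B : CStarAlg.{u}} {f : A ⟶ B} {g : A' ⟶ B} (h : Orth f g) : Orth g f :=
  fun a' a => by
    have h1 := congrArg star (h (star a) (star a'))
    rw [star_mul, star_zero, ← map_star, ← map_star, star_star, star_star] at h1
    exact h1

lemma Orth.comp {A A' C C' B : CStarAlg.{u}} {f : A ⟶ B} {g : A' ⟶ B} (h : Orth f g)
    (k : C ⟶ A) (l : C' ⟶ A') : Orth (k ≫ f) (l ≫ g) := fun a a' => h (k a) (l a')

/-- The sum of two orthogonal `*`-homomorphisms. -/
def orthAdd {A B : CStarAlg.{u}} (f g : A ⟶ B) (h : Orth f g) : A ⟶ B :=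
  ofHom
    { toFun := fun a => f a + g a
      map_smul' := fun c a => by
        change toHom f (c • a) + toHom g (c • a) = c • (toHom f a + toHom g a)
        rw [map_smul, map_smul, smul_add]
      map_zero' := by
        change toHom f 0 + toHom g 0 = 0
        rw [map_zero, map_zero, add_zero]
      map_add' := fun a b => by
        change toHom f (a + b) + toHom g (a + b) = (toHom f a + toHom g a) + (toHom f b + toHom g b)
        rw [map_add, map_add]; abel
      map_mul' := fun a b => by
        change toHom f (a * b) + toHom g (a * b) = (toHom f a + toHom g a) * (toHom f b + toHom g b)
        have h1 : toHom f a * toHom g b = 0 := h a b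
        have h2 : toHom g a * toHom f b = 0 := h.symm a b
        rw [map_mul, map_mul, add_mul, mul_add, mul_add, h1, h2]; simp
      map_star' := fun a => by
        change toHom f (star a) + toHom g (star a) = star (toHom f a + toHom g a)
        rw [map_star, map_star, star_add] }

lemma orthAdd_apply {A B : CStarAlg.{u}} (f g : A ⟶ B) (h : Orth f g) (a : A) :
    orthAdd f g h a = f a + g a := rfl

lemma comp_orthAdd {A' A B : CStarAlg.{u}} (k : A' ⟶ A) (f g : A ⟶ B) (h : Orth f g) :
    k ≫ orthAdd f g h = orthAdd (k ≫ f) (k ≫ g) (h.comp k k) := rfl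

lemma Orth.comp_right {A A' B C : CStarAlg.{u}} {f : A ⟶ B} {g : A' ⟶ B} (h : Orth f g)
    (k : B ⟶ C) : Orth (f ≫ k) (g ≫ k) := fun a a' => by
  change toHom k (toHom f a) * toHom k (toHom g a') = 0
  rw [← map_mul]
  exact (congrArg (toHom k) (h a a')).trans (map_zero _)

lemma orthAdd_comp {A B C : CStarAlg.{u}} (f g : A ⟶ B) (h : Orth f g) (k : B ⟶ C) :
    orthAdd f g h ≫ k = orthAdd (f ≫ k) (g ≫ k) (h.comp_right k) :=
  hom_ext' fun a => map_add (toHom k) (f a) (g a)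

/-- Functors that preserve orthogonality of morphisms, for which sums of generalized morphisms can
be defined. -/
class OrthPreserving (F : CStarAlg.{u} ⥤ CStarAlg.{u}) : Prop where
  orth : ∀ {A A' B : CStarAlg.{u}} (f : A ⟶ B) (g : A' ⟶ B), Orth f g → Orth (F.map f) (F.map g)

instance : OrthPreserving (𝟭 CStarAlg.{u}) := ⟨fun _ _ h => h⟩

instance (F G : CStarAlg.{u} ⥤ CStarAlg.{u}) [OrthPreserving F] [OrthPreserving G] :
    OrthPreserving (F ⋙ G) :=
  ⟨fun f g h => OrthPreserving.orth (F := G) _ _ (OrthPreserving.orth (F := F) f g h)⟩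

instance : OrthPreserving asym.{u} := ⟨fun f g h a a' => by
  obtain ⟨a, rfl⟩ := CQuot.mk_surjective a
  obtain ⟨a', rfl⟩ := CQuot.mk_surjective a'
  refine congrArg (CQuot.mk _) (?_ : bcfMap (toHom f) a * bcfMap (toHom g) a' = 0)
  exact BoundedContinuousFunction.ext fun t => h (a t) (a' t)⟩

lemma orth_colMap {X A A' B : Type*} [NonUnitalCStarAlgebra A] [NonUnitalCStarAlgebra A']
    [NonUnitalCStarAlgebra B] (f : A →⋆ₙₐ[ℂ] B) (g : A' →⋆ₙₐ[ℂ] B) (h : ∀ a a', f a * g a' = 0)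
    (S : ColOp X A) (T : ColOp X A') : colMap f S * colMap g T = 0 := by
  refine entry_ext fun x y => ?_
  by_contra hne
  rw [entry_zero] at hne
  refine hne ((hasSum_entry_mul _ _ x y).unique ?_)
  simp only [entry_colMap, h]
  exact hasSum_zero

instance (X : Type u) [PseudoMetricSpace X] (X₀ : Set X) : OrthPreserving (roeQuot X X₀) :=
  ⟨fun f g h a a' => by
    obtain ⟨a, rfl⟩ := CQuot.mk_surjective a
    obtain ⟨a', rfl⟩ := CQuot.mk_surjective a'
    exact congrArg (CQuot.mk _)
      (CtrlAlg.op_injective (orth_colMap (toHom f) (toHom g) h a.op a'.op))⟩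

/-! ### The two inclusions of `𝕂` into itself -/

/-- The natural transformation `𝕂 → 𝕂` given by conjugation with the isometry
`V e_n = e_{f n}` for an injection `f`. -/
def conjK {f : ℕ → ℕ} (hf : Function.Injective f) : compact.{u} ⟶ compact.{u} where
  app B := ofHom (A := compact.obj B) (B := compact.obj B) (pushK B hf)
  naturality A B φ := hom_ext' fun a => (map_pushK hf (toHom φ) a).symm

lemma two_mul_injective : Function.Injective fun n : ℕ => 2 * n := fun m n h => by
  simpa using h

lemma two_mul_add_one_injective : Function.Injective fun n : ℕ => 2 * n + 1 := fun m n h => by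
  simpa using h

/-- Conjugation by `V₀ e_n = e_{2n}`. -/
def inc₀ : compact.{u} ⟶ compact.{u} := conjK two_mul_injective

/-- Conjugation by `V₁ e_n = e_{2n+1}`; since `V₀ V₀^* + V₁ V₁^* = 1`, the transformation
`inc₀ ⊕ inc₁ : 𝕂 ⊕ 𝕂 → 𝕂` is the inclusion as block diagonal matrices for an isomorphism
`ℓ² ⊕ ℓ² ≅ ℓ²`. -/
def inc₁ : compact.{u} ⟶ compact.{u} := conjK two_mul_add_one_injective

lemma orth_inc (B : CStarAlg.{u}) : Orth (inc₀.app B) (inc₁.app B) := fun a a' =>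
  pushK_mul_pushK two_mul_injective two_mul_add_one_injective (fun x y => by omega) a a'

/-! ### Generalized morphisms -/

section GenMor
variable {A A' B B' : CStarAlg.{u}}

/-- Two `*`-homomorphisms `A → F B` are `F`-homotopic if they are the compositions of one
`*`-homomorphism `A → F I B` with `F ev₀` and `F ev₁`. -/
def Homotopic (F : CStarAlg.{u} ⥤ CStarAlg.{u}) (φ ψ : A ⟶ F.obj B) : Prop :=
  ∃ Φ : A ⟶ F.obj (cyl.obj B),
    Φ ≫ F.map ((ev 0).app B) = φ ∧ Φ ≫ F.map ((ev 1).app B) = ψ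

/-- The set `[A, F, B]` of `F`-homotopy classes of `*`-homomorphisms `A → F B`. (The quotient is
by the equivalence relation generated by `F`-homotopy.) -/
def GenMor (F : CStarAlg.{u} ⥤ CStarAlg.{u}) (A B : CStarAlg.{u}) : Type u :=
  Quot (Homotopic (A := A) (B := B) F)

/-- The class of a `*`-homomorphism. -/
def GenMor.mk (F : CStarAlg.{u} ⥤ CStarAlg.{u}) (φ : A ⟶ F.obj B) : GenMor F A B := Quot.mk _ φ

variable {F F' : CStarAlg.{u} ⥤ CStarAlg.{u}}

/-- The map `[A, F, B] → [A, F', B]` induced by a natural transformation `F → F'`. -/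
def GenMor.mapNat (η : F ⟶ F') : GenMor F A B → GenMor F' A B :=
  Quot.map (fun φ => φ ≫ η.app B) (by
    rintro φ ψ ⟨Φ, rfl, rfl⟩
    exact ⟨Φ ≫ η.app _, by simp, by simp⟩)

/-- The map `[A, F, B] → [A', F, B]` induced by a `*`-homomorphism `A' → A`. -/
def GenMor.pre (f : A' ⟶ A) : GenMor F A B → GenMor F A' B :=
  Quot.map (fun φ => f ≫ φ) (by
    rintro φ ψ ⟨Φ, rfl, rfl⟩
    exact ⟨f ≫ Φ, by simp, by simp⟩)

/-- The map `[A, F, B] → [A, F, B']` induced by a `*`-homomorphism `B → B'`. -/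
def GenMor.post (g : B ⟶ B') : GenMor F A B → GenMor F A B' :=
  Quot.map (fun φ => φ ≫ F.map g) (by
    rintro φ ψ ⟨Φ, rfl, rfl⟩
    refine ⟨Φ ≫ F.map (cyl.map g), ?_, ?_⟩ <;>
    · simp only [Category.assoc, ← F.map_comp]
      rw [NatTrans.naturality]
      rfl)

/-- The sum of `φ, ψ : A → G 𝕂 B`, obtained from `(φ, ψ) : A → G 𝕂 B ⊕ G 𝕂 B` and the inclusion
`𝕂 ⊕ 𝕂 → 𝕂` as block diagonal matrices. -/
def dsum (G : CStarAlg.{u} ⥤ CStarAlg.{u}) [OrthPreserving G]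
    (φ ψ : A ⟶ (compact ⋙ G).obj B) : A ⟶ (compact ⋙ G).obj B :=
  orthAdd (φ ≫ G.map (inc₀.app B)) (ψ ≫ G.map (inc₁.app B))
    ((OrthPreserving.orth _ _ (orth_inc B)).comp φ ψ)

lemma dsum_comp (G : CStarAlg.{u} ⥤ CStarAlg.{u}) [OrthPreserving G]
    (φ ψ : A ⟶ (compact ⋙ G).obj B) (g : B ⟶ B') :
    dsum G φ ψ ≫ (compact ⋙ G).map g =
      dsum G (φ ≫ (compact ⋙ G).map g) (ψ ≫ (compact ⋙ G).map g) := by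
  have h0 : G.map (inc₀.app B) ≫ (compact ⋙ G).map g =
      (compact ⋙ G).map g ≫ G.map (inc₀.app B') := by
    simp only [Functor.comp_map, ← G.map_comp]
    rw [inc₀.naturality]
  have h1 : G.map (inc₁.app B) ≫ (compact ⋙ G).map g =
      (compact ⋙ G).map g ≫ G.map (inc₁.app B') := by
    simp only [Functor.comp_map, ← G.map_comp]
    rw [inc₁.naturality]
  rw [dsum, orthAdd_comp]
  simp only [Category.assoc, h0, h1]
  rfl

lemma const_comp_ev (F : CStarAlg.{u} ⥤ CStarAlg.{u}) (φ : A ⟶ F.obj B) (t : unitInterval) :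
    (φ ≫ F.map (const.app B)) ≫ F.map ((ev t).app B) = φ := by
  have h : F.map (const.app B) ≫ F.map ((ev t).app B) = 𝟙 _ := by
    rw [← F.map_comp, const_ev]
    exact F.map_id B
  rw [Category.assoc, h]
  exact Category.comp_id φ

/-- The set `[A, G 𝕂, B]`, with the addition induced by `dsum`. -/
def SumMor (G : CStarAlg.{u} ⥤ CStarAlg.{u}) (A B : CStarAlg.{u}) : Type u :=
  GenMor (compact ⋙ G) A B

variable {G G' : CStarAlg.{u} ⥤ CStarAlg.{u}}

instance [OrthPreserving G] : Add (SumMor G A B) :=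
  ⟨Quot.map₂ (dsum G)
    (by
      rintro φ ψ ψ' ⟨Φ, rfl, rfl⟩
      refine ⟨dsum G (φ ≫ (compact ⋙ G).map (const.app B)) Φ, ?_, ?_⟩ <;>
      · rw [dsum_comp, const_comp_ev])
    (by
      rintro φ φ' ψ ⟨Φ, rfl, rfl⟩
      refine ⟨dsum G Φ (ψ ≫ (compact ⋙ G).map (const.app B)), ?_, ?_⟩ <;>
      · rw [dsum_comp, const_comp_ev])⟩

/-- The class of the zero homomorphism. -/
instance : Zero (SumMor G A B) := ⟨GenMor.mk (compact ⋙ G) (ofHom 0)⟩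

/-- The additive map `[A, G 𝕂, B] → [A, G' 𝕂, B]` induced by a natural transformation `G → G'`. -/
def SumMor.mapNat [OrthPreserving G] [OrthPreserving G'] (η : G ⟶ G') :
    SumMor G A B →ₙ+ SumMor G' A B where
  toFun := GenMor.mapNat (Functor.whiskerLeft compact η)
  map_add' := by
    rintro ⟨φ⟩ ⟨ψ⟩
    refine congrArg (GenMor.mk (compact ⋙ G')) (?_ : dsum G φ ψ ≫ η.app _ =
      dsum G' (φ ≫ η.app _) (ψ ≫ η.app _))
    rw [dsum, orthAdd_comp]
    simp only [Category.assoc, η.naturality]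
    simp only [dsum, Category.assoc]

/-- Precomposition on `[A, G 𝕂, B]`. -/
def SumMor.pre (f : A' ⟶ A) : SumMor G A B → SumMor G A' B := GenMor.pre f

/-- Postcomposition on `[A, G 𝕂, B]`. -/
def SumMor.post (g : B ⟶ B') : SumMor G A B → SumMor G A B' := GenMor.post g

lemma SumMor.pre_mapNat [OrthPreserving G] [OrthPreserving G'] (η : G ⟶ G') (f : A' ⟶ A)
    (x : SumMor G A B) : SumMor.pre f (SumMor.mapNat η x) = SumMor.mapNat η (SumMor.pre f x) := by
  obtain ⟨φ⟩ := x
  exact congrArg (GenMor.mk (compact ⋙ G')) (Category.assoc _ _ _).symm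

lemma SumMor.post_mapNat [OrthPreserving G] [OrthPreserving G'] (η : G ⟶ G') (g : B ⟶ B')
    (x : SumMor G A B) : SumMor.post g (SumMor.mapNat η x) = SumMor.mapNat η (SumMor.post g x) := by
  obtain ⟨φ⟩ := x
  refine congrArg (GenMor.mk (compact ⋙ G')) (?_ : (φ ≫ η.app _) ≫ G'.map (compact.map g) =
    (φ ≫ G.map (compact.map g)) ≫ η.app _)
  rw [Category.assoc, Category.assoc, η.naturality]

end GenMor

/-! ### The colimit over the powers of the asymptotic algebra functor -/

section Colimit

/-- The functor `𝔄^{k+1}`, with `𝔄^{k+2} = 𝔄 ∘ 𝔄^{k+1}`. -/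
def asymPow : ℕ → (CStarAlg.{u} ⥤ CStarAlg.{u})
  | 0 => asym
  | k + 1 => asymPow k ⋙ asym

instance (k : ℕ) : OrthPreserving (asymPow.{u} k) := by
  induction k with
  | zero => exact inferInstanceAs (OrthPreserving asym)
  | succ k ih => exact inferInstanceAs (OrthPreserving (asymPow k ⋙ asym))

variable (F : CStarAlg.{u} ⥤ CStarAlg.{u}) [OrthPreserving F] (A A' B B' : CStarAlg.{u})

/-- The set `[A, F 𝔄^{k+1} 𝕂, B]`. -/
abbrev Stage (k : ℕ) : Type u := SumMor (asymPow k ⋙ F) A B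

/-- The natural transformation `F α 𝔄^{k+1} : F 𝔄^{k+1} → F 𝔄^{k+2}`. -/
def stageNat (k : ℕ) : asymPow.{u} k ⋙ F ⟶ asymPow (k + 1) ⋙ F where
  app D := F.map (alpha.app ((asymPow k).obj D))
  naturality D D' f := by
    change F.map ((asymPow k).map f) ≫ F.map _ = F.map _ ≫ F.map (asym.map ((asymPow k).map f))
    rw [← F.map_comp, ← F.map_comp, ← alpha.naturality]
    rfl

/-- The transition maps `[A, F 𝔄^{i+1} 𝕂, B] → [A, F 𝔄^{j+1} 𝕂, B]` for `i ≤ j`, composed of those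
induced by the transformations `F α 𝔄^{k+1}`. -/
def stageMap (i j : ℕ) (h : i ≤ j) : Stage F A B i →ₙ+ Stage F A B j :=
  Nat.leRec (motive := fun j _ => Stage F A B i →ₙ+ Stage F A B j) (AddHom.id _)
    (fun j _ g => (SumMor.mapNat (stageNat F j)).comp g) h

lemma stageMap_self (i : ℕ) : stageMap F A B i i le_rfl = AddHom.id _ := Nat.leRec_self _ _

lemma stageMap_succ (i j : ℕ) (h : i ≤ j) :
    stageMap F A B i (j + 1) (h.trans j.le_succ) =
      (SumMor.mapNat (stageNat F j)).comp (stageMap F A B i j h) :=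
  Nat.leRec_succ _ _ _

instance : DirectedSystem (Stage F A B) (stageMap F A B · · ·) where
  map_self i x := by rw [stageMap_self]; rfl
  map_map k j i hij hjk x := by
    induction k, hjk using Nat.le_induction with
    | base => rw [stageMap_self]; rfl
    | succ k hjk ih =>
      rw [stageMap_succ F A B j k hjk, stageMap_succ F A B i k (hij.trans hjk)]
      exact congrArg _ (ih)

/-- The colimit `colim_{k ≥ 1} [A, F 𝔄^k 𝕂, B]`. -/
abbrev AsymMor : Type u := DirectLimit (Stage F A B) (stageMap F A B)

variable {A A' B B'}

variable (A B) in
/-- The canonical map from a stage to the colimit. -/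
def toColim (k : ℕ) (x : Stage F A B k) : AsymMor F A B := ⟦⟨k, x⟩⟧

/-- Precomposition on the colimit. -/
def AsymMor.pre (f : A' ⟶ A) : AsymMor F A B → AsymMor F A' B :=
  DirectLimit.map (stageMap F A B) (stageMap F A' B) (fun k => SumMor.pre f) (by
    intro i j h x
    induction j, h using Nat.le_induction with
    | base => rw [stageMap_self, stageMap_self]; rfl
    | succ j h ih =>
      rw [stageMap_succ F A B i j h, stageMap_succ F A' B i j h, AddHom.comp_apply,
        AddHom.comp_apply, ih, SumMor.pre_mapNat])

/-- Postcomposition on the colimit. -/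
def AsymMor.post (g : B ⟶ B') : AsymMor F A B → AsymMor F A B' :=
  DirectLimit.map (stageMap F A B) (stageMap F A B') (fun k => SumMor.post g) (by
    intro i j h x
    induction j, h using Nat.le_induction with
    | base => rw [stageMap_self, stageMap_self]; rfl
    | succ j h ih =>
      rw [stageMap_succ F A B i j h, stageMap_succ F A B' i j h, AddHom.comp_apply,
        AddHom.comp_apply, ih, SumMor.post_mapNat])

end Colimit

/-- The laws of a commutative monoid. -/
structure IsCommMonoid (M : Type*) [Add M] [Zero M] : Prop where
  assoc : ∀ a b c : M, a + b + c = a + (b + c)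
  comm : ∀ a b : M, a + b = b + a
  zero_add : ∀ a : M, 0 + a = a

/-! ### Scalable pairs and discretizations -/

/-- The pair `(Y, Y₀)` of a metric space and a subspace is scalable: there are a continuous map
`sc : Y × [0,∞) → Y` preserving `Y₀` and functions `ρ_t : [0,∞) → [0,∞)` such that `sc_0 = id`,
preimages of bounded sets are bounded locally uniformly in `t`, each `sc_t` is expansive with
control function `ρ_t`, each `ρ_t` is monotone, and for each `r` the function `t ↦ ρ_t(r)` is
bounded and converges to `0`. -/
def IsScalable (Y : Type*) [PseudoMetricSpace Y] (Y₀ : Set Y) : Prop :=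
  ∃ (sc : ℝ≥0 → Y → Y) (ρ : ℝ≥0 → ℝ≥0 → ℝ≥0),
    Continuous (fun p : Y × ℝ≥0 => sc p.2 p.1) ∧
    (∀ t, ∀ y ∈ Y₀, sc t y ∈ Y₀) ∧
    (∀ y, sc 0 y = y) ∧
    (∀ S : Set Y, Bornology.IsBounded S → ∀ T > 0,
      Bornology.IsBounded (⋃ t ∈ Set.Icc 0 T, sc t ⁻¹' S)) ∧
    (∀ t x y, nndist (sc t x) (sc t y) ≤ ρ t (nndist x y)) ∧
    (∀ t, Monotone (ρ t)) ∧
    (∀ r, BddAbove (Set.range fun t => ρ t r) ∧ Tendsto (fun t => ρ t r) atTop (𝓝 0))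

/-- `X` is a discretization of `Y` at the scale `δ`: it is `δ`-separated and each point of `Y` has
distance less than `δ` from `X`. -/
structure IsDiscretization {Y : Type*} [PseudoMetricSpace Y] (δ : ℝ) (X : Set Y) : Prop where
  separated : ∀ x ∈ X, ∀ y ∈ X, x ≠ y → δ ≤ dist x y
  dense : ∀ y : Y, ∃ x ∈ X, dist y x < δ

/-- The points of `X` at distance less than `δ` from `Y₀` (none, if `Y₀` is empty). -/
def nearPoints {Y : Type*} [PseudoMetricSpace Y] (δ : ℝ) (X Y₀ : Set Y) : Set X :=
  {x | (x : Y) ∈ Metric.thickening δ Y₀}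

/-- Bounded geometry of a discrete metric space: for each `R`, the numbers of points in the balls of
radius `R` are uniformly bounded. -/
def BoundedGeometry (X : Type*) [PseudoMetricSpace X] : Prop :=
  ∀ R : ℝ, ∃ N : ℕ, ∀ x : X, (Metric.closedBall x R).encard ≤ N

end

end AsympAdj

open AsympAdj

namespace AsympAdj
noncomputable section
/-! ### Homomorphisms of C*-algebras -/

section Hom
variable {A B C : Type*} [NonUnitalCStarAlgebra A] [NonUnitalCStarAlgebra B]
  [NonUnitalCStarAlgebra C]

/-- The kernel of a `*`-homomorphism. -/
def kerIdeal (φ : A →⋆ₙₐ[ℂ] B) : ClosedIdeal A where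
  alg :=
    { carrier := {a | φ a = 0}
      zero_mem' := map_zero φ
      add_mem' := fun {a b} ha hb => by
        change φ (a + b) = 0
        rw [map_add, show φ a = 0 from ha, show φ b = 0 from hb, add_zero]
      mul_mem' := fun {a b} ha hb => by
        change φ (a * b) = 0
        rw [map_mul, show φ a = 0 from ha, zero_mul]
      smul_mem' := fun c a ha => by
        change φ (c • a) = 0
        rw [map_smul, show φ a = 0 from ha, smul_zero]
      star_mem' := fun {a} ha => by
        change φ (star a) = 0
        rw [map_star, show φ a = 0 from ha, star_zero] }
  mul_mem_left a j hj := by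
    change φ (a * j) = 0
    rw [map_mul, show φ j = 0 from hj, mul_zero]
  mul_mem_right a j hj := by
    change φ (j * a) = 0
    rw [map_mul, show φ j = 0 from hj, zero_mul]
  isClosed := isClosed_eq (hom_continuous φ) continuous_const

lemma mem_kerIdeal {φ : A →⋆ₙₐ[ℂ] B} {a : A} : a ∈ (kerIdeal φ).alg ↔ φ a = 0 := Iff.rfl

/-- A `*`-homomorphism that vanishes on an ideal, as a `*`-homomorphism on the quotient. -/
def CQuot.lift (J : ClosedIdeal A) (φ : A →⋆ₙₐ[ℂ] B) (h : ∀ a ∈ J.alg, φ a = 0) :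
    CQuot J →⋆ₙₐ[ℂ] B where
  toFun := Quotient.lift φ fun a a' ha => by
    replace ha : CQuot.mk J a = CQuot.mk J a' := Quotient.sound ha
    rw [CQuot.mk_eq] at ha
    have := h _ ha
    rwa [map_sub, sub_eq_zero] at this
  map_smul' c x := by
    obtain ⟨a, rfl⟩ := CQuot.mk_surjective x
    exact map_smul φ c a
  map_zero' := map_zero φ
  map_add' x y := by
    obtain ⟨a, rfl⟩ := CQuot.mk_surjective x
    obtain ⟨b, rfl⟩ := CQuot.mk_surjective y
    exact map_add φ a b
  map_mul' x y := by
    obtain ⟨a, rfl⟩ := CQuot.mk_surjective x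
    obtain ⟨b, rfl⟩ := CQuot.mk_surjective y
    exact map_mul φ a b
  map_star' x := by
    obtain ⟨a, rfl⟩ := CQuot.mk_surjective x
    exact map_star φ a

lemma norm_mk_kerIdeal (φ : A →⋆ₙₐ[ℂ] B) (a : A) : ‖CQuot.mk (kerIdeal φ) a‖ = ‖φ a‖ := by
  have hinj : Function.Injective (CQuot.lift (kerIdeal φ) φ fun a ha => ha) := by
    intro x y hxy
    obtain ⟨a, rfl⟩ := CQuot.mk_surjective x
    obtain ⟨b, rfl⟩ := CQuot.mk_surjective y
    rw [CQuot.mk_eq, mem_kerIdeal, map_sub, sub_eq_zero]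
    exact hxy
  exact (NonUnitalStarAlgHom.norm_map _ hinj (CQuot.mk (kerIdeal φ) a)).symm

/-- A `*`-homomorphism `p` with a larger kernel than `q` satisfies `‖p a‖ ≤ ‖q a‖`. -/
lemma norm_le_of_ker_le (q : A →⋆ₙₐ[ℂ] B) (p : A →⋆ₙₐ[ℂ] C) (h : ∀ a, q a = 0 → p a = 0) (a : A) :
    ‖p a‖ ≤ ‖q a‖ := by
  rw [← norm_mk_kerIdeal q]
  exact NonUnitalStarAlgHom.norm_apply_le (CQuot.lift (kerIdeal q) p h) (CQuot.mk (kerIdeal q) a)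

/-- Elements of the range of a `*`-homomorphism lift with almost the same norm. -/
lemma exists_preimage_norm_lt (q : A →⋆ₙₐ[ℂ] B) (a : A) {ε : ℝ} (hε : 0 < ε) :
    ∃ a', q a' = q a ∧ ‖a'‖ < ‖q a‖ + ε := by
  obtain ⟨a', h, hn⟩ := CQuot.exists_norm_lt (CQuot.mk (kerIdeal q) a) hε
  refine ⟨a', ?_, by rwa [norm_mk_kerIdeal] at hn⟩
  rw [CQuot.mk_eq, mem_kerIdeal, map_sub, sub_eq_zero] at h
  exact h

/-- A relation compatible with the operations of C*-algebras which is contractive and densely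
defined extends to a `*`-homomorphism. -/
theorem exists_hom_of_rel (R : A → B → Prop) (h0 : R 0 0)
    (hadd : ∀ a b a' b', R a b → R a' b' → R (a + a') (b + b'))
    (hsmul : ∀ (c : ℂ) a b, R a b → R (c • a) (c • b))
    (hmul : ∀ a b a' b', R a b → R a' b' → R (a * a') (b * b'))
    (hstar : ∀ a b, R a b → R (star a) (star b))
    (hnorm : ∀ a b, R a b → ‖b‖ ≤ ‖a‖)
    (hdense : ∀ a, ∀ ε > 0, ∃ a' b', R a' b' ∧ ‖a - a'‖ < ε) :
    ∃ φ : A →⋆ₙₐ[ℂ] B, ∀ a b, R a b → φ a = b := by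
  let S : NonUnitalStarSubalgebra ℂ (A × B) :=
    { carrier := {p | R p.1 p.2}
      zero_mem' := h0
      add_mem' := fun ha hb => hadd _ _ _ _ ha hb
      mul_mem' := fun ha hb => hmul _ _ _ _ ha hb
      smul_mem' := fun c a ha => hsmul c _ _ ha
      star_mem' := fun ha => hstar _ _ ha }
  let T := S.topologicalClosure
  have hT : ∀ p ∈ T, ‖p.2‖ ≤ ‖p.1‖ := by
    intro p hp
    have hc : IsClosed {p : A × B | ‖p.2‖ ≤ ‖p.1‖} :=
      isClosed_le continuous_snd.norm continuous_fst.norm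
    exact closure_minimal (fun q hq => hnorm _ _ hq) hc hp
  have huniq : ∀ a b b', (a, b) ∈ T → (a, b') ∈ T → b = b' := by
    intro a b b' h h'
    have := hT _ (sub_mem h h')
    simpa [sub_eq_zero] using this
  have htot : ∀ a, ∃ b, (a, b) ∈ T := by
    intro a
    choose u v huv hu using fun n : ℕ => hdense a (1 / ((n : ℝ) + 1)) Nat.one_div_pos_of_nat
    have hua : Tendsto u atTop (𝓝 a) := by
      rw [tendsto_iff_norm_sub_tendsto_zero]
      refine squeeze_zero (fun _ => norm_nonneg _) (fun n => ?_)
        (tendsto_one_div_add_atTop_nhds_zero_nat (𝕜 := ℝ))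
      rw [norm_sub_rev]
      exact (hu n).le
    have hvc : CauchySeq v := by
      refine Metric.cauchySeq_iff.2 fun ε hε => ?_
      obtain ⟨N, hN⟩ := Metric.cauchySeq_iff.1 hua.cauchySeq ε hε
      refine ⟨N, fun m hm n hn => lt_of_le_of_lt ?_ (hN m hm n hn)⟩
      rw [dist_eq_norm, dist_eq_norm]
      exact hT _ (sub_mem (subset_closure (huv m)) (subset_closure (huv n)) : (u m, v m) - (u n, v n) ∈ T)
    obtain ⟨b, hb⟩ := cauchySeq_tendsto_of_complete hvc
    exact ⟨b, mem_closure_of_tendsto (hua.prodMk_nhds hb) (Eventually.of_forall huv)⟩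
  choose f hf using htot
  refine ⟨{ toFun := f
            map_smul' := fun c a => huniq _ _ _ (hf _) (SMulMemClass.smul_mem c (hf a) : c • (a, f a) ∈ T)
            map_zero' := huniq _ _ _ (hf _) (zero_mem T)
            map_add' := fun a b => huniq _ _ _ (hf _) (add_mem (hf a) (hf b))
            map_mul' := fun a b => huniq _ _ _ (hf _) (mul_mem (hf a) (hf b))
            map_star' := fun a => huniq _ _ _ (hf _) (star_mem (hf a) : star (a, f a) ∈ T) },
    fun a b hab => huniq _ _ _ (hf a) (subset_closure hab)⟩

/-- A `*`-homomorphism with dense range is surjective. -/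
lemma surjective_of_dense (φ : A →⋆ₙₐ[ℂ] B) (h : ∀ b, ∀ ε > 0, ∃ a, ‖b - φ a‖ < ε) :
    Function.Surjective φ := by
  obtain ⟨ψ, hψ⟩ := exists_hom_of_rel (A := B) (B := CQuot (kerIdeal φ))
    (fun b x => ∃ a, φ a = b ∧ CQuot.mk _ a = x) ⟨0, map_zero φ, rfl⟩
    (by rintro _ _ _ _ ⟨a, rfl, rfl⟩ ⟨a', rfl, rfl⟩; exact ⟨a + a', map_add φ _ _, rfl⟩)
    (by rintro c _ _ ⟨a, rfl, rfl⟩; exact ⟨c • a, map_smul φ _ _, rfl⟩)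
    (by rintro _ _ _ _ ⟨a, rfl, rfl⟩ ⟨a', rfl, rfl⟩; exact ⟨a * a', map_mul φ _ _, rfl⟩)
    (by rintro _ _ ⟨a, rfl, rfl⟩; exact ⟨star a, map_star φ _, rfl⟩)
    (by rintro _ _ ⟨a, rfl, rfl⟩; exact (norm_mk_kerIdeal φ a).le)
    (fun b ε hε => by
      obtain ⟨a, ha⟩ := h b ε hε
      exact ⟨φ a, _, ⟨a, rfl, rfl⟩, ha⟩)
  intro b
  obtain ⟨a, ha⟩ := CQuot.mk_surjective (ψ b)
  refine ⟨a, ?_⟩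
  have hid : ∀ b, CQuot.lift (kerIdeal φ) φ (fun a ha => ha) (ψ b) = b := by
    intro b
    refine eq_of_forall_dist_le fun ε hε => ?_
    obtain ⟨a, ha⟩ := h b (ε / 2) (half_pos hε)
    have h1 : CQuot.lift (kerIdeal φ) φ (fun a ha => ha) (ψ (φ a)) = φ a := by
      rw [hψ (φ a) _ ⟨a, rfl, rfl⟩]; rfl
    have h2 := NonUnitalStarAlgHom.norm_apply_le
      ((CQuot.lift (kerIdeal φ) φ (fun a ha => ha)).comp ψ) (b - φ a)
    rw [map_sub] at h2
    simp only [NonUnitalStarAlgHom.comp_apply, h1] at h2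
    rw [dist_eq_norm]
    calc _ = ‖(CQuot.lift (kerIdeal φ) φ (fun a ha => ha) (ψ b) - φ a) - (b - φ a)‖ := by
          rw [sub_sub_sub_cancel_right]
      _ ≤ _ := norm_sub_le _ _
      _ ≤ ε := by linarith
  have := hid b
  rwa [← ha] at this

/-- A `*`-homomorphism factors through each surjective one with a smaller kernel. -/
lemma exists_factor (q : A →⋆ₙₐ[ℂ] B) (hq : Function.Surjective q) (p : A →⋆ₙₐ[ℂ] C)
    (h : ∀ a, q a = 0 → p a = 0) : ∃ r : B →⋆ₙₐ[ℂ] C, ∀ a, r (q a) = p a := by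
  obtain ⟨r, hr⟩ := exists_hom_of_rel (A := B) (B := C) (fun b c => ∃ a, q a = b ∧ p a = c)
    ⟨0, map_zero q, map_zero p⟩
    (by rintro _ _ _ _ ⟨a, rfl, rfl⟩ ⟨a', rfl, rfl⟩; exact ⟨a + a', map_add q _ _, map_add p _ _⟩)
    (by rintro c _ _ ⟨a, rfl, rfl⟩; exact ⟨c • a, map_smul q _ _, map_smul p _ _⟩)
    (by rintro _ _ _ _ ⟨a, rfl, rfl⟩ ⟨a', rfl, rfl⟩; exact ⟨a * a', map_mul q _ _, map_mul p _ _⟩)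
    (by rintro _ _ ⟨a, rfl, rfl⟩; exact ⟨star a, map_star q _, map_star p _⟩)
    (by rintro _ _ ⟨a, rfl, rfl⟩; exact norm_le_of_ker_le q p h a)
    (fun b ε hε => by
      obtain ⟨a, rfl⟩ := hq b
      exact ⟨q a, _, ⟨a, rfl, rfl⟩, by simpa using hε⟩)
  exact ⟨r, fun a => hr _ _ ⟨a, rfl, rfl⟩⟩

/-- Two `*`-homomorphisms that agree on a dense set are equal. -/
lemma hom_eq_of_dense (φ ψ : A →⋆ₙₐ[ℂ] B) (s : Set A) (hs : Dense s) (h : ∀ a ∈ s, φ a = ψ a) :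
    φ = ψ :=
  DFunLike.coe_injective ((hom_continuous φ).ext_on hs (hom_continuous ψ) h)

end Hom

/-! ### Construction of operators from matrices -/

section Matrices
variable {X : Type*} {B C : Type*} [NonUnitalCStarAlgebra B] [NonUnitalCStarAlgebra C]

/-- A function with finite support as a vector of `l₂(X, B)`. -/
def L2.ofFinite (f : X → B) (hf : f.support.Finite) : L2 X B where
  toFun := f
  mem := by
    change Summable _
    refine summable_of_ne_finset_zero (s := hf.toFinset) fun x hx => ?_
    have : f x = 0 := by simpa using hx
    rw [this, mul_zero]

@[simp] lemma L2.ofFinite_apply (f : X → B) (hf : f.support.Finite) (x : X) :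
    L2.ofFinite f hf x = f x := rfl

lemma L2.sum_apply {ι : Type*} (s : Finset ι) (f : ι → L2 X B) (x : X) :
    (∑ i ∈ s, f i).toFun x = ∑ i ∈ s, f i x := map_sum (L2.evalL x) _ _

lemma norm_entry_le (T : ColOp X B) (x y : X) : ‖entry T x y‖ ≤ ‖T‖ :=
  ((col T y).norm_apply_le x).trans ((hasCols_col T).norm_le y)

lemma entry_sub (S T : ColOp X B) (x y : X) : entry (S - T) x y = entry S x y - entry T x y := by
  have : S - T = S + (-1 : ℂ) • T := by simp [sub_eq_add_neg]
  rw [this, entry_add, entry_smul]; simp [sub_eq_add_neg]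

lemma ColOp.norm_le_of_cols (T : ColOp X B) {K : ℝ} (hK : 0 ≤ K)
    (h : ∀ (s : Finset X) (ξ : X → B), ‖∑ y ∈ s, (col T y).rmul (ξ y)‖ ≤ K * finNorm s ξ) :
    ‖T‖ ≤ K := by
  refine ContinuousLinearMap.opNorm_le_bound T.adj.op hK fun ξ => ?_
  refine le_of_tendsto' ((hasCols_col T).hasSum ξ).norm fun s => (h s _).trans ?_
  gcongr
  exact ξ.finNorm_le s

/-- A matrix with finite rows and columns that satisfies a norm bound defines an operator. -/
lemma exists_colOp_of_finite (m : X → X → B) (hcol : ∀ y, (fun x => m x y).support.Finite)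
    (hrow : ∀ x, (m x).support.Finite) {K : ℝ} (hK : 0 ≤ K)
    (h1 : ∀ (u s : Finset X) (ξ : X → B),
      finNorm u (fun x => ∑ y ∈ s, m x y * ξ y) ≤ K * finNorm s ξ)
    (h2 : ∀ (u s : Finset X) (ξ : X → B),
      finNorm u (fun x => ∑ y ∈ s, star (m y x) * ξ y) ≤ K * finNorm s ξ) :
    ∃ S : ColOp X B, (∀ x y, entry S x y = m x y) ∧ ‖S‖ ≤ K := by
  have key : ∀ (n : X → X → B) (hn : ∀ y, (fun x => n x y).support.Finite)
      (h : ∀ (u s : Finset X) (ξ : X → B),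
        finNorm u (fun x => ∑ y ∈ s, n x y * ξ y) ≤ K * finNorm s ξ) (s : Finset X) (ξ : X → B),
      ‖∑ y ∈ s, (L2.ofFinite (fun x => n x y) (hn y)).rmul (ξ y)‖ ≤ K * finNorm s ξ := by
    intro n hn h s ξ
    refine L2.norm_le_of_finNorm fun u => le_trans (le_of_eq ?_) (h u s ξ)
    congr 1
    ext x
    rw [L2.sum_apply]; rfl
  have hrow' : ∀ y, (fun x => star (m y x)).support.Finite := fun y =>
    (hrow y).subset fun x hx => by
      intro h0; exact hx (by simp only [h0, star_zero])
  obtain ⟨S, hS⟩ := exists_adj_of_cols (fun y => L2.ofFinite (fun x => m x y) (hcol y))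
    (fun y => L2.ofFinite (fun x => star (m y x)) (hrow' y)) (fun x y => rfl) K
    (key m hcol h1) (key (fun x y => star (m y x)) hrow' h2)
  refine ⟨S, fun x y => by rw [entry, hS]; rfl, S.norm_le_of_cols hK ?_⟩
  rw [hS]
  exact key m hcol h1

lemma finNorm_hom (φ : B →⋆ₙₐ[ℂ] C) (s : Finset X) (f : X → B) :
    finNorm s (fun x => φ (f x)) = √‖φ (∑ x ∈ s, star (f x) * f x)‖ := by
  simp [finNorm, map_sum, map_star]

lemma finNorm_hom_le (φ : B →⋆ₙₐ[ℂ] C) (s : Finset X) (f : X → B) :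
    finNorm s (fun x => φ (f x)) ≤ finNorm s f := by
  rw [finNorm_hom]
  exact Real.sqrt_le_sqrt (NonUnitalStarAlgHom.norm_apply_le φ _)

lemma finNorm_mul_le (s : Finset X) (r : X → B) (b : B) :
    finNorm s (fun x => r x * b) ≤ finNorm s r * ‖b‖ := by
  refine Real.sqrt_le_iff.2 ⟨mul_nonneg (finNorm_nonneg _ _) (norm_nonneg _), ?_⟩
  have : ∑ x ∈ s, star (r x * b) * (r x * b) = star b * (∑ x ∈ s, star (r x) * r x) * b := by
    simp [Finset.mul_sum, Finset.sum_mul, mul_assoc]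
  rw [this, mul_pow, finNorm_sq]
  refine (norm_mul_le _ _).trans ?_
  refine (mul_le_mul_of_nonneg_right (norm_mul_le _ _) (norm_nonneg _)).trans ?_
  rw [norm_star]; apply le_of_eq; ring

/-- The matrix `(r_x t r_y^*)`, where `∑ r_x^* r_x ≤ 1`, has norm at most `‖t‖`. Its entries are only
required to be of this form under a family of homomorphisms that determines the norm. -/
lemma exists_colOp_conj {Ω : Type*} (j : Ω → (B →⋆ₙₐ[ℂ] C))
    (hj : ∀ (b : B) (K : ℝ), 0 ≤ K → (∀ ω, ‖j ω b‖ ≤ K) → ‖b‖ ≤ K) (r : Ω → X → C)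
    (hr : ∀ ω s, finNorm s (r ω) ≤ 1) (t : Ω → C) {K : ℝ} (hK : 0 ≤ K) (ht : ∀ ω, ‖t ω‖ ≤ K)
    (m : X → X → B) (hcol : ∀ y, (fun x => m x y).support.Finite)
    (hrow : ∀ x, (m x).support.Finite) (hm : ∀ ω x y, j ω (m x y) = r ω x * t ω * star (r ω y)) :
    ∃ S : ColOp X B, (∀ x y, entry S x y = m x y) ∧ ‖S‖ ≤ K := by
  have key : ∀ (t : Ω → C) (ht : ∀ ω, ‖t ω‖ ≤ K) (m : X → X → B)
      (hm : ∀ ω x y, j ω (m x y) = r ω x * t ω * star (r ω y)) (u s : Finset X) (ξ : X → B),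
      finNorm u (fun x => ∑ y ∈ s, m x y * ξ y) ≤ K * finNorm s ξ := by
    intro t ht m hm u s ξ
    have h0 : 0 ≤ K * finNorm s ξ := mul_nonneg hK (finNorm_nonneg _ _)
    refine Real.sqrt_le_iff.2 ⟨h0, hj _ _ (by positivity) fun ω => ?_⟩
    rw [← Real.sqrt_le_left h0, ← finNorm_hom (j ω) u]
    have e : (fun x => j ω (∑ y ∈ s, m x y * ξ y)) =
        fun x => r ω x * (t ω * ∑ y ∈ s, star (r ω y) * j ω (ξ y)) := by
      ext x
      simp [map_sum, hm, Finset.mul_sum, mul_assoc]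
    rw [e]
    calc _ ≤ finNorm u (r ω) * ‖t ω * ∑ y ∈ s, star (r ω y) * j ω (ξ y)‖ := finNorm_mul_le _ _ _
      _ ≤ 1 * (‖t ω‖ * ‖∑ y ∈ s, star (r ω y) * j ω (ξ y)‖) := by
        gcongr
        · exact hr ω u
        · exact norm_mul_le _ _
      _ ≤ 1 * (K * (finNorm s (r ω) * finNorm s fun y => j ω (ξ y))) := by
        gcongr
        · exact ht ω
        · exact norm_sum_star_mul_le s _ _
      _ ≤ 1 * (K * (1 * finNorm s ξ)) := by
        gcongr
        · exact finNorm_nonneg _ _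
        · exact hr ω s
        · exact finNorm_hom_le _ _ _
      _ = _ := by ring
  refine exists_colOp_of_finite m hcol hrow hK (key t ht m hm) ?_
  exact key (fun ω => star (t ω)) (fun ω => (norm_star _).trans_le (ht ω)) (fun x y => star (m y x))
    (fun ω x y => by rw [map_star, hm]; simp [mul_assoc])

lemma star_sum_mul_sum_le [PartialOrder B] [StarOrderedRing B] (s : Finset X) (v : X → B) :
    star (∑ x ∈ s, v x) * (∑ x ∈ s, v x) ≤ (s.card : ℝ) • ∑ x ∈ s, star (v x) * v x := by
  have h : 0 ≤ ∑ x ∈ s, ∑ y ∈ s, star (v x - v y) * (v x - v y) :=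
    Finset.sum_nonneg fun x _ => Finset.sum_nonneg fun y _ => star_mul_self_nonneg _
  have e : ∑ x ∈ s, ∑ y ∈ s, star (v x - v y) * (v x - v y) =
      (2 : ℝ) • ((s.card : ℝ) • ∑ x ∈ s, star (v x) * v x -
        star (∑ x ∈ s, v x) * (∑ x ∈ s, v x)) := by
    have e1 : ∀ x y, star (v x - v y) * (v x - v y) =
        star (v x) * v x - star (v x) * v y - star (v y) * v x + star (v y) * v y := by
      intro x y; rw [star_sub, sub_mul, mul_sub, mul_sub]; abel
    simp only [e1, Finset.sum_add_distrib, Finset.sum_sub_distrib, Finset.sum_const,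
      star_sum, Finset.sum_mul_sum, ← Finset.smul_sum]
    rw [Finset.sum_comm (f := fun x y => star (v y) * v x)]
    rw [two_smul, ← Nat.cast_smul_eq_nsmul ℝ]
    abel
  rw [e] at h
  have h2 := smul_nonneg (show (0 : ℝ) ≤ 2⁻¹ by norm_num) h
  rw [smul_smul] at h2
  norm_num at h2
  rw [star_sum]
  exact h2

/-- The Schur test: a matrix with at most `N` non-zero entries of norm at most `ε` in each row and
each column has norm at most `N ε`. -/
lemma exists_colOp_of_card (m : X → X → B) (N : ℕ) {ε : ℝ} (hε : 0 ≤ ε)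
    (hrow : ∀ x, ∃ F : Finset X, F.card ≤ N ∧ ∀ y, m x y ≠ 0 → y ∈ F)
    (hcol : ∀ y, ∃ F : Finset X, F.card ≤ N ∧ ∀ x, m x y ≠ 0 → x ∈ F)
    (hm : ∀ x y, ‖m x y‖ ≤ ε) :
    ∃ S : ColOp X B, (∀ x y, entry S x y = m x y) ∧ ‖S‖ ≤ N * ε := by
  classical
  have key : ∀ (m : X → X → B)
      (hrow : ∀ x, ∃ F : Finset X, F.card ≤ N ∧ ∀ y, m x y ≠ 0 → y ∈ F)
      (hcol : ∀ y, ∃ F : Finset X, F.card ≤ N ∧ ∀ x, m x y ≠ 0 → x ∈ F)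
      (hm : ∀ x y, ‖m x y‖ ≤ ε) (u s : Finset X) (ξ : X → B),
      finNorm u (fun x => ∑ y ∈ s, m x y * ξ y) ≤ N * ε * finNorm s ξ := by
    intro m hrow hcol hm u s ξ
    let _ := CStarAlgebra.spectralOrder B
    have _ := CStarAlgebra.spectralOrderedRing B
    have h0 : 0 ≤ N * ε * finNorm s ξ :=
      mul_nonneg (by positivity) (finNorm_nonneg _ _)
    refine Real.sqrt_le_iff.2 ⟨h0, ?_⟩
    have step : ∀ x, star (∑ y ∈ s, m x y * ξ y) * (∑ y ∈ s, m x y * ξ y) ≤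
        (N * ε ^ 2 : ℝ) • ∑ y ∈ s with m x y ≠ 0, star (ξ y) * ξ y := by
      intro x
      have e : ∑ y ∈ s, m x y * ξ y = ∑ y ∈ s with m x y ≠ 0, m x y * ξ y := by
        rw [Finset.sum_filter]
        refine Finset.sum_congr rfl fun y _ => ?_
        split_ifs with h
        · rfl
        · rw [not_not.1 h, zero_mul]
      rw [e]
      refine (star_sum_mul_sum_le _ _).trans ?_
      rw [mul_smul]
      refine (smul_le_smul_of_nonneg_right (a₂ := (N : ℝ)) ?_ ?_).trans
        (smul_le_smul_of_nonneg_left ?_ (Nat.cast_nonneg (α := ℝ) N))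
      · obtain ⟨F, hF, hF'⟩ := hrow x
        have hsub : (s.filter fun y => m x y ≠ 0) ⊆ F := fun y hy => hF' y (Finset.mem_filter.1 hy).2
        exact_mod_cast (Finset.card_le_card hsub).trans hF
      · exact Finset.sum_nonneg fun y _ => star_mul_self_nonneg _
      · rw [Finset.smul_sum]
        refine Finset.sum_le_sum fun y _ => ?_
        have h1 : star (m x y * ξ y) * (m x y * ξ y) = star (ξ y) * (star (m x y) * m x y) * ξ y := by
          simp [mul_assoc]
        rw [h1]
        refine (CStarAlgebra.star_left_conjugate_le_norm_smul (.star_mul_self _)).trans ?_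
        refine smul_le_smul_of_nonneg_right ?_ (star_mul_self_nonneg _)
        rw [CStarRing.norm_star_mul_self, sq]
        exact mul_le_mul (hm x y) (hm x y) (norm_nonneg _) hε
    have hle : ∑ x ∈ u, star (∑ y ∈ s, m x y * ξ y) * (∑ y ∈ s, m x y * ξ y) ≤
        ((N * ε) ^ 2 : ℝ) • ∑ y ∈ s, star (ξ y) * ξ y := by
      refine (Finset.sum_le_sum fun x _ => step x).trans ?_
      rw [← Finset.smul_sum]
      simp only [Finset.sum_filter]
      rw [Finset.sum_comm, show ((N * ε) ^ 2 : ℝ) = (N * ε ^ 2) * N by ring,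
        mul_smul (N * ε ^ 2 : ℝ) (N : ℝ)]
      refine smul_le_smul_of_nonneg_left ?_ (show (0 : ℝ) ≤ N * ε ^ 2 by positivity)
      rw [Finset.smul_sum]
      refine Finset.sum_le_sum fun y _ => ?_
      rw [← Finset.sum_filter, Finset.sum_const, ← Nat.cast_smul_eq_nsmul ℝ]
      refine smul_le_smul_of_nonneg_right ?_ (star_mul_self_nonneg _)
      obtain ⟨F, hF, hF'⟩ := hcol y
      have hsub : (u.filter fun x => m x y ≠ 0) ⊆ F := fun x hx => hF' x (Finset.mem_filter.1 hx).2
      exact_mod_cast (Finset.card_le_card hsub).trans hF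
    refine (CStarAlgebra.norm_le_norm_of_nonneg_of_le
      (Finset.sum_nonneg fun x _ => star_mul_self_nonneg _) hle).trans ?_
    rw [norm_smul, mul_pow _ (finNorm s _), finNorm_sq, Real.norm_of_nonneg (by positivity)]
  have hfin : ∀ {f : X → B}, (∃ F : Finset X, F.card ≤ N ∧ ∀ y, f y ≠ 0 → y ∈ F) →
      f.support.Finite := by
    rintro f ⟨F, -, hF⟩
    exact F.finite_toSet.subset fun y hy => hF y hy
  refine exists_colOp_of_finite m (fun y => hfin (hcol y)) (fun x => hfin (hrow x)) (by positivity)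
    (key m hrow hcol hm) (key (fun x y => star (m y x)) ?_ ?_ ?_)
  · intro x
    obtain ⟨F, hF, hF'⟩ := hcol x
    exact ⟨F, hF, fun y hy => hF' y (star_ne_zero.1 hy)⟩
  · intro x
    obtain ⟨F, hF, hF'⟩ := hrow x
    exact ⟨F, hF, fun y hy => hF' y (star_ne_zero.1 hy)⟩
  · intro x y
    rw [norm_star]; exact hm y x

lemma finNorm_smul_le (s : Finset X) (g : X → ℂ) {K : ℝ} (hK : 0 ≤ K) (hg : ∀ x, ‖g x‖ ≤ K)
    (f : X → B) : finNorm s (fun x => g x • f x) ≤ K * finNorm s f := by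
  let _ := CStarAlgebra.spectralOrder B
  have _ := CStarAlgebra.spectralOrderedRing B
  refine Real.sqrt_le_iff.2 ⟨mul_nonneg hK (finNorm_nonneg _ _), ?_⟩
  have hle : ∑ x ∈ s, star (g x • f x) * (g x • f x) ≤ (K ^ 2 : ℝ) • ∑ x ∈ s, star (f x) * f x := by
    rw [Finset.smul_sum]
    refine Finset.sum_le_sum fun x _ => ?_
    have e : star (g x • f x) * (g x • f x) = (‖g x‖ ^ 2 : ℝ) • (star (f x) * f x) := by
      rw [star_smul, smul_mul_smul_comm, ← Complex.coe_smul]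
      congr 1
      rw [Complex.ofReal_pow]
      exact Complex.conj_mul' (g x)
    rw [e]
    exact smul_le_smul_of_nonneg_right (pow_le_pow_left₀ (norm_nonneg _) (hg x) 2)
      (star_mul_self_nonneg _)
  refine (CStarAlgebra.norm_le_norm_of_nonneg_of_le
    (Finset.sum_nonneg fun x _ => star_mul_self_nonneg _) hle).trans ?_
  rw [norm_smul, mul_pow _ (finNorm s _), finNorm_sq, Real.norm_of_nonneg (by positivity)]

/-- The boundedness of a function. -/
def Bdd (g : X → ℂ) : Prop := ∃ K : ℝ, ∀ x, ‖g x‖ ≤ K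

lemma Bdd.exists_nonneg {g : X → ℂ} (hg : Bdd g) : ∃ K : ℝ, 0 ≤ K ∧ ∀ x, ‖g x‖ ≤ K := by
  obtain ⟨K, hK⟩ := hg
  exact ⟨|K|, abs_nonneg K, fun x => (hK x).trans (le_abs_self K)⟩

lemma Bdd.star {g : X → ℂ} (hg : Bdd g) : Bdd (star g) := by
  obtain ⟨K, hK⟩ := hg
  exact ⟨K, fun x => (norm_star (g x)).trans_le (hK x)⟩

lemma Bdd.mul {g h : X → ℂ} (hg : Bdd g) (hh : Bdd h) : Bdd (g * h) := by
  obtain ⟨K, hK0, hK⟩ := hg.exists_nonneg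
  obtain ⟨L, hL⟩ := hh
  exact ⟨K * L, fun x => (norm_mul_le _ _).trans (mul_le_mul (hK x) (hL x) (norm_nonneg _) hK0)⟩

/-- Pointwise multiplication by a bounded function on `l₂(X, B)`. -/
def L2.dmul (g : X → ℂ) (hg : Bdd g) : L2 X B →L[ℂ] L2 X B :=
  LinearMap.mkContinuous
    { toFun := fun ξ => ⟨fun x => g x • ξ x, by
        obtain ⟨K, hK0, hK⟩ := hg.exists_nonneg
        change Summable _
        rw [summable_iff_finNorm]
        intro ε hε
        obtain ⟨s, hs⟩ := (summable_iff_finNorm ξ.toFun).1 ξ.mem (ε / (K + 1)) (by positivity)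
        refine ⟨s, fun t ht => (finNorm_smul_le t g hK0 hK _).trans_lt ?_⟩
        calc K * finNorm t ξ.toFun ≤ K * (ε / (K + 1)) := by gcongr; exact (hs t ht).le
          _ < ε := by rw [mul_div_assoc', div_lt_iff₀ (by positivity)]; nlinarith⟩
      map_add' := fun ξ ζ => L2.ext_apply fun x => smul_add _ _ _
      map_smul' := fun c ξ => L2.ext_apply fun x => smul_comm _ _ _ } hg.exists_nonneg.choose
    fun ξ => L2.norm_le_of_finNorm fun s =>
      (finNorm_smul_le s g hg.exists_nonneg.choose_spec.1 hg.exists_nonneg.choose_spec.2 _).trans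
        (mul_le_mul_of_nonneg_left (ξ.finNorm_le s) hg.exists_nonneg.choose_spec.1)

@[simp] lemma L2.dmul_apply (g : X → ℂ) (hg : Bdd g) (ξ : L2 X B) (x : X) :
    L2.dmul g hg ξ x = g x • ξ x := rfl

lemma L2.inner_dmul (g : X → ℂ) (hg : Bdd g) (ξ ζ : L2 X B) :
    L2.inner (L2.dmul (star g) hg.star ξ) ζ = L2.inner ξ (L2.dmul g hg ζ) := by
  simp [L2.inner, smul_mul_assoc, mul_smul_comm]

open Classical in
variable (B) in
/-- The diagonal operator with the entries `g x` for bounded `g` (and `0` for unbounded `g`). -/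
def dop (g : X → ℂ) : Adj X B :=
  if hg : Bdd g then Adj.mk (L2.dmul g hg) (L2.dmul (star g) hg.star) (L2.inner_dmul g hg) else 0

lemma dop_op {g : X → ℂ} (hg : Bdd g) (ξ : L2 X B) (x : X) : (dop B g).op ξ x = g x • ξ x := by
  rw [dop, dif_pos hg]; rfl

lemma star_dop {g : X → ℂ} (hg : Bdd g) : star (dop B g) = dop B (star g) :=
  Adj.star_eq_of fun ξ ζ => by
    have := L2.inner_dmul (star g) hg.star ξ ζ
    rw [dop, dif_pos hg, dop, dif_pos hg.star]
    change L2.inner (L2.dmul g hg ξ) ζ = L2.inner ξ (L2.dmul (star g) hg.star ζ)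
    simpa only [star_star] using this

lemma dop_mul_dop {g h : X → ℂ} (hg : Bdd g) (hh : Bdd h) :
    dop B g * dop B h = dop B (g * h) :=
  Adj.ext_apply fun ξ => L2.ext_apply fun x => by
    rw [Adj.mul_op, dop_op hg, dop_op hh, dop_op (hg.mul hh), smul_smul]; rfl

lemma norm_dop_le {g : X → ℂ} {K : ℝ} (hK : 0 ≤ K) (h : ∀ x, ‖g x‖ ≤ K) : ‖dop B g‖ ≤ K := by
  refine ContinuousLinearMap.opNorm_le_bound (dop B g).op hK fun ξ =>
    L2.norm_le_of_finNorm fun s => ?_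
  have e : ((dop B g).op ξ).toFun = fun x => g x • ξ x := funext fun x => dop_op ⟨K, h⟩ ξ x
  rw [e]
  exact (finNorm_smul_le s g hK h _).trans (mul_le_mul_of_nonneg_left (ξ.finNorm_le s) hK)

lemma dop_smul_left {g : X → ℂ} (hg : Bdd g) (y : X) (b : B) :
    (dop B g).op (L2.single y b) = g y • L2.single y b := L2.ext_apply fun x => by
  rw [dop_op hg]
  by_cases h : x = y
  · subst h; rfl
  · change g x • (L2.single y b) x = g y • (L2.single y b) x
    rw [L2.single_of_ne h]; simp

lemma cut_mem (g h : X → ℂ) (T : ColOp X B) :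
    dop B g * T.adj * dop B h ∈ colAlg X B := by
  have key : ∀ (g h : X → ℂ) (S : ColOp X B), ∃ c, HasCols (dop B g * S.adj * dop B h) c := by
    intro g h S
    by_cases hh : Bdd h
    · refine ⟨fun y => h y • (dop B g).op (col S y), fun y b => ?_⟩
      rw [Adj.mul_op, dop_smul_left hh, Adj.mul_op, map_smul, map_smul, hasCols_col S, Adj.map_rmul,
        L2.smul_rmul]
    · refine ⟨0, ?_⟩
      have : dop B h = 0 := dif_neg hh
      rw [this, mul_zero]
      exact .zero
  refine ⟨key g h T, ?_⟩
  have hs : ∀ g : X → ℂ, ∃ g', star (dop B g) = dop B g' := by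
    intro g
    by_cases hg : Bdd g
    · exact ⟨_, star_dop hg⟩
    · exact ⟨g, by rw [dop, dif_neg hg, star_zero]⟩
  obtain ⟨g', hg'⟩ := hs g
  obtain ⟨h', hh'⟩ := hs h
  rw [star_mul, star_mul, hg', hh', ← mul_assoc]
  exact key h' g' (star T)

/-- The matrix `(g(x) m_{x,y} h(y))` for bounded functions `g` and `h`. -/
def cut (g : X → ℂ) (T : ColOp X B) (h : X → ℂ) : ColOp X B :=
  ⟨dop B g * T.adj * dop B h, cut_mem g h T⟩

lemma cut_adj (g h : X → ℂ) (T : ColOp X B) : (cut g T h).adj = dop B g * T.adj * dop B h := rfl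

lemma entry_cut {g h : X → ℂ} (hg : Bdd g) (hh : Bdd h) (T : ColOp X B) (x y : X) :
    entry (cut g T h) x y = (g x * h y) • entry T x y := by
  have : HasCols (cut g T h).adj (fun y => h y • (dop B g).op (col T y)) := fun y b => by
    rw [cut_adj, Adj.mul_op, dop_smul_left hh, Adj.mul_op, map_smul, map_smul, hasCols_col T,
      Adj.map_rmul, L2.smul_rmul]
  rw [entry, this.col_eq]
  change h y • ((dop B g).op (col T y)) x = _
  rw [dop_op hg, smul_smul, mul_comm]
  rfl

lemma norm_cut_le {g h : X → ℂ} {K L : ℝ} (hK : 0 ≤ K) (hL : 0 ≤ L) (hg : ∀ x, ‖g x‖ ≤ K)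
    (hh : ∀ x, ‖h x‖ ≤ L) (T : ColOp X B) : ‖cut g T h‖ ≤ K * ‖T‖ * L := by
  change ‖dop B g * T.adj * dop B h‖ ≤ _
  refine (norm_mul_le _ _).trans ?_
  refine mul_le_mul ((norm_mul_le _ _).trans ?_) (norm_dop_le hL hh) (norm_nonneg _)
    (mul_nonneg hK (norm_nonneg _))
  exact mul_le_mul (norm_dop_le hK hg) le_rfl (norm_nonneg _) hK

/-! ### Operators on a larger index set -/

variable {W : Type*} {f : X → W} (hf : Function.Injective f)

/-- Extension by zero along an injection. -/
def L2.ext0 (ξ : L2 X B) : L2 W B where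
  toFun := Function.extend f ξ.toFun 0
  mem := by
    change Summable _
    rw [← hf.summable_iff]
    · convert ξ.summable using 1
      ext x; simp [hf.extend_apply]
    · intro x hx
      rw [Function.extend_apply' _ _ _ hx]; simp

lemma L2.ext0_apply (ξ : L2 X B) (x : X) : L2.ext0 hf ξ (f x) = ξ x := hf.extend_apply _ _ _

lemma L2.ext0_of_notMem (ξ : L2 X B) {w : W} (hw : ¬ ∃ x, f x = w) : L2.ext0 hf ξ w = 0 :=
  Function.extend_apply' _ _ _ hw

lemma L2.norm_ext0 (ξ : L2 X B) : ‖L2.ext0 hf ξ‖ = ‖ξ‖ := by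
  rw [L2.norm_def, L2.norm_def]
  congr 2
  rw [L2.inner, L2.inner, ← hf.tsum_eq]
  · simp [L2.ext0_apply]
  · intro x hx
    by_contra hne
    exact hx (by beta_reduce; rw [L2.ext0_of_notMem hf _ hne, mul_zero])

open Classical in
/-- The columns of the matrix extended by zero along an injection. -/
def extCol (T : ColOp X B) (w : W) : L2 W B :=
  if h : ∃ x, f x = w then L2.ext0 hf (col T h.choose) else 0

lemma extCol_apply (T : ColOp X B) (x : X) : extCol hf T (f x) = L2.ext0 hf (col T x) := by
  have h : ∃ x', f x' = f x := ⟨x, rfl⟩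
  rw [extCol, dif_pos h, hf h.choose_spec]

lemma extCol_of_notMem (T : ColOp X B) {w : W} (hw : ¬ ∃ x, f x = w) : extCol hf T w = 0 :=
  dif_neg hw

lemma norm_sum_extCol_le (T : ColOp X B) (s : Finset W) (ξ : W → B) :
    ‖∑ w ∈ s, (extCol hf T w).rmul (ξ w)‖ ≤ ‖T‖ * finNorm s ξ := by
  classical
  let u : Finset X := s.preimage f hf.injOn
  have e : ∑ w ∈ s, (extCol hf T w).rmul (ξ w) =
      L2.ext0 hf (∑ x ∈ u, (col T x).rmul (ξ (f x))) := by
    have e1 : ∑ w ∈ s, (extCol hf T w).rmul (ξ w) =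
        ∑ x ∈ u, (extCol hf T (f x)).rmul (ξ (f x)) := by
      rw [Finset.sum_preimage f s hf.injOn (fun w => (extCol hf T w).rmul (ξ w))]
      intro w _ hw
      rw [extCol_of_notMem hf T (by simpa using hw)]
      exact L2.ext_apply fun x => by simp
    rw [e1]
    refine L2.ext_apply fun w => ?_
    rw [L2.sum_apply]
    by_cases hw : ∃ x, f x = w
    · obtain ⟨x, rfl⟩ := hw
      rw [L2.ext0_apply, L2.sum_apply]
      simp [extCol_apply, L2.ext0_apply]
    · rw [L2.ext0_of_notMem hf _ hw]
      simp [extCol_apply, L2.ext0_of_notMem hf _ hw]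
  rw [e, L2.norm_ext0]
  have e2 : ∑ x ∈ u, (col T x).rmul (ξ (f x)) = T.adj.op (∑ x ∈ u, L2.single x (ξ (f x))) := by
    rw [map_sum]
    exact Finset.sum_congr rfl fun y _ => (hasCols_col T _ _).symm
  rw [e2]
  refine (T.adj.le_norm _).trans ?_
  rw [L2.norm_sum_single, T.norm_adj]
  refine mul_le_mul_of_nonneg_left ?_ (norm_nonneg _)
  refine le_trans (le_of_eq ?_) (finNorm_mono (s := u.map ⟨f, hf⟩) (t := s) ?_ ξ)
  · simp [finNorm]
  · intro w hw
    obtain ⟨x, hx, rfl⟩ := Finset.mem_map.1 hw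
    exact Finset.mem_preimage.1 hx

lemma extCol_star (T : ColOp X B) (v w : W) :
    extCol hf (star T) v w = star (extCol hf T w v) := by
  by_cases hv : ∃ x, f x = v
  · obtain ⟨x, rfl⟩ := hv
    rw [extCol_apply]
    by_cases hw : ∃ y, f y = w
    · obtain ⟨y, rfl⟩ := hw
      rw [extCol_apply, L2.ext0_apply, L2.ext0_apply]
      exact entry_star T y x
    · rw [extCol_of_notMem hf T hw, L2.ext0_of_notMem hf _ hw]; simp
  · rw [extCol_of_notMem hf _ hv]
    by_cases hw : ∃ y, f y = w
    · obtain ⟨y, rfl⟩ := hw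
      rw [extCol_apply, L2.ext0_of_notMem hf _ hv]; simp
    · rw [extCol_of_notMem hf T hw]; simp

lemma exists_extOp (T : ColOp X B) : ∃ S : ColOp W B, col S = extCol hf T :=
  exists_adj_of_cols (extCol hf T) (extCol hf (star T)) (extCol_star hf T) ‖T‖
    (norm_sum_extCol_le hf T) (fun s ξ => by
      rw [← norm_star T]
      exact norm_sum_extCol_le hf (star T) s ξ)

lemma extOp_apply (T : ColOp X B) (x y : X) :
    entry (exists_extOp hf T).choose (f x) (f y) = entry T x y := by
  rw [entry, (exists_extOp hf T).choose_spec, extCol_apply, L2.ext0_apply]; rfl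

lemma extOp_left (T : ColOp X B) {v : W} (hv : ¬ ∃ x, f x = v) (w : W) :
    entry (exists_extOp hf T).choose v w = 0 := by
  rw [entry, (exists_extOp hf T).choose_spec]
  by_cases hw : ∃ y, f y = w
  · obtain ⟨y, rfl⟩ := hw
    rw [extCol_apply, L2.ext0_of_notMem hf _ hv]
  · rw [extCol_of_notMem hf T hw]; rfl

lemma extOp_right (T : ColOp X B) {w : W} (hw : ¬ ∃ x, f x = w) (v : W) :
    entry (exists_extOp hf T).choose v w = 0 := by
  rw [entry, (exists_extOp hf T).choose_spec, extCol_of_notMem hf T hw]; rfl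

lemma entry_ext_range {S T : ColOp W B} (h : ∀ x y, entry S (f x) (f y) = entry T (f x) (f y))
    (hS : ∀ v w, (¬ ∃ x, f x = v) ∨ (¬ ∃ x, f x = w) → entry S v w = 0)
    (hT : ∀ v w, (¬ ∃ x, f x = v) ∨ (¬ ∃ x, f x = w) → entry T v w = 0) : S = T := by
  refine entry_ext fun v w => ?_
  by_cases hvw : (¬ ∃ x, f x = v) ∨ (¬ ∃ x, f x = w)
  · rw [hS v w hvw, hT v w hvw]
  · push Not at hvw
    obtain ⟨⟨x, rfl⟩, ⟨y, rfl⟩⟩ := hvw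
    exact h x y

lemma extOp_zero (T : ColOp X B) (v w : W) (h : (¬ ∃ x, f x = v) ∨ (¬ ∃ x, f x = w)) :
    entry (exists_extOp hf T).choose v w = 0 := by
  rcases h with h | h
  · exact extOp_left hf T h w
  · exact extOp_right hf T h v

variable (B) in
/-- Extension of matrices by zero along an injection of index sets. -/
def extOp : ColOp X B →⋆ₙₐ[ℂ] ColOp W B where
  toFun T := (exists_extOp hf T).choose
  map_smul' c T := entry_ext_range (f := f) (fun x y => by simp [entry_smul, extOp_apply])
    (extOp_zero hf _) (fun v w h => by simp [entry_smul, extOp_zero hf _ v w h])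
  map_zero' := entry_ext_range (f := f) (fun x y => by simp [entry_zero, extOp_apply])
    (extOp_zero hf _) (fun v w h => entry_zero _ _)
  map_add' S T := entry_ext_range (f := f) (fun x y => by simp [entry_add, extOp_apply])
    (extOp_zero hf _) (fun v w h => by simp [entry_add, extOp_zero hf _ v w h])
  map_star' T := entry_ext_range (f := f) (fun x y => by simp [entry_star, extOp_apply])
    (extOp_zero hf _) (fun v w h => by rw [entry_star, extOp_zero hf _ w v h.symm, star_zero])
  map_mul' S T := by
    refine entry_ext_range (f := f) (fun x y => ?_) (extOp_zero hf _) (fun v w h => ?_)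
    · rw [extOp_apply]
      refine (hasSum_entry_mul S T x y).unique ?_
      have h := hasSum_entry_mul (exists_extOp hf S).choose (exists_extOp hf T).choose (f x) (f y)
      rw [← hf.hasSum_iff] at h
      · convert h using 2 with z
        simp [extOp_apply]
      · intro w hw
        rw [extOp_right hf S (by simpa using hw), zero_mul]
    · by_contra hne
      obtain ⟨z, h1, h2⟩ := exists_entry_ne_zero hne
      rcases h with h | h
      · exact h1 (extOp_left hf S h z)
      · exact h2 (extOp_right hf T h z)

lemma entry_extOp (T : ColOp X B) (x y : X) : entry (extOp B hf T) (f x) (f y) = entry T x y :=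
  extOp_apply hf T x y

lemma entry_extOp_ne_zero {T : ColOp X B} {v w : W} (h : entry (extOp B hf T) v w ≠ 0) :
    ∃ x y, f x = v ∧ f y = w := by
  by_contra hne
  apply h
  apply extOp_zero hf T v w
  by_contra hn
  push Not at hn
  obtain ⟨⟨x, hx⟩, ⟨y, hy⟩⟩ := hn
  exact hne ⟨x, y, hx, hy⟩

lemma colMap_extOp (φ : B →⋆ₙₐ[ℂ] C) (T : ColOp X B) :
    colMap φ (extOp B hf T) = extOp C hf (colMap φ T) :=
  entry_ext_range (f := f) (fun x y => by simp [entry_extOp])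
    (fun v w h => by rw [entry_colMap]; exact (congrArg φ (extOp_zero hf T v w h)).trans (map_zero φ))
    (fun v w h => extOp_zero hf _ v w h)

end Matrices

/-! ### Compact operators and matrix units -/

section Compact
variable {B C : Type*} [NonUnitalCStarAlgebra B] [NonUnitalCStarAlgebra C]

variable (B) in
/-- The compact operators on `l₂(ℕ, B)`. -/
abbrev KAlg : Type _ := CtrlAlg B (finiteFamily ℕ)

lemma KAlg.ext {S T : KAlg B} (h : ∀ i j, entry S.op i j = entry T.op i j) : S = T :=
  CtrlAlg.op_injective (entry_ext h)

lemma exists_munit (i j : ℕ) (b : B) : ∃ S : KAlg B,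
    (∀ k l, entry S.op k l = if k = i ∧ l = j then b else 0) ∧ ‖S‖ ≤ ‖b‖ := by
  obtain ⟨S, hS, hn⟩ := exists_colOp_of_card (fun k l : ℕ => if k = i ∧ l = j then b else 0) 1
    (norm_nonneg b)
    (fun x => ⟨{j}, by simp, fun y hy => by
      by_contra hne; apply hy; rw [if_neg]; rintro ⟨-, h⟩; exact hne (by simp [h])⟩)
    (fun y => ⟨{i}, by simp, fun x hx => by
      by_contra hne; apply hx; rw [if_neg]; rintro ⟨h, -⟩; exact hne (by simp [h])⟩)
    (fun x y => by split_ifs <;> simp)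
  refine ⟨⟨S, subset_closure ⟨{(i, j)}, Set.finite_singleton _, fun x y h => ?_⟩⟩, hS, ?_⟩
  · rw [hS] at h
    by_contra hne
    apply h
    rw [if_neg]
    rintro ⟨rfl, rfl⟩
    exact hne rfl
  · rw [Nat.cast_one, one_mul] at hn
    exact hn

/-- The matrix with the entry `b` at `(i, j)` and zeros elsewhere. -/
def munit (i j : ℕ) (b : B) : KAlg B := (exists_munit i j b).choose

lemma entry_munit (i j : ℕ) (b : B) (k l : ℕ) :
    entry (munit i j b).op k l = if k = i ∧ l = j then b else 0 :=
  (exists_munit i j b).choose_spec.1 k l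

lemma norm_munit_le (i j : ℕ) (b : B) : ‖munit i j b‖ ≤ ‖b‖ := (exists_munit i j b).choose_spec.2

lemma munit_add (i j : ℕ) (a b : B) : munit i j (a + b) = munit i j a + munit i j b :=
  KAlg.ext fun k l => by
    rw [CtrlAlg.op_add, entry_add, entry_munit, entry_munit, entry_munit]
    split_ifs <;> simp

lemma munit_smul (i j : ℕ) (c : ℂ) (b : B) : munit i j (c • b) = c • munit i j b :=
  KAlg.ext fun k l => by
    rw [CtrlAlg.op_smul, entry_smul, entry_munit, entry_munit]
    split_ifs <;> simp

/-- The inclusion at the position `(i, j)` as a continuous linear map. -/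
def munitL (i j : ℕ) : B →L[ℂ] KAlg B :=
  LinearMap.mkContinuous
    { toFun := munit i j, map_add' := munit_add i j, map_smul' := munit_smul i j } 1
    fun b => by rw [one_mul]; exact norm_munit_le i j b

@[simp] lemma munitL_apply (i j : ℕ) (b : B) : munitL i j b = munit i j b := rfl

lemma munit_zero (i j : ℕ) : munit i j (0 : B) = 0 := map_zero (munitL i j)

lemma munit_star (i j : ℕ) (b : B) : star (munit i j b) = munit j i (star b) :=
  KAlg.ext fun k l => by
    rw [CtrlAlg.op_star, entry_star, entry_munit, entry_munit]
    simp only [and_comm (a := l = i)]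
    split_ifs <;> simp

lemma munit_mul (i j k l : ℕ) (a b : B) :
    munit i j a * munit k l b = if j = k then munit i l (a * b) else 0 := by
  refine KAlg.ext fun p q => ?_
  rw [CtrlAlg.op_mul]
  refine (hasSum_entry_mul _ _ p q).unique ?_
  have h := hasSum_single (f := fun z => entry (munit i j a).op p z * entry (munit k l b).op z q) j
    (fun z hz => by rw [entry_munit, if_neg (fun h => hz h.2), zero_mul])
  convert h using 1
  simp only [entry_munit]
  split_ifs with h1 h2 h3 h4 <;> simp_all [entry_munit, CtrlAlg.op_zero, entry_zero]

lemma map_munit (φ : B →⋆ₙₐ[ℂ] C) (i j : ℕ) (b : B) :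
    CtrlAlg.map _ φ (munit i j b) = munit i j (φ b) :=
  KAlg.ext fun k l => by
    rw [CtrlAlg.op_map, entry_colMap, entry_munit, entry_munit]
    split_ifs <;> simp

lemma pushK_munit {f : ℕ → ℕ} (hf : Function.Injective f) (i j : ℕ) (b : B) :
    pushK B hf (munit i j b) = munit (f i) (f j) b :=
  KAlg.ext fun k l => by
    rw [op_pushK, entry_munit]
    by_cases h : ∃ x' y', f x' = k ∧ f y' = l
    · obtain ⟨x, y, rfl, rfl⟩ := h
      rw [entry_pushOp, entry_munit]
      simp [hf.eq_iff]
    · have h0 : entry (pushOp B hf (munit i j b).op) k l = 0 := by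
        by_contra hne; exact h (entry_pushOp_ne_zero hf hne)
      rw [h0, if_neg]
      rintro ⟨rfl, rfl⟩
      exact h ⟨i, j, rfl, rfl⟩

/-- The upper left corner of a matrix. -/
def trunc (n : ℕ) (T : KAlg B) : KAlg B :=
  ∑ i ∈ Finset.range n, ∑ j ∈ Finset.range n, munit i j (entry T.op i j)

lemma CtrlAlg.op_sum {X ι : Type*} {E : ControlFamily X} (s : Finset ι) (f : ι → CtrlAlg B E) :
    (∑ i ∈ s, f i).op = ∑ i ∈ s, (f i).op := by
  classical
  induction s using Finset.induction_on with
  | empty => rfl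
  | insert a s ha ih => rw [Finset.sum_insert ha, Finset.sum_insert ha, CtrlAlg.op_add, ih]

lemma entry_sum {X ι : Type*} (s : Finset ι) (f : ι → ColOp X B) (x y : X) :
    entry (∑ i ∈ s, f i) x y = ∑ i ∈ s, entry (f i) x y := by
  classical
  induction s using Finset.induction_on with
  | empty => simp [entry_zero]
  | insert a s ha ih => rw [Finset.sum_insert ha, Finset.sum_insert ha, entry_add, ih]

lemma entry_trunc (n : ℕ) (T : KAlg B) (k l : ℕ) :
    entry (trunc n T).op k l = if k < n ∧ l < n then entry T.op k l else 0 := by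
  simp only [trunc, CtrlAlg.op_sum, entry_sum, entry_munit]
  simp only [ite_and, Finset.sum_ite_irrel, Finset.sum_const_zero]
  rw [Finset.sum_ite_eq (Finset.range n) k]
  by_cases h1 : k < n
  · rw [if_pos (Finset.mem_range.2 h1), Finset.sum_ite_eq (Finset.range n) l]
    simp [h1]
  · simp [h1]

lemma norm_trunc_le (n : ℕ) (T : KAlg B) : ‖trunc n T‖ ≤ ‖T‖ := by
  have hg : ∀ k, ‖(if k < n then 1 else 0 : ℂ)‖ ≤ 1 := fun k => by split_ifs <;> simp
  have e : (trunc n T).op = cut (fun k => if k < n then 1 else 0) T.op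
      (fun k => if k < n then 1 else 0) := entry_ext fun k l => by
    rw [entry_trunc, entry_cut ⟨1, hg⟩ ⟨1, hg⟩]
    split_ifs <;> simp_all
  rw [← CtrlAlg.norm_op, e, ← CtrlAlg.norm_op]
  simpa using norm_cut_le zero_le_one zero_le_one hg hg T.op

lemma trunc_sub (n : ℕ) (S T : KAlg B) : trunc n (S - T) = trunc n S - trunc n T := by
  refine KAlg.ext fun k l => ?_
  have h : ∀ S T : KAlg B, (S - T).op = S.op - T.op := fun _ _ => rfl
  rw [entry_trunc, h, h, entry_sub, entry_sub, entry_trunc, entry_trunc]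
  split_ifs <;> simp

lemma trunc_eq_self {n : ℕ} {T : KAlg B} (h : ∀ k l, entry T.op k l ≠ 0 → k < n ∧ l < n) :
    trunc n T = T := KAlg.ext fun k l => by
  rw [entry_trunc]
  split_ifs with h1
  · rfl
  · by_contra hne; exact h1 (h k l (Ne.symm hne))

lemma exists_norm_sub_trunc_lt (T : KAlg B) {ε : ℝ} (hε : 0 < ε) :
    ∃ n, ∀ m ≥ n, ‖T - trunc m T‖ < ε := by
  obtain ⟨S, ⟨F, hF, hS⟩, hTS⟩ := Metric.mem_closure_iff.1 T.mem_closure (ε / 2) (half_pos hε)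
  let S' : KAlg B := ⟨S, subset_closure ⟨F, hF, hS⟩⟩
  have hTS' : ‖T - S'‖ < ε / 2 := by rw [dist_eq_norm] at hTS; exact hTS
  obtain ⟨n, hn⟩ : ∃ n, ∀ p ∈ F, p.1 < n ∧ p.2 < n := by
    obtain ⟨a, ha⟩ := (Set.Finite.image Prod.fst hF).bddAbove
    obtain ⟨b, hb⟩ := (Set.Finite.image Prod.snd hF).bddAbove
    refine ⟨a + b + 1, fun p hp => ?_⟩
    have h1 := ha ⟨p, hp, rfl⟩
    have h2 := hb ⟨p, hp, rfl⟩
    omega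
  refine ⟨n, fun m hm => ?_⟩
  have h1 : trunc m S' = S' := trunc_eq_self fun k l h => by
    have := hn _ (hS k l h)
    exact ⟨this.1.trans_le hm, this.2.trans_le hm⟩
  calc ‖T - trunc m T‖ = ‖(T - S') - trunc m (T - S')‖ := by rw [trunc_sub, h1]; congr 1; abel
    _ ≤ ‖T - S'‖ + ‖trunc m (T - S')‖ := norm_sub_le _ _
    _ ≤ ‖T - S'‖ + ‖T - S'‖ := by gcongr; exact norm_trunc_le m _
    _ < ε := by linarith

/-- `*`-homomorphisms on `𝕂 B` are determined by their values on the matrix units. -/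
lemma KAlg.hom_ext {φ ψ : KAlg B →⋆ₙₐ[ℂ] C} (h : ∀ i j b, φ (munit i j b) = ψ (munit i j b)) :
    φ = ψ := by
  refine hom_eq_of_dense φ ψ (Set.range fun p : ℕ × KAlg B => trunc p.1 p.2) ?_ ?_
  · intro T
    refine Metric.mem_closure_iff.2 fun ε hε => ?_
    obtain ⟨n, hn⟩ := exists_norm_sub_trunc_lt T hε
    exact ⟨_, ⟨(n, T), rfl⟩, by rw [dist_eq_norm]; exact hn n le_rfl⟩
  · rintro _ ⟨⟨n, T⟩, rfl⟩
    simp [trunc, map_sum, h]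

variable (B) in
/-- The matrices supported in the upper left `n × n`-corner. -/
def corner (n : ℕ) : NonUnitalStarSubalgebra ℂ (KAlg B) where
  carrier := {T | ∀ k l, entry T.op k l ≠ 0 → k < n ∧ l < n}
  zero_mem' k l h := absurd (entry_zero k l) h
  add_mem' {S T} hS hT k l h := (entry_add_ne_zero h).elim (hS k l) (hT k l)
  mul_mem' {S T} hS hT k l h := by
    obtain ⟨z, h1, h2⟩ := exists_entry_ne_zero h
    exact ⟨(hS _ _ h1).1, (hT _ _ h2).2⟩
  smul_mem' c T hT k l h := hT k l (entry_smul_ne_zero h)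
  star_mem' {T} hT k l h := (hT l k (entry_star_ne_zero h)).symm

lemma isClosed_corner (n : ℕ) : IsClosed (corner B n : Set (KAlg B)) := by
  have hc : ∀ k l, Continuous fun T : KAlg B => entry T.op k l := fun k l =>
    LipschitzWith.continuous (K := 1) (LipschitzWith.of_dist_le_mul fun S T => by
      rw [dist_eq_norm, dist_eq_norm, NNReal.coe_one, one_mul, ← entry_sub]
      exact norm_entry_le (S.op - T.op) k l)
  have : (corner B n : Set (KAlg B)) = ⋂ (k) (l) (_ : ¬ (k < n ∧ l < n)), {T | entry T.op k l = 0} := by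
    ext T
    simp only [Set.mem_iInter]
    exact ⟨fun h k l hkl => by_contra fun hne => hkl (h k l hne),
      fun h k l hne => by_contra fun hkl => hne (h k l hkl)⟩
  rw [this]
  exact isClosed_iInter fun k => isClosed_iInter fun l => isClosed_iInter fun _ =>
    isClosed_eq (hc k l) continuous_const

variable (B) in
/-- The C*-algebra of the matrices supported in the upper left `n × n`-corner. -/
def CornerAlg (n : ℕ) : Type _ := corner B n

instance (n : ℕ) : NonUnitalCStarAlgebra (CornerAlg B n) :=
  NonUnitalStarSubalgebra.nonUnitalCStarAlgebra (h_closed := isClosed_corner n) (corner B n)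

/-- The universal property of `𝕂 B`: a system of matrix units over `B` in a C*-algebra defines a
`*`-homomorphism. -/
theorem exists_KAlg_hom (β : ℕ → ℕ → B → C)
    (hadd : ∀ i j a b, β i j (a + b) = β i j a + β i j b)
    (hsmul : ∀ i j (c : ℂ) b, β i j (c • b) = c • β i j b)
    (hmul : ∀ i j k l a b, β i j a * β k l b = if j = k then β i l (a * b) else 0)
    (hstar : ∀ i j b, star (β i j b) = β j i (star b)) :
    ∃ φ : KAlg B →⋆ₙₐ[ℂ] C, ∀ i j b, φ (munit i j b) = β i j b := by
  have hzero : ∀ i j, β i j 0 = 0 := fun i j => by simpa using hsmul i j 0 0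
  let v : ℕ → KAlg B → C := fun n T =>
    ∑ i ∈ Finset.range n, ∑ j ∈ Finset.range n, β i j (entry T.op i j)
  have hv : ∀ {n m : ℕ} {T : KAlg B}, n ≤ m → T ∈ corner B n → v m T = v n T := by
    intro n m T hnm hT
    have hsub := Finset.range_subset_range.2 hnm
    have h0 : ∀ i j, ¬ (i < n ∧ j < n) → β i j (entry T.op i j) = 0 := by
      intro i j hij
      have : entry T.op i j = 0 := by by_contra hne; exact hij (hT i j hne)
      rw [this, hzero]
    change ∑ i ∈ Finset.range m, ∑ j ∈ Finset.range m, _ = ∑ i ∈ Finset.range n, _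
    rw [← Finset.sum_subset hsub fun i _ hi => Finset.sum_eq_zero fun j _ =>
      h0 i j fun h => hi (Finset.mem_range.2 h.1)]
    refine Finset.sum_congr rfl fun i _ => ?_
    rw [← Finset.sum_subset hsub fun j _ hj => h0 i j fun h => hj (Finset.mem_range.2 h.2)]
  have vadd : ∀ n (S T : KAlg B), v n (S + T) = v n S + v n T := by
    intro n S T
    simp [v, CtrlAlg.op_add, entry_add, hadd, Finset.sum_add_distrib]
  have vsmul : ∀ n (c : ℂ) (T : KAlg B), v n (c • T) = c • v n T := by
    intro n c T
    simp [v, CtrlAlg.op_smul, entry_smul, hsmul, Finset.smul_sum]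
  have vstar : ∀ n (T : KAlg B), v n (star T) = star (v n T) := by
    intro n T
    simp only [v, CtrlAlg.op_star, entry_star, star_sum, hstar]
    rw [Finset.sum_comm]
  have hβsum : ∀ i j (s : Finset ℕ) (g : ℕ → B), β i j (∑ k ∈ s, g k) = ∑ k ∈ s, β i j (g k) := by
    intro i j s g
    exact map_sum (AddMonoidHom.mk' (β i j) (hadd i j)) g s
  have vmul : ∀ n (S T : KAlg B), S ∈ corner B n → v n (S * T) = v n S * v n T := by
    intro n S T hS
    have he : ∀ i j, entry (S * T).op i j =
        ∑ k ∈ Finset.range n, entry S.op i k * entry T.op k j := by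
      intro i j
      refine (hasSum_entry_mul S.op T.op i j).unique (hasSum_sum_of_ne_finset_zero fun k hk => ?_)
      have : entry S.op i k = 0 := by
        by_contra hne; exact hk (Finset.mem_range.2 (hS i k hne).2)
      rw [this, zero_mul]
    simp only [v, he, hβsum]
    rw [Finset.sum_mul]
    refine Finset.sum_congr rfl fun i _ => ?_
    rw [Finset.sum_mul, Finset.sum_comm]
    refine Finset.sum_congr rfl fun k hk => ?_
    rw [Finset.mul_sum]
    simp only [Finset.mul_sum, hmul]
    rw [Finset.sum_comm]
    refine Finset.sum_congr rfl fun j _ => ?_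
    rw [Finset.sum_ite_eq (Finset.range n) k, if_pos hk]
  have vnorm : ∀ n (T : KAlg B), T ∈ corner B n → ‖v n T‖ ≤ ‖T‖ := by
    intro n T hT
    let w : CornerAlg B n →⋆ₙₐ[ℂ] C :=
      { toFun := fun S => v n S.1
        map_smul' := fun c S => vsmul n c S.1
        map_zero' := show v n 0 = 0 by simpa using vsmul n 0 0
        map_add' := fun S S' => vadd n S.1 S'.1
        map_mul' := fun S S' => vmul n S.1 S'.1 S.2
        map_star' := fun S => vstar n S.1 }
    let T' : CornerAlg B n := ⟨T, hT⟩
    exact NonUnitalStarAlgHom.norm_apply_le w T'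
  have hmono : ∀ {n m : ℕ}, n ≤ m → corner B n ≤ corner B m := fun hnm T hT k l h =>
    ⟨(hT k l h).1.trans_le hnm, (hT k l h).2.trans_le hnm⟩
  obtain ⟨φ, hφ⟩ := exists_hom_of_rel (A := KAlg B) (B := C)
    (fun T c => ∃ n, T ∈ corner B n ∧ v n T = c)
    ⟨0, zero_mem _, by simp [v]⟩
    (by
      rintro S _ T _ ⟨n, hS, rfl⟩ ⟨m, hT, rfl⟩
      refine ⟨max n m, add_mem (hmono (le_max_left n m) hS) (hmono (le_max_right n m) hT), ?_⟩
      rw [vadd, hv (le_max_left n m) hS, hv (le_max_right n m) hT])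
    (by
      rintro c T _ ⟨n, hT, rfl⟩
      exact ⟨n, SMulMemClass.smul_mem c hT, vsmul n c T⟩)
    (by
      rintro S _ T _ ⟨n, hS, rfl⟩ ⟨m, hT, rfl⟩
      have hS' := hmono (le_max_left n m) hS
      refine ⟨max n m, mul_mem hS' (hmono (le_max_right n m) hT), ?_⟩
      rw [vmul _ _ _ hS', hv (le_max_left n m) hS, hv (le_max_right n m) hT])
    (by
      rintro T _ ⟨n, hT, rfl⟩
      exact ⟨n, star_mem hT, vstar n T⟩)
    (by
      rintro T _ ⟨n, hT, rfl⟩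
      exact vnorm n T hT)
    (fun T ε hε => by
      obtain ⟨n, hn⟩ := exists_norm_sub_trunc_lt T hε
      refine ⟨trunc n T, _, ⟨n, fun k l h => ?_, rfl⟩, hn n le_rfl⟩
      rw [entry_trunc] at h
      by_contra hne
      exact h (if_neg hne))
  refine ⟨φ, fun i j b => hφ _ _ ⟨max i j + 1, fun k l h => ?_, ?_⟩⟩
  · rw [entry_munit] at h
    by_contra hne
    apply h
    rw [if_neg]
    rintro ⟨rfl, rfl⟩
    omega
  · simp only [v, entry_munit]
    rw [Finset.sum_eq_single i, Finset.sum_eq_single j]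
    · simp
    · intro l _ hl; rw [if_neg (fun h => hl h.2), hzero]
    · intro h; exfalso; apply h; rw [Finset.mem_range]; omega
    · intro k _ hk; exact Finset.sum_eq_zero fun l _ => by rw [if_neg (fun h => hk h.1), hzero]
    · intro h; exfalso; apply h; rw [Finset.mem_range]; omega

variable (B) in
/-- The inclusion of `B` into `𝕂 B` as the upper left corner. -/
def stab : B →⋆ₙₐ[ℂ] KAlg B where
  toFun := munit 0 0
  map_smul' c b := munit_smul 0 0 c b
  map_zero' := munit_zero 0 0
  map_add' := munit_add 0 0
  map_mul' a b := by rw [munit_mul, if_pos rfl]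
  map_star' b := (munit_star 0 0 b).symm

lemma stab_apply (b : B) : stab B b = munit 0 0 b := rfl

lemma map_stab (φ : B →⋆ₙₐ[ℂ] C) (b : B) : CtrlAlg.map _ φ (stab B b) = stab C (φ b) :=
  map_munit φ 0 0 b

end Compact

/-! ### Homotopies of endomorphisms of the compact operators -/

section Rotation
variable {B C : Type*} [NonUnitalCStarAlgebra B] [NonUnitalCStarAlgebra C]

variable (B) in
/-- Evaluation of paths. -/
def evHom (t : unitInterval) : C(unitInterval, B) →⋆ₙₐ[ℂ] B where
  toFun f := f t
  map_smul' _ _ := rfl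
  map_zero' := rfl
  map_add' _ _ := rfl
  map_mul' _ _ := rfl
  map_star' _ := rfl

@[simp] lemma evHom_apply (t : unitInterval) (f : C(unitInterval, B)) : evHom B t f = f t := rfl

/-- The path `t ↦ w(t) b`. -/
def smulPath (w : C(unitInterval, ℝ)) (b : B) : C(unitInterval, B) :=
  ⟨fun t => ((w t : ℝ) : ℂ) • b, by fun_prop⟩

@[simp] lemma smulPath_apply (w : C(unitInterval, ℝ)) (b : B) (t : unitInterval) :
    smulPath w b t = ((w t : ℝ) : ℂ) • b := rfl

set_option maxHeartbeats 1000000 in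
/-- Isometries `e_i ↦ c_i e_{f i} + d_i e_{g i}`, where `c_i` and `d_i` are paths of real numbers,
define a homotopy of endomorphisms of `𝕂 B`. -/
theorem exists_rotation (f g : ℕ → ℕ) (hf : Function.Injective f) (hg : Function.Injective g)
    (c d : ℕ → C(unitInterval, ℝ)) (hfg : ∀ i, f i ≠ g i) (hcd : ∀ i t, c i t ^ 2 + d i t ^ 2 = 1)
    (hx : ∀ i j t, f i = g j → c i t * d j t = 0) :
    ∃ χ : KAlg B →⋆ₙₐ[ℂ] KAlg C(unitInterval, B),
      (∀ t, (∀ i, c i t = 1) → (∀ i, d i t = 0) → (CtrlAlg.map _ (evHom B t)).comp χ = pushK B hf) ∧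
      ∀ t, (∀ i, c i t = 0) → (∀ i, d i t = 1) → (CtrlAlg.map _ (evHom B t)).comp χ = pushK B hg := by
  let v : ℕ → ℕ → C(unitInterval, ℝ) := fun i k =>
    (if k = f i then c i else 0) + (if k = g i then d i else 0)
  have hv0 : ∀ i k, k ∉ ({f i, g i} : Finset ℕ) → v i k = 0 := by
    intro i k hk
    simp only [Finset.mem_insert, Finset.mem_singleton, not_or] at hk
    simp [v, hk.1, hk.2]
  have horth : ∀ i j, ∑ z ∈ ({f i, g i} : Finset ℕ), v i z * v j z = if i = j then 1 else 0 := by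
    intro i j
    rw [Finset.sum_pair (hfg i)]
    ext t
    have h1 := hcd i t
    have h2 := hfg i
    have h3 := (hfg i).symm
    by_cases hij : i = j
    · subst hij
      simp [v, h2, h3]
      nlinarith
    · have h4 : f i ≠ f j := hf.ne hij
      have h5 : g i ≠ g j := hg.ne hij
      simp only [v, if_neg h2, if_neg h3, if_neg h4, if_neg h5, if_neg hij]
      by_cases h6 : f i = g j
      · by_cases h7 : g i = f j
        · have := hx i j t h6
          have := hx j i t h7.symm
          simp [h6, h7]; linarith
        · have := hx i j t h6
          simpa [h6, h7] using this
      · by_cases h7 : g i = f j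
        · have := hx j i t h7.symm
          simpa [h6, h7, mul_comm] using this
        · simp [h6, h7]
  let β : ℕ → ℕ → B → KAlg C(unitInterval, B) := fun i j b =>
    ∑ k ∈ ({f i, g i} : Finset ℕ), ∑ l ∈ ({f j, g j} : Finset ℕ), munit k l (smulPath (v i k * v j l) b)
  have hβ : ∀ i j b p q, entry (β i j b).op p q = smulPath (v i p * v j q) b := by
    intro i j b p q
    simp only [β, CtrlAlg.op_sum, entry_sum, entry_munit, ite_and, Finset.sum_ite_irrel,
      Finset.sum_const_zero]
    rw [Finset.sum_ite_eq, Finset.sum_ite_eq]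
    split_ifs with h1 h2
    · rfl
    · rw [hv0 j q h2]; ext t; simp
    · rw [hv0 i p h1]; ext t; simp
  obtain ⟨χ, hχ⟩ := exists_KAlg_hom (B := B) (C := KAlg C(unitInterval, B)) β
    (fun i j a b => KAlg.ext fun p q => by
      rw [CtrlAlg.op_add, entry_add, hβ, hβ, hβ]; ext t; simp)
    (fun i j z b => KAlg.ext fun p q => by
      rw [CtrlAlg.op_smul, entry_smul, hβ, hβ]; ext t; simp [smul_smul, mul_comm])
    (fun i j k l a b => KAlg.ext fun p q => by
      rw [CtrlAlg.op_mul]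
      have h : HasSum (fun z => entry (β i j a).op p z * entry (β k l b).op z q)
          (∑ z ∈ ({f j, g j} : Finset ℕ), entry (β i j a).op p z * entry (β k l b).op z q) :=
        hasSum_sum_of_ne_finset_zero fun z hz => by rw [hβ, hv0 j z hz]; ext t; simp
      refine ((hasSum_entry_mul _ _ p q).unique h).trans ?_
      have e : ∑ z ∈ ({f j, g j} : Finset ℕ), entry (β i j a).op p z * entry (β k l b).op z q =
          smulPath (v i p * v l q * ∑ z ∈ ({f j, g j} : Finset ℕ), v j z * v k z) (a * b) := by
        simp only [hβ]
        ext t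
        simp only [ContinuousMap.sum_apply, ContinuousMap.mul_apply, smulPath_apply,
          smul_mul_smul_comm, Finset.mul_sum, Complex.ofReal_sum, Finset.sum_smul]
        refine Finset.sum_congr rfl fun z _ => ?_
        congr 1
        push_cast
        ring
      rw [e, horth]
      split_ifs with h
      · rw [hβ]; ext t; simp
      · rw [CtrlAlg.op_zero, entry_zero]; ext t; simp)
    (fun i j b => KAlg.ext fun p q => by
      rw [CtrlAlg.op_star, entry_star, hβ, hβ]; ext t; simp [mul_comm])
  have hend : ∀ (t : unitInterval) {h : ℕ → ℕ} (hh : Function.Injective h)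
      (_ : ∀ i k, v i k t = if k = h i then 1 else 0),
      (CtrlAlg.map _ (evHom B t)).comp χ = pushK B hh := by
    intro t h hh hvt
    refine KAlg.hom_ext fun i j b => KAlg.ext fun p q => ?_
    rw [NonUnitalStarAlgHom.comp_apply, hχ, pushK_munit, CtrlAlg.op_map, entry_colMap, hβ,
      entry_munit, evHom_apply, smulPath_apply, ContinuousMap.mul_apply, hvt, hvt]
    by_cases h1 : p = h i
    · by_cases h2 : q = h j
      · rw [if_pos h1, if_pos h2, if_pos ⟨h1, h2⟩]; simp
      · rw [if_neg h2, if_neg (show ¬ (p = h i ∧ q = h j) from fun hh => h2 hh.2)]; simp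
    · rw [if_neg h1, if_neg (show ¬ (p = h i ∧ q = h j) from fun hh => h1 hh.1)]; simp
  refine ⟨χ, fun t hc hd => hend t hf fun i k => ?_, fun t hc hd => hend t hg fun i k => ?_⟩
  · simp only [v, ContinuousMap.add_apply]
    split_ifs <;> simp [hc, hd]
  · simp only [v, ContinuousMap.add_apply]
    split_ifs <;> simp [hc, hd]

/-- Homotopy of endomorphisms of `𝕂 B`, by homotopies `𝕂 B → 𝕂 I B`. -/
def KHomotopic (φ ψ : KAlg B →⋆ₙₐ[ℂ] KAlg B) : Prop :=
  ∃ χ : KAlg B →⋆ₙₐ[ℂ] KAlg C(unitInterval, B),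
    (CtrlAlg.map _ (evHom B 0)).comp χ = φ ∧ (CtrlAlg.map _ (evHom B 1)).comp χ = ψ

lemma pushK_comp {f g : ℕ → ℕ} (hf : Function.Injective f) (hg : Function.Injective g) :
    (pushK B hg).comp (pushK B hf) = pushK B (hg.comp hf) :=
  KAlg.hom_ext fun i j b => by simp [pushK_munit]

lemma pushK_id : pushK B Function.injective_id = NonUnitalStarAlgHom.id ℂ (KAlg B) :=
  KAlg.hom_ext fun i j b => by simp [pushK_munit]

lemma KHomotopic.comp {φ ψ : KAlg B →⋆ₙₐ[ℂ] KAlg B} (h : KHomotopic φ ψ)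
    (η : KAlg B →⋆ₙₐ[ℂ] KAlg B) : KHomotopic (φ.comp η) (ψ.comp η) := by
  obtain ⟨χ, rfl, rfl⟩ := h
  exact ⟨χ.comp η, rfl, rfl⟩

lemma kHomotopic_of_disjoint {f g : ℕ → ℕ} (hf : Function.Injective f) (hg : Function.Injective g)
    (h : ∀ i j, f i ≠ g j) : KHomotopic (pushK B hf) (pushK B hg) := by
  let c : C(unitInterval, ℝ) := ⟨fun t => Real.cos (Real.pi / 2 * t), by fun_prop⟩
  let d : C(unitInterval, ℝ) := ⟨fun t => Real.sin (Real.pi / 2 * t), by fun_prop⟩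
  obtain ⟨χ, h0, h1⟩ := exists_rotation (B := B) f g hf hg (fun _ => c) (fun _ => d) (fun i => h i i)
    (fun i t => Real.cos_sq_add_sin_sq _) (fun i j t hij => absurd hij (h i j))
  exact ⟨χ, h0 0 (by simp [c]) (by simp [d]), h1 1 (by simp [c]) (by simp [d])⟩

/-- The angle that moves from `0` to `π/2` on the interval `[1/(n+2), 1/(n+1)]`. -/
def angle (n : ℕ) (t : unitInterval) : ℝ :=
  Real.pi / 2 * max 0 (min 1 (((n : ℝ) + 1) * (n + 2) * (t : ℝ) - (n + 1)))

lemma angle_zero (n : ℕ) : angle n 0 = 0 := by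
  have : min (1 : ℝ) ((n + 1) * (n + 2) * (0 : unitInterval) - (n + 1)) ≤ 0 :=
    (min_le_right _ _).trans (by
      simp only [Set.Icc.coe_zero, mul_zero, zero_sub, Left.neg_nonpos_iff]; positivity)
  rw [angle, max_eq_left this, mul_zero]

lemma angle_one (n : ℕ) : angle n 1 = Real.pi / 2 := by
  have : (1 : ℝ) ≤ (n + 1) * (n + 2) * (1 : unitInterval) - (n + 1) := by
    simp only [Set.Icc.coe_one, mul_one]
    nlinarith [(Nat.cast_nonneg n : (0 : ℝ) ≤ n)]
  rw [angle, min_eq_left this, max_eq_right zero_le_one, mul_one]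

lemma angle_eq {m n : ℕ} (h : n < m) (t : unitInterval) : angle n t = 0 ∨ angle m t = Real.pi / 2 := by
  rcases le_or_gt (((n : ℝ) + 2) * t) 1 with ht | ht
  · left
    have : min (1 : ℝ) ((n + 1) * (n + 2) * t - (n + 1)) ≤ 0 :=
      (min_le_right _ _).trans (by nlinarith [(Nat.cast_nonneg n : (0 : ℝ) ≤ n)])
    rw [angle, max_eq_left this, mul_zero]
  · right
    have hm : (n : ℝ) + 1 ≤ m := by exact_mod_cast h
    have ht0 : (0 : ℝ) ≤ t := t.2.1
    have h1 : 1 < ((m : ℝ) + 1) * t := ht.trans_le (by nlinarith)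
    have : (1 : ℝ) ≤ (m + 1) * (m + 2) * t - (m + 1) := by
      nlinarith [(Nat.cast_nonneg m : (0 : ℝ) ≤ m)]
    rw [angle, min_eq_left this, max_eq_right zero_le_one, mul_one]

lemma kHomotopic_id_of_lt {f : ℕ → ℕ} (hf : Function.Injective f) (h : ∀ n, n < f n) :
    KHomotopic (pushK B Function.injective_id) (pushK B hf) := by
  have hcont : ∀ n, Continuous (angle n) := fun n => by unfold angle; fun_prop
  let c : ℕ → C(unitInterval, ℝ) := fun n => ⟨fun t => Real.cos (angle n t), by fun_prop⟩
  let d : ℕ → C(unitInterval, ℝ) := fun n => ⟨fun t => Real.sin (angle n t), by fun_prop⟩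
  obtain ⟨χ, h0, h1⟩ := exists_rotation (B := B) id f Function.injective_id hf c d
    (fun i => (h i).ne) (fun i t => Real.cos_sq_add_sin_sq _) (fun i j t hij => by
      have hji : j < i := by
        rw [show i = f j from hij]; exact h j
      rcases angle_eq hji t with h | h
      · simp [d, h]
      · simp [c, h])
  exact ⟨χ, h0 0 (by simp [c, angle_zero]) (by simp [d, angle_zero]),
    h1 1 (by simp [c, angle_one]) (by simp [d, angle_one])⟩

/-- Conjugation by the isometry of each injection is homotopic to the identity. -/
theorem eqvGen_pushK {f : ℕ → ℕ} (hf : Function.Injective f) :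
    Relation.EqvGen (KHomotopic (B := B)) (pushK B hf) (NonUnitalStarAlgHom.id ℂ (KAlg B)) := by
  have ho : Function.Injective fun n : ℕ => 2 * n + 1 := two_mul_add_one_injective
  have he : Function.Injective fun n : ℕ => 2 * n + 2 := fun m n h => by simpa using h
  have h1 := (kHomotopic_id_of_lt (B := B) ho fun n => by omega).comp (pushK B hf)
  have h2 := kHomotopic_id_of_lt (B := B) he fun n => by omega
  rw [pushK_comp, pushK_comp] at h1
  have h3 : KHomotopic (pushK B (ho.comp hf)) (pushK B he) :=
    kHomotopic_of_disjoint _ _ fun i j => by simp only [Function.comp_apply]; omega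
  rw [← pushK_id]
  exact .trans _ _ _ (.rel _ _ h1) (.trans _ _ _ (.rel _ _ h3) (.symm _ _ (.rel _ _ h2)))

end Rotation

/-! ### The monoid laws -/

section Monoid
variable {A B : CStarAlg.{u}} (G : CStarAlg.{u} ⥤ CStarAlg.{u})

lemma GenMor.mk_comp_eq_of_eqvGen {p q : KAlg B →⋆ₙₐ[ℂ] KAlg B}
    (h : Relation.EqvGen KHomotopic p q) (φ : A ⟶ (compact ⋙ G).obj B) :
    GenMor.mk (compact ⋙ G) (φ ≫ G.map (ofHom (A := compact.obj B) (B := compact.obj B) p)) =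
      GenMor.mk (compact ⋙ G) (φ ≫ G.map (ofHom (A := compact.obj B) (B := compact.obj B) q)) := by
  induction h with
  | rel p q h =>
    obtain ⟨χ, rfl, rfl⟩ := h
    refine Quot.sound ⟨φ ≫ G.map (ofHom (A := compact.obj B) (B := compact.obj (cyl.obj B)) χ), ?_, ?_⟩ <;>
    · rw [Category.assoc, Functor.comp_map, ← G.map_comp]
      rfl
  | refl p => rfl
  | symm p q _ ih => exact ih.symm
  | trans p q r _ _ ih1 ih2 => exact ih1.trans ih2

lemma GenMor.mk_comp_conjK {f : ℕ → ℕ} (hf : Function.Injective f) (φ : A ⟶ (compact ⋙ G).obj B) :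
    GenMor.mk (compact ⋙ G) (φ ≫ G.map ((conjK hf).app B)) = GenMor.mk (compact ⋙ G) φ := by
  have h := GenMor.mk_comp_eq_of_eqvGen G (eqvGen_pushK (B := B) hf) φ
  refine h.trans (congrArg _ ?_)
  have e : ofHom (A := compact.obj B) (B := compact.obj B) (NonUnitalStarAlgHom.id ℂ (KAlg B)) =
    𝟙 (compact.obj B) := rfl
  rw [e, G.map_id]
  exact Category.comp_id φ

lemma conjK_comp_app {f g h : ℕ → ℕ} (hf : Function.Injective f) (hg : Function.Injective g)
    (hh : Function.Injective h) (e : ∀ n, g (f n) = h n) :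
    (conjK hf).app B ≫ (conjK hg).app B = (conjK hh).app B := by
  obtain rfl : h = g ∘ f := funext fun n => (e n).symm
  exact pushK_comp (B := B) hf hg

variable {G}

lemma orthAdd_congr {f f' g g' : A ⟶ B} {h : Orth f g} {h' : Orth f' g'} (e : ∀ a, f a + g a = f' a + g' a) :
    orthAdd f g h = orthAdd f' g' h' := hom_ext' e

theorem SumMor.isCommMonoid (G : CStarAlg.{u} ⥤ CStarAlg.{u}) [OrthPreserving G] (A B : CStarAlg.{u}) :
    IsCommMonoid (SumMor G A B) where
  comm := by
    rintro ⟨φ⟩ ⟨ψ⟩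
    let σ : ℕ → ℕ := fun n => if n % 2 = 0 then n + 1 else n - 1
    have hσ : Function.Injective σ := fun m n h => by
      simp only [σ] at h; split_ifs at h <;> omega
    change GenMor.mk (compact ⋙ G) (dsum G φ ψ) = GenMor.mk (compact ⋙ G) (dsum G ψ φ)
    rw [← GenMor.mk_comp_conjK G hσ (dsum G φ ψ)]
    congr 1
    have e0 : inc₀.app B ≫ (conjK hσ).app B = inc₁.app B :=
      conjK_comp_app _ _ _ fun n => by simp [σ]
    have e1 : inc₁.app B ≫ (conjK hσ).app B = inc₀.app B :=
      conjK_comp_app _ _ _ fun n => by simp only [σ]; split_ifs <;> omega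
    rw [dsum, dsum, orthAdd_comp]
    simp only [Category.assoc, ← G.map_comp, e0, e1]
    exact orthAdd_congr fun a => add_comm _ _
  zero_add := by
    rintro ⟨φ⟩
    change GenMor.mk (compact ⋙ G) (dsum G (ofHom 0) φ) = GenMor.mk (compact ⋙ G) φ
    rw [← GenMor.mk_comp_conjK G two_mul_add_one_injective φ]
    congr 1
    refine hom_ext' fun a => ?_
    change toHom (G.map (inc₀.app B)) 0 + _ = _
    rw [map_zero, zero_add]
    rfl
  assoc := by
    rintro ⟨φ⟩ ⟨ψ⟩ ⟨χ⟩
    let σ : ℕ → ℕ := fun n => if n % 4 = 0 then n / 2 else if n % 4 = 2 then n - 1 else 2 * n + 1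
    have hσ : Function.Injective σ := fun m n h => by
      simp only [σ] at h; split_ifs at h <;> omega
    change GenMor.mk (compact ⋙ G) (dsum G (dsum G φ ψ) χ) =
      GenMor.mk (compact ⋙ G) (dsum G φ (dsum G ψ χ))
    rw [← GenMor.mk_comp_conjK G hσ (dsum G (dsum G φ ψ) χ)]
    congr 1
    have h4 : ∀ k, Function.Injective fun n : ℕ => 4 * n + k := fun k m n h => by simpa using h
    have key : ∀ {f g h : ℕ → ℕ} (hf : Function.Injective f) (hg : Function.Injective g)
        (hh : Function.Injective h), (∀ n, g (f n) = h n) → ∀ x,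
        toHom (G.map ((conjK hg).app B)) (toHom (G.map ((conjK hf).app B)) x) =
          toHom (G.map ((conjK hh).app B)) x := by
      intro f g h hf hg hh e x
      rw [← conjK_comp_app hf hg hh e, G.map_comp]
      rfl
    refine hom_ext' fun a => ?_
    change toHom (G.map ((conjK hσ).app B)) (toHom (G.map (inc₀.app B))
        (toHom (G.map (inc₀.app B)) (φ a) + toHom (G.map (inc₁.app B)) (ψ a)) +
        toHom (G.map (inc₁.app B)) (χ a)) =
      toHom (G.map (inc₀.app B)) (φ a) + toHom (G.map (inc₁.app B))
        (toHom (G.map (inc₀.app B)) (ψ a) + toHom (G.map (inc₁.app B)) (χ a))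
    simp only [map_add]
    unfold inc₀ inc₁
    rw [key two_mul_injective two_mul_injective (h4 0) (fun n => by omega),
      key two_mul_add_one_injective two_mul_injective (h4 2) (fun n => by omega),
      key (h4 0) hσ two_mul_injective (fun n => by simp only [σ]; split_ifs <;> omega),
      key (h4 2) hσ (h4 1) (fun n => by simp only [σ]; split_ifs <;> omega),
      key two_mul_add_one_injective hσ (h4 3) (fun n => by simp only [σ]; split_ifs <;> omega),
      key two_mul_injective two_mul_add_one_injective (h4 1) (fun n => by omega),
      key two_mul_add_one_injective two_mul_add_one_injective (h4 3) (fun n => by omega), add_assoc]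

end Monoid

/-! ### Double matrices -/

section Swap
open scoped BoundedContinuousFunction
variable {B C : Type*} [NonUnitalCStarAlgebra B] [NonUnitalCStarAlgebra C]

/-- The entries of compact operators. -/
def entryL (i j : ℕ) : KAlg B →L[ℂ] B :=
  LinearMap.mkContinuous
    { toFun := fun T => entry T.op i j
      map_add' := fun S T => by rw [CtrlAlg.op_add, entry_add]
      map_smul' := fun c T => by rw [CtrlAlg.op_smul, entry_smul]; rfl } 1
    fun T => by rw [one_mul]; exact norm_entry_le T.op i j

@[simp] lemma entryL_apply (i j : ℕ) (T : KAlg B) : entryL i j T = entry T.op i j := rfl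

lemma KAlg.clm_ext {V : Type*} [NormedAddCommGroup V] [NormedSpace ℂ V] {φ ψ : KAlg B →L[ℂ] V}
    (h : ∀ i j b, φ (munit i j b) = ψ (munit i j b)) : φ = ψ := by
  have hs : Dense (Set.range fun p : ℕ × KAlg B => trunc p.1 p.2) := fun T =>
    Metric.mem_closure_iff.2 fun ε hε => by
      obtain ⟨n, hn⟩ := exists_norm_sub_trunc_lt T hε
      exact ⟨_, ⟨(n, T), rfl⟩, by rw [dist_eq_norm]; exact hn n le_rfl⟩
  refine DFunLike.coe_injective (φ.continuous.ext_on hs ψ.continuous ?_)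
  rintro _ ⟨⟨n, T⟩, rfl⟩
  simp [trunc, map_sum, h]

/-- A `*`-homomorphism as a continuous linear map. -/
def homL (φ : B →⋆ₙₐ[ℂ] C) : B →L[ℂ] C :=
  LinearMap.mkContinuous
    { toFun := φ, map_add' := map_add φ, map_smul' := map_smul φ } 1
    fun b => by rw [one_mul]; exact NonUnitalStarAlgHom.norm_apply_le φ b

@[simp] lemma homL_apply (φ : B →⋆ₙₐ[ℂ] C) (b : B) : homL φ b = φ b := rfl

lemma KAlg.hom_ext_double {φ ψ : KAlg (KAlg B) →⋆ₙₐ[ℂ] C}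
    (h : ∀ i j a b x, φ (munit i j (munit a b x)) = ψ (munit i j (munit a b x))) : φ = ψ := by
  refine KAlg.hom_ext fun i j T => ?_
  have : (homL φ).comp (munitL i j) = (homL ψ).comp (munitL i j) :=
    KAlg.clm_ext fun a b x => h i j a b x
  exact DFunLike.congr_fun this T

variable (B) in
lemma exists_mu : ∃ μ : KAlg (KAlg B) →⋆ₙₐ[ℂ] KAlg B, ∀ i j a b x,
    μ (munit i j (munit a b x)) = munit (Nat.pair i a) (Nat.pair j b) x := by
  obtain ⟨l, hl⟩ := exists_KAlg_hom (B := B) (C := KAlg (KAlg B))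
    (fun p q x => munit p.unpair.1 q.unpair.1 (munit p.unpair.2 q.unpair.2 x))
    (fun p q a b => by rw [munit_add, munit_add])
    (fun p q c b => by rw [munit_smul, munit_smul])
    (fun p q r s a b => by
      rw [munit_mul, munit_mul]
      have : q = r ↔ q.unpair.1 = r.unpair.1 ∧ q.unpair.2 = r.unpair.2 := by
        rw [← Prod.ext_iff]; exact Nat.pairEquiv.symm.injective.eq_iff.symm
      by_cases h1 : q.unpair.1 = r.unpair.1 <;> by_cases h2 : q.unpair.2 = r.unpair.2 <;>
        simp [this, h1, h2, munit_zero])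
    (fun p q b => by rw [munit_star, munit_star])
  have hl' : ∀ i j a b x, l (munit (Nat.pair i a) (Nat.pair j b) x) = munit i j (munit a b x) :=
    fun i j a b x => by simp [hl]
  have hinj : ∀ T, l T = 0 → T = 0 := by
    intro T hT
    refine KAlg.ext fun p q => ?_
    have h : (entryL p.unpair.2 q.unpair.2).comp ((entryL p.unpair.1 q.unpair.1).comp (homL l)) =
        entryL (B := B) p q := KAlg.clm_ext fun i j b => by
      simp only [ContinuousLinearMap.comp_apply, homL_apply, entryL_apply, hl, entry_munit]
      have h1 : p = i ↔ p.unpair.1 = i.unpair.1 ∧ p.unpair.2 = i.unpair.2 := by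
        rw [← Prod.ext_iff]; exact Nat.pairEquiv.symm.injective.eq_iff.symm
      have h2 : q = j ↔ q.unpair.1 = j.unpair.1 ∧ q.unpair.2 = j.unpair.2 := by
        rw [← Prod.ext_iff]; exact Nat.pairEquiv.symm.injective.eq_iff.symm
      by_cases h3 : p.unpair.1 = i.unpair.1 ∧ q.unpair.1 = j.unpair.1
      · rw [if_pos h3, entry_munit]; simp only [h1, h2, h3.1, h3.2, true_and]
      · rw [if_neg h3, CtrlAlg.op_zero, entry_zero, if_neg]
        rintro ⟨rfl, rfl⟩; exact h3 ⟨rfl, rfl⟩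
    have := DFunLike.congr_fun h T
    simp only [ContinuousLinearMap.comp_apply, homL_apply, hT, map_zero] at this
    rw [CtrlAlg.op_zero, entry_zero]
    exact this.symm
  have hsurj : Function.Surjective l := by
    refine surjective_of_dense l fun S ε hε => ?_
    have hcl : ∀ S, S ∈ closure (Set.range l) := by
      have hsub : closure (Set.range l) = (((NonUnitalStarAlgHom.range l).topologicalClosure :
        NonUnitalStarSubalgebra ℂ (KAlg (KAlg B))) : Set (KAlg (KAlg B))) := rfl
      have hm : ∀ i j T, munit i j T ∈ closure (Set.range l) := by
        intro i j T
        have hT : T ∈ closure (Set.range fun p : ℕ × KAlg B => trunc p.1 p.2) :=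
          Metric.mem_closure_iff.2 fun ε hε => by
            obtain ⟨n, hn⟩ := exists_norm_sub_trunc_lt T hε
            exact ⟨_, ⟨(n, T), rfl⟩, by rw [dist_eq_norm]; exact hn n le_rfl⟩
        refine map_mem_closure (munitL i j).continuous hT ?_
        rintro _ ⟨⟨n, T⟩, rfl⟩
        refine ⟨∑ a ∈ Finset.range n, ∑ b ∈ Finset.range n,
          munit (Nat.pair i a) (Nat.pair j b) (entry T.op a b), ?_⟩
        change _ = munitL i j (∑ a ∈ Finset.range n, ∑ b ∈ Finset.range n, munit a b (entry T.op a b))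
        rw [map_sum, map_sum]
        refine Finset.sum_congr rfl fun a _ => ?_
        rw [map_sum, map_sum]
        exact Finset.sum_congr rfl fun b _ => hl' _ _ _ _ _
      intro S
      have hS : S ∈ closure (Set.range fun p : ℕ × KAlg (KAlg B) => trunc p.1 p.2) :=
        Metric.mem_closure_iff.2 fun ε hε => by
          obtain ⟨n, hn⟩ := exists_norm_sub_trunc_lt S hε
          exact ⟨_, ⟨(n, S), rfl⟩, by rw [dist_eq_norm]; exact hn n le_rfl⟩
      refine closure_minimal ?_ isClosed_closure hS
      rintro _ ⟨⟨n, T⟩, rfl⟩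
      rw [hsub]
      exact sum_mem fun i _ => sum_mem fun j _ => hm i j _
    obtain ⟨_, ⟨a, rfl⟩, h⟩ := Metric.mem_closure_iff.1 (hcl S) ε hε
    exact ⟨a, by rwa [dist_eq_norm] at h⟩
  obtain ⟨μ, hμ⟩ := exists_factor l hsurj (NonUnitalStarAlgHom.id ℂ _) hinj
  exact ⟨μ, fun i j a b x => by rw [← hl', hμ]; rfl⟩

variable (B) in
/-- The isomorphism `𝕂 𝕂 B ≅ 𝕂 B` given by a bijection `ℕ × ℕ ≅ ℕ`. -/
def mu : KAlg (KAlg B) →⋆ₙₐ[ℂ] KAlg B := (exists_mu B).choose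

lemma mu_munit (i j a b : ℕ) (x : B) :
    mu B (munit i j (munit a b x)) = munit (Nat.pair i a) (Nat.pair j b) x :=
  (exists_mu B).choose_spec i j a b x

lemma map_mu (φ : B →⋆ₙₐ[ℂ] C) :
    (CtrlAlg.map _ φ).comp (mu B) = (mu C).comp (CtrlAlg.map _ (CtrlAlg.map _ φ)) :=
  KAlg.hom_ext_double fun i j a b x => by simp [mu_munit, map_munit]

lemma pair_zero_injective : Function.Injective fun n => Nat.pair 0 n := fun m n h => by
  simpa [Nat.pair_eq_pair] using h

lemma mu_comp_stab : (mu B).comp (stab (KAlg B)) = pushK B pair_zero_injective :=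
  KAlg.hom_ext fun i j b => by simp [stab_apply, mu_munit, pushK_munit]

/-! ### Interchange of matrices and asymptotic algebras -/

/-- Matrix units over functions. -/
def bcfMunit (i j : ℕ) : (ℝ≥0 →ᵇ B) →L[ℂ] (ℝ≥0 →ᵇ KAlg B) :=
  (munitL i j).compLeftContinuousBounded ℝ≥0

@[simp] lemma bcfMunit_apply (i j : ℕ) (f : ℝ≥0 →ᵇ B) (t : ℝ≥0) :
    bcfMunit i j f t = munit i j (f t) := rfl

lemma bcfMunit_mem (i j : ℕ) (f : ℝ≥0 →ᵇ B) (hf : f ∈ (asymIdeal B).alg) :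
    bcfMunit i j f ∈ (asymIdeal (KAlg B)).alg := by
  have := ((munitL (B := B) i j).continuous.tendsto 0).comp (show Tendsto f atTop (𝓝 0) from hf)
  rw [map_zero] at this
  exact this

/-- Matrix units over the asymptotic algebra. -/
def asymMunit (i j : ℕ) (x : CQuot (asymIdeal B)) : CQuot (asymIdeal (KAlg B)) :=
  CQuot.mk _ (bcfMunit i j (CQuot.mk_surjective x).choose)

lemma asymMunit_mk (i j : ℕ) (f : ℝ≥0 →ᵇ B) :
    asymMunit i j (CQuot.mk _ f) = CQuot.mk _ (bcfMunit i j f) := by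
  have h := (CQuot.mk_surjective (CQuot.mk (asymIdeal B) f)).choose_spec
  rw [asymMunit, CQuot.mk_eq, ← map_sub]
  exact bcfMunit_mem _ _ _ (CQuot.mk_eq.1 h)

variable (B) in
lemma exists_tau : ∃ τ : KAlg (CQuot (asymIdeal B)) →⋆ₙₐ[ℂ] CQuot (asymIdeal (KAlg B)),
    ∀ i j f, τ (munit i j (CQuot.mk _ f)) = CQuot.mk _ (bcfMunit i j f) := by
  obtain ⟨τ, hτ⟩ := exists_KAlg_hom (B := CQuot (asymIdeal B)) (asymMunit (B := B))
    (fun i j a b => by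
      obtain ⟨a, rfl⟩ := CQuot.mk_surjective a
      obtain ⟨b, rfl⟩ := CQuot.mk_surjective b
      rw [← CQuot.mk_add]
      rw [asymMunit_mk, asymMunit_mk, asymMunit_mk, map_add, CQuot.mk_add])
    (fun i j c b => by
      obtain ⟨b, rfl⟩ := CQuot.mk_surjective b
      rw [← CQuot.mk_smul]
      rw [asymMunit_mk, asymMunit_mk, map_smul, CQuot.mk_smul])
    (fun i j k l a b => by
      obtain ⟨a, rfl⟩ := CQuot.mk_surjective a
      obtain ⟨b, rfl⟩ := CQuot.mk_surjective b
      rw [← CQuot.mk_mul]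
      simp only [asymMunit_mk, ← CQuot.mk_mul]
      rw [show bcfMunit i j a * bcfMunit k l b = if j = k then bcfMunit i l (a * b) else 0 from
        BoundedContinuousFunction.ext fun t => by
          rw [BoundedContinuousFunction.mul_apply, bcfMunit_apply, bcfMunit_apply, munit_mul]
          split_ifs <;> rfl]
      split_ifs <;> rfl)
    (fun i j b => by
      obtain ⟨b, rfl⟩ := CQuot.mk_surjective b
      rw [← CQuot.mk_star]
      simp only [asymMunit_mk, ← CQuot.mk_star]
      congr 1
      exact BoundedContinuousFunction.ext fun t => munit_star i j (b t))
  exact ⟨τ, fun i j f => by rw [hτ, asymMunit_mk]⟩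

variable (B) in
/-- The transformation `𝕂 𝔄 → 𝔄 𝕂`. -/
def tau : KAlg (CQuot (asymIdeal B)) →⋆ₙₐ[ℂ] CQuot (asymIdeal (KAlg B)) := (exists_tau B).choose

lemma tau_munit (i j : ℕ) (f : ℝ≥0 →ᵇ B) :
    tau B (munit i j (CQuot.mk _ f)) = CQuot.mk _ (bcfMunit i j f) := (exists_tau B).choose_spec i j f

lemma map_tau (φ : B →⋆ₙₐ[ℂ] C) :
    (asymMap (CtrlAlg.map _ φ)).comp (tau B) = (tau C).comp (CtrlAlg.map _ (asymMap φ)) := by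
  refine KAlg.hom_ext fun i j x => ?_
  obtain ⟨f, rfl⟩ := CQuot.mk_surjective x
  rw [NonUnitalStarAlgHom.comp_apply, NonUnitalStarAlgHom.comp_apply, tau_munit, map_munit,
    asymMap_mk, asymMap_mk, tau_munit]
  congr 1
  exact BoundedContinuousFunction.ext fun t => map_munit φ i j (f t)

lemma tau_comp_stab : (tau B).comp (stab _) = asymMap (stab B) := by
  refine NonUnitalStarAlgHom.ext fun x => ?_
  obtain ⟨f, rfl⟩ := CQuot.mk_surjective x
  exact tau_munit 0 0 f

/-! ### Interchange of matrices and cylinders -/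

variable (B) in
theorem exists_cylK : ∃ r : C(unitInterval, KAlg B) →⋆ₙₐ[ℂ] KAlg C(unitInterval, B),
    ∀ t, (CtrlAlg.map _ (evHom B t)).comp r = evHom (KAlg B) t := by
  obtain ⟨κ, hκ⟩ := exists_KAlg_hom (B := C(unitInterval, B)) (C := C(unitInterval, KAlg B))
    (fun i j f => ⟨fun t => munitL i j (f t), by fun_prop⟩)
    (fun i j a b => by ext1 t; exact munit_add i j (a t) (b t))
    (fun i j c b => by ext1 t; exact munit_smul i j c (b t))
    (fun i j k l a b => by ext1 t; simp [munit_mul]; split_ifs <;> rfl)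
    (fun i j b => by ext1 t; simp [munit_star])
  have hev : ∀ t, (evHom (KAlg B) t).comp κ = CtrlAlg.map _ (evHom B t) := fun t =>
    KAlg.hom_ext fun i j f => by
      rw [NonUnitalStarAlgHom.comp_apply, hκ, map_munit]; rfl
  have hinj : ∀ T, κ T = 0 → T = 0 := by
    intro T hT
    refine KAlg.ext fun i j => ContinuousMap.ext fun t => ?_
    have h := DFunLike.congr_fun (hev t) T
    rw [NonUnitalStarAlgHom.comp_apply, hT, map_zero] at h
    have h2 := congrArg (fun S : KAlg B => entry S.op i j) h
    simp only [CtrlAlg.op_zero, entry_zero, CtrlAlg.op_map, entry_colMap, evHom_apply] at h2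
    rw [CtrlAlg.op_zero, entry_zero]
    exact h2.symm
  have hsurj : Function.Surjective κ := by
    refine surjective_of_dense κ fun g ε hε => ?_
    have hn : ∃ n, ∀ t, ‖g t - trunc n (g t)‖ ≤ ε / 2 := by
      have hc : ∀ t, ∃ n, ∀ᶠ s in 𝓝 t, ∀ m ≥ n, ‖g s - trunc m (g s)‖ ≤ ε / 2 := by
        intro t
        obtain ⟨n, hn⟩ := exists_norm_sub_trunc_lt (g t) (show 0 < ε / 6 by positivity)
        refine ⟨n, ?_⟩
        filter_upwards [Metric.tendsto_nhds.1 (g.continuous.tendsto t) (ε / 6) (by positivity)]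
          with s hs m hm
        rw [dist_eq_norm] at hs
        have h1 := norm_trunc_le m (g s - g t)
        have h2 := hn m hm
        calc ‖g s - trunc m (g s)‖
            = ‖(g s - g t) + (g t - trunc m (g t)) - trunc m (g s - g t)‖ := by
              rw [trunc_sub]; congr 1; abel
          _ ≤ ‖g s - g t‖ + ‖g t - trunc m (g t)‖ + ‖trunc m (g s - g t)‖ :=
              (norm_sub_le _ _).trans (by gcongr; exact norm_add_le _ _)
          _ ≤ ε / 2 := by linarith
      choose n hn using hc
      obtain ⟨s, -, hs⟩ := isCompact_univ.elim_nhds_subcover (fun t => {r | ∀ m ≥ n t, ‖g r - trunc m (g r)‖ ≤ ε / 2})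
        (fun t _ => hn t)
      refine ⟨s.sup n, fun t => ?_⟩
      obtain ⟨r, hr, htr⟩ := Set.mem_iUnion₂.1 (hs (Set.mem_univ t))
      exact htr _ (Finset.le_sup hr)
    obtain ⟨n, hn⟩ := hn
    refine ⟨∑ i ∈ Finset.range n, ∑ j ∈ Finset.range n,
      munit i j ⟨fun t => entryL i j (g t), by fun_prop⟩, ?_⟩
    refine lt_of_le_of_lt ((ContinuousMap.norm_le _ (half_pos hε).le).2 fun t => ?_) (half_lt_self hε)
    refine le_of_eq_of_le (congrArg norm ?_) (hn t)
    rw [ContinuousMap.sub_apply]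
    congr 1
    rw [map_sum, ContinuousMap.sum_apply, trunc]
    refine Finset.sum_congr rfl fun i _ => ?_
    rw [map_sum, ContinuousMap.sum_apply]
    exact Finset.sum_congr rfl fun j _ => by rw [hκ]; rfl
  obtain ⟨r, hr⟩ := exists_factor κ hsurj (NonUnitalStarAlgHom.id ℂ _) hinj
  refine ⟨r, fun t => NonUnitalStarAlgHom.ext fun g => ?_⟩
  obtain ⟨T, rfl⟩ := hsurj g
  rw [NonUnitalStarAlgHom.comp_apply, hr]
  exact (DFunLike.congr_fun (hev t) T).symm

end Swap

/-! ### Bounded continuous functions -/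

section Bounded
open scoped BoundedContinuousFunction
variable {A B C : Type*} [NonUnitalCStarAlgebra A] [NonUnitalCStarAlgebra B] [NonUnitalCStarAlgebra C]
variable {W Z : Type*} [TopologicalSpace W] [TopologicalSpace Z]

/-- Continuous functions lift approximately along surjective `*`-homomorphisms. -/
lemma exists_continuous_lift [NormalSpace Z] [ParacompactSpace Z] (q : A →⋆ₙₐ[ℂ] B)
    (hq : Function.Surjective q) (g : Z → B) (hg : Continuous g) {M : ℝ} (hM : ∀ z, ‖g z‖ ≤ M)
    {ε : ℝ} (hε : 0 < ε) : ∃ f : C(Z, A), ∀ z, ‖g z - q (f z)‖ ≤ ε ∧ ‖f z‖ ≤ M + 1 := by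
  let _ : NormedSpace ℝ A := NormedSpace.restrictScalars ℝ ℂ A
  refine exists_continuous_forall_mem_convex_of_local_const
    (t := fun z => {a : A | ‖g z - q a‖ ≤ ε ∧ ‖a‖ ≤ M + 1}) (fun z => ?_) fun z => ?_
  · rintro a ⟨ha, ha'⟩ b ⟨hb, hb'⟩ s t hs ht hst
    have e1 : ∀ x : A, s • x = (s : ℂ) • x := fun x => rfl
    have e2 : ∀ x : A, t • x = (t : ℂ) • x := fun x => rfl
    constructor
    · have hst' : (s : ℂ) + t = 1 := by exact_mod_cast hst
      rw [e1, e2, map_add, map_smul, map_smul]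
      have : g z - ((s : ℂ) • q a + (t : ℂ) • q b) =
          (s : ℂ) • (g z - q a) + (t : ℂ) • (g z - q b) := by
        have : g z = (s : ℂ) • g z + (t : ℂ) • g z := by rw [← add_smul, hst', one_smul]
        rw [smul_sub, smul_sub]
        nth_rewrite 1 [this]
        abel
      rw [this]
      refine (norm_add_le _ _).trans ?_
      rw [norm_smul, norm_smul, Complex.norm_real, Complex.norm_real, Real.norm_of_nonneg hs,
        Real.norm_of_nonneg ht]
      calc _ ≤ s * ε + t * ε := by gcongr
        _ = ε := by rw [← add_mul, hst, one_mul]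
    · rw [e1, e2]
      refine (norm_add_le _ _).trans ?_
      rw [norm_smul, norm_smul, Complex.norm_real, Complex.norm_real, Real.norm_of_nonneg hs,
        Real.norm_of_nonneg ht]
      calc _ ≤ s * (M + 1) + t * (M + 1) := by gcongr
        _ = M + 1 := by rw [← add_mul, hst, one_mul]
  · obtain ⟨a, ha⟩ := hq (g z)
    obtain ⟨a', ha', hn⟩ := exists_preimage_norm_lt q a one_pos
    refine ⟨a', ?_⟩
    filter_upwards [Metric.tendsto_nhds.1 (hg.tendsto z) ε hε] with y hy
    rw [ha] at ha' hn
    refine ⟨?_, hn.le.trans (by linarith [hM z])⟩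
    rw [ha', ← dist_eq_norm]
    exact hy.le

/-- Postcomposition of bounded continuous functions with a `*`-homomorphism. -/
def bcfPost (Z : Type*) [TopologicalSpace Z] (φ : A →⋆ₙₐ[ℂ] B) : (Z →ᵇ A) →⋆ₙₐ[ℂ] (Z →ᵇ B) where
  toFun f := BoundedContinuousFunction.ofNormedAddCommGroup (fun t => φ (f t))
    ((hom_continuous φ).comp f.continuous) ‖f‖
    fun t => (NonUnitalStarAlgHom.norm_apply_le φ _).trans (f.norm_coe_le_norm t)
  map_smul' c f := BoundedContinuousFunction.ext fun t => map_smul φ c (f t)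
  map_zero' := BoundedContinuousFunction.ext fun t => map_zero φ
  map_add' f g := BoundedContinuousFunction.ext fun t => map_add φ (f t) (g t)
  map_mul' f g := BoundedContinuousFunction.ext fun t => map_mul φ (f t) (g t)
  map_star' f := BoundedContinuousFunction.ext fun t => map_star φ (f t)

@[simp] lemma bcfPost_apply (φ : A →⋆ₙₐ[ℂ] B) (f : Z →ᵇ A) (z : Z) : bcfPost Z φ f z = φ (f z) := rfl

lemma bcfPost_surjective [NormalSpace Z] [ParacompactSpace Z] {q : A →⋆ₙₐ[ℂ] B}
    (hq : Function.Surjective q) : Function.Surjective (bcfPost Z q) := by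
  refine surjective_of_dense _ fun g ε hε => ?_
  obtain ⟨f, hf⟩ := exists_continuous_lift q hq g g.continuous g.norm_coe_le_norm (half_pos hε)
  refine ⟨BoundedContinuousFunction.ofNormedAddCommGroup f f.continuous _ fun z => (hf z).2, ?_⟩
  refine lt_of_le_of_lt ((BoundedContinuousFunction.norm_le (half_pos hε).le).2 fun z => ?_)
    (half_lt_self hε)
  exact (hf z).1

/-- Precomposition of bounded continuous functions. -/
def bcfPre (B : Type*) [NonUnitalCStarAlgebra B] (θ : C(Z, W)) : (W →ᵇ B) →⋆ₙₐ[ℂ] (Z →ᵇ B) where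
  toFun f := f.compContinuous θ
  map_smul' c f := rfl
  map_zero' := rfl
  map_add' f g := rfl
  map_mul' f g := rfl
  map_star' f := rfl

@[simp] lemma bcfPre_apply (θ : C(Z, W)) (f : W →ᵇ B) (z : Z) : bcfPre B θ f z = f (θ z) := rfl

variable (W Z B) in
/-- Functions with values in functions as functions of two variables. -/
def bcfUncurry : (W →ᵇ (Z →ᵇ B)) →⋆ₙₐ[ℂ] (W × Z →ᵇ B) where
  toFun f := BoundedContinuousFunction.ofNormedAddCommGroup (fun p => f p.1 p.2)
    (continuous_eval.comp (f.continuous.prodMap continuous_id)) ‖f‖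
    fun p => ((f p.1).norm_coe_le_norm _).trans (f.norm_coe_le_norm _)
  map_smul' c f := rfl
  map_zero' := rfl
  map_add' f g := rfl
  map_mul' f g := rfl
  map_star' f := rfl

@[simp] lemma bcfUncurry_apply (f : W →ᵇ (Z →ᵇ B)) (p : W × Z) : bcfUncurry B W Z f p = f p.1 p.2 := rfl

variable (Z B) in
/-- Functions on `Z × [0,1]` as functions with values in `I B`. -/
def bcfCurry : (Z × unitInterval →ᵇ B) →⋆ₙₐ[ℂ] (Z →ᵇ C(unitInterval, B)) where
  toFun f := BoundedContinuousFunction.ofNormedAddCommGroup f.toContinuousMap.curry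
    f.toContinuousMap.curry.continuous ‖f‖
    fun z => (ContinuousMap.norm_le _ (norm_nonneg f)).2 fun s => f.norm_coe_le_norm (z, s)
  map_smul' c f := rfl
  map_zero' := rfl
  map_add' f g := rfl
  map_mul' f g := rfl
  map_star' f := rfl

@[simp] lemma bcfCurry_apply (f : Z × unitInterval →ᵇ B) (z : Z) (s : unitInterval) :
    bcfCurry B Z f z s = f (z, s) := rfl

variable (Z B) in
/-- Continuous functions on a compact space are bounded. -/
def bcfOfCompact [CompactSpace Z] : C(Z, B) →⋆ₙₐ[ℂ] (Z →ᵇ B) where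
  toFun f := BoundedContinuousFunction.mkOfCompact f
  map_smul' c f := rfl
  map_zero' := rfl
  map_add' f g := rfl
  map_mul' f g := rfl
  map_star' f := rfl

@[simp] lemma bcfOfCompact_apply [CompactSpace Z] (f : C(Z, B)) (z : Z) : bcfOfCompact B Z f z = f z := rfl

lemma mem_asymIdeal {f : ℝ≥0 →ᵇ B} : f ∈ (asymIdeal B).alg ↔ ∀ ε > 0, ∃ t₀, ∀ t ≥ t₀, ‖f t‖ ≤ ε := by
  change Tendsto f atTop (𝓝 0) ↔ _
  rw [Metric.tendsto_atTop]
  simp only [dist_zero_right]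
  exact ⟨fun h ε hε => (h ε hε).imp fun t₀ h t ht => (h t ht).le, fun h ε hε =>
    (h (ε / 2) (half_pos hε)).imp fun t₀ h t ht => (h t ht).trans_lt (half_lt_self hε)⟩

variable (B) in
theorem exists_cylAsym :
    ∃ r : C(unitInterval, CQuot (asymIdeal B)) →⋆ₙₐ[ℂ] CQuot (asymIdeal C(unitInterval, B)),
      ∀ t, (asymMap (evHom B t)).comp r = evHom (CQuot (asymIdeal B)) t := by
  let q := contMap unitInterval (CQuot.proj (asymIdeal B))
  have hq : Function.Surjective q := by
    intro g
    obtain ⟨f, hf⟩ := bcfPost_surjective (Z := unitInterval) (q := CQuot.proj (asymIdeal B))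
      CQuot.mk_surjective (BoundedContinuousFunction.mkOfCompact g)
    exact ⟨f.toContinuousMap, ContinuousMap.ext fun t => DFunLike.congr_fun hf t⟩
  let p : C(unitInterval, ℝ≥0 →ᵇ B) →⋆ₙₐ[ℂ] CQuot (asymIdeal C(unitInterval, B)) :=
    (CQuot.proj _).comp ((bcfCurry B ℝ≥0).comp ((bcfPre B ⟨Prod.swap, continuous_swap⟩).comp
      ((bcfUncurry B unitInterval ℝ≥0).comp (bcfOfCompact _ unitInterval))))
  have hker : ∀ f, q f = 0 → p f = 0 := by
    intro f hf
    refine CQuot.mk_eq_zero.2 (mem_asymIdeal.2 fun ε hε => ?_)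
    have h1 : ∀ s, ∃ t₀ : ℝ≥0, ∀ᶠ s' in 𝓝 s, ∀ t ≥ t₀, ‖f s' t‖ ≤ ε := by
      intro s
      have h2 : f s ∈ (asymIdeal B).alg := CQuot.mk_eq_zero.1 (DFunLike.congr_fun hf s)
      obtain ⟨t₀, ht₀⟩ := mem_asymIdeal.1 h2 (ε / 2) (half_pos hε)
      refine ⟨t₀, ?_⟩
      filter_upwards [Metric.tendsto_nhds.1 (f.continuous.tendsto s) (ε / 2) (half_pos hε)] with s' hs' t ht
      have h3 := (BoundedContinuousFunction.dist_coe_le_dist t).trans hs'.le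
      rw [dist_eq_norm] at h3
      calc ‖f s' t‖ = ‖(f s' t - f s t) + f s t‖ := by rw [sub_add_cancel]
        _ ≤ _ := norm_add_le _ _
        _ ≤ ε := by linarith [ht₀ t ht]
    choose t₀ ht₀ using h1
    obtain ⟨F, -, hF⟩ := isCompact_univ.elim_nhds_subcover
      (fun s => {s' | ∀ t ≥ t₀ s, ‖f s' t‖ ≤ ε}) fun s _ => ht₀ s
    refine ⟨F.sup t₀, fun t ht => (ContinuousMap.norm_le _ hε.le).2 fun s => ?_⟩
    obtain ⟨r, hr, hsr⟩ := Set.mem_iUnion₂.1 (hF (Set.mem_univ s))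
    exact hsr t ((Finset.le_sup hr).trans ht)
  obtain ⟨r, hr⟩ := exists_factor q hq p hker
  refine ⟨r, fun t => NonUnitalStarAlgHom.ext fun g => ?_⟩
  obtain ⟨f, rfl⟩ := hq g
  rw [NonUnitalStarAlgHom.comp_apply, hr]
  rfl

variable (B) in
/-- The homotopy `g ↦ (t ↦ (s ↦ g(st)))`. -/
def scaleHom : (ℝ≥0 →ᵇ B) →⋆ₙₐ[ℂ] CQuot (asymIdeal C(unitInterval, B)) :=
  (CQuot.proj _).comp ((bcfCurry B ℝ≥0).comp
    (bcfPre B ⟨fun p : ℝ≥0 × unitInterval => unitInterval.toNNReal p.2 * p.1, by fun_prop⟩))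

lemma asymMap_ev_scaleHom_one :
    (asymMap (evHom B 1)).comp (scaleHom B) = CQuot.proj (asymIdeal B) :=
  NonUnitalStarAlgHom.ext fun g => congrArg (CQuot.mk _) (BoundedContinuousFunction.ext fun t => by
    change g (unitInterval.toNNReal 1 * t) = g t
    rw [unitInterval.toNNReal_one, one_mul])

lemma asymMap_ev_scaleHom_zero (g : ℝ≥0 →ᵇ B) :
    asymMap (evHom B 0) (scaleHom B g) = asymConst B (g 0) :=
  congrArg (CQuot.mk _) (BoundedContinuousFunction.ext fun t => by
    change g (unitInterval.toNNReal 0 * t) = g 0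
    rw [unitInterval.toNNReal_zero, zero_mul])

end Bounded

/-! ### Interchange of cylinders with other functors -/

section HasSwap

/-- The functor `G` has maps `I G D → G I D` compatible with the evaluations. -/
def HasSwap (G : CStarAlg.{u} ⥤ CStarAlg.{u}) : Prop :=
  ∀ D, ∃ r : cyl.obj (G.obj D) ⟶ G.obj (cyl.obj D),
    ∀ t, r ≫ G.map ((ev t).app D) = (ev t).app (G.obj D)

lemma HasSwap.comp {G H : CStarAlg.{u} ⥤ CStarAlg.{u}} (hG : HasSwap G) (hH : HasSwap H) :
    HasSwap (G ⋙ H) := fun D => by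
  obtain ⟨r, hr⟩ := hG D
  obtain ⟨s, hs⟩ := hH (G.obj D)
  refine ⟨s ≫ H.map r, fun t => ?_⟩
  rw [Category.assoc, Functor.comp_map, ← H.map_comp, hr, hs]
  rfl

lemma hasSwap_compact : HasSwap compact.{u} := fun D => exists_cylK D

lemma hasSwap_asym : HasSwap asym.{u} := fun D => exists_cylAsym D

lemma hasSwap_asymPow (k : ℕ) : HasSwap (asymPow.{u} k) := by
  induction k with
  | zero => exact hasSwap_asym
  | succ k ih => exact ih.comp hasSwap_asym

/-- A homotopy parametrized by the values of `G` yields a homotopy. -/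
lemma GenMor.mk_eq_of_cyl {A B : CStarAlg.{u}} {G : CStarAlg.{u} ⥤ CStarAlg.{u}} (hG : HasSwap G)
    (H : CStarAlg.{u} ⥤ CStarAlg.{u}) (χ : A ⟶ H.obj (cyl.obj (G.obj B))) :
    GenMor.mk (B := B) (G ⋙ H) (χ ≫ H.map ((ev 0).app (G.obj B))) =
      GenMor.mk (B := B) (G ⋙ H) (χ ≫ H.map ((ev 1).app (G.obj B))) := by
  obtain ⟨r, hr⟩ := hG B
  refine Quot.sound ⟨χ ≫ H.map r, ?_, ?_⟩ <;>
  · rw [Category.assoc, Functor.comp_map, ← H.map_comp, hr]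

end HasSwap

/-! ### Interchange of matrices and powers of the asymptotic algebra -/

section TauPow

/-- The transformations `𝕂 𝔄^{k+1} → 𝔄^{k+1} 𝕂`. -/
def tauPow : ∀ (k : ℕ) (D : CStarAlg.{u}), compact.obj ((asymPow k).obj D) ⟶ (asymPow k).obj (compact.obj D)
  | 0, D => ofHom (A := compact.obj (asym.obj D)) (B := asym.obj (compact.obj D)) (tau D)
  | k + 1, D => ofHom (A := compact.obj (asym.obj ((asymPow k).obj D)))
      (B := asym.obj (compact.obj ((asymPow k).obj D))) (tau ((asymPow k).obj D)) ≫ asym.map (tauPow k D)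

lemma tauPow_naturality (k : ℕ) {D D' : CStarAlg.{u}} (f : D ⟶ D') :
    compact.map ((asymPow k).map f) ≫ tauPow k D' = tauPow k D ≫ (asymPow k).map (compact.map f) := by
  induction k with
  | zero => exact (map_tau (toHom f)).symm
  | succ k ih =>
    have h := (map_tau (toHom ((asymPow k).map f))).symm
    change compact.map (asym.map ((asymPow k).map f)) ≫ (ofHom (A := compact.obj (asym.obj ((asymPow k).obj D')))
      (B := asym.obj (compact.obj ((asymPow k).obj D'))) (tau ((asymPow k).obj D'))) ≫ asym.map (tauPow k D') =
      (ofHom (A := compact.obj (asym.obj ((asymPow k).obj D)))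
      (B := asym.obj (compact.obj ((asymPow k).obj D))) (tau ((asymPow k).obj D)) ≫ asym.map (tauPow k D)) ≫
      asym.map ((asymPow k).map (compact.map f))
    rw [Category.assoc, ← asym.map_comp, ← ih, asym.map_comp, ← Category.assoc, ← Category.assoc]
    exact congrArg (· ≫ asym.map (tauPow k D')) h

/-- The inclusion into `𝕂 D` as the upper left corner, as a morphism. -/
def stabMor (D : CStarAlg.{u}) : D ⟶ compact.obj D := ofHom (A := D) (B := compact.obj D) (stab D)

/-- The multiplication of `𝕂`, as a morphism. -/
def muMor (D : CStarAlg.{u}) : compact.obj (compact.obj D) ⟶ compact.obj D :=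
  ofHom (A := compact.obj (compact.obj D)) (B := compact.obj D) (mu D)

lemma stabMor_naturality {D D' : CStarAlg.{u}} (f : D ⟶ D') :
    f ≫ stabMor D' = stabMor D ≫ compact.map f :=
  hom_ext' fun a => (map_stab (toHom f) a).symm

lemma muMor_naturality {D D' : CStarAlg.{u}} (f : D ⟶ D') :
    compact.map (compact.map f) ≫ muMor D' = muMor D ≫ compact.map f := (map_mu (toHom f)).symm

lemma stabMor_tauPow (k : ℕ) (D : CStarAlg.{u}) :
    stabMor ((asymPow k).obj D) ≫ tauPow k D = (asymPow k).map (stabMor D) := by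
  induction k with
  | zero => exact tau_comp_stab (B := D)
  | succ k ih =>
    have h := tau_comp_stab (B := (asymPow k).obj D)
    change stabMor (asym.obj ((asymPow k).obj D)) ≫ (ofHom (A := compact.obj (asym.obj ((asymPow k).obj D)))
      (B := asym.obj (compact.obj ((asymPow k).obj D))) (tau ((asymPow k).obj D))) ≫ asym.map (tauPow k D) =
      asym.map ((asymPow k).map (stabMor D))
    rw [← ih, asym.map_comp, ← Category.assoc]
    exact congrArg (· ≫ asym.map (tauPow k D)) h

lemma stabMor_muMor (D : CStarAlg.{u}) :
    stabMor (compact.obj D) ≫ muMor D = (conjK pair_zero_injective).app D := mu_comp_stab (B := D)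

/-- The transformation `𝕂 𝔄^{k+1} 𝕂 → 𝔄^{k+1} 𝕂`. -/
def absorb (k : ℕ) (D : CStarAlg.{u}) :
    compact.obj ((asymPow k).obj (compact.obj D)) ⟶ (asymPow k).obj (compact.obj D) :=
  tauPow k (compact.obj D) ≫ (asymPow k).map (muMor D)

lemma absorb_naturality (k : ℕ) {D D' : CStarAlg.{u}} (f : D ⟶ D') :
    compact.map ((asymPow k).map (compact.map f)) ≫ absorb k D' =
      absorb k D ≫ (asymPow k).map (compact.map f) := by
  rw [absorb, absorb, ← Category.assoc, tauPow_naturality, Category.assoc, Category.assoc,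
    ← (asymPow k).map_comp, ← (asymPow k).map_comp, muMor_naturality]

lemma stabMor_absorb (k : ℕ) (D : CStarAlg.{u}) :
    stabMor ((asymPow k).obj (compact.obj D)) ≫ absorb k D =
      (asymPow k).map ((conjK pair_zero_injective).app D) := by
  rw [absorb, ← Category.assoc, stabMor_tauPow, ← (asymPow k).map_comp, stabMor_muMor]

end TauPow

/-! ### Two-parameter asymptotic algebras -/

section Slow
open scoped BoundedContinuousFunction
variable {B C : Type*} [NonUnitalCStarAlgebra B] [NonUnitalCStarAlgebra C]

lemma norm_mk_asym_le {f : ℝ≥0 →ᵇ B} {ε : ℝ} (hε : 0 ≤ ε) (h : ∀ᶠ t in atTop, ‖f t‖ ≤ ε) :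
    ‖CQuot.mk (asymIdeal B) f‖ ≤ ε := by
  obtain ⟨t₀, ht₀⟩ := eventually_atTop.1 h
  let u : ℝ≥0 → ℝ := fun t => min 1 (max 0 ((t₀ : ℝ) + 1 - t))
  have hu0 : ∀ t, 0 ≤ u t := fun t => le_min zero_le_one (le_max_left _ _)
  have hu1 : ∀ t, u t ≤ 1 := fun t => min_le_left _ _
  have hn : ∀ t, ‖((1 - u t : ℝ) : ℂ)‖ ≤ 1 := fun t => by
    rw [Complex.norm_real, Real.norm_of_nonneg (by linarith [hu1 t])]; linarith [hu0 t]
  let g : ℝ≥0 →ᵇ B := BoundedContinuousFunction.ofNormedAddCommGroup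
    (fun t => ((1 - u t : ℝ) : ℂ) • f t) (by fun_prop) ‖f‖ (fun t => by
      rw [norm_smul]
      exact (mul_le_of_le_one_left (norm_nonneg _) (hn t)).trans (f.norm_coe_le_norm t))
  have hg : CQuot.mk (asymIdeal B) f = CQuot.mk _ g := by
    rw [CQuot.mk_eq]
    refine mem_asymIdeal.2 fun η hη => ⟨t₀ + 1, fun t ht => ?_⟩
    have h1 : u t = 0 := by
      have : (t₀ : ℝ) + 1 ≤ t := by exact_mod_cast ht
      simp only [u]
      rw [max_eq_left (by linarith), min_eq_right zero_le_one]
    have : (f - g) t = 0 := by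
      change f t - ((1 - u t : ℝ) : ℂ) • f t = 0
      simp [h1]
    rw [this, norm_zero]
    exact hη.le
  rw [hg]
  refine (CQuot.norm_mk_le _).trans ((BoundedContinuousFunction.norm_le hε).2 fun t => ?_)
  change ‖((1 - u t : ℝ) : ℂ) • f t‖ ≤ ε
  by_cases ht : t₀ ≤ t
  · rw [norm_smul]
    exact (mul_le_of_le_one_left (norm_nonneg _) (hn t)).trans (ht₀ t ht)
  · have : u t = 1 := by
      have : (t : ℝ) < t₀ := by exact_mod_cast not_le.1 ht
      simp only [u]
      rw [max_eq_right (by linarith), min_eq_left (by linarith)]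
    simpa [this] using hε

lemma eventually_norm_lt_of_norm_mk {f : ℝ≥0 →ᵇ B} {ε : ℝ} (h : ‖CQuot.mk (asymIdeal B) f‖ < ε) :
    ∀ᶠ t in atTop, ‖f t‖ < ε := by
  obtain ⟨g, hg, hn⟩ := CQuot.exists_norm_lt (CQuot.mk (asymIdeal B) f)
    (show 0 < (ε - ‖CQuot.mk (asymIdeal B) f‖) / 2 by linarith)
  have h1 : Tendsto (f - g) atTop (𝓝 0) := CQuot.mk_eq.1 hg.symm
  filter_upwards [Metric.tendsto_nhds.1 h1 ((ε - ‖CQuot.mk (asymIdeal B) f‖) / 2) (by linarith)] with t ht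
  rw [dist_zero_right] at ht
  calc ‖f t‖ = ‖(f - g) t + g t‖ := by simp
    _ ≤ ‖(f - g) t‖ + ‖g t‖ := norm_add_le _ _
    _ < ε := by linarith [g.norm_coe_le_norm t]

variable (B) in
/-- The ideal of the bounded continuous functions that converge to `0` along a filter. -/
def zeroIdeal {Z : Type*} [TopologicalSpace Z] (l : Filter Z) : ClosedIdeal (Z →ᵇ B) where
  alg :=
    { carrier := {f | Tendsto f l (𝓝 0)}
      zero_mem' := tendsto_const_nhds
      add_mem' := fun {f g} hf hg => by
        have h := Tendsto.add hf hg
        rwa [add_zero] at h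
      mul_mem' := fun {f g} hf hg => by
        have h := Tendsto.mul hf hg
        rwa [mul_zero] at h
      smul_mem' := fun c f hf => by
        have h := Tendsto.const_smul hf c
        rwa [smul_zero] at h
      star_mem' := fun {f} hf => by
        have h := Tendsto.star hf
        rwa [star_zero] at h }
  mul_mem_left a j hj := by
    change Tendsto _ _ _ at hj
    change Tendsto _ _ _
    rw [tendsto_zero_iff_norm_tendsto_zero] at hj ⊢
    have h2 := hj.const_mul ‖a‖
    rw [mul_zero] at h2
    refine squeeze_zero (fun _ => norm_nonneg _) (fun t => ?_) h2
    exact (norm_mul_le _ _).trans (by gcongr; exact a.norm_coe_le_norm t)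
  mul_mem_right a j hj := by
    change Tendsto _ _ _ at hj
    change Tendsto _ _ _
    rw [tendsto_zero_iff_norm_tendsto_zero] at hj ⊢
    have h2 := hj.mul_const ‖a‖
    rw [zero_mul] at h2
    refine squeeze_zero (fun _ => norm_nonneg _) (fun t => ?_) h2
    exact (norm_mul_le _ _).trans (by gcongr; exact a.norm_coe_le_norm t)
  isClosed := by
    refine isClosed_of_closure_subset fun f hf => ?_
    change Tendsto f l (𝓝 0)
    rw [Metric.tendsto_nhds]
    intro ε hε
    obtain ⟨g, hg, hfg⟩ := Metric.mem_closure_iff.1 hf (ε / 2) (half_pos hε)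
    filter_upwards [Metric.tendsto_nhds.1 (show Tendsto g l (𝓝 0) from hg) (ε / 2) (half_pos hε)]
      with t ht
    have := BoundedContinuousFunction.dist_coe_le_dist (f := f) (g := g) t
    linarith [dist_triangle (f t) (g t) 0]

/-- Continuous functions `[0,∞) → [0,∞)` that tend to infinity. -/
structure Slow where
  fn : C(ℝ≥0, ℝ≥0)
  tendsto : Tendsto fn atTop atTop

/-- The filter on the pairs `(m, t)` with `m ≤ ρ(t)` and both parameters large. -/
def Slow.filter (ρ : Slow) : Filter (ℝ≥0 × ℝ≥0) := (atTop ×ˢ atTop) ⊓ 𝓟 {p | p.1 ≤ ρ.fn p.2}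

lemma Slow.eventually_filter {ρ : Slow} {P : ℝ≥0 × ℝ≥0 → Prop} : (∀ᶠ p in ρ.filter, P p) ↔
    ∃ m₀ t₀, ∀ t ≥ t₀, ∀ m ≥ m₀, m ≤ ρ.fn t → P (m, t) := by
  rw [Slow.filter, eventually_inf_principal, prod_atTop_atTop_eq, eventually_atTop]
  constructor
  · rintro ⟨⟨m₀, t₀⟩, h⟩
    exact ⟨m₀, t₀, fun t ht m hm hmt => h (m, t) ⟨hm, ht⟩ hmt⟩
  · rintro ⟨m₀, t₀, h⟩
    exact ⟨(m₀, t₀), fun p hp hpt => h p.2 hp.2 p.1 hp.1 hpt⟩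

variable (B) in
/-- The bounded continuous functions of two variables `m` and `t`, norm continuous in `m`. -/
abbrev BiFun : Type _ := ℝ≥0 →ᵇ (ℝ≥0 →ᵇ B)

variable (B) in
/-- The functions of two variables that converge to zero along `ρ.filter`. -/
def slowIdeal (ρ : Slow) : ClosedIdeal (BiFun B) :=
  kerIdeal ((CQuot.proj (zeroIdeal B ρ.filter)).comp (bcfUncurry B ℝ≥0 ℝ≥0))

lemma mem_slowIdeal {ρ : Slow} {f : BiFun B} :
    f ∈ (slowIdeal B ρ).alg ↔ ∀ ε > 0, ∃ m₀ t₀, ∀ t ≥ t₀, ∀ m ≥ m₀, m ≤ ρ.fn t → ‖f m t‖ ≤ ε := by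
  have h1 : f ∈ (slowIdeal B ρ).alg ↔ Tendsto (bcfUncurry B ℝ≥0 ℝ≥0 f) ρ.filter (𝓝 0) :=
    CQuot.mk_eq_zero (J := zeroIdeal B ρ.filter)
  rw [h1, Metric.tendsto_nhds]
  simp only [dist_zero_right, Slow.eventually_filter]
  refine ⟨fun h ε hε => ?_, fun h ε hε => ?_⟩
  · obtain ⟨m, t, hmt⟩ := h ε hε
    exact ⟨m, t, fun t' ht m' hm h => (hmt t' ht m' hm h).le⟩
  · obtain ⟨m, t, hmt⟩ := h (ε / 2) (half_pos hε)
    exact ⟨m, t, fun t' ht m' hm h => (hmt t' ht m' hm h).trans_lt (half_lt_self hε)⟩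

variable (B) in
/-- The projection onto `𝔄 𝔄 B`. -/
def biProj : BiFun B →⋆ₙₐ[ℂ] CQuot (asymIdeal (CQuot (asymIdeal B))) :=
  (CQuot.proj _).comp (bcfPost ℝ≥0 (CQuot.proj (asymIdeal B)))

lemma biProj_surjective : Function.Surjective (biProj B) := fun x => by
  obtain ⟨g, rfl⟩ := CQuot.mk_surjective x
  obtain ⟨f, rfl⟩ := bcfPost_surjective (Z := ℝ≥0) (q := CQuot.proj (asymIdeal B)) CQuot.mk_surjective g
  exact ⟨f, rfl⟩

lemma biProj_eq_zero {f : BiFun B} (h : ∀ ε > 0, ∃ m₀, ∀ m ≥ m₀, ∀ᶠ t in atTop, ‖f m t‖ ≤ ε) :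
    biProj B f = 0 :=
  CQuot.mk_eq_zero.2 (mem_asymIdeal.2 fun ε hε => by
    obtain ⟨m₀, hm⟩ := h ε hε
    exact ⟨m₀, fun m hmm => norm_mk_asym_le hε.le (hm m hmm)⟩)

lemma biProj_of_mem {ρ : Slow} {f : BiFun B} (hf : f ∈ (slowIdeal B ρ).alg) : biProj B f = 0 := by
  refine biProj_eq_zero fun ε hε => ?_
  obtain ⟨m₀, t₀, h⟩ := mem_slowIdeal.1 hf ε hε
  refine ⟨m₀, fun m hm => ?_⟩
  filter_upwards [eventually_ge_atTop t₀, ρ.tendsto.eventually_ge_atTop m] with t ht hmt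
  exact h t ht m hm hmt

/-- The bound for functions in the kernel of `biProj` is uniform on compact sets. -/
lemma exists_forall_of_biProj {f : BiFun B} (hf : biProj B f = 0) {ε : ℝ} (hε : 0 < ε) :
    ∃ m₀, ∀ M, ∃ t₀, ∀ t ≥ t₀, ∀ m ≥ m₀, m ≤ M → ‖f m t‖ ≤ ε := by
  obtain ⟨m₀, hm₀⟩ := mem_asymIdeal.1 (CQuot.mk_eq_zero.1 hf) (ε / 3) (by positivity)
  refine ⟨m₀, fun M => ?_⟩
  have h1 : ∀ m ∈ Set.Icc m₀ M, ∃ t₀ : ℝ≥0, ∀ᶠ m' in 𝓝 m, ∀ t ≥ t₀, ‖f m' t‖ ≤ ε := by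
    intro m hm
    have h2 : ‖CQuot.mk (asymIdeal B) (f m)‖ < ε / 2 := (hm₀ m hm.1).trans_lt (by linarith)
    obtain ⟨t₀, ht₀⟩ := eventually_atTop.1 (eventually_norm_lt_of_norm_mk h2)
    refine ⟨t₀, ?_⟩
    filter_upwards [Metric.tendsto_nhds.1 (f.continuous.tendsto m) (ε / 2) (half_pos hε)] with m' hm' t ht
    have h3 := (BoundedContinuousFunction.dist_coe_le_dist t).trans hm'.le
    rw [dist_eq_norm] at h3
    calc ‖f m' t‖ = ‖(f m' t - f m t) + f m t‖ := by rw [sub_add_cancel]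
      _ ≤ _ := norm_add_le _ _
      _ ≤ ε := by linarith [ht₀ t ht]
  choose! t₀ ht₀ using h1
  obtain ⟨F, -, hF⟩ := isCompact_Icc.elim_nhds_subcover
    (fun s => {s' | ∀ t ≥ t₀ s, ‖f s' t‖ ≤ ε}) ht₀
  refine ⟨F.sup t₀, fun t ht m hm hM => ?_⟩
  obtain ⟨r, hr, hsr⟩ := Set.mem_iUnion₂.1 (hF ⟨hm, hM⟩)
  exact hsr t ((Finset.le_sup hr).trans ht)

/-- For each sequence of times there is a function tending to infinity that only exceeds `n` after
the `n`-th time. -/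
lemma exists_slow (T : ℕ → ℝ≥0) : ∃ ρ : Slow, ∀ (n : ℕ) (t : ℝ≥0), (n : ℝ≥0) < ρ.fn t → T n ≤ t := by
  let g : ℕ → ℝ≥0 → ℝ := fun n t => n + max 0 ((t : ℝ) - T n)
  have hg0 : ∀ n t, 0 ≤ g n t := fun n t => add_nonneg n.cast_nonneg (le_max_left _ _)
  have hbdd : ∀ t, BddBelow (Set.range fun n => g n t) := fun t => ⟨0, by rintro _ ⟨n, rfl⟩; exact hg0 n t⟩
  let r : ℝ≥0 → ℝ := fun t => ⨅ n, g n t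
  have hr0 : ∀ t, 0 ≤ r t := fun t => le_ciInf fun n => hg0 n t
  have hlip : ∀ s t, r s ≤ r t + |(s : ℝ) - t| := by
    intro s t
    rw [← sub_le_iff_le_add]
    refine le_ciInf fun n => ?_
    rw [sub_le_iff_le_add]
    refine (ciInf_le (hbdd s) n).trans ?_
    simp only [g]
    have : max 0 ((s : ℝ) - T n) ≤ max 0 ((t : ℝ) - T n) + |(s : ℝ) - t| := by
      refine max_le (by positivity) ?_
      linarith [le_max_right 0 ((t : ℝ) - T n), le_abs_self ((s : ℝ) - t)]
    linarith
  have hcont : Continuous r := by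
    refine LipschitzWith.continuous (K := 1) (LipschitzWith.of_dist_le_mul fun s t => ?_)
    rw [NNReal.coe_one, one_mul, Real.dist_eq, NNReal.dist_eq, abs_sub_le_iff]
    constructor
    · linarith [hlip s t]
    · linarith [hlip t s, abs_sub_comm (s : ℝ) t]
  refine ⟨⟨⟨fun t => ⟨r t, hr0 t⟩, hcont.subtype_mk _⟩, ?_⟩, fun n t h => ?_⟩
  · refine tendsto_atTop.2 fun M => ?_
    obtain ⟨N, hN⟩ := exists_nat_ge M
    refine eventually_atTop.2 ⟨(Finset.range N).sup T + N, fun t ht => ?_⟩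
    refine (show M ≤ (N : ℝ≥0) from hN).trans ?_
    refine (show (N : ℝ) ≤ r t from le_ciInf fun n => ?_)
    by_cases hn : N ≤ n
    · have h1 : (N : ℝ) ≤ n := by exact_mod_cast hn
      exact h1.trans (le_add_of_nonneg_right (le_max_left _ _))
    · have h1 : T n ≤ (Finset.range N).sup T := Finset.le_sup (by simpa using hn)
      have h2 : T n + N ≤ t := (add_le_add_left h1 _).trans ht
      have h3 : (T n : ℝ) + N ≤ t := by exact_mod_cast h2
      simp only [g]
      linarith [le_max_right 0 ((t : ℝ) - T n), (n.cast_nonneg : (0 : ℝ) ≤ n)]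
  · by_contra hlt
    have h1 : (t : ℝ) < T n := by exact_mod_cast not_le.1 hlt
    have h2 : (n : ℝ) < r t := by exact_mod_cast h
    have h3 : r t ≤ g n t := ciInf_le (hbdd t) n
    simp only [g] at h3
    rw [max_eq_left (by linarith)] at h3
    linarith

/-- Countably many functions in the kernel of `biProj` are contained in a common `slowIdeal`. -/
theorem exists_slow_of_countable (J : Set (BiFun B)) (hJ : J.Countable) (h : ∀ f ∈ J, biProj B f = 0)
    (ρ₀ : Slow) : ∃ ρ : Slow, (∀ t, ρ.fn t ≤ ρ₀.fn t) ∧ ∀ f ∈ J, f ∈ (slowIdeal B ρ).alg := by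
  obtain ⟨F, hF⟩ : ∃ F : ℕ → BiFun B, J ⊆ Set.range F ∧ ∀ n, biProj B (F n) = 0 := by
    rcases J.eq_empty_or_nonempty with rfl | hne
    · exact ⟨fun _ => 0, by simp, fun n => map_zero _⟩
    · obtain ⟨F, rfl⟩ := hJ.exists_eq_range hne
      exact ⟨F, le_rfl, fun n => h _ ⟨n, rfl⟩⟩
  have h1 : ∀ i n : ℕ, ∃ m₀, ∀ M, ∃ t₀, ∀ t ≥ t₀, ∀ m ≥ m₀, m ≤ M → ‖F i m t‖ ≤ 1 / ((n : ℝ) + 1) :=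
    fun i n => exists_forall_of_biProj (hF.2 i) (by positivity)
  choose m₀ hm₀ using h1
  choose t₀ ht₀ using hm₀
  obtain ⟨ρ, hρ⟩ := exists_slow fun N => (Finset.range (N + 1) ×ˢ Finset.range (N + 1)).sup
    fun p => t₀ p.1 p.2 (N + 1)
  refine ⟨⟨ρ.fn ⊓ ρ₀.fn, tendsto_atTop.2 fun M => ?_⟩, fun t => inf_le_right, fun f hf => ?_⟩
  · filter_upwards [ρ.tendsto.eventually_ge_atTop M, ρ₀.tendsto.eventually_ge_atTop M] with t h1 h2
    exact le_inf h1 h2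
  · obtain ⟨i, rfl⟩ := hF.1 hf
    refine mem_slowIdeal.2 fun ε hε => ?_
    obtain ⟨n, hn⟩ := exists_nat_one_div_lt hε
    obtain ⟨t₁, ht₁⟩ := eventually_atTop.1 (ρ.tendsto.eventually_gt_atTop ((max i n : ℕ) : ℝ≥0))
    refine ⟨m₀ i n, t₁, fun t ht m hm hmt => ?_⟩
    have hmt' : m ≤ ρ.fn t := hmt.trans inf_le_left
    have hpos : 0 < ⌈ρ.fn t⌉₊ := Nat.ceil_pos.2 (pos_of_gt (ht₁ t ht))
    obtain ⟨N, hN⟩ := Nat.exists_eq_succ_of_ne_zero hpos.ne'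
    have hN1 : (N : ℝ≥0) < ρ.fn t := Nat.lt_ceil.1 (by omega)
    have hN2 : ρ.fn t ≤ (N : ℝ≥0) + 1 := by
      have := Nat.le_ceil (ρ.fn t)
      rw [hN] at this
      exact_mod_cast this
    have hN3 : max i n ≤ N := by
      have : max i n < ⌈ρ.fn t⌉₊ := Nat.lt_ceil.2 (ht₁ t ht)
      omega
    have h2 : t₀ i n (N + 1) ≤ t := by
      refine le_trans ?_ (hρ N t hN1)
      exact Finset.le_sup (f := fun p : ℕ × ℕ => t₀ p.1 p.2 ((N : ℝ≥0) + 1)) (b := (i, n))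
        (Finset.mem_product.2 ⟨Finset.mem_range.2 (by omega), Finset.mem_range.2 (by omega)⟩)
    exact (ht₀ i n (N + 1) t h2 m hm (hmt'.trans hN2)).trans hn.le

end Slow

/-! ### Maps on two-parameter asymptotic algebras -/

section SlowMaps
open scoped BoundedContinuousFunction
variable {B C : Type*} [NonUnitalCStarAlgebra B] [NonUnitalCStarAlgebra C]

variable (B) in
/-- The quotient of the functions of two variables by `slowIdeal`. -/
abbrev SlowAlg (ρ : Slow) : Type _ := CQuot (slowIdeal B ρ)

variable (B) in
/-- The projection `SlowAlg B ρ → 𝔄 𝔄 B`. -/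
def slowProj (ρ : Slow) : SlowAlg B ρ →⋆ₙₐ[ℂ] CQuot (asymIdeal (CQuot (asymIdeal B))) :=
  CQuot.lift _ (biProj B) fun _ hf => biProj_of_mem hf

variable (B) in
/-- Restriction to a smaller function. -/
def slowRes {ρ ρ' : Slow} (h : ∀ t, ρ'.fn t ≤ ρ.fn t) : SlowAlg B ρ →⋆ₙₐ[ℂ] SlowAlg B ρ' :=
  CQuot.lift _ (CQuot.proj _) fun f hf => CQuot.mk_eq_zero.2 (mem_slowIdeal.2 fun ε hε => by
    obtain ⟨m₀, t₀, h1⟩ := mem_slowIdeal.1 hf ε hε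
    exact ⟨m₀, t₀, fun t ht m hm hmt => h1 t ht m hm (hmt.trans (h t))⟩)

lemma slowProj_slowRes {ρ ρ' : Slow} (h : ∀ t, ρ'.fn t ≤ ρ.fn t) :
    (slowProj B ρ').comp (slowRes B h) = slowProj B ρ := by
  refine NonUnitalStarAlgHom.ext fun x => ?_
  obtain ⟨f, rfl⟩ := CQuot.mk_surjective x
  rfl

variable (B) in
/-- Composition with `t ↦ (ρ(t), t)`. -/
def diagFun (ρ : Slow) : BiFun B →⋆ₙₐ[ℂ] (ℝ≥0 →ᵇ B) :=
  (bcfPre B ⟨fun t => (ρ.fn t, t), by fun_prop⟩).comp (bcfUncurry B ℝ≥0 ℝ≥0)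

variable (B) in
/-- The map `SlowAlg B ρ → 𝔄 B` given by `f ↦ f(ρ(t), t)`. -/
def slowDiag (ρ : Slow) : SlowAlg B ρ →⋆ₙₐ[ℂ] CQuot (asymIdeal B) :=
  CQuot.lift _ ((CQuot.proj _).comp (diagFun B ρ)) fun f hf =>
    CQuot.mk_eq_zero.2 (mem_asymIdeal.2 fun ε hε => by
      obtain ⟨m₀, t₀, h1⟩ := mem_slowIdeal.1 hf ε hε
      obtain ⟨t₁, h2⟩ := eventually_atTop.1 (ρ.tendsto.eventually_ge_atTop m₀)
      exact ⟨max t₀ t₁, fun t ht => h1 t ((le_max_left _ _).trans ht) _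
        (h2 t ((le_max_right _ _).trans ht)) le_rfl⟩)

variable (B) in
/-- Functions of one variable as functions of two variables. -/
def constBi : (ℝ≥0 →ᵇ B) →⋆ₙₐ[ℂ] BiFun B where
  toFun g := BoundedContinuousFunction.const _ g
  map_smul' _ _ := rfl
  map_zero' := rfl
  map_add' _ _ := rfl
  map_mul' _ _ := rfl
  map_star' _ := rfl

variable (B) in
/-- The inclusion `𝔄 B → SlowAlg B ρ`. -/
def slowConst (ρ : Slow) : CQuot (asymIdeal B) →⋆ₙₐ[ℂ] SlowAlg B ρ :=
  CQuot.lift _ ((CQuot.proj _).comp (constBi B)) fun f hf =>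
    CQuot.mk_eq_zero.2 (mem_slowIdeal.2 fun ε hε => by
      obtain ⟨t₀, h1⟩ := mem_asymIdeal.1 hf ε hε
      exact ⟨0, t₀, fun t ht m hm hmt => h1 t ht⟩)

lemma slowDiag_slowConst (ρ : Slow) :
    (slowDiag B ρ).comp (slowConst B ρ) = NonUnitalStarAlgHom.id ℂ _ := by
  refine NonUnitalStarAlgHom.ext fun x => ?_
  obtain ⟨f, rfl⟩ := CQuot.mk_surjective x
  rfl

lemma slowProj_slowConst (ρ : Slow) : (slowProj B ρ).comp (slowConst B ρ) = asymConst _ := by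
  refine NonUnitalStarAlgHom.ext fun x => ?_
  obtain ⟨f, rfl⟩ := CQuot.mk_surjective x
  rfl

/-- Functoriality. -/
def slowMap (ρ : Slow) (φ : B →⋆ₙₐ[ℂ] C) : SlowAlg B ρ →⋆ₙₐ[ℂ] SlowAlg C ρ :=
  CQuot.map (bcfPost ℝ≥0 (bcfMap φ)) fun f hf => mem_slowIdeal.2 fun ε hε => by
    obtain ⟨m₀, t₀, h1⟩ := mem_slowIdeal.1 hf ε hε
    exact ⟨m₀, t₀, fun t ht m hm hmt =>
      (NonUnitalStarAlgHom.norm_apply_le φ _).trans (h1 t ht m hm hmt)⟩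

lemma slowProj_slowMap (ρ : Slow) (φ : B →⋆ₙₐ[ℂ] C) :
    (slowProj C ρ).comp (slowMap ρ φ) = (asymMap (asymMap φ)).comp (slowProj B ρ) := by
  refine NonUnitalStarAlgHom.ext fun x => ?_
  obtain ⟨f, rfl⟩ := CQuot.mk_surjective x
  rfl

lemma slowDiag_slowMap (ρ : Slow) (φ : B →⋆ₙₐ[ℂ] C) :
    (slowDiag C ρ).comp (slowMap ρ φ) = (asymMap φ).comp (slowDiag B ρ) := by
  refine NonUnitalStarAlgHom.ext fun x => ?_
  obtain ⟨f, rfl⟩ := CQuot.mk_surjective x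
  rfl

variable (B) in
/-- Diagonals along different functions are homotopic. -/
lemma exists_slowDiag_homotopy {ρ ρ' : Slow} (h : ∀ t, ρ'.fn t ≤ ρ.fn t) :
    ∃ H : SlowAlg B ρ →⋆ₙₐ[ℂ] CQuot (asymIdeal C(unitInterval, B)),
      (asymMap (evHom B 0)).comp H = slowDiag B ρ ∧
      (asymMap (evHom B 1)).comp H = (slowDiag B ρ').comp (slowRes B h) := by
  let θ : ℝ≥0 × unitInterval → ℝ≥0 := fun p =>
    unitInterval.toNNReal (unitInterval.symm p.2) * ρ.fn p.1 + unitInterval.toNNReal p.2 * ρ'.fn p.1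
  have hθ : Continuous fun p : ℝ≥0 × unitInterval => (θ p, p.1) := by fun_prop
  have hsum : ∀ s : unitInterval, unitInterval.toNNReal (unitInterval.symm s) + unitInterval.toNNReal s = 1 := by
    intro s
    ext
    simp
  have hle : ∀ p, θ p ≤ ρ.fn p.1 := fun p => by
    calc θ p ≤ unitInterval.toNNReal (unitInterval.symm p.2) * ρ.fn p.1 +
          unitInterval.toNNReal p.2 * ρ.fn p.1 := by
          simp only [θ]; gcongr; exact h p.1
      _ = ρ.fn p.1 := by rw [← add_mul, hsum, one_mul]
  have hge : ∀ p, ρ'.fn p.1 ≤ θ p := fun p => by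
    calc ρ'.fn p.1 = unitInterval.toNNReal (unitInterval.symm p.2) * ρ'.fn p.1 +
          unitInterval.toNNReal p.2 * ρ'.fn p.1 := by rw [← add_mul, hsum, one_mul]
      _ ≤ θ p := by simp only [θ]; gcongr; exact h p.1
  refine ⟨CQuot.lift _ ((CQuot.proj _).comp ((bcfCurry B ℝ≥0).comp
    ((bcfPre B ⟨_, hθ⟩).comp (bcfUncurry B ℝ≥0 ℝ≥0)))) fun f hf =>
    CQuot.mk_eq_zero.2 (mem_asymIdeal.2 fun ε hε => ?_), ?_, ?_⟩
  · obtain ⟨m₀, t₀, h1⟩ := mem_slowIdeal.1 hf ε hε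
    obtain ⟨t₁, h2⟩ := eventually_atTop.1 (ρ'.tendsto.eventually_ge_atTop m₀)
    exact ⟨max t₀ t₁, fun t ht => (ContinuousMap.norm_le _ hε.le).2 fun s =>
      h1 t ((le_max_left _ _).trans ht) _ ((h2 t ((le_max_right _ _).trans ht)).trans (hge (t, s)))
        (hle (t, s))⟩
  · refine NonUnitalStarAlgHom.ext fun x => ?_
    obtain ⟨f, rfl⟩ := CQuot.mk_surjective x
    refine congrArg (CQuot.mk _) (BoundedContinuousFunction.ext fun t => ?_)
    change f (θ (t, 0)) t = f (ρ.fn t) t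
    have : θ (t, 0) = ρ.fn t := by simp [θ]
    rw [this]
  · refine NonUnitalStarAlgHom.ext fun x => ?_
    obtain ⟨f, rfl⟩ := CQuot.mk_surjective x
    refine congrArg (CQuot.mk _) (BoundedContinuousFunction.ext fun t => ?_)
    change f (θ (t, 1)) t = f (ρ'.fn t) t
    have : θ (t, 1) = ρ'.fn t := by simp [θ]
    rw [this]

/-- The argument of the homotopy from `slowProj` to `slowDiag`. -/
def maxArg (ρ : Slow) (m : ℝ≥0) : C(ℝ≥0 × unitInterval, ℝ≥0 × ℝ≥0) :=
  ⟨fun p => (max m (unitInterval.toNNReal p.2 * ρ.fn p.1), p.1), by fun_prop⟩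

lemma continuous_maxArg (ρ : Slow) (f : BiFun B) : Continuous fun m =>
    bcfCurry B ℝ≥0 (bcfPre B (maxArg ρ m) (bcfUncurry B ℝ≥0 ℝ≥0 f)) := by
  rw [Metric.continuous_iff]
  intro m ε hε
  have huc : UniformContinuousOn f (Set.Icc 0 (m + 1)) :=
    isCompact_Icc.uniformContinuousOn_of_continuous f.continuous.continuousOn
  obtain ⟨η, hη, h⟩ := Metric.uniformContinuousOn_iff.1 huc (ε / 2) (half_pos hε)
  refine ⟨min η 1, by positivity, fun m' hm' => ?_⟩
  refine lt_of_le_of_lt ((BoundedContinuousFunction.dist_le (half_pos hε).le).2 fun t =>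
    (ContinuousMap.dist_le (half_pos hε).le).2 fun s => ?_) (half_lt_self hε)
  change dist (f (max m' (unitInterval.toNNReal s * ρ.fn t)) t)
    (f (max m (unitInterval.toNNReal s * ρ.fn t)) t) ≤ ε / 2
  set x := unitInterval.toNNReal s * ρ.fn t
  have hm1 : m' ≤ m + 1 := by
    have h1 : dist m' m < 1 := hm'.trans_le (min_le_right _ _)
    rw [NNReal.dist_eq] at h1
    have h2 : (m' : ℝ) ≤ m + 1 := by linarith [le_abs_self ((m' : ℝ) - m)]
    exact_mod_cast h2
  by_cases hx : x ≤ m + 1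
  · refine (BoundedContinuousFunction.dist_coe_le_dist t).trans (h _ ⟨zero_le, max_le hm1 hx⟩ _
      ⟨zero_le, max_le (by simp) hx⟩ ?_).le
    refine lt_of_le_of_lt ?_ (hm'.trans_le (min_le_left _ _))
    rw [NNReal.dist_eq, NNReal.dist_eq, NNReal.coe_max, NNReal.coe_max]
    exact abs_max_sub_max_le_abs _ _ _
  · have hx' := (not_le.1 hx).le
    rw [max_eq_right (hm1.trans hx'), max_eq_right ((show m ≤ m + 1 by simp).trans hx'), dist_self]
    positivity

variable (B) in
/-- The family of functions `f(max(m, sρ(t)), t)`. -/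
def maxHom (ρ : Slow) : BiFun B →⋆ₙₐ[ℂ] BiFun C(unitInterval, B) where
  toFun f := BoundedContinuousFunction.ofNormedAddCommGroup _ (continuous_maxArg ρ f) ‖f‖ fun m => by
    refine (BoundedContinuousFunction.norm_le (norm_nonneg _)).2 fun t =>
      (ContinuousMap.norm_le _ (norm_nonneg _)).2 fun s => ?_
    exact ((f _).norm_coe_le_norm _).trans (f.norm_coe_le_norm _)
  map_smul' _ _ := rfl
  map_zero' := rfl
  map_add' _ _ := rfl
  map_mul' _ _ := rfl
  map_star' _ := rfl

variable (B) in
/-- The projection to `𝔄 𝔄 B` is homotopic to the diagonal. -/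
lemma exists_slowProj_homotopy (ρ : Slow) :
    ∃ H : SlowAlg B ρ →⋆ₙₐ[ℂ] CQuot (asymIdeal (CQuot (asymIdeal C(unitInterval, B)))),
      (asymMap (asymMap (evHom B 0))).comp H = slowProj B ρ ∧
      (asymMap (asymMap (evHom B 1))).comp H = (asymConst _).comp (slowDiag B ρ) := by
  refine ⟨CQuot.lift _ ((biProj _).comp (maxHom B ρ)) fun f hf => ?_, ?_, ?_⟩
  · refine biProj_eq_zero fun ε hε => ?_
    obtain ⟨m₀, t₀, h1⟩ := mem_slowIdeal.1 hf ε hε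
    refine ⟨m₀, fun m hm => ?_⟩
    filter_upwards [eventually_ge_atTop t₀, ρ.tendsto.eventually_ge_atTop m] with t ht hmt
    refine (ContinuousMap.norm_le _ hε.le).2 fun s => ?_
    change ‖f (max m (unitInterval.toNNReal s * ρ.fn t)) t‖ ≤ ε
    refine h1 t ht _ (hm.trans (le_max_left _ _)) (max_le hmt ?_)
    exact mul_le_of_le_one_left' s.2.2
  · refine NonUnitalStarAlgHom.ext fun x => ?_
    obtain ⟨f, rfl⟩ := CQuot.mk_surjective x
    refine congrArg (CQuot.mk _) (BoundedContinuousFunction.ext fun m =>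
      congrArg (CQuot.mk _) (BoundedContinuousFunction.ext fun t => ?_))
    change f (max m (unitInterval.toNNReal 0 * ρ.fn t)) t = f m t
    rw [unitInterval.toNNReal_zero, zero_mul, max_eq_left zero_le]
  · refine NonUnitalStarAlgHom.ext fun x => ?_
    obtain ⟨f, rfl⟩ := CQuot.mk_surjective x
    refine congrArg (CQuot.mk _) (BoundedContinuousFunction.ext fun m =>
      CQuot.mk_eq.2 (mem_asymIdeal.2 fun ε hε => ?_))
    obtain ⟨t₀, ht₀⟩ := eventually_atTop.1 (ρ.tendsto.eventually_ge_atTop m)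
    refine ⟨t₀, fun t ht => ?_⟩
    change ‖f (max m (unitInterval.toNNReal 1 * ρ.fn t)) t - f (ρ.fn t) t‖ ≤ ε
    rw [unitInterval.toNNReal_one, one_mul, max_eq_right (ht₀ t ht), sub_self, norm_zero]
    exact hε.le

end SlowMaps

/-! ### Separable domains -/

section Separable

lemma countable_subsemigroup_closure {M : Type*} [Semigroup M] {s : Set M} (hs : s.Countable) :
    (Subsemigroup.closure s : Set M).Countable := by
  have : Countable s := hs
  let f : M → s → M := fun m a => m * (a : M)
  let p : s × List s → M := fun x => List.foldl f (x.1 : M) x.2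
  have hmul : ∀ (l : List s) (m n : M), m * List.foldl f n l = List.foldl f (m * n) l := by
    intro l
    induction l with
    | nil => intro m n; rfl
    | cons a l ih => intro m n; simp only [List.foldl_cons, f]; rw [ih, mul_assoc]
  let S : Subsemigroup M :=
    { carrier := Set.range p
      mul_mem' := by
        rintro _ _ ⟨⟨a, l⟩, rfl⟩ ⟨⟨b, l'⟩, rfl⟩
        refine ⟨(a, l ++ b :: l'), ?_⟩
        simp only [p, List.foldl_append, List.foldl_cons, hmul]; rfl }
  have h : Subsemigroup.closure s ≤ S :=
    Subsemigroup.closure_le.2 fun a ha => ⟨(⟨a, ha⟩, []), rfl⟩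
  exact (Set.countable_range p).mono h

/-- Countable sets are contained in separable C*-subalgebras. -/
lemma exists_separable_subalgebra {E : Type*} [NonUnitalCStarAlgebra E] (s : Set E) (hs : s.Countable) :
    ∃ P : NonUnitalStarSubalgebra ℂ E, IsClosed (P : Set E) ∧ s ⊆ P ∧
      TopologicalSpace.IsSeparable (P : Set E) := by
  refine ⟨(NonUnitalStarAlgebra.adjoin ℂ s).topologicalClosure,
    NonUnitalStarSubalgebra.isClosed_topologicalClosure _, ?_, ?_⟩
  · exact (NonUnitalStarAlgebra.subset_adjoin ℂ s).trans
      (NonUnitalStarSubalgebra.le_topologicalClosure _)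
  · have h1 : (NonUnitalStarAlgebra.adjoin ℂ s : Set E) =
        (Submodule.span ℂ (Subsemigroup.closure (s ∪ star s) : Set E) : Set E) := by
      have := NonUnitalStarAlgebra.adjoin_eq_span (R := ℂ) s
      exact congrArg (fun p : Submodule ℂ E => (p : Set E)) this
    have h2 : TopologicalSpace.IsSeparable (NonUnitalStarAlgebra.adjoin ℂ s : Set E) := by
      rw [h1]
      refine TopologicalSpace.IsSeparable.span (Set.Countable.isSeparable ?_)
      refine countable_subsemigroup_closure (hs.union ?_)
      rw [← Set.image_star]
      exact hs.image _
    exact h2.closure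

/-- The functor maps surjections to surjections. -/
def PreservesSurj (F : CStarAlg.{u} ⥤ CStarAlg.{u}) : Prop :=
  ∀ {D D' : CStarAlg.{u}} (q : D ⟶ D'), Function.Surjective q → Function.Surjective (F.map q)

/-- The kernel of `F q` consists of elements that are killed if countably many elements of the
kernel of `q` are killed. -/
def CountablyDetermined (F : CStarAlg.{u} ⥤ CStarAlg.{u}) : Prop :=
  ∀ {D D' : CStarAlg.{u}} (q : D ⟶ D'), Function.Surjective q → ∀ T : F.obj D, F.map q T = 0 →
    ∃ J : Set D, J.Countable ∧ (∀ j ∈ J, q j = 0) ∧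
      ∀ {D'' : CStarAlg.{u}} (r : D ⟶ D''), (∀ j ∈ J, r j = 0) → F.map r T = 0

lemma preservesSurj_id : PreservesSurj (𝟭 CStarAlg.{u}) := fun q hq => hq

lemma countablyDetermined_id : CountablyDetermined (𝟭 CStarAlg.{u}) := fun q hq T hT =>
  ⟨{T}, Set.countable_singleton T, fun j hj => by rw [Set.mem_singleton_iff.1 hj]; exact hT,
    fun r hr => hr T rfl⟩

variable {F : CStarAlg.{u} ⥤ CStarAlg.{u}} {A D D' : CStarAlg.{u}}

lemma CountablyDetermined.of_countable (hC : CountablyDetermined F) (q : D ⟶ D')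
    (hq : Function.Surjective q) (S : Set (F.obj D)) (hS : S.Countable) (h : ∀ T ∈ S, F.map q T = 0) :
    ∃ J : Set D, J.Countable ∧ (∀ j ∈ J, q j = 0) ∧
      ∀ {D'' : CStarAlg.{u}} (r : D ⟶ D''), (∀ j ∈ J, r j = 0) → ∀ T ∈ S, F.map r T = 0 := by
  choose! J hJ1 hJ2 hJ3 using fun T (hT : T ∈ S) => hC q hq T (h T hT)
  refine ⟨⋃ T ∈ S, J T, hS.biUnion hJ1, fun j hj => ?_, fun r hr T hT => ?_⟩
  · obtain ⟨T, hT, hj⟩ := Set.mem_iUnion₂.1 hj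
    exact hJ2 T hT j hj
  · exact hJ3 T hT r fun j hj => hr j (Set.mem_iUnion₂.2 ⟨T, hT, hj⟩)

/-- Morphisms on separable algebras lift to quotients by countably generated ideals. -/
lemma exists_lift_of_separable (hS : PreservesSurj F) (hC : CountablyDetermined F)
    [TopologicalSpace.SeparableSpace A] (q : D ⟶ D') (hq : Function.Surjective q)
    (χ : A ⟶ F.obj D') : ∃ J : Set D, J.Countable ∧ (∀ j ∈ J, q j = 0) ∧
      ∀ {D'' : CStarAlg.{u}} (r : D ⟶ D'') (p : D'' ⟶ D'), r ≫ p = q → (∀ j ∈ J, r j = 0) →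
        ∃ χ' : A ⟶ F.obj D'', χ' ≫ F.map p = χ := by
  have : Nonempty A := ⟨0⟩
  let a := TopologicalSpace.denseSeq A
  choose x hx using fun n => hS q hq (toHom χ (a n))
  obtain ⟨P, hPc, hxP, hPs⟩ := exists_separable_subalgebra (Set.range x) (Set.countable_range x)
  have hK : TopologicalSpace.IsSeparable ({T | T ∈ P ∧ F.map q T = 0} : Set (F.obj D)) :=
    hPs.mono fun T hT => hT.1
  obtain ⟨S, hSK, hSc, hSd⟩ := hK.exists_countable_dense_subset
  obtain ⟨J, hJ1, hJ2, hJ3⟩ := hC.of_countable q hq S hSc fun T hT => (hSK hT).2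
  refine ⟨J, hJ1, hJ2, fun {D''} r p hrp hr => ?_⟩
  have hker : ∀ T ∈ P, toHom (F.map q) T = 0 → toHom (F.map r) T = 0 := by
    intro T hT h0
    have h1 : T ∈ closure S := hSd ⟨hT, h0⟩
    have h2 : closure S ⊆ {T | toHom (F.map r) T = 0} :=
      closure_minimal (fun T hT => hJ3 r hr T hT)
        (isClosed_eq (hom_continuous (toHom (F.map r))) continuous_const)
    exact h2 h1
  let _ : NonUnitalCStarAlgebra P := NonUnitalStarSubalgebra.nonUnitalCStarAlgebra (h_closed := hPc) P
  let i : P →⋆ₙₐ[ℂ] F.obj D :=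
    { toFun := fun T => T.1
      map_smul' := fun _ _ => rfl
      map_zero' := rfl
      map_add' := fun _ _ => rfl
      map_mul' := fun _ _ => rfl
      map_star' := fun _ => rfl }
  obtain ⟨χ', hχ'⟩ := exists_hom_of_rel (A := A) (B := F.obj D'')
    (fun b c => ∃ T ∈ P, toHom (F.map q) T = toHom χ b ∧ toHom (F.map r) T = c)
    ⟨0, zero_mem P, by simp, map_zero _⟩
    (by
      rintro b _ b' _ ⟨T, hT, h, rfl⟩ ⟨T', hT', h', rfl⟩
      exact ⟨T + T', add_mem hT hT', by rw [map_add, map_add, h, h'], map_add _ _ _⟩)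
    (by
      rintro c b _ ⟨T, hT, h, rfl⟩
      exact ⟨c • T, SMulMemClass.smul_mem c hT, by rw [map_smul, map_smul, h], map_smul _ _ _⟩)
    (by
      rintro b _ b' _ ⟨T, hT, h, rfl⟩ ⟨T', hT', h', rfl⟩
      exact ⟨T * T', mul_mem hT hT', by rw [map_mul, map_mul, h, h'], map_mul _ _ _⟩)
    (by
      rintro b _ ⟨T, hT, h, rfl⟩
      exact ⟨star T, star_mem hT, by rw [map_star, map_star, h], map_star _ _⟩)
    (by
      rintro b _ ⟨T, hT, h, rfl⟩
      have h1 := norm_le_of_ker_le ((toHom (F.map q)).comp i) ((toHom (F.map r)).comp i)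
        (fun T hT => hker T.1 T.2 hT) ⟨T, hT⟩
      refine h1.trans (le_of_eq_of_le (congrArg norm h) (NonUnitalStarAlgHom.norm_apply_le (toHom χ) b)))
    (fun b ε hε => by
      obtain ⟨_, ⟨n, rfl⟩, hn⟩ := Metric.mem_closure_iff.1 (TopologicalSpace.denseRange_denseSeq A b) ε hε
      exact ⟨a n, _, ⟨x n, hxP ⟨n, rfl⟩, hx n, rfl⟩, by rwa [dist_eq_norm] at hn⟩)
  refine ⟨ofHom χ', ?_⟩
  refine hom_eq_of_dense _ _ _ (TopologicalSpace.denseRange_denseSeq A) ?_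
  rintro _ ⟨n, rfl⟩
  have h1 : χ' (a n) = toHom (F.map r) (x n) := hχ' _ _ ⟨x n, hxP ⟨n, rfl⟩, hx n, rfl⟩
  change toHom (F.map p) (χ' (a n)) = toHom χ (a n)
  rw [h1]
  refine Eq.trans ?_ (hx n)
  rw [← hrp, F.map_comp]
  rfl

/-- Lifts of morphisms on separable algebras agree in quotients by countably generated ideals. -/
lemma exists_eq_of_separable (hC : CountablyDetermined F) [TopologicalSpace.SeparableSpace A]
    (q : D ⟶ D') (hq : Function.Surjective q) (χ χ' : A ⟶ F.obj D) (h : χ ≫ F.map q = χ' ≫ F.map q) :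
    ∃ J : Set D, J.Countable ∧ (∀ j ∈ J, q j = 0) ∧
      ∀ {D'' : CStarAlg.{u}} (r : D ⟶ D''), (∀ j ∈ J, r j = 0) → χ ≫ F.map r = χ' ≫ F.map r := by
  have : Nonempty A := ⟨0⟩
  let a := TopologicalSpace.denseSeq A
  obtain ⟨J, hJ1, hJ2, hJ3⟩ := hC.of_countable q hq (Set.range fun n => toHom χ (a n) - toHom χ' (a n))
    (Set.countable_range _) (by
      rintro _ ⟨n, rfl⟩
      change toHom (F.map q) _ = 0
      rw [map_sub, sub_eq_zero]
      exact congrArg (fun m => toHom m (a n)) h)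
  refine ⟨J, hJ1, hJ2, fun {D''} r hr => ?_⟩
  refine hom_eq_of_dense _ _ _ (TopologicalSpace.denseRange_denseSeq A) ?_
  rintro _ ⟨n, rfl⟩
  have h1 : toHom (F.map r) (toHom χ (a n) - toHom χ' (a n)) = 0 := hJ3 r hr _ ⟨n, rfl⟩
  rw [map_sub, sub_eq_zero] at h1
  exact h1

end Separable

/-! ### Stages of the colimit for separable domains -/

section Stages
variable {F : CStarAlg.{u} ⥤ CStarAlg.{u}} {A B : CStarAlg.{u}}

/-- `SlowAlg` as an object of the category. -/
abbrev slowObj (ρ : Slow) (E : CStarAlg.{u}) : CStarAlg.{u} := ⟨SlowAlg E ρ⟩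

/-- `slowProj` as a morphism. -/
def slowProjMor (ρ : Slow) (E : CStarAlg.{u}) : slowObj ρ E ⟶ asym.obj (asym.obj E) := slowProj E ρ

/-- `slowDiag` as a morphism. -/
def slowDiagMor (ρ : Slow) (E : CStarAlg.{u}) : slowObj ρ E ⟶ asym.obj E := slowDiag E ρ

lemma slowProjMor_surjective (ρ : Slow) (E : CStarAlg.{u}) : Function.Surjective (slowProjMor ρ E) :=
  fun x => by
    obtain ⟨f, hf⟩ := biProj_surjective (B := E) x
    exact ⟨CQuot.mk _ f, hf⟩

/-- `φ` is the diagonal of a lift of `χ`. -/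
def LiftsTo {E : CStarAlg.{u}} (χ : A ⟶ F.obj (asym.obj (asym.obj E))) (φ : A ⟶ F.obj (asym.obj E)) :
    Prop :=
  ∃ (ρ : Slow) (χ' : A ⟶ F.obj (slowObj ρ E)), χ' ≫ F.map (slowProjMor ρ E) = χ ∧
    χ' ≫ F.map (slowDiagMor ρ E) = φ

lemma exists_liftsTo (hS : PreservesSurj F) (hC : CountablyDetermined F)
    [TopologicalSpace.SeparableSpace A] {E : CStarAlg.{u}} (χ : A ⟶ F.obj (asym.obj (asym.obj E))) :
    ∃ φ, LiftsTo χ φ := by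
  let CC : CStarAlg.{u} := ⟨BiFun E⟩
  obtain ⟨J, hJ1, hJ2, hJ3⟩ := exists_lift_of_separable hS hC
    (ofHom (A := CC) (B := asym.obj (asym.obj E)) (biProj E)) biProj_surjective χ
  obtain ⟨ρ, -, hρ⟩ := exists_slow_of_countable J hJ1 hJ2 ⟨ContinuousMap.id _, tendsto_id⟩
  obtain ⟨χ', hχ'⟩ := hJ3 (ofHom (A := CC) (B := slowObj ρ E) (CQuot.proj _)) (slowProjMor ρ E) rfl
    fun j hj => CQuot.mk_eq_zero.2 (hρ j hj)
  exact ⟨_, ρ, χ', hχ', rfl⟩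

lemma liftsTo_alpha {E : CStarAlg.{u}} (φ : A ⟶ F.obj (asym.obj E)) :
    LiftsTo (φ ≫ F.map (alpha.app (asym.obj E))) φ := by
  let ρ : Slow := ⟨ContinuousMap.id _, tendsto_id⟩
  let c : asym.obj E ⟶ slowObj ρ E := slowConst E ρ
  refine ⟨ρ, φ ≫ F.map c, ?_, ?_⟩
  · rw [Category.assoc, ← F.map_comp]
    exact congrArg (fun m => φ ≫ F.map m) (slowProj_slowConst (B := E) ρ)
  · rw [Category.assoc, ← F.map_comp]
    have : c ≫ slowDiagMor ρ E = 𝟙 _ := slowDiag_slowConst (B := E) ρ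
    rw [this, F.map_id, Category.comp_id]

variable {G : CStarAlg.{u} ⥤ CStarAlg.{u}}

lemma GenMor.mk_slowDiag (hG : HasSwap G) {ρ ρ' : Slow} (h : ∀ t, ρ'.fn t ≤ ρ.fn t)
    (χ : A ⟶ F.obj (slowObj ρ (G.obj B))) :
    GenMor.mk (B := B) (G ⋙ asym ⋙ F) (χ ≫ F.map (slowDiagMor ρ (G.obj B))) =
      GenMor.mk (B := B) (G ⋙ asym ⋙ F)
        (χ ≫ F.map (ofHom (A := slowObj ρ (G.obj B)) (B := slowObj ρ' (G.obj B)) (slowRes _ h)) ≫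
          F.map (slowDiagMor ρ' (G.obj B))) := by
  obtain ⟨H, h0, h1⟩ := exists_slowDiag_homotopy (G.obj B) h
  have := GenMor.mk_eq_of_cyl hG (asym ⋙ F) (B := B)
    (χ ≫ F.map (ofHom (A := slowObj ρ (G.obj B)) (B := asym.obj (cyl.obj (G.obj B))) H))
  convert this using 2
  · rw [Category.assoc, Functor.comp_map, ← F.map_comp]
    exact congrArg (fun m => χ ≫ F.map m) h0.symm
  · rw [Category.assoc, Functor.comp_map, ← F.map_comp, ← F.map_comp]
    exact congrArg (fun m => χ ≫ F.map m) h1.symm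

lemma GenMor.mk_eq_of_liftsTo (hC : CountablyDetermined F) [TopologicalSpace.SeparableSpace A]
    (hG : HasSwap G) {χ : A ⟶ F.obj (asym.obj (asym.obj (G.obj B)))}
    {φ φ' : A ⟶ F.obj (asym.obj (G.obj B))} (h : LiftsTo χ φ) (h' : LiftsTo χ φ') :
    GenMor.mk (B := B) (G ⋙ asym ⋙ F) φ = GenMor.mk (B := B) (G ⋙ asym ⋙ F) φ' := by
  obtain ⟨ρ₁, χ₁, hχ₁, rfl⟩ := h
  obtain ⟨ρ₂, χ₂, hχ₂, rfl⟩ := h'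
  let ρ : Slow := ⟨ρ₁.fn ⊓ ρ₂.fn, tendsto_atTop.2 fun M => by
    filter_upwards [ρ₁.tendsto.eventually_ge_atTop M, ρ₂.tendsto.eventually_ge_atTop M] with t h1 h2
    exact le_inf h1 h2⟩
  have e₁ : ∀ t, ρ.fn t ≤ ρ₁.fn t := fun t => inf_le_left
  have e₂ : ∀ t, ρ.fn t ≤ ρ₂.fn t := fun t => inf_le_right
  have hres : ∀ {ρ ρ' : Slow} (h : ∀ t, ρ'.fn t ≤ ρ.fn t),
      ofHom (A := slowObj ρ (G.obj B)) (B := slowObj ρ' (G.obj B)) (slowRes _ h) ≫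
        slowProjMor ρ' (G.obj B) = slowProjMor ρ (G.obj B) := fun h => slowProj_slowRes h
  rw [GenMor.mk_slowDiag hG e₁, GenMor.mk_slowDiag hG e₂, ← Category.assoc, ← Category.assoc]
  obtain ⟨J, hJ1, hJ2, hJ3⟩ := exists_eq_of_separable hC (slowProjMor ρ (G.obj B))
    (slowProjMor_surjective ρ _)
    (χ₁ ≫ F.map (ofHom (A := slowObj ρ₁ (G.obj B)) (B := slowObj ρ (G.obj B)) (slowRes _ e₁)))
    (χ₂ ≫ F.map (ofHom (A := slowObj ρ₂ (G.obj B)) (B := slowObj ρ (G.obj B)) (slowRes _ e₂))) (by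
      rw [Category.assoc, Category.assoc, ← F.map_comp, ← F.map_comp, hres, hres, hχ₁, hχ₂])
  choose l hl using fun x : slowObj ρ (G.obj B) => CQuot.mk_surjective x
  obtain ⟨ρ', hρ', hJ'⟩ := exists_slow_of_countable (l '' J) (hJ1.image l) (by
    rintro _ ⟨j, hj, rfl⟩
    have := hJ2 j hj
    rw [← hl j] at this
    exact this) ρ
  have := hJ3 (ofHom (A := slowObj ρ (G.obj B)) (B := slowObj ρ' (G.obj B)) (slowRes _ hρ')) (by
    intro j hj
    rw [← hl j]
    exact CQuot.mk_eq_zero.2 (hJ' _ ⟨j, hj, rfl⟩))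
  rw [GenMor.mk_slowDiag hG hρ', GenMor.mk_slowDiag hG hρ', ← Category.assoc, ← Category.assoc, this]

lemma LiftsTo.map {E E' : CStarAlg.{u}} {χ : A ⟶ F.obj (asym.obj (asym.obj E))}
    {φ : A ⟶ F.obj (asym.obj E)} (h : LiftsTo χ φ) (f : E ⟶ E') :
    LiftsTo (χ ≫ F.map (asym.map (asym.map f))) (φ ≫ F.map (asym.map f)) := by
  obtain ⟨ρ, χ', rfl, rfl⟩ := h
  refine ⟨ρ, χ' ≫ F.map (ofHom (A := slowObj ρ E) (B := slowObj ρ E') (slowMap ρ (toHom f))), ?_, ?_⟩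
  · simp only [Category.assoc, ← F.map_comp]
    exact congrArg (fun m => χ' ≫ F.map m) (slowProj_slowMap ρ (toHom f))
  · simp only [Category.assoc, ← F.map_comp]
    exact congrArg (fun m => χ' ≫ F.map m) (slowDiag_slowMap ρ (toHom f))

/-- For separable domains, morphisms to `F 𝔄 𝔄 G` that are homotopic after stabilization are
homotopic. -/
theorem GenMor.mk_eq_of_alpha (hS : PreservesSurj F) (hC : CountablyDetermined F)
    [TopologicalSpace.SeparableSpace A] (hG : HasSwap G) {φ φ' : A ⟶ F.obj (asym.obj (G.obj B))}
    (h : GenMor.mk (B := B) (G ⋙ asym ⋙ asym ⋙ F) (φ ≫ F.map (alpha.app (asym.obj (G.obj B)))) =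
      GenMor.mk (B := B) (G ⋙ asym ⋙ asym ⋙ F) (φ' ≫ F.map (alpha.app (asym.obj (G.obj B))))) :
    GenMor.mk (B := B) (G ⋙ asym ⋙ F) φ = GenMor.mk (B := B) (G ⋙ asym ⋙ F) φ' := by
  have key : ∀ χ χ' : A ⟶ F.obj (asym.obj (asym.obj (G.obj B))),
      Relation.EqvGen (Homotopic (B := B) (G ⋙ asym ⋙ asym ⋙ F)) χ χ' → ∀ φ φ', LiftsTo χ φ →
        LiftsTo χ' φ' →
          GenMor.mk (B := B) (G ⋙ asym ⋙ F) φ = GenMor.mk (B := B) (G ⋙ asym ⋙ F) φ' := by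
    intro χ χ' h
    induction h with
    | rel χ χ' h =>
      intro φ φ' hφ hφ'
      obtain ⟨Φ, rfl, rfl⟩ := h
      obtain ⟨ψ, hψ⟩ := exists_liftsTo hS hC (E := G.obj (cyl.obj B)) Φ
      rw [GenMor.mk_eq_of_liftsTo hC hG hφ (hψ.map (G.map ((ev 0).app B))),
        GenMor.mk_eq_of_liftsTo hC hG hφ' (hψ.map (G.map ((ev 1).app B)))]
      exact Quot.sound ⟨ψ, rfl, rfl⟩
    | refl χ => exact fun φ φ' h h' => GenMor.mk_eq_of_liftsTo hC hG h h'
    | symm χ χ' _ ih => exact fun φ φ' h h' => (ih φ' φ h' h).symm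
    | trans χ₁ χ₂ χ₃ _ _ ih1 ih2 =>
      intro φ φ' h h'
      obtain ⟨ψ, hψ⟩ := exists_liftsTo hS hC χ₂
      exact (ih1 φ ψ h hψ).trans (ih2 ψ φ' hψ h')
  exact key _ _ (Quot.eqvGen_exact h) _ _ (liftsTo_alpha φ) (liftsTo_alpha φ')

/-- For separable domains, each morphism to `F 𝔄 𝔄 G` is homotopic to one from `F 𝔄 G`. -/
theorem GenMor.exists_mk_alpha (hS : PreservesSurj F) (hC : CountablyDetermined F)
    [TopologicalSpace.SeparableSpace A] (hG : HasSwap G)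
    (χ : A ⟶ F.obj (asym.obj (asym.obj (G.obj B)))) : ∃ φ : A ⟶ F.obj (asym.obj (G.obj B)),
      GenMor.mk (B := B) (G ⋙ asym ⋙ asym ⋙ F) (φ ≫ F.map (alpha.app (asym.obj (G.obj B)))) =
        GenMor.mk (B := B) (G ⋙ asym ⋙ asym ⋙ F) χ := by
  obtain ⟨φ, ρ, χ', rfl, rfl⟩ := exists_liftsTo hS hC χ
  refine ⟨χ' ≫ F.map (slowDiagMor ρ (G.obj B)), ?_⟩
  obtain ⟨H, h0, h1⟩ := exists_slowProj_homotopy (G.obj B) ρ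
  have := GenMor.mk_eq_of_cyl hG (asym ⋙ asym ⋙ F) (B := B)
    (χ' ≫ F.map (ofHom (A := slowObj ρ (G.obj B)) (B := asym.obj (asym.obj (cyl.obj (G.obj B)))) H))
  refine Eq.trans ?_ (this.symm.trans ?_)
  · congr 1
    simp only [Category.assoc, Functor.comp_map, ← F.map_comp]
    exact congrArg (fun m => χ' ≫ F.map m) h1.symm
  · congr 1
    simp only [Category.assoc, Functor.comp_map, ← F.map_comp]
    exact congrArg (fun m => χ' ≫ F.map m) h0

/-- For separable domains, the transition maps are bijective. -/
theorem stageMap_succ_bijective [OrthPreserving F] (hS : PreservesSurj F) (hC : CountablyDetermined F)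
    [TopologicalSpace.SeparableSpace A] (k : ℕ) :
    Function.Bijective (SumMor.mapNat (A := A) (B := B) (stageNat F k)) := by
  cases k with
  | zero =>
    constructor
    · rintro ⟨φ⟩ ⟨φ'⟩ h
      exact GenMor.mk_eq_of_alpha hS hC hasSwap_compact h
    · rintro ⟨χ⟩
      obtain ⟨φ, h⟩ := GenMor.exists_mk_alpha hS hC (B := B) hasSwap_compact χ
      exact ⟨GenMor.mk _ φ, h⟩
  | succ k =>
    have hG : HasSwap (compact.{u} ⋙ asymPow k) := hasSwap_compact.comp (hasSwap_asymPow k)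
    constructor
    · rintro ⟨φ⟩ ⟨φ'⟩ h
      exact GenMor.mk_eq_of_alpha hS hC hG h
    · rintro ⟨χ⟩
      obtain ⟨φ, h⟩ := GenMor.exists_mk_alpha hS hC (B := B) hG χ
      exact ⟨GenMor.mk _ φ, h⟩

/-- For separable domains, the first stage is the colimit. -/
theorem toColim_zero_bijective [OrthPreserving F] (hS : PreservesSurj F) (hC : CountablyDetermined F)
    [TopologicalSpace.SeparableSpace A] : Function.Bijective (toColim F A B 0) := by
  have hb : ∀ j, Function.Bijective (stageMap F A B 0 j (Nat.zero_le j)) := by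
    intro j
    induction j with
    | zero => rw [stageMap_self]; exact Function.bijective_id
    | succ j ih =>
      rw [stageMap_succ F A B 0 j (Nat.zero_le j)]
      exact (stageMap_succ_bijective hS hC j).comp ih
  constructor
  · intro x y h
    obtain ⟨j, h1, h2, e⟩ := Quotient.exact h
    exact (hb j).1 e
  · intro z
    induction z using DirectLimit.induction with
    | _ i x =>
      obtain ⟨y, hy⟩ := (hb i).2 x
      refine ⟨y, Quotient.sound ⟨i, Nat.zero_le i, le_rfl, ?_⟩⟩
      rw [stageMap_self]
      exact hy

end Stages

/-! ### The geometry of scalable spaces and their discretizations -/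

section Geometry
open scoped ZeroAtInfty BoundedContinuousFunction

/-- A scaling of a pair of spaces, together with a discretization of bounded geometry, a subordinate
partition of unity with `∑ φ_x² = 1`, and an enumeration of the discrete space by positive numbers. -/
structure Geometry (Y : Type u) [MetricSpace Y] (Y₀ : Set Y) (δ : ℝ) (X : Set Y) where
  isClosed : IsClosed Y₀
  pos : 0 < δ
  disc : IsDiscretization δ X
  geom : BoundedGeometry X
  sc : ℝ≥0 → Y → Y
  ρ : ℝ≥0 → ℝ≥0 → ℝ≥0
  sc_continuous : Continuous fun p : Y × ℝ≥0 => sc p.2 p.1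
  sc_mem : ∀ t, ∀ y ∈ Y₀, sc t y ∈ Y₀
  sc_zero : ∀ y, sc 0 y = y
  sc_bounded : ∀ S : Set Y, Bornology.IsBounded S → ∀ T > 0,
    Bornology.IsBounded (⋃ t ∈ Set.Icc 0 T, sc t ⁻¹' S)
  sc_dist : ∀ t x y, nndist (sc t x) (sc t y) ≤ ρ t (nndist x y)
  ρ_mono : ∀ t, Monotone (ρ t)
  ρ_tendsto : ∀ r, BddAbove (Set.range fun t => ρ t r) ∧ Tendsto (fun t => ρ t r) atTop (𝓝 0)
  φ : X → C(Y, ℝ)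
  φ_nonneg : ∀ x y, 0 ≤ φ x y
  φ_dist : ∀ x y, φ x y ≠ 0 → dist y x < 2 * δ
  φ_sum : ∀ y (s : Finset X), (∀ x, φ x y ≠ 0 → x ∈ s) → ∑ x ∈ s, φ x y ^ 2 = 1
  ι : X → ℕ
  ι_injective : Function.Injective ι
  ι_ne_zero : ∀ x, ι x ≠ 0

lemma BoundedGeometry.exists_card {Y : Type*} [PseudoMetricSpace Y] {X : Set Y} (h : BoundedGeometry X)
    (R : ℝ) : ∃ N : ℕ, ∀ x : X, ∃ F : Finset X, F.card ≤ N ∧ ∀ y, dist x y ≤ R → y ∈ F := by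
  obtain ⟨N, hN⟩ := h R
  refine ⟨N, fun x => ?_⟩
  have hf : (Metric.closedBall x R).Finite :=
    Set.encard_lt_top_iff.1 ((hN x).trans_lt (ENat.natCast_lt_top N))
  refine ⟨hf.toFinset, ?_, fun y hy => by
    rw [Set.Finite.mem_toFinset, Metric.mem_closedBall, dist_comm]; exact hy⟩
  have := hN x
  rw [hf.encard_eq_coe_toFinset_card] at this
  exact_mod_cast this

variable {Y : Type u} [MetricSpace Y] {Y₀ : Set Y} {δ : ℝ} {X : Set Y}

lemma IsDiscretization.finite_near (hX : IsDiscretization δ X) (hg : BoundedGeometry X) (y : Y) (r : ℝ) :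
    {x : X | dist y x ≤ r}.Finite := by
  obtain ⟨x₀, hx₀, h⟩ := hX.dense y
  obtain ⟨N, hN⟩ := hg.exists_card (δ + r)
  obtain ⟨F, -, hF⟩ := hN ⟨x₀, hx₀⟩
  refine F.finite_toSet.subset fun x hx => hF x ?_
  have h1 : dist y x ≤ r := hx
  have h2 := dist_triangle x₀ y x
  rw [dist_comm x₀ y] at h2
  change dist x₀ (x : Y) ≤ _
  linarith

/-- Scalable pairs with discretizations of bounded geometry carry the required data. -/
theorem exists_geometry (hY₀ : IsClosed Y₀) (hsc : IsScalable Y Y₀) (hδ : 0 < δ)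
    (hX : IsDiscretization δ X) (hgeom : BoundedGeometry X) : Nonempty (Geometry Y Y₀ δ X) := by
  obtain ⟨sc, ρ, h1, h2, h3, h4, h5, h6, h7⟩ := hsc
  have hcount : Countable X := by
    rcases isEmpty_or_nonempty X with h | ⟨⟨x₀⟩⟩
    · infer_instance
    · rw [← Set.countable_univ_iff]
      have : (Set.univ : Set X) = ⋃ n : ℕ, {x : X | dist (x₀ : Y) x ≤ n} := by
        ext x
        simp only [Set.mem_univ, Set.mem_iUnion, true_iff]
        exact exists_nat_ge (dist (x₀ : Y) x)
      rw [this]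
      exact Set.countable_iUnion fun n => (hX.finite_near hgeom x₀ n).countable
  obtain ⟨i, hi⟩ := exists_injective_nat X
  let ψ : X → Y → ℝ := fun x y => max 0 (2 * δ - dist y x)
  have hψ : ∀ x, Continuous (ψ x) := fun x => by fun_prop
  have hψ0 : ∀ x y, ψ x y ≠ 0 → dist y x < 2 * δ := fun x y h => by
    by_contra hne
    exact h (max_eq_left (by linarith [not_lt.1 hne]))
  let S : Y → ℝ := fun y => ∑ᶠ x, ψ x y ^ 2
  have hS : Continuous S := by
    refine continuous_finsum (fun x => (hψ x).pow 2) fun y => ?_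
    refine ⟨Metric.ball y 1, Metric.ball_mem_nhds y one_pos, ?_⟩
    refine (hX.finite_near hgeom y (2 * δ + 1)).subset ?_
    rintro x ⟨z, hz1, hz2⟩
    have hz3 : ψ x z ≠ 0 := fun h => hz1 (by simp [h])
    have h8 := hψ0 x z hz3
    rw [Metric.mem_ball, dist_comm] at hz2
    have := dist_triangle y z x
    exact (show dist y x ≤ _ by linarith)
  have hfin : ∀ y (s : Finset X), (∀ x, ψ x y ≠ 0 → x ∈ s) → ∑ x ∈ s, ψ x y ^ 2 = S y := by
    intro y s hs
    refine (finsum_eq_sum_of_support_subset _ fun x hx => hs x fun h => hx ?_).symm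
    simp [h]
  have hSpos : ∀ y, 0 < S y := by
    intro y
    obtain ⟨x₀, hx₀, h8⟩ := hX.dense y
    have hf : {x : X | ψ x y ≠ 0}.Finite :=
      (hX.finite_near hgeom y (2 * δ)).subset fun x hx => (hψ0 x y hx).le
    rw [← hfin y hf.toFinset fun x hx => by simpa using hx]
    have h9 : 0 < ψ ⟨x₀, hx₀⟩ y := lt_max_of_lt_right (by simp only; linarith)
    refine Finset.sum_pos' (fun x _ => sq_nonneg _) ⟨⟨x₀, hx₀⟩, ?_, by positivity⟩
    simpa using h9.ne'
  have hφ : ∀ x, Continuous fun y => ψ x y / √(S y) := fun x =>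
    (hψ x).div (hS.sqrt) fun y => (Real.sqrt_pos.2 (hSpos y)).ne'
  have hne : ∀ x y, ψ x y / √(S y) ≠ 0 ↔ ψ x y ≠ 0 := fun x y => by
    rw [div_ne_zero_iff]; exact ⟨fun h => h.1, fun h => ⟨h, (Real.sqrt_pos.2 (hSpos y)).ne'⟩⟩
  exact ⟨{
    isClosed := hY₀, pos := hδ, disc := hX, geom := hgeom, sc := sc, ρ := ρ, sc_continuous := h1
    sc_mem := h2, sc_zero := h3, sc_bounded := h4, sc_dist := h5, ρ_mono := h6, ρ_tendsto := h7
    φ := fun x => ⟨_, hφ x⟩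
    φ_nonneg := fun x y => div_nonneg (le_max_left _ _) (Real.sqrt_nonneg _)
    φ_dist := fun x y h => hψ0 x y ((hne x y).1 h)
    φ_sum := fun y s hs => by
      simp only [ContinuousMap.coe_mk, div_pow, ← Finset.sum_div]
      rw [hfin y s fun x hx => hs x ((hne x y).2 hx), Real.sq_sqrt (hSpos y).le, div_self (hSpos y).ne']
    ι := fun x => i x + 1
    ι_injective := fun x y h => hi (by simpa using h)
    ι_ne_zero := fun x => Nat.succ_ne_zero _ }⟩

namespace Geometry
variable (G : Geometry Y Y₀ δ X)

lemma finite_near (G : Geometry Y Y₀ δ X) (y : Y) (r : ℝ) : {x : X | dist y x ≤ r}.Finite := G.disc.finite_near G.geom y r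

lemma φ_finite (y : Y) : {x : X | G.φ x y ≠ 0}.Finite :=
  (G.finite_near y (2 * δ)).subset fun x hx => (G.φ_dist x y hx).le

lemma φ_le_one (x : X) (y : Y) : G.φ x y ≤ 1 := by
  classical
  have h := G.φ_sum y (insert x (G.φ_finite y).toFinset) fun x hx =>
    Finset.mem_insert_of_mem (by simpa using hx)
  have h1 : G.φ x y ^ 2 ≤ 1 := by
    rw [← h]
    exact Finset.single_le_sum (f := fun x => G.φ x y ^ 2) (fun x _ => sq_nonneg _)
      (Finset.mem_insert_self _ _)
  nlinarith [G.φ_nonneg x y]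

/-- Matrices of finite propagation with uniformly bounded entries define operators. -/
lemma exists_op (G : Geometry Y Y₀ δ X) (R : ℝ) : ∃ N : ℕ, ∀ {B : Type u} [NonUnitalCStarAlgebra B] (m : X → X → B) (ε : ℝ),
    0 ≤ ε → (∀ x y, m x y ≠ 0 → dist x y ≤ R) → (∀ x y, ‖m x y‖ ≤ ε) →
    ∃ S : CtrlAlg B (metricFamily X), (∀ x y, entry S.op x y = m x y) ∧ ‖S‖ ≤ N * ε := by
  obtain ⟨N, hN⟩ := G.geom.exists_card R
  refine ⟨N, fun m ε hε hR hm => ?_⟩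
  obtain ⟨S, hS, hn⟩ := exists_colOp_of_card m N hε
    (fun x => by
      obtain ⟨F, h1, h2⟩ := hN x
      exact ⟨F, h1, fun y hy => h2 y (hR x y hy)⟩)
    (fun y => by
      obtain ⟨F, h1, h2⟩ := hN y
      exact ⟨F, h1, fun x hx => h2 x (by rw [dist_comm]; exact hR x y hx)⟩) hm
  refine ⟨⟨S, subset_closure ⟨{p | dist p.1 p.2 ≤ R}, ⟨R, fun p hp => hp⟩, fun x y h => ?_⟩⟩, hS, hn⟩
  rw [hS] at h
  exact hR x y h

lemma mem_thickening_nearPoints (G : Geometry Y Y₀ δ X) {r : ℝ} {x : X} (h : (x : Y) ∈ Metric.thickening r Y₀) :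
    x ∈ Metric.thickening (r + δ) (nearPoints δ X Y₀) := by
  obtain ⟨y, hy, hxy⟩ := Metric.mem_thickening_iff.1 h
  obtain ⟨x', hx', hd⟩ := G.disc.dense y
  refine Metric.mem_thickening_iff.2 ⟨⟨x', hx'⟩, Metric.mem_thickening_iff.2 ⟨y, hy, ?_⟩, ?_⟩
  · rwa [dist_comm]
  · have := dist_triangle (x : Y) y x'
    exact (show dist (x : Y) x' < _ by linarith)

lemma mem_thickening_of_nearPoints {r : ℝ} {x : X} (h : x ∈ Metric.thickening r (nearPoints δ X Y₀)) :
    (x : Y) ∈ Metric.thickening (r + δ) Y₀ := by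
  obtain ⟨x', hx', hd⟩ := Metric.mem_thickening_iff.1 h
  obtain ⟨y, hy, hxy⟩ := Metric.mem_thickening_iff.1 hx'
  refine Metric.mem_thickening_iff.2 ⟨y, hy, ?_⟩
  have := dist_triangle (x : Y) x' y
  have h1 : dist (x : Y) x' < r := hd
  linarith

lemma exists_sc_dist_le (R : ℝ) : ∃ C : ℝ, ∀ t y z, dist y z ≤ R → dist (G.sc t y) (G.sc t z) ≤ C := by
  obtain ⟨C, hC⟩ := (G.ρ_tendsto R.toNNReal).1
  refine ⟨C, fun t y z h => ?_⟩
  have h1 : nndist y z ≤ R.toNNReal := by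
    rw [← NNReal.coe_le_coe, coe_nndist]; exact h.trans (Real.le_coe_toNNReal R)
  have h2 := (G.sc_dist t y z).trans ((G.ρ_mono t h1).trans (hC ⟨t, rfl⟩))
  rw [← coe_nndist]; exact_mod_cast h2

lemma eventually_sc_dist_lt (R : ℝ) {ε : ℝ} (hε : 0 < ε) :
    ∀ᶠ t in atTop, ∀ y z, dist y z ≤ R → dist (G.sc t y) (G.sc t z) < ε := by
  have h := (G.ρ_tendsto R.toNNReal).2.eventually (gt_mem_nhds (show 0 < ε.toNNReal by simpa using hε))
  filter_upwards [h] with t ht y z hyz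
  have h1 : nndist y z ≤ R.toNNReal := by
    rw [← NNReal.coe_le_coe, coe_nndist]; exact hyz.trans (Real.le_coe_toNNReal R)
  have h2 := ((G.sc_dist t y z).trans (G.ρ_mono t h1)).trans_lt ht
  rw [← coe_nndist]
  exact (Real.lt_toNNReal_iff_coe_lt).1 h2

variable {E : Type*} [NonUnitalCStarAlgebra E]

/-- Functions vanishing at infinity vary slowly after scaling. -/
lemma eventually_norm_sub_le (f : C0Pair Y Y₀ E) (R : ℝ) {ε : ℝ} (hε : 0 < ε) :
    ∀ᶠ t in atTop, ∀ y z, dist y z ≤ R → ‖f.fn (G.sc t y) - f.fn (G.sc t z)‖ ≤ ε := by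
  obtain ⟨η, hη, h⟩ := Metric.uniformContinuous_iff.1
    (ZeroAtInftyContinuousMap.uniformContinuous f.fn) ε hε
  filter_upwards [G.eventually_sc_dist_lt R hη] with t ht y z hyz
  rw [← dist_eq_norm]
  exact (h (ht y z hyz)).le

lemma fn_eq_zero (f : C0Pair Y Y₀ E) {y : Y} (hy : y ∈ Y₀) : f.fn y = 0 := f.2 y hy

/-- Functions vanishing on the subspace become small near it after scaling. -/
lemma eventually_norm_le (f : C0Pair Y Y₀ E) (R : ℝ) {ε : ℝ} (hε : 0 < ε) :
    ∀ᶠ t in atTop, ∀ y ∈ Metric.thickening R Y₀, ‖f.fn (G.sc t y)‖ ≤ ε := by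
  filter_upwards [G.eventually_norm_sub_le f R hε] with t ht y hy
  obtain ⟨z, hz, hyz⟩ := Metric.mem_thickening_iff.1 hy
  have := ht y z hyz.le
  rwa [fn_eq_zero f (G.sc_mem t z hz), sub_zero] at this

lemma sc_continuous_left (t : ℝ≥0) : Continuous (G.sc t) :=
  G.sc_continuous.comp (Continuous.prodMk continuous_id continuous_const)

/-- Outside a bounded set, all functions `f ∘ sc_t` with bounded `t` are small. -/
lemma exists_isBounded [ProperSpace Y] (f : C0Pair Y Y₀ E) (T : ℝ≥0) {ε : ℝ} (hε : 0 < ε) :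
    ∃ K : Set Y, Bornology.IsBounded K ∧ ∀ t ≤ T, ∀ y ∉ K, ‖f.fn (G.sc t y)‖ < ε := by
  have h1 := Metric.tendsto_nhds.1 f.fn.zero_at_infty' ε hε
  rw [← Metric.cobounded_eq_cocompact] at h1
  have h2 : Bornology.IsBounded {y | ¬ dist (f.fn y) 0 < ε} := by
    rw [Bornology.isBounded_def]
    filter_upwards [h1] with y hy
    exact not_not.2 hy
  refine ⟨_, G.sc_bounded _ h2 (T + 1) (by positivity), fun t ht y hy => ?_⟩
  by_contra hne
  refine hy (Set.mem_iUnion₂.2 ⟨t, ⟨zero_le, ht.trans (by simp)⟩, ?_⟩)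
  change ¬ dist (f.fn (G.sc t y)) 0 < ε
  rwa [dist_zero_right]

/-- The `*`-endomorphism `f ↦ f ∘ sc_t`. -/
def scHom [ProperSpace Y] (t : ℝ≥0) : C0Pair Y Y₀ E →⋆ₙₐ[ℂ] C0Pair Y Y₀ E where
  toFun f := ⟨⟨⟨fun y => f.fn (G.sc t y), f.fn.continuous.comp (G.sc_continuous_left t)⟩, by
      refine Metric.tendsto_nhds.2 fun ε hε => ?_
      obtain ⟨K, hK, h⟩ := G.exists_isBounded f t hε
      rw [← Metric.cobounded_eq_cocompact]
      filter_upwards [show Kᶜ ∈ Bornology.cobounded Y from hK] with y hy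
      rw [dist_zero_right]
      exact h t le_rfl y hy⟩,
    fun y hy => fn_eq_zero f (G.sc_mem t y hy)⟩
  map_smul' c f := rfl
  map_zero' := rfl
  map_add' f g := rfl
  map_mul' f g := rfl
  map_star' f := rfl

@[simp] lemma scHom_apply [ProperSpace Y] (t : ℝ≥0) (f : C0Pair Y Y₀ E) (y : Y) :
    (G.scHom t f).fn y = f.fn (G.sc t y) := rfl

lemma norm_fn_le (f : C0Pair Y Y₀ E) (y : Y) : ‖f.fn y‖ ≤ ‖f‖ :=
  f.fn.toBCF.norm_coe_le_norm y

lemma norm_le_of_fn {f : C0Pair Y Y₀ E} {C : ℝ} (hC : 0 ≤ C) (h : ∀ y, ‖f.fn y‖ ≤ C) : ‖f‖ ≤ C :=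
  (BoundedContinuousFunction.norm_le hC).2 h

lemma continuous_scHom [ProperSpace Y] (f : C0Pair Y Y₀ E) : Continuous fun t => G.scHom t f := by
  rw [Metric.continuous_iff']
  intro t₀ ε hε
  obtain ⟨K, hK, h⟩ := G.exists_isBounded f (t₀ + 1) (show 0 < ε / 4 by positivity)
  let g : C(ℝ≥0, C(Y, E)) := ContinuousMap.curry ⟨fun p : ℝ≥0 × Y => f.fn (G.sc p.1 p.2),
    f.fn.continuous.comp (G.sc_continuous.comp continuous_swap)⟩
  have hg := ContinuousMap.tendsto_iff_forall_isCompact_tendstoUniformlyOn.1 (g.continuous.tendsto t₀)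
    (closure K) hK.isCompact_closure
  filter_upwards [Metric.tendstoUniformlyOn_iff.1 hg (ε / 2) (half_pos hε),
    gt_mem_nhds (show t₀ < t₀ + 1 by simp)] with t ht htt
  rw [dist_eq_norm]
  refine lt_of_le_of_lt (norm_le_of_fn (half_pos hε).le fun y => ?_) (half_lt_self hε)
  change ‖f.fn (G.sc t y) - f.fn (G.sc t₀ y)‖ ≤ ε / 2
  by_cases hy : y ∈ K
  · have := ht y (subset_closure hy)
    rw [dist_comm, dist_eq_norm] at this
    exact this.le
  · have h1 := h t htt.le y hy
    have h2 := h t₀ (by simp) y hy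
    exact (norm_sub_le _ _).trans (by linarith)

/-- The function `t ↦ f ∘ sc_t`. -/
def scFun [ProperSpace Y] : C0Pair Y Y₀ E →⋆ₙₐ[ℂ] (ℝ≥0 →ᵇ C0Pair Y Y₀ E) where
  toFun f := BoundedContinuousFunction.ofNormedAddCommGroup _ (G.continuous_scHom f) ‖f‖ fun t =>
    NonUnitalStarAlgHom.norm_apply_le (G.scHom t) f
  map_smul' c f := rfl
  map_zero' := rfl
  map_add' f g := rfl
  map_mul' f g := rfl
  map_star' f := rfl

lemma scHom_zero [ProperSpace Y] (f : C0Pair Y Y₀ E) : G.scHom 0 f = f :=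
  C0Pair.ext' fun y => by rw [scHom_apply, G.sc_zero]

end Geometry

end Geometry

/-! ### Functions vanishing at infinity -/

section Tensors
open scoped ZeroAtInfty BoundedContinuousFunction
variable {Y : Type u} [MetricSpace Y] {Y₀ : Set Y} {E : Type*} [NonUnitalCStarAlgebra E]

namespace C0Pair

@[simp] lemma fn_add (f g : C0Pair Y Y₀ E) (y : Y) : (f + g).fn y = f.fn y + g.fn y := rfl
@[simp] lemma fn_sub (f g : C0Pair Y Y₀ E) (y : Y) : (f - g).fn y = f.fn y - g.fn y := rfl
@[simp] lemma fn_mul (f g : C0Pair Y Y₀ E) (y : Y) : (f * g).fn y = f.fn y * g.fn y := rfl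
@[simp] lemma fn_smul (c : ℂ) (f : C0Pair Y Y₀ E) (y : Y) : (c • f).fn y = c • f.fn y := rfl
@[simp] lemma fn_star (f : C0Pair Y Y₀ E) (y : Y) : (star f).fn y = star (f.fn y) := rfl
@[simp] lemma fn_zero (y : Y) : (0 : C0Pair Y Y₀ E).fn y = 0 := rfl

lemma fn_sum {ι : Type*} (s : Finset ι) (f : ι → C0Pair Y Y₀ E) (y : Y) :
    (∑ i ∈ s, f i).fn y = ∑ i ∈ s, (f i).fn y := by
  classical
  induction s using Finset.induction_on with
  | empty => rfl
  | insert i s hi ih => rw [Finset.sum_insert hi, Finset.sum_insert hi, fn_add, ih]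

/-- A continuous function supported in a compact set which avoids the subspace. -/
def ofCompact (f : C(Y, E)) (hf : HasCompactSupport f) (h0 : ∀ y ∈ Y₀, f y = 0) : C0Pair Y Y₀ E :=
  ⟨⟨f, by
    refine tendsto_const_nhds.congr' ?_
    rw [EventuallyEq, Filter.eventually_iff]
    refine mem_of_superset (mem_cocompact.2 ⟨_, hf.isCompact, subset_rfl⟩) fun y hy => ?_
    exact (image_eq_zero_of_notMem_tsupport hy).symm⟩, h0⟩

/-- The elementary tensor `f ⊗ a`. -/
def tens (f : C0Pair Y Y₀ ℂ) (a : E) : C0Pair Y Y₀ E :=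
  ⟨⟨⟨fun y => f.fn y • a, by have := f.fn.continuous; fun_prop⟩, by
    have h : Tendsto (fun y => f.fn y • a) (cocompact Y) (𝓝 ((0 : ℂ) • a)) :=
      Tendsto.smul_const (show Tendsto f.fn (cocompact Y) (𝓝 0) from f.fn.zero_at_infty') a
    rw [zero_smul] at h
    exact h⟩,
    fun y hy => by
      change f.fn y • a = 0
      rw [Geometry.fn_eq_zero f hy, zero_smul]⟩

@[simp] lemma tens_fn (f : C0Pair Y Y₀ ℂ) (a : E) (y : Y) : (tens f a).fn y = f.fn y • a := rfl

/-- Approximation of finitely many functions by a partition of unity. -/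
lemma exists_partition [ProperSpace Y] (hY₀ : IsClosed Y₀) {n : ℕ} (g : Fin n → C0Pair Y Y₀ E) {ε : ℝ}
    (hε : 0 < ε) : ∃ (m : ℕ) (ψ : Fin m → C0Pair Y Y₀ ℂ) (p : Fin m → Y),
      (∀ j, star (ψ j) = ψ j) ∧ (∀ y, ∑ j, ‖(ψ j).fn y‖ ^ 2 ≤ 1) ∧
      ∀ i y, ‖(g i).fn y - ∑ j, (ψ j).fn y ^ 2 • (g i).fn (p j)‖ ≤ ε := by
  let K : Set Y := ⋃ i, {y | ε ≤ ‖(g i).fn y‖}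
  have hKc : IsClosed K := isClosed_iUnion_of_finite fun i =>
    isClosed_le continuous_const (g i).fn.continuous.norm
  have hK : IsCompact K := by
    refine isCompact_iUnion fun i => ?_
    refine Metric.isCompact_of_isClosed_isBounded
      (isClosed_le continuous_const (g i).fn.continuous.norm) ?_
    have h1 := Metric.tendsto_nhds.1 (g i).fn.zero_at_infty' ε hε
    rw [← Metric.cobounded_eq_cocompact] at h1
    rw [Bornology.isBounded_def]
    filter_upwards [h1] with y hy
    rw [dist_zero_right] at hy
    exact not_le.2 hy
  let V : Y → Set Y := fun q => (⋂ i, {y | ‖(g i).fn y - (g i).fn q‖ < ε}) ∩ Y₀ᶜ ∩ Metric.ball q 1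
  have hV : ∀ q, IsOpen (V q) := fun q => by
    refine ((isOpen_iInter_of_finite fun i => ?_).inter hY₀.isOpen_compl).inter Metric.isOpen_ball
    exact isOpen_lt (((g i).fn.continuous.sub continuous_const).norm) continuous_const
  obtain ⟨t, htK, ht⟩ := hK.elim_finite_subcover_image (b := K) (c := V) (fun q _ => hV q) (by
    intro y hy
    refine Set.mem_iUnion₂.2 ⟨y, hy, ⟨?_, ?_⟩, Metric.mem_ball_self one_pos⟩
    · refine Set.mem_iInter.2 fun i => ?_
      simpa using hε
    · intro hy0
      obtain ⟨i, hi⟩ := Set.mem_iUnion.1 hy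
      have hi' : ε ≤ ‖(g i).fn y‖ := hi
      rw [Geometry.fn_eq_zero (g i) hy0, norm_zero] at hi'
      exact absurd hi' (not_le.2 hε))
  have htf : Finite t := ht.1
  obtain ⟨m, ⟨e⟩⟩ := Finite.exists_equiv_fin t
  let p : Fin m → Y := fun j => (e.symm j : Y)
  obtain ⟨f, hf⟩ := PartitionOfUnity.exists_isSubordinate hKc (fun j => V (p j)) (fun j => hV _) (by
    intro y hy
    obtain ⟨q, hq, hyq⟩ := Set.mem_iUnion₂.1 (ht.2 hy)
    refine Set.mem_iUnion.2 ⟨e ⟨q, hq⟩, ?_⟩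
    simpa [p] using hyq)
  have hVf : ∀ j y, f j y ≠ 0 → y ∈ V (p j) := fun j y h => hf j (subset_tsupport _ h)
  have hsqrt : ∀ j y, √(f j y) ≠ 0 → f j y ≠ 0 := fun j y h h0 => h (by rw [h0, Real.sqrt_zero])
  let ψ : Fin m → C0Pair Y Y₀ ℂ := fun j => ofCompact
    ⟨fun y => ((√(f j y) : ℝ) : ℂ), by have := (f j).continuous; fun_prop⟩
    (by
      refine HasCompactSupport.intro (isCompact_closedBall (p j) 1) fun y hy => ?_
      by_contra hne
      have : f j y ≠ 0 := fun h0 => hne (by simp [h0])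
      exact hy (Metric.ball_subset_closedBall (hVf j y this).2))
    (fun y hy => by
      by_contra hne
      have : f j y ≠ 0 := fun h0 => hne (by simp [h0])
      exact (hVf j y this).1.2 hy)
  have hψ : ∀ j y, (ψ j).fn y = ((√(f j y) : ℝ) : ℂ) := fun j y => rfl
  have hψ2 : ∀ j y, (ψ j).fn y ^ 2 = ((f j y : ℝ) : ℂ) := fun j y => by
    rw [hψ, ← Complex.ofReal_pow, Real.sq_sqrt (f.nonneg j y)]
  have hsum : ∀ y, ∑ j, f j y ≤ 1 := fun y => by
    have := f.sum_le_one y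
    rwa [finsum_eq_sum_of_fintype] at this
  refine ⟨m, ψ, p, fun j => ?_, fun y => ?_, fun i y => ?_⟩
  · refine C0Pair.ext' fun y => ?_
    rw [fn_star, hψ, Complex.star_def, Complex.conj_ofReal]
  · refine le_of_eq_of_le (Finset.sum_congr rfl fun j _ => ?_) (hsum y)
    rw [← norm_pow, hψ2, Complex.norm_real, Real.norm_of_nonneg (f.nonneg j y)]
  · simp only [hψ2]
    have e1 : (g i).fn y - ∑ j, ((f j y : ℝ) : ℂ) • (g i).fn (p j) =
        ((1 - ∑ j, f j y : ℝ) : ℂ) • (g i).fn y +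
          ∑ j, ((f j y : ℝ) : ℂ) • ((g i).fn y - (g i).fn (p j)) := by
      simp only [smul_sub, Finset.sum_sub_distrib, ← Finset.sum_smul]
      push_cast
      rw [sub_smul, one_smul]
      abel
    rw [e1]
    have h1 : ‖((1 - ∑ j, f j y : ℝ) : ℂ) • (g i).fn y‖ ≤ (1 - ∑ j, f j y) * ε := by
      rw [norm_smul, Complex.norm_real, Real.norm_of_nonneg (by linarith [hsum y])]
      by_cases hy : y ∈ K
      · have := f.sum_eq_one hy
        rw [finsum_eq_sum_of_fintype] at this
        simp [this]
      · refine mul_le_mul_of_nonneg_left ?_ (by linarith [hsum y])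
        by_contra hne
        exact hy (Set.mem_iUnion.2 ⟨i, (not_le.1 hne).le⟩)
    have h2 : ‖∑ j, ((f j y : ℝ) : ℂ) • ((g i).fn y - (g i).fn (p j))‖ ≤ (∑ j, f j y) * ε := by
      rw [Finset.sum_mul]
      refine norm_sum_le_of_le _ fun j _ => ?_
      rw [norm_smul, Complex.norm_real, Real.norm_of_nonneg (f.nonneg j y)]
      by_cases hj : f j y = 0
      · simp [hj]
      · have := Set.mem_iInter.1 (hVf j y hj).1.1 i
        exact mul_le_mul_of_nonneg_left (le_of_lt this) (f.nonneg j y)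
    refine (norm_add_le _ _).trans ((add_le_add h1 h2).trans (le_of_eq ?_))
    ring

/-- Sums of elementary tensors are dense. -/
lemma exists_tens [ProperSpace Y] (hY₀ : IsClosed Y₀) (g : C0Pair Y Y₀ E) {ε : ℝ} (hε : 0 < ε) :
    ∃ (m : ℕ) (f : Fin m → C0Pair Y Y₀ ℂ) (a : Fin m → E), ‖g - ∑ j, tens (f j) (a j)‖ < ε := by
  obtain ⟨m, ψ, p, -, -, h⟩ := exists_partition hY₀ (fun _ : Fin 1 => g) (half_pos hε)
  refine ⟨m, fun j => ψ j * ψ j, fun j => g.fn (p j), ?_⟩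
  refine lt_of_le_of_lt (Geometry.norm_le_of_fn (half_pos hε).le fun y => ?_) (half_lt_self hε)
  rw [fn_sub, fn_sum]
  have := h 0 y
  simpa only [tens_fn, fn_mul, sq] using this

/-- `C₀(Y, Y₀, A)` is separable if `A` is. -/
theorem separableSpace [ProperSpace Y] [TopologicalSpace.SeparableSpace E] :
    TopologicalSpace.SeparableSpace (C0Pair Y Y₀ E) := by
  rcases isEmpty_or_nonempty Y with hY | ⟨⟨y₀⟩⟩
  · have : Subsingleton (C0Pair Y Y₀ E) := ⟨fun f g => C0Pair.ext' fun y => isEmptyElim y⟩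
    infer_instance
  have : SecondCountableTopology E := UniformSpace.secondCountable_of_separable E
  let S : ℕ → Set (C0Pair Y Y₀ E) := fun n => {f | ∀ y, f.fn y ≠ 0 → y ∈ Metric.closedBall y₀ n}
  have hS : ∀ n, TopologicalSpace.IsSeparable (S n) := by
    intro n
    have : CompactSpace (Metric.closedBall y₀ n) := isCompact_iff_compactSpace.1 (isCompact_closedBall _ _)
    let r : S n → C(Metric.closedBall y₀ n, E) := fun f => ⟨fun y => f.1.fn y, by
      have := f.1.fn.continuous; fun_prop⟩
    have hr : Isometry r := by
      refine Isometry.of_dist_eq fun f g => le_antisymm ?_ ?_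
      · refine (ContinuousMap.dist_le dist_nonneg).2 fun y => ?_
        change dist (f.1.fn y) (g.1.fn y) ≤ dist f.1 g.1
        rw [dist_eq_norm, dist_eq_norm]
        exact Geometry.norm_fn_le (f.1 - g.1) y
      · change dist f.1 g.1 ≤ _
        rw [dist_eq_norm]
        refine Geometry.norm_le_of_fn dist_nonneg fun y => ?_
        by_cases hy : y ∈ Metric.closedBall y₀ n
        · rw [fn_sub, ← dist_eq_norm]
          exact ContinuousMap.dist_apply_le_dist (f := r f) (g := r g) ⟨y, hy⟩
        · have h1 : f.1.fn y = 0 := by by_contra h; exact hy (f.2 y h)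
          have h2 : g.1.fn y = 0 := by by_contra h; exact hy (g.2 y h)
          rw [fn_sub, h1, h2, sub_zero, norm_zero]
          exact dist_nonneg
    have : SecondCountableTopology (S n) := hr.isUniformInducing.isInducing.secondCountableTopology
    exact TopologicalSpace.IsSeparable.of_subtype (S n)
  have hU : TopologicalSpace.IsSeparable (closure (⋃ n, S n)) :=
    (TopologicalSpace.IsSeparable.iUnion hS).closure
  rw [← TopologicalSpace.isSeparable_univ_iff]
  refine hU.mono fun f _ => Metric.mem_closure_iff.2 fun ε hε => ?_
  have h1 := Metric.tendsto_nhds.1 f.fn.zero_at_infty' (ε / 2) (half_pos hε)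
  rw [← Metric.cobounded_eq_cocompact] at h1
  obtain ⟨r, hr⟩ := (Metric.isBounded_iff_subset_closedBall y₀).1 (show Bornology.IsBounded
    {y | ¬ dist (f.fn y) 0 < ε / 2} by
      rw [Bornology.isBounded_def]
      filter_upwards [h1] with y hy
      exact not_not.2 hy)
  obtain ⟨n, hn⟩ := exists_nat_ge r
  let w : Y → ℝ := fun y => max 0 (min 1 ((n : ℝ) + 1 - dist y y₀))
  have hw0 : ∀ y, 0 ≤ w y := fun y => le_max_left _ _
  have hw1 : ∀ y, w y ≤ 1 := fun y => max_le zero_le_one (min_le_left _ _)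
  let f' : C0Pair Y Y₀ E := ofCompact ⟨fun y => ((w y : ℝ) : ℂ) • f.fn y, by
      have := f.fn.continuous; fun_prop⟩
    (by
      refine HasCompactSupport.intro (isCompact_closedBall y₀ ((n : ℝ) + 1)) fun y hy => ?_
      have : w y = 0 := max_eq_left ((min_le_right _ _).trans (by
        rw [Metric.mem_closedBall] at hy; linarith))
      simp [this])
    (fun y hy => by
      change ((w y : ℝ) : ℂ) • f.fn y = 0
      rw [Geometry.fn_eq_zero f hy, smul_zero])
  refine ⟨f', Set.mem_iUnion.2 ⟨n + 1, fun y hy => ?_⟩, ?_⟩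
  · by_contra hne
    apply hy
    have : w y = 0 := max_eq_left ((min_le_right _ _).trans (by
      rw [Metric.mem_closedBall] at hne; push_cast at hne; linarith))
    change ((w y : ℝ) : ℂ) • f.fn y = 0
    simp [this]
  · rw [dist_eq_norm]
    refine lt_of_le_of_lt (Geometry.norm_le_of_fn (half_pos hε).le fun y => ?_) (half_lt_self hε)
    have e : (f - f').fn y = ((1 - w y : ℝ) : ℂ) • f.fn y := by
      change f.fn y - ((w y : ℝ) : ℂ) • f.fn y = _
      push_cast
      rw [sub_smul, one_smul]
    rw [e, norm_smul, Complex.norm_real, Real.norm_of_nonneg (by linarith [hw1 y])]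
    by_cases hy : dist (f.fn y) 0 < ε / 2
    · rw [dist_zero_right] at hy
      exact (mul_le_of_le_one_left (norm_nonneg _) (by linarith [hw0 y])).trans hy.le
    · have h2 : dist y y₀ ≤ r := hr hy
      have : w y = 1 := by
        simp only [w]
        rw [min_eq_left (by linarith), max_eq_right zero_le_one]
      simp only [this, sub_self, zero_mul]
      positivity

end C0Pair

end Tensors

/-! ### The uniform Roe algebra functor -/

section RoeFunctor
variable {W : Type*} {B C : Type*} [NonUnitalCStarAlgebra B] [NonUnitalCStarAlgebra C]

lemma cut_sub {g h : W → ℂ} (hg : Bdd g) (hh : Bdd h) (S T : ColOp W B) :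
    cut g (S - T) h = cut g S h - cut g T h := entry_ext fun x y => by
  rw [entry_cut hg hh, entry_sub, entry_sub, entry_cut hg hh, entry_cut hg hh, smul_sub]

lemma CtrlAlg.op_sub {E : ControlFamily W} (S T : CtrlAlg B E) : (S - T).op = S.op - T.op := rfl

lemma CtrlAlg.entry_ext {E : ControlFamily W} {S T : CtrlAlg B E}
    (h : ∀ x y, entry S.op x y = entry T.op x y) : S = T :=
  CtrlAlg.op_injective (AsympAdj.entry_ext h)

lemma CtrlAlg.norm_entry_le {E : ControlFamily W} (T : CtrlAlg B E) (x y : W) :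
    ‖entry T.op x y‖ ≤ ‖T‖ := AsympAdj.norm_entry_le T.op x y

/-- An element of the algebra is approximated by controlled matrices. -/
lemma CtrlAlg.exists_ctrl {E : ControlFamily W} (T : CtrlAlg B E) {ε : ℝ} (hε : 0 < ε) :
    ∃ S : CtrlAlg B E, S.op ∈ ctrl B E ∧ ‖T - S‖ < ε := by
  obtain ⟨b, hb, hab⟩ := Metric.mem_closure_iff.1 T.mem_closure ε hε
  refine ⟨⟨b, subset_closure hb⟩, hb, ?_⟩
  rw [dist_eq_norm] at hab
  exact hab

lemma CtrlAlg.exists_cut {E : ControlFamily W} (T : CtrlAlg B E) {g h : W → ℂ} (hg : Bdd g)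
    (hh : Bdd h) : ∃ S : CtrlAlg B E, S.op = cut g T.op h := by
  suffices h1 : cut g T.op h ∈ closure (ctrl B E : Set (ColOp W B)) from ⟨⟨_, h1⟩, rfl⟩
  obtain ⟨K, hK0, hK⟩ := hg.exists_nonneg
  obtain ⟨L, hL0, hL⟩ := hh.exists_nonneg
  refine Metric.mem_closure_iff.2 fun ε hε => ?_
  obtain ⟨S, ⟨F, hF, hS⟩, hTS⟩ := T.exists_ctrl (ε := ε / (K * L + 1)) (by positivity)
  refine ⟨cut g S.op h, ⟨F, hF, fun x y hxy => hS x y fun h0 => hxy ?_⟩, ?_⟩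
  · rw [entry_cut hg hh, h0, smul_zero]
  · rw [dist_eq_norm, ← cut_sub hg hh]
    refine (norm_cut_le hK0 hL0 hK hL _).trans_lt ?_
    have h2 : ‖T.op - S.op‖ < ε / (K * L + 1) := hTS
    rw [lt_div_iff₀ (by positivity)] at h2
    nlinarith [norm_nonneg (T.op - S.op), mul_nonneg hK0 hL0]

open Classical in
/-- The characteristic function of a set. -/
def charFn (s : Set W) (x : W) : ℂ := if x ∈ s then 1 else 0

lemma norm_charFn_le (s : Set W) (x : W) : ‖charFn s x‖ ≤ 1 := by
  unfold charFn; split_ifs <;> simp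

lemma bdd_charFn (s : Set W) : Bdd (charFn s) := ⟨1, norm_charFn_le s⟩

lemma charFn_of_mem {s : Set W} {x : W} (h : x ∈ s) : charFn s x = 1 := if_pos h

lemma charFn_of_notMem {s : Set W} {x : W} (h : x ∉ s) : charFn s x = 0 := if_neg h

lemma mem_of_charFn_ne_zero {s : Set W} {x : W} (h : charFn s x ≠ 0) : x ∈ s := by
  by_contra hx; exact h (charFn_of_notMem hx)

lemma mem_ctrl_metric [PseudoMetricSpace W] {T : ColOp W B} :
    T ∈ ctrl B (metricFamily W) ↔ ∃ R : ℝ, ∀ x y, entry T x y ≠ 0 → dist x y ≤ R := by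
  constructor
  · rintro ⟨F, ⟨R, hR⟩, hF⟩
    exact ⟨R, fun x y h => hR _ (hF x y h)⟩
  · rintro ⟨R, hR⟩
    exact ⟨{p | dist p.1 p.2 ≤ R}, ⟨R, fun p hp => hp⟩, hR⟩

/-- An operator supported near a subset is approximated by such operators of finite propagation. -/
lemma exists_ctrl_near [PseudoMetricSpace W] {W₀ : Set W} {T : CtrlAlg B (metricFamily W)}
    (hT : T ∈ nearAlg B W₀) {ε : ℝ} (hε : 0 < ε) :
    ∃ S ∈ nearAlg B W₀, S.op ∈ ctrl B (metricFamily W) ∧ ‖T - S‖ < ε := by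
  obtain ⟨R, hR⟩ := hT
  obtain ⟨S, hS, hTS⟩ := T.exists_ctrl hε
  let χ := charFn (Metric.thickening R W₀)
  have hχ : Bdd χ := bdd_charFn _
  obtain ⟨S', hS'⟩ := S.exists_cut hχ hχ
  refine ⟨S', ⟨R, fun x y h => ?_⟩, ?_, ?_⟩
  · rw [hS', entry_cut hχ hχ] at h
    have h1 := left_ne_zero_of_smul h
    exact ⟨mem_of_charFn_ne_zero (left_ne_zero_of_mul h1),
      mem_of_charFn_ne_zero (right_ne_zero_of_mul h1)⟩
  · obtain ⟨F, hF, hSF⟩ := hS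
    refine ⟨F, hF, fun x y h => hSF x y fun h0 => h ?_⟩
    rw [hS', entry_cut hχ hχ, h0, smul_zero]
  · have e : T.op = cut χ T.op χ := entry_ext fun x y => by
      rw [entry_cut hχ hχ]
      by_cases h0 : entry T.op x y = 0
      · rw [h0, smul_zero]
      · rw [show χ x = 1 from charFn_of_mem (hR x y h0).1, show χ y = 1 from charFn_of_mem (hR x y h0).2,
          mul_one, one_smul]
    refine lt_of_le_of_lt ?_ hTS
    change ‖T.op - S'.op‖ ≤ ‖T.op - S.op‖
    rw [hS', e, ← cut_sub hχ hχ, ← e]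
    simpa using norm_cut_le zero_le_one zero_le_one (norm_charFn_le _) (norm_charFn_le _) (T.op - S.op)

/-- The ideal is generated by operators of finite propagation supported near the subset. -/
lemma exists_ctrl_of_mem_roeIdeal [PseudoMetricSpace W] {W₀ : Set W} {T : CtrlAlg B (metricFamily W)}
    (hT : T ∈ (roeIdeal B W₀).alg) {ε : ℝ} (hε : 0 < ε) :
    ∃ S ∈ nearAlg B W₀, S.op ∈ ctrl B (metricFamily W) ∧ ‖T - S‖ < ε := by
  obtain ⟨T', hT', h⟩ := Metric.mem_closure_iff.1 hT (ε / 2) (half_pos hε)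
  obtain ⟨S, hS, hS', h'⟩ := exists_ctrl_near hT' (half_pos hε)
  refine ⟨S, hS, hS', ?_⟩
  rw [dist_eq_norm] at h
  have := norm_sub_le_norm_sub_add_norm_sub T T' S
  linarith

lemma mem_roeIdeal_of_forall [PseudoMetricSpace W] {W₀ : Set W} {T : CtrlAlg B (metricFamily W)}
    (h : ∀ ε > 0, ∃ S ∈ (roeIdeal B W₀).alg, ‖T - S‖ < ε) : T ∈ (roeIdeal B W₀).alg := by
  have hc := (roeIdeal B W₀).isClosed.closure_eq
  have : T ∈ closure ((roeIdeal B W₀).alg : Set (CtrlAlg B (metricFamily W))) :=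
    Metric.mem_closure_iff.2 fun ε hε => by
      obtain ⟨S, hS, h1⟩ := h ε hε
      exact ⟨S, hS, by rwa [dist_eq_norm]⟩
  rwa [hc] at this

lemma nearAlg_le_roeIdeal [PseudoMetricSpace W] {W₀ : Set W} {T : CtrlAlg B (metricFamily W)}
    (h : T ∈ nearAlg B W₀) : T ∈ (roeIdeal B W₀).alg := subset_closure h

end RoeFunctor

section RoeQuotient
variable {Y : Type u} [MetricSpace Y] {Y₀ : Set Y} {δ : ℝ} {X : Set Y}

namespace Geometry
variable (G : Geometry Y Y₀ δ X)

lemma countable (G : Geometry Y Y₀ δ X) : Countable X := ⟨G.ι, G.ι_injective⟩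

/-- Entrywise application of a surjection is surjective. -/
lemma map_surjective (G : Geometry Y Y₀ δ X) {D D' : Type u} [NonUnitalCStarAlgebra D] [NonUnitalCStarAlgebra D']
    (q : D →⋆ₙₐ[ℂ] D') (hq : Function.Surjective q) :
    Function.Surjective (CtrlAlg.map (metricFamily X) q) := by
  refine surjective_of_dense _ fun T ε hε => ?_
  obtain ⟨S, hS, hTS⟩ := T.exists_ctrl hε
  obtain ⟨R, hR⟩ := mem_ctrl_metric.1 hS
  have hl : ∀ d : D', ∃ a, q a = d ∧ ‖a‖ ≤ ‖d‖ + 1 := fun d => by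
    obtain ⟨a, rfl⟩ := hq d
    obtain ⟨a', h1, h2⟩ := exists_preimage_norm_lt q a one_pos
    exact ⟨a', h1, h2.le⟩
  choose l hl1 hl2 using hl
  classical
  let m : X → X → D := fun x y => if entry S.op x y = 0 then 0 else l (entry S.op x y)
  obtain ⟨N, hN⟩ := G.exists_op R
  obtain ⟨V, hV, -⟩ := hN m (‖S‖ + 1) (by positivity)
    (fun x y h => hR x y fun h0 => h (if_pos h0)) (fun x y => by
      by_cases h0 : entry S.op x y = 0
      · simp only [m, if_pos h0, norm_zero]; positivity
      · simp only [m, if_neg h0]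
        exact (hl2 _).trans (by have := S.norm_entry_le x y; linarith))
  refine ⟨V, ?_⟩
  have : CtrlAlg.map _ q V = S := CtrlAlg.entry_ext fun x y => by
    rw [CtrlAlg.op_map, entry_colMap, hV]
    by_cases h0 : entry S.op x y = 0
    · simp only [m, if_pos h0, map_zero, h0]
    · simp only [m, if_neg h0, hl1]
  rwa [this]

lemma preservesSurj (G : Geometry Y Y₀ δ X) : PreservesSurj (roeQuot X (nearPoints δ X Y₀)) := fun q hq T => by
  obtain ⟨T, rfl⟩ := CQuot.mk_surjective T
  obtain ⟨S, rfl⟩ := G.map_surjective (toHom q) hq T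
  exact ⟨CQuot.mk _ S, rfl⟩

lemma countablyDetermined (G : Geometry Y Y₀ δ X) : CountablyDetermined (roeQuot X (nearPoints δ X Y₀)) := by
  intro D D' q hq T hT
  obtain ⟨T, rfl⟩ := CQuot.mk_surjective T
  have hT' : CtrlAlg.map (metricFamily X) (toHom q) T ∈ (roeIdeal D' (nearPoints δ X Y₀)).alg :=
    CQuot.mk_eq_zero.1 hT
  have key : ∀ n : ℕ, ∃ S ∈ nearAlg D (nearPoints δ X Y₀), ∃ U : CtrlAlg D (metricFamily X),
      CtrlAlg.map _ (toHom q) U = 0 ∧ ‖T - S - U‖ < 1 / ((n : ℝ) + 1) := by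
    intro n
    have hn : (0 : ℝ) < 1 / ((n : ℝ) + 1) := by positivity
    obtain ⟨S', hS', h1⟩ := Metric.mem_closure_iff.1 hT' _ hn
    rw [dist_eq_norm] at h1
    obtain ⟨R, hR⟩ := hS'
    obtain ⟨S₀, rfl⟩ := G.map_surjective (toHom q) hq S'
    let χ := charFn (Metric.thickening R (nearPoints δ X Y₀))
    have hχ : Bdd χ := bdd_charFn _
    obtain ⟨S, hS⟩ := S₀.exists_cut hχ hχ
    have hSS : CtrlAlg.map (metricFamily X) (toHom q) S = CtrlAlg.map _ (toHom q) S₀ :=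
      CtrlAlg.entry_ext fun x y => by
        rw [CtrlAlg.op_map, entry_colMap, hS, entry_cut hχ hχ, map_smul, CtrlAlg.op_map, entry_colMap]
        by_cases h0 : toHom q (entry S₀.op x y) = 0
        · rw [h0, smul_zero]
        · have := hR x y (by rw [CtrlAlg.op_map, entry_colMap]; exact h0)
          rw [show χ x = 1 from charFn_of_mem this.1, show χ y = 1 from charFn_of_mem this.2, mul_one,
            one_smul]
    rw [← hSS, ← map_sub] at h1
    obtain ⟨V, hV1, hV2⟩ := exists_preimage_norm_lt (CtrlAlg.map (metricFamily X) (toHom q)) (T - S)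
      (ε := 1 / ((n : ℝ) + 1) - ‖CtrlAlg.map (metricFamily X) (toHom q) (T - S)‖) (by linarith)
    refine ⟨S, ⟨R, fun x y h => ?_⟩, T - S - V, ?_, ?_⟩
    · rw [hS, entry_cut hχ hχ] at h
      have h1 := left_ne_zero_of_smul h
      exact ⟨mem_of_charFn_ne_zero (left_ne_zero_of_mul h1),
        mem_of_charFn_ne_zero (right_ne_zero_of_mul h1)⟩
    · rw [map_sub, hV1, sub_self]
    · rw [sub_sub_cancel]
      linarith
  choose S hS U hU hSU using key
  have := G.countable
  refine ⟨Set.range fun p : ℕ × X × X => entry (U p.1).op p.2.1 p.2.2, Set.countable_range _, ?_, ?_⟩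
  · rintro _ ⟨⟨n, x, y⟩, rfl⟩
    have h := congrArg (fun V : CtrlAlg D' (metricFamily X) => entry V.op x y) (hU n)
    simp only [CtrlAlg.op_map, entry_colMap, CtrlAlg.op_zero, entry_zero] at h
    exact h
  · intro D'' r hr
    refine CQuot.mk_eq_zero.2 (?_ : CtrlAlg.map (metricFamily X) (toHom r) T ∈ _)
    have hrU : ∀ n, CtrlAlg.map (metricFamily X) (toHom r) (U n) = 0 := fun n =>
      CtrlAlg.entry_ext fun x y => by
        rw [CtrlAlg.op_map, entry_colMap, CtrlAlg.op_zero, entry_zero]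
        exact hr _ ⟨(n, x, y), rfl⟩
    refine mem_roeIdeal_of_forall fun ε hε => ?_
    obtain ⟨n, hn⟩ := exists_nat_one_div_lt hε
    refine ⟨CtrlAlg.map _ (toHom r) (S n), map_roeIdeal _ _ _ (nearAlg_le_roeIdeal (hS n)), ?_⟩
    have e : CtrlAlg.map (metricFamily X) (toHom r) T - CtrlAlg.map _ (toHom r) (S n) =
        CtrlAlg.map _ (toHom r) (T - S n - U n) := by
      rw [map_sub, map_sub, hrU, sub_zero]
    rw [e]
    exact ((NonUnitalStarAlgHom.norm_apply_le _ _).trans_lt (hSU n)).trans hn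

end Geometry
end RoeQuotient

/-! ### The unit transformation -/

section Unit
open scoped ZeroAtInfty
variable {Y : Type u} [MetricSpace Y] {Y₀ : Set Y} {δ : ℝ} {X : Set Y}

/-- Evaluation at a point. -/
def C0Pair.evalHom {E : Type*} [NonUnitalCStarAlgebra E] (y : Y) : C0Pair Y Y₀ E →⋆ₙₐ[ℂ] E where
  toFun f := f.fn y
  map_smul' _ _ := rfl
  map_zero' := rfl
  map_add' _ _ := rfl
  map_mul' _ _ := rfl
  map_star' _ := rfl

lemma C0Pair.evalHom_apply {E : Type*} [NonUnitalCStarAlgebra E] (y : Y) (f : C0Pair Y Y₀ E) :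
    C0Pair.evalHom y f = f.fn y := rfl

namespace Geometry
variable (G : Geometry Y Y₀ δ X)

lemma dist_lt_of_φ {x x' : X} {y : Y} (h : G.φ x y ≠ 0) (h' : G.φ x' y ≠ 0) :
    dist x x' < 4 * δ := by
  have h1 := G.φ_dist x y h
  have h2 := G.φ_dist x' y h'
  have h3 := dist_triangle_left (x : Y) x' y
  change dist (x : Y) x' < _
  linarith

variable [ProperSpace Y]

open Classical in
/-- The partition function at `x`, or `0` if `x` is close to the subspace. -/
def ψ (x : X) : C0Pair Y Y₀ ℂ :=
  if h : (x : Y) ∈ Metric.thickening (2 * δ) Y₀ then 0 else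
    C0Pair.ofCompact ⟨fun y => ((G.φ x y : ℝ) : ℂ), by have := (G.φ x).continuous; fun_prop⟩
      (by
        refine HasCompactSupport.intro (isCompact_closedBall (x : Y) (2 * δ)) fun y hy => ?_
        by_contra hne
        have : G.φ x y ≠ 0 := fun h0 => hne (by simp [h0])
        exact hy (Metric.mem_closedBall.2 (G.φ_dist x y this).le))
      (fun y hy => by
        by_contra hne
        have : G.φ x y ≠ 0 := fun h0 => hne (by simp [h0])
        refine h (Metric.mem_thickening_iff.2 ⟨y, hy, ?_⟩)
        rw [dist_comm]
        exact G.φ_dist x y this)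

lemma ψ_of_mem {x : X} (h : (x : Y) ∈ Metric.thickening (2 * δ) Y₀) : G.ψ x = 0 := dif_pos h

lemma ψ_of_notMem {x : X} (h : (x : Y) ∉ Metric.thickening (2 * δ) Y₀) (y : Y) :
    (G.ψ x).fn y = ((G.φ x y : ℝ) : ℂ) := by rw [ψ, dif_neg h]; rfl

lemma φ_ne_zero_of_ψ {x : X} {y : Y} (h : (G.ψ x).fn y ≠ 0) : G.φ x y ≠ 0 := fun h0 => h (by
  by_cases hx : (x : Y) ∈ Metric.thickening (2 * δ) Y₀
  · rw [G.ψ_of_mem hx]; rfl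
  · rw [G.ψ_of_notMem hx, h0, Complex.ofReal_zero])

lemma star_ψ (x : X) : star (G.ψ x) = G.ψ x := C0Pair.ext' fun y => by
  rw [C0Pair.fn_star]
  by_cases hx : (x : Y) ∈ Metric.thickening (2 * δ) Y₀
  · rw [G.ψ_of_mem hx]; exact star_zero _
  · rw [G.ψ_of_notMem hx, Complex.star_def, Complex.conj_ofReal]

lemma norm_ψ_fn_le (x : X) (y : Y) : ‖(G.ψ x).fn y‖ ≤ 1 := by
  by_cases hx : (x : Y) ∈ Metric.thickening (2 * δ) Y₀
  · rw [G.ψ_of_mem hx, C0Pair.fn_zero, norm_zero]; exact zero_le_one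
  · rw [G.ψ_of_notMem hx, Complex.norm_real, Real.norm_of_nonneg (G.φ_nonneg x y)]
    exact G.φ_le_one x y

variable {A A' : Type u} [NonUnitalCStarAlgebra A] [NonUnitalCStarAlgebra A']

lemma exists_unitOp (a : A) : ∃ S : CtrlAlg (C0Pair Y Y₀ A) (metricFamily X),
    ∀ x x', entry S.op x x' = C0Pair.tens (G.ψ x * G.ψ x') a := by
  obtain ⟨N, hN⟩ := G.exists_op (4 * δ)
  obtain ⟨S, hS, -⟩ := hN (fun x x' => C0Pair.tens (G.ψ x * G.ψ x') a) ‖a‖ (norm_nonneg _)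
    (fun x x' h => by
      by_contra hne
      refine h (C0Pair.ext' fun y => ?_)
      rw [C0Pair.tens_fn, C0Pair.fn_mul, C0Pair.fn_zero]
      by_contra h0
      have h1 := left_ne_zero_of_smul h0
      exact hne (G.dist_lt_of_φ (G.φ_ne_zero_of_ψ (left_ne_zero_of_mul h1))
        (G.φ_ne_zero_of_ψ (right_ne_zero_of_mul h1))).le)
    (fun x x' => Geometry.norm_le_of_fn (norm_nonneg _) fun y => by
      rw [C0Pair.tens_fn, C0Pair.fn_mul, norm_smul, norm_mul]
      have h1 := G.norm_ψ_fn_le x y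
      have h2 := G.norm_ψ_fn_le x' y
      have : ‖(G.ψ x).fn y‖ * ‖(G.ψ x').fn y‖ ≤ 1 := mul_le_one₀ h1 (norm_nonneg _) h2
      nlinarith [norm_nonneg a])
  exact ⟨S, hS⟩

/-- The matrix with the entries `ψ_x ψ_{x'} a`. -/
def unitOp (a : A) : CtrlAlg (C0Pair Y Y₀ A) (metricFamily X) := (G.exists_unitOp a).choose

lemma entry_unitOp (a : A) (x x' : X) :
    entry (G.unitOp a).op x x' = C0Pair.tens (G.ψ x * G.ψ x') a := (G.exists_unitOp a).choose_spec x x'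

lemma entry_unitOp_fn (a : A) (x x' : X) (y : Y) :
    (entry (G.unitOp a).op x x').fn y = ((G.ψ x).fn y * (G.ψ x').fn y) • a := by
  rw [entry_unitOp]; rfl

/-- Away from the subspace, the products of matrices `ψ_x ψ_{x'} a` are as expected. -/
lemma entry_unitOp_mul (a b : A) (x x' : X) (h : (x : Y) ∉ Metric.thickening (6 * δ) Y₀ ∨
    (x' : Y) ∉ Metric.thickening (6 * δ) Y₀) :
    entry (G.unitOp a * G.unitOp b).op x x' = entry (G.unitOp (a * b)).op x x' := by
  refine C0Pair.ext' fun y => ?_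
  have h1 := (hasSum_entry_mul (G.unitOp a).op (G.unitOp b).op x x').map (C0Pair.evalHom y)
    (hom_continuous _)
  simp only [Function.comp_def, map_mul, C0Pair.evalHom_apply, entry_unitOp_fn] at h1
  rw [CtrlAlg.op_mul]
  refine h1.unique ?_
  rw [entry_unitOp_fn]
  by_cases hz : (G.ψ x).fn y = 0 ∨ (G.ψ x').fn y = 0
  · rcases hz with hz | hz <;> simp [hz, hasSum_zero]
  push Not at hz
  let s := (G.φ_finite y).toFinset
  have hs : ∀ z, G.φ z y ≠ 0 → z ∈ s := fun z hz => by simpa [s] using hz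
  have e : ∀ z, ((G.ψ x).fn y * (G.ψ z).fn y) • a * ((G.ψ z).fn y * (G.ψ x').fn y) • b =
      ((G.φ z y ^ 2 : ℝ) : ℂ) • ((G.ψ x).fn y * (G.ψ x').fn y) • (a * b) := fun z => by
    have e1 : (G.ψ z).fn y = ((G.φ z y : ℝ) : ℂ) := by
      by_cases hzy : G.φ z y = 0
      · by_contra hne
        exact G.φ_ne_zero_of_ψ (x := z) (y := y) (fun h0 => hne (by rw [h0, hzy]; simp)) hzy
      · refine G.ψ_of_notMem (fun hmem => ?_) y
        obtain ⟨w, hw, hzw⟩ := Metric.mem_thickening_iff.1 hmem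
        have h2 : ∀ x : X, G.φ x y ≠ 0 → (x : Y) ∈ Metric.thickening (6 * δ) Y₀ := fun x hx => by
          refine Metric.mem_thickening_iff.2 ⟨w, hw, ?_⟩
          have h3 : dist (x : Y) z < 4 * δ := G.dist_lt_of_φ hx hzy
          have := dist_triangle (x : Y) z w
          linarith
        exact h.elim (fun h => h (h2 x (G.φ_ne_zero_of_ψ hz.1)))
          (fun h => h (h2 x' (G.φ_ne_zero_of_ψ hz.2)))
    rw [e1, smul_mul_smul_comm, smul_smul]
    congr 1
    push_cast
    ring
  simp only [e]
  have hsum : HasSum (fun z => ((G.φ z y ^ 2 : ℝ) : ℂ)) 1 := by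
    have : (1 : ℂ) = ∑ z ∈ s, ((G.φ z y ^ 2 : ℝ) : ℂ) := by
      rw [← Complex.ofReal_sum, G.φ_sum y s hs, Complex.ofReal_one]
    rw [this]
    refine hasSum_sum_of_ne_finset_zero fun z hz => ?_
    have : G.φ z y = 0 := by by_contra h0; exact hz (hs z h0)
    simp [this]
  have := hsum.smul_const (((G.ψ x).fn y * (G.ψ x').fn y) • (a * b))
  rwa [one_smul] at this

/-- The unit `A → 𝔑 C₀(Y, Y₀, A)`. -/
def unit (A : Type u) [NonUnitalCStarAlgebra A] :
    A →⋆ₙₐ[ℂ] CQuot (roeIdeal (C0Pair Y Y₀ A) (nearPoints δ X Y₀)) where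
  toFun a := CQuot.mk _ (G.unitOp a)
  map_smul' c a := congrArg (CQuot.mk _) (CtrlAlg.entry_ext fun x x' => C0Pair.ext' fun y => by
    rw [CtrlAlg.op_smul, entry_smul, C0Pair.fn_smul, entry_unitOp_fn, entry_unitOp_fn, smul_comm]; rfl)
  map_zero' := congrArg (CQuot.mk _) (CtrlAlg.entry_ext fun x x' => C0Pair.ext' fun y => by
    rw [CtrlAlg.op_zero, entry_zero, entry_unitOp_fn, smul_zero]; rfl)
  map_add' a b := congrArg (CQuot.mk _) (CtrlAlg.entry_ext fun x x' => C0Pair.ext' fun y => by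
    rw [CtrlAlg.op_add, entry_add, C0Pair.fn_add, entry_unitOp_fn, entry_unitOp_fn, entry_unitOp_fn,
      smul_add])
  map_mul' a b := by
    rw [← CQuot.mk_mul]
    refine CQuot.mk_eq.2 (nearAlg_le_roeIdeal ⟨7 * δ, fun x x' h => ?_⟩)
    rw [CtrlAlg.op_sub, entry_sub] at h
    have key : (x : Y) ∈ Metric.thickening (6 * δ) Y₀ ∧ (x' : Y) ∈ Metric.thickening (6 * δ) Y₀ := by
      by_contra hne
      rw [not_and_or] at hne
      exact h (by rw [G.entry_unitOp_mul a b x x' hne, sub_self])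
    have e : 7 * δ = 6 * δ + δ := by ring
    rw [e]
    exact ⟨G.mem_thickening_nearPoints key.1, G.mem_thickening_nearPoints key.2⟩
  map_star' a := congrArg (CQuot.mk _) (CtrlAlg.entry_ext fun x x' => C0Pair.ext' fun y => by
    have hs : ∀ x, star ((G.ψ x).fn y) = (G.ψ x).fn y := fun x => by
      rw [← C0Pair.fn_star, star_ψ]
    rw [CtrlAlg.op_star, entry_star, C0Pair.fn_star, entry_unitOp_fn, entry_unitOp_fn, star_smul,
      star_mul, hs, hs])

/-- The unit is natural. -/
lemma map_unit (f : A →⋆ₙₐ[ℂ] A') (a : A) :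
    CtrlAlg.map _ (C0Pair.map Y Y₀ f) (G.unitOp a) = G.unitOp (f a) :=
  CtrlAlg.entry_ext fun x x' => C0Pair.ext' fun y => by
    rw [CtrlAlg.op_map, entry_colMap, entry_unitOp_fn]
    change f ((entry (G.unitOp a).op x x').fn y) = _
    rw [entry_unitOp_fn, map_smul]

/-- The unit as a morphism. -/
def unitMor (A : CStarAlg.{u}) : A ⟶ (roeQuot X (nearPoints δ X Y₀)).obj ((c0Pair Y Y₀).obj A) :=
  ofHom (B := (roeQuot X (nearPoints δ X Y₀)).obj ((c0Pair Y Y₀).obj A)) (G.unit A)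

lemma unitMor_naturality {A A' : CStarAlg.{u}} (f : A ⟶ A') :
    f ≫ G.unitMor A' = G.unitMor A ≫ (roeQuot X (nearPoints δ X Y₀)).map ((c0Pair Y Y₀).map f) :=
  hom_ext' fun a => congrArg (CQuot.mk _) (G.map_unit (toHom f) a).symm

end Geometry
end Unit

/-! ### The counit transformation -/

section Counit
open scoped ZeroAtInfty BoundedContinuousFunction
variable {W : Type*} {B : Type*} [NonUnitalCStarAlgebra B]

lemma bdd_one : Bdd (1 : W → ℂ) := ⟨1, fun _ => by simp⟩

lemma dop_one : dop B (1 : W → ℂ) = 1 := Adj.ext_apply fun ξ => L2.ext_apply fun x => by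
  rw [dop_op bdd_one, Pi.one_apply, one_smul]; rfl

lemma cut_one_adj (g : W → ℂ) (T : ColOp W B) : (cut g T 1).adj = dop B g * T.adj := by
  rw [cut_adj, dop_one, mul_one]

lemma one_cut_adj (g : W → ℂ) (T : ColOp W B) : (cut 1 T g).adj = T.adj * dop B g := by
  rw [cut_adj, dop_one, one_mul]

lemma ColOp.sub_adj (S T : ColOp W B) : (S - T).adj = S.adj - T.adj := rfl

lemma Bdd.sub {g h : W → ℂ} (hg : Bdd g) (hh : Bdd h) : Bdd (g - h) := by
  obtain ⟨K, hK⟩ := hg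
  obtain ⟨L, hL⟩ := hh
  exact ⟨K + L, fun x => (norm_sub_le _ _).trans (add_le_add (hK x) (hL x))⟩

lemma Bdd.smul {g : W → ℂ} (c : ℂ) (hg : Bdd g) : Bdd (c • g) := by
  obtain ⟨K, hK⟩ := hg
  refine ⟨‖c‖ * K, fun x => ?_⟩
  rw [Pi.smul_apply, norm_smul]
  exact mul_le_mul_of_nonneg_left (hK x) (norm_nonneg c)

lemma Bdd.sum {ι : Type*} (s : Finset ι) {g : ι → W → ℂ} (hg : ∀ i, Bdd (g i)) :
    Bdd (∑ i ∈ s, g i) := by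
  choose K hK using hg
  refine ⟨∑ i ∈ s, K i, fun x => ?_⟩
  rw [Finset.sum_apply]
  exact norm_sum_le_of_le _ fun i _ => hK i x

lemma dop_sub {g h : W → ℂ} (hg : Bdd g) (hh : Bdd h) : dop B (g - h) = dop B g - dop B h :=
  Adj.ext_apply fun ξ => L2.ext_apply fun x => by
    rw [Adj.sub_op, L2.coe_sub, Pi.sub_apply, dop_op hg, dop_op hh, dop_op (hg.sub hh), Pi.sub_apply,
      sub_smul]

lemma dop_smul {g : W → ℂ} (c : ℂ) (hg : Bdd g) : dop B (c • g) = c • dop B g :=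
  Adj.ext_apply fun ξ => L2.ext_apply fun x => by
    rw [Adj.smul_op, L2.coe_smul, Pi.smul_apply, dop_op hg, dop_op (hg.smul c), Pi.smul_apply,
      smul_smul]; rfl

lemma dop_zero : dop B (0 : W → ℂ) = 0 := Adj.ext_apply fun ξ => L2.ext_apply fun x => by
  rw [dop_op ⟨0, fun _ => by simp⟩, Pi.zero_apply, zero_smul]; rfl

lemma dop_sum {ι : Type*} (s : Finset ι) {g : ι → W → ℂ} (hg : ∀ i, Bdd (g i)) :
    dop B (∑ i ∈ s, g i) = ∑ i ∈ s, dop B (g i) := by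
  classical
  induction s using Finset.induction_on with
  | empty => exact dop_zero
  | insert i s hi ih =>
    rw [Finset.sum_insert hi, Finset.sum_insert hi, ← ih]
    have h1 : g i + ∑ j ∈ s, g j = g i - ((-1 : ℂ) • ∑ j ∈ s, g j) := by
      rw [neg_smul, one_smul, sub_neg_eq_add]
    rw [h1, dop_sub (hg i) ((Bdd.sum s hg).smul _), dop_smul _ (Bdd.sum s hg), neg_smul, one_smul,
      sub_neg_eq_add]

/-- A compression of contractions by a row contraction. -/
lemma norm_sum_conj_le {A ι : Type*} [CStarAlgebra A] (s : Finset ι) (d S : ι → A) {C : ℝ} (hC : 0 ≤ C)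
    (hd : finNorm s d ≤ 1) (hS : ∀ i, ‖S i‖ ≤ C) : ‖∑ i ∈ s, star (d i) * (S i * d i)‖ ≤ C := by
  let _ := CStarAlgebra.spectralOrder A
  have _ := CStarAlgebra.spectralOrderedRing A
  have h1 : finNorm s (fun i => S i * d i) ≤ C * finNorm s d := by
    refine le_of_sq_le_sq ?_ (mul_nonneg hC (finNorm_nonneg _ _))
    rw [mul_pow, finNorm_sq, finNorm_sq]
    have h2 : ∑ i ∈ s, star (S i * d i) * (S i * d i) ≤ (C ^ 2) • ∑ i ∈ s, star (d i) * d i := by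
      rw [Finset.smul_sum]
      refine Finset.sum_le_sum fun i _ => ?_
      have h3 := CStarAlgebra.star_left_conjugate_le_norm_smul (a := d i) (b := star (S i) * S i)
        (IsSelfAdjoint.star_mul_self (S i))
      rw [star_mul, mul_assoc, ← mul_assoc (star (S i)), ← mul_assoc]
      refine h3.trans ?_
      rw [CStarRing.norm_star_mul_self, ← sq]
      exact smul_le_smul_of_nonneg_right (pow_le_pow_left₀ (norm_nonneg _) (hS i) 2)
        (star_mul_self_nonneg _)
    refine (CStarAlgebra.norm_le_norm_of_nonneg_of_le
      (Finset.sum_nonneg fun i _ => star_mul_self_nonneg _) h2).trans ?_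
    rw [norm_smul, Real.norm_of_nonneg (by positivity)]
  calc _ ≤ finNorm s d * finNorm s (fun i => S i * d i) := norm_sum_star_mul_le s _ _
    _ ≤ 1 * (C * 1) := by
      gcongr
      · exact finNorm_nonneg _ _
      · exact h1.trans (mul_le_mul_of_nonneg_left hd hC)
    _ = C := by ring

end Counit

section CounitGeometry
open scoped ZeroAtInfty BoundedContinuousFunction
variable {Y : Type u} [MetricSpace Y] {Y₀ : Set Y} {δ : ℝ} {X : Set Y}

namespace Geometry
variable (G : Geometry Y Y₀ δ X) {D D' : Type u} [NonUnitalCStarAlgebra D] [NonUnitalCStarAlgebra D']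

/-- The rescaled function `f ∘ sc_t`, restricted to the discrete space. -/
def resc (f : C0Pair Y Y₀ ℂ) (t : ℝ≥0) (x : X) : ℂ := f.fn (G.sc t x)

lemma norm_resc_le (f : C0Pair Y Y₀ ℂ) (t : ℝ≥0) (x : X) : ‖G.resc f t x‖ ≤ ‖f‖ := norm_fn_le f _

lemma bdd_resc (f : C0Pair Y Y₀ ℂ) (t : ℝ≥0) : Bdd (G.resc f t) := ⟨_, G.norm_resc_le f t⟩

variable (D) in
/-- Multiplication by the rescaled function. -/
def rescOp (f : C0Pair Y Y₀ ℂ) (t : ℝ≥0) : Adj X D := dop D (G.resc f t)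

lemma norm_rescOp_le (f : C0Pair Y Y₀ ℂ) (t : ℝ≥0) : ‖G.rescOp D f t‖ ≤ ‖f‖ :=
  norm_dop_le (norm_nonneg _) (G.norm_resc_le f t)

lemma rescOp_mul (f g : C0Pair Y Y₀ ℂ) (t : ℝ≥0) :
    G.rescOp D (f * g) t = G.rescOp D f t * G.rescOp D g t :=
  (dop_mul_dop (G.bdd_resc f t) (G.bdd_resc g t)).symm

lemma rescOp_star (f : C0Pair Y Y₀ ℂ) (t : ℝ≥0) :
    G.rescOp D (star f) t = star (G.rescOp D f t) := (star_dop (G.bdd_resc f t)).symm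

/-- Rescaled functions commute asymptotically with the elements of the uniform Roe algebra. -/
lemma eventually_commutator_le (f : C0Pair Y Y₀ ℂ) (T : CtrlAlg D (metricFamily X)) {ε : ℝ}
    (hε : 0 < ε) : ∀ᶠ t in atTop,
      ‖T.op.adj * G.rescOp D f t - G.rescOp D f t * T.op.adj‖ ≤ ε := by
  obtain ⟨S, hS, hTS⟩ := T.exists_ctrl (ε := ε / (4 * (‖f‖ + 1))) (by positivity)
  obtain ⟨R, hR⟩ := mem_ctrl_metric.1 hS
  obtain ⟨N, hN⟩ := G.exists_op R
  filter_upwards [G.eventually_norm_sub_le f R (ε := ε / (2 * (N + 1) * (‖S‖ + 1))) (by positivity)]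
    with t ht
  have hb := G.bdd_resc f t
  obtain ⟨V, hV, hVn⟩ := hN (fun x y => (G.resc f t y - G.resc f t x) • entry S.op x y)
    (ε / (2 * (N + 1) * (‖S‖ + 1)) * ‖S‖) (by positivity)
    (fun x y h => hR x y (right_ne_zero_of_smul h)) (fun x y => by
      rw [norm_smul]
      by_cases h0 : entry S.op x y = 0
      · rw [h0, norm_zero, mul_zero]; positivity
      · refine mul_le_mul (ht _ _ ?_) (S.norm_entry_le x y) (norm_nonneg _) (by positivity)
        rw [dist_comm]
        exact hR x y h0)
  have e : V.op = cut 1 S.op (G.resc f t) - cut (G.resc f t) S.op 1 := entry_ext fun x y => by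
    rw [hV, entry_sub, entry_cut bdd_one hb, entry_cut hb bdd_one, ← sub_smul]
    simp
  have h1 : ‖S.op.adj * G.rescOp D f t - G.rescOp D f t * S.op.adj‖ ≤ ε / 2 := by
    have e' := congrArg ColOp.adj e
    rw [ColOp.sub_adj, one_cut_adj, cut_one_adj] at e'
    rw [rescOp, ← e']
    refine le_trans (le_of_eq_of_le rfl hVn) ?_
    have h2 : (N : ℝ) * (ε / (2 * (N + 1) * (‖S‖ + 1)) * ‖S‖) =
        (ε / 2) * ((N / (N + 1)) * (‖S‖ / (‖S‖ + 1))) := by field_simp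
    rw [h2]
    have h3 : (N : ℝ) / (N + 1) ≤ 1 := (div_le_one (by positivity)).2 (by linarith)
    have h4 : ‖S‖ / (‖S‖ + 1) ≤ 1 := (div_le_one (by positivity)).2 (by linarith)
    have h5 : (N : ℝ) / (N + 1) * (‖S‖ / (‖S‖ + 1)) ≤ 1 := mul_le_one₀ h3 (by positivity) h4
    nlinarith
  have h2 : T.op.adj * G.rescOp D f t - G.rescOp D f t * T.op.adj =
      (S.op.adj * G.rescOp D f t - G.rescOp D f t * S.op.adj) +
        ((T.op.adj - S.op.adj) * G.rescOp D f t - G.rescOp D f t * (T.op.adj - S.op.adj)) := by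
    noncomm_ring
  have h3 : ‖T.op.adj - S.op.adj‖ < ε / (4 * (‖f‖ + 1)) := hTS
  have h4 := G.norm_rescOp_le (D := D) f t
  have h5 : ‖T.op.adj - S.op.adj‖ * ‖G.rescOp D f t‖ ≤ ε / 4 := by
    calc _ ≤ ε / (4 * (‖f‖ + 1)) * ‖f‖ := by gcongr
      _ = ε / 4 * (‖f‖ / (‖f‖ + 1)) := by field_simp
      _ ≤ ε / 4 * 1 := by gcongr; exact (div_le_one (by positivity)).2 (by linarith)
      _ = ε / 4 := mul_one _
  rw [h2]
  calc _ ≤ _ := norm_add_le _ _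
    _ ≤ ε / 2 + (ε / 4 + ε / 4) := by
      gcongr
      refine (norm_sub_le _ _).trans (add_le_add ((norm_mul_le _ _).trans h5) ?_)
      refine (norm_mul_le _ _).trans ?_
      rw [mul_comm]; exact h5
    _ = ε := by ring

/-- Rescaled functions asymptotically annihilate the operators near the subspace. -/
lemma eventually_norm_mul_le (f : C0Pair Y Y₀ ℂ) {T : CtrlAlg D (metricFamily X)}
    (hT : T ∈ (roeIdeal D (nearPoints δ X Y₀)).alg) {ε : ℝ} (hε : 0 < ε) :
    ∀ᶠ t in atTop, ‖G.rescOp D f t * T.op.adj‖ ≤ ε := by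
  obtain ⟨S, ⟨R, hR⟩, -, hTS⟩ := exists_ctrl_of_mem_roeIdeal hT (ε := ε / (2 * (‖f‖ + 1))) (by positivity)
  filter_upwards [G.eventually_norm_le f (R + δ) (ε := ε / (2 * (‖S‖ + 1))) (by positivity)] with t ht
  have hb := G.bdd_resc f t
  let χ : X → ℂ := charFn (Metric.thickening R (nearPoints δ X Y₀))
  have hχ : Bdd χ := bdd_charFn _
  have e : cut (G.resc f t) S.op 1 = cut (G.resc f t * χ) S.op 1 := entry_ext fun x y => by
    rw [entry_cut hb bdd_one, entry_cut (hb.mul hχ) bdd_one]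
    by_cases h0 : entry S.op x y = 0
    · rw [h0, smul_zero, smul_zero]
    · rw [Pi.mul_apply, show χ x = 1 from charFn_of_mem (hR x y h0).1, mul_one]
  have h1 : ‖G.rescOp D f t * S.op.adj‖ ≤ ε / 2 := by
    rw [rescOp, ← cut_one_adj, e]
    have h2 : ‖cut (G.resc f t * χ) S.op 1‖ ≤ ε / (2 * (‖S‖ + 1)) * ‖S.op‖ * 1 := by
      refine norm_cut_le (by positivity) zero_le_one (fun x => ?_) (fun x => by simp) S.op
      rw [Pi.mul_apply, norm_mul]
      by_cases hx : x ∈ Metric.thickening R (nearPoints δ X Y₀)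
      · have := ht _ (mem_thickening_of_nearPoints hx)
        calc _ ≤ ε / (2 * (‖S‖ + 1)) * 1 :=
              mul_le_mul this (norm_charFn_le _ _) (norm_nonneg _) (by positivity)
          _ = _ := mul_one _
      · rw [show χ x = 0 from charFn_of_notMem hx, norm_zero, mul_zero]; positivity
    refine le_trans (le_of_eq_of_le rfl h2) ?_
    rw [mul_one, CtrlAlg.norm_op]
    calc ε / (2 * (‖S‖ + 1)) * ‖S‖ = ε / 2 * (‖S‖ / (‖S‖ + 1)) := by field_simp
      _ ≤ ε / 2 * 1 := by gcongr; exact (div_le_one (by positivity)).2 (by linarith)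
      _ = ε / 2 := mul_one _
  have h3 : ‖T.op.adj - S.op.adj‖ < ε / (2 * (‖f‖ + 1)) := hTS
  have h5 : ‖G.rescOp D f t‖ * ‖T.op.adj - S.op.adj‖ ≤ ε / 2 := by
    calc _ ≤ ‖f‖ * (ε / (2 * (‖f‖ + 1))) := by gcongr; exact G.norm_rescOp_le f t
      _ = ε / 2 * (‖f‖ / (‖f‖ + 1)) := by field_simp
      _ ≤ ε / 2 * 1 := by gcongr; exact (div_le_one (by positivity)).2 (by linarith)
      _ = ε / 2 := mul_one _
  have h2 : G.rescOp D f t * T.op.adj =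
      G.rescOp D f t * S.op.adj + G.rescOp D f t * (T.op.adj - S.op.adj) := by noncomm_ring
  rw [h2]
  calc _ ≤ _ := norm_add_le _ _
    _ ≤ ε / 2 + ε / 2 := add_le_add h1 ((norm_mul_le _ _).trans h5)
    _ = ε := by ring

/-- A matrix of the uniform Roe algebra is made compact by a function vanishing at infinity. -/
lemma exists_compact (g : X → ℂ) (hg : Bdd g) (hg0 : ∀ ε > 0, {x | ε ≤ ‖g x‖}.Finite)
    (T : CtrlAlg D (metricFamily X)) : ∃ S : KAlg D, S.op = extOp D G.ι_injective (cut g T.op 1) := by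
  suffices h : extOp D G.ι_injective (cut g T.op 1) ∈ closure (ctrl D (finiteFamily ℕ) : Set (ColOp ℕ D))
    from ⟨⟨_, h⟩, rfl⟩
  obtain ⟨K, hK0, hK⟩ := hg.exists_nonneg
  refine Metric.mem_closure_iff.2 fun ε hε => ?_
  obtain ⟨S, hS, hTS⟩ := T.exists_ctrl (ε := ε / (2 * (K + 1))) (by positivity)
  obtain ⟨R, hR⟩ := mem_ctrl_metric.1 hS
  let F : Set X := {x | ε / (2 * (‖S‖ + 1)) ≤ ‖g x‖}
  have hF : F.Finite := hg0 _ (by positivity)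
  have hχ : Bdd (charFn F) := bdd_charFn F
  refine ⟨extOp D G.ι_injective (cut (g * charFn F) S.op 1), ?_, ?_⟩
  · refine ⟨(fun p : X × X => (G.ι p.1, G.ι p.2)) '' (⋃ x ∈ F, {x} ×ˢ {z : X | dist (x : Y) z ≤ R}),
      Set.Finite.image _ (hF.biUnion fun x _ => (Set.finite_singleton x).prod (G.finite_near x R)), ?_⟩
    intro i j h
    obtain ⟨x, z, rfl, rfl⟩ := entry_extOp_ne_zero _ h
    rw [entry_extOp, entry_cut (hg.mul hχ) bdd_one] at h
    refine ⟨(x, z), Set.mem_iUnion₂.2 ⟨x, ?_, rfl, hR x z (right_ne_zero_of_smul h)⟩, rfl⟩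
    exact mem_of_charFn_ne_zero (right_ne_zero_of_mul (left_ne_zero_of_mul (left_ne_zero_of_smul h)))
  · have e : cut g T.op 1 - cut (g * charFn F) S.op 1 =
        cut g (T.op - S.op) 1 + cut (g - g * charFn F) S.op 1 := entry_ext fun x y => by
      rw [entry_sub, entry_add, entry_cut hg bdd_one, entry_cut hg bdd_one,
        entry_cut (hg.mul hχ) bdd_one, entry_cut (hg.sub (hg.mul hχ)) bdd_one, entry_sub]
      simp only [Pi.sub_apply, Pi.one_apply, mul_one, smul_sub, sub_smul]
      abel
    rw [dist_eq_norm, ← map_sub, e]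
    refine (NonUnitalStarAlgHom.norm_apply_le _ _).trans_lt ((norm_add_le _ _).trans_lt ?_)
    have h1 := norm_cut_le hK0 zero_le_one hK (fun x => by simp) (h := 1) (T.op - S.op)
    have h2 : ‖cut (g - g * charFn F) S.op 1‖ ≤ ε / (2 * (‖S‖ + 1)) * ‖S.op‖ * 1 := by
      refine norm_cut_le (by positivity) zero_le_one (fun x => ?_) (fun x => by simp) S.op
      by_cases hx : x ∈ F
      · rw [Pi.sub_apply, Pi.mul_apply, charFn_of_mem hx, mul_one, sub_self, norm_zero]; positivity
      · rw [Pi.sub_apply, Pi.mul_apply, charFn_of_notMem hx, mul_zero, sub_zero]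
        exact (not_le.1 hx).le
    have h3 : ‖T.op - S.op‖ < ε / (2 * (K + 1)) := hTS
    have h4 : K * ‖T.op - S.op‖ * 1 < ε / 2 := by
      rw [mul_one]
      rw [lt_div_iff₀ (by positivity)] at h3
      nlinarith [norm_nonneg (T.op - S.op)]
    have h5 : ε / (2 * (‖S‖ + 1)) * ‖S.op‖ * 1 ≤ ε / 2 := by
      rw [mul_one, CtrlAlg.norm_op]
      calc ε / (2 * (‖S‖ + 1)) * ‖S‖ = ε / 2 * (‖S‖ / (‖S‖ + 1)) := by field_simp
        _ ≤ ε / 2 * 1 := by gcongr; exact (div_le_one (by positivity)).2 (by linarith)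
        _ = ε / 2 := mul_one _
    linarith

lemma norm_le_of_extOp {k : KAlg D} {S : ColOp X D} (h : k.op = extOp D G.ι_injective S) :
    ‖k‖ ≤ ‖S.adj‖ := by
  rw [← CtrlAlg.norm_op, h]
  exact NonUnitalStarAlgHom.norm_apply_le _ _

variable [ProperSpace Y]

lemma finite_resc (f : C0Pair Y Y₀ ℂ) (t : ℝ≥0) {ε : ℝ} (hε : 0 < ε) :
    {x | ε ≤ ‖G.resc f t x‖}.Finite := by
  rcases isEmpty_or_nonempty X with h | ⟨⟨x₀⟩⟩
  · exact Set.toFinite _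
  obtain ⟨K, hK, h⟩ := G.exists_isBounded f t hε
  obtain ⟨r, hr⟩ := hK.subset_closedBall (x₀ : Y)
  refine (G.finite_near x₀ r).subset fun x hx => ?_
  by_contra hne
  have hxK : (x : Y) ∉ K := fun hxK => hne (by
    have := hr hxK
    rw [Metric.mem_closedBall, dist_comm] at this
    exact this)
  exact absurd (h t le_rfl x hxK) (not_lt.2 hx)

/-- The compact operator `(f ∘ sc_t) T`. -/
def kop (f : C0Pair Y Y₀ ℂ) (T : CtrlAlg D (metricFamily X)) (t : ℝ≥0) : KAlg D :=
  (G.exists_compact (G.resc f t) (G.bdd_resc f t) (fun ε hε => G.finite_resc f t hε) T).choose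

lemma op_kop (f : C0Pair Y Y₀ ℂ) (T : CtrlAlg D (metricFamily X)) (t : ℝ≥0) :
    (G.kop f T t).op = extOp D G.ι_injective (cut (G.resc f t) T.op 1) :=
  (G.exists_compact (G.resc f t) (G.bdd_resc f t) (fun ε hε => G.finite_resc f t hε) T).choose_spec

lemma norm_kop_le (f : C0Pair Y Y₀ ℂ) (T : CtrlAlg D (metricFamily X)) (t : ℝ≥0) :
    ‖G.kop f T t‖ ≤ ‖f‖ * ‖T‖ := by
  refine (G.norm_le_of_extOp (G.op_kop f T t)).trans ?_
  rw [cut_one_adj]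
  exact (norm_mul_le _ _).trans (mul_le_mul_of_nonneg_right (G.norm_rescOp_le f t) (norm_nonneg _))

lemma continuous_kop (f : C0Pair Y Y₀ ℂ) (T : CtrlAlg D (metricFamily X)) :
    Continuous (G.kop f T) := by
  rw [continuous_iff_continuousAt]
  intro s
  have h := (G.continuous_scHom f).tendsto s
  rw [tendsto_iff_norm_sub_tendsto_zero] at h
  refine tendsto_iff_norm_sub_tendsto_zero.2 ?_
  have h2 := h.mul_const ‖T‖
  rw [zero_mul] at h2
  refine squeeze_zero (fun _ => norm_nonneg _) (fun t => ?_) h2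
  have hb := G.bdd_resc f t
  have hb' := G.bdd_resc f s
  have e : (G.kop f T t - G.kop f T s).op =
      extOp D G.ι_injective (cut (G.resc f t - G.resc f s) T.op 1) := by
    rw [CtrlAlg.op_sub, op_kop, op_kop, ← map_sub]
    refine congrArg _ (entry_ext fun x y => ?_)
    rw [entry_sub, entry_cut hb bdd_one, entry_cut hb' bdd_one, entry_cut (hb.sub hb') bdd_one,
      Pi.sub_apply, ← sub_smul]
    simp
  refine (G.norm_le_of_extOp e).trans ?_
  rw [cut_one_adj]
  refine (norm_mul_le _ _).trans (mul_le_mul_of_nonneg_right ?_ (norm_nonneg _))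
  exact norm_dop_le (norm_nonneg _) fun x => norm_fn_le (G.scHom t f - G.scHom s f) x

/-- The path of compact operators `t ↦ (f ∘ sc_t) T`. -/
def kpath (f : C0Pair Y Y₀ ℂ) (T : CtrlAlg D (metricFamily X)) : ℝ≥0 →ᵇ KAlg D :=
  BoundedContinuousFunction.ofNormedAddCommGroup (G.kop f T) (G.continuous_kop f T) (‖f‖ * ‖T‖)
    (G.norm_kop_le f T)

lemma kpath_apply (f : C0Pair Y Y₀ ℂ) (T : CtrlAlg D (metricFamily X)) (t : ℝ≥0) :
    G.kpath f T t = G.kop f T t := rfl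

lemma op_kpath_adj (f : C0Pair Y Y₀ ℂ) (T : CtrlAlg D (metricFamily X)) (t : ℝ≥0) :
    ∃ S : ColOp X D, (G.kpath f T t).op = extOp D G.ι_injective S ∧
      S.adj = G.rescOp D f t * T.op.adj :=
  ⟨_, G.op_kop f T t, cut_one_adj _ _⟩

lemma kpath_smul (c : ℂ) (f : C0Pair Y Y₀ ℂ) (T : CtrlAlg D (metricFamily X)) :
    G.kpath (c • f) T = c • G.kpath f T :=
  BoundedContinuousFunction.ext fun t => CtrlAlg.op_injective (by
    change (G.kop _ T t).op = c • (G.kop f T t).op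
    rw [op_kop, op_kop, ← map_smul]
    refine congrArg _ (entry_ext fun x y => ?_)
    rw [entry_smul, entry_cut (G.bdd_resc _ t) bdd_one, entry_cut (G.bdd_resc _ t) bdd_one, smul_smul,
      ← mul_assoc]
    rfl)

lemma mk_kpath_mul (f g : C0Pair Y Y₀ ℂ) (S T : CtrlAlg D (metricFamily X)) :
    CQuot.mk (asymIdeal (KAlg D)) (G.kpath (f * g) (S * T)) =
      CQuot.mk _ (G.kpath f S) * CQuot.mk _ (G.kpath g T) := by
  rw [← CQuot.mk_mul]
  refine CQuot.mk_eq.2 (mem_asymIdeal.2 fun ε hε => eventually_atTop.1 ?_)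
  filter_upwards [G.eventually_commutator_le g S (ε := ε / (‖f‖ * ‖T‖ + 1)) (by positivity)] with t ht
  obtain ⟨U, hU, hU'⟩ := G.op_kpath_adj f S t
  obtain ⟨V, hV, hV'⟩ := G.op_kpath_adj g T t
  obtain ⟨Z, hZ, hZ'⟩ := G.op_kpath_adj (f * g) (S * T) t
  have e : ((G.kpath (f * g) (S * T) - G.kpath f S * G.kpath g T) t).op =
      extOp D G.ι_injective (Z - U * V) := by
    rw [map_sub, map_mul, ← hU, ← hV, ← hZ]; rfl
  refine (G.norm_le_of_extOp e).trans ?_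
  have e2 : (Z - U * V).adj = -(G.rescOp D f t *
      (S.op.adj * G.rescOp D g t - G.rescOp D g t * S.op.adj) * T.op.adj) := by
    rw [ColOp.sub_adj, ColOp.mul_adj, hU', hV', hZ', rescOp_mul, CtrlAlg.op_mul, ColOp.mul_adj]
    noncomm_ring
  rw [e2, norm_neg]
  have h1 := G.norm_rescOp_le (D := D) f t
  calc _ ≤ ‖G.rescOp D f t‖ * _ * ‖T.op.adj‖ :=
        (norm_mul_le _ _).trans (mul_le_mul_of_nonneg_right (norm_mul_le _ _) (norm_nonneg _))
    _ ≤ ‖f‖ * (ε / (‖f‖ * ‖T‖ + 1)) * ‖T‖ := by gcongr; exact le_rfl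
    _ = ε * ((‖f‖ * ‖T‖) / (‖f‖ * ‖T‖ + 1)) := by ring
    _ ≤ ε * 1 := by gcongr; exact (div_le_one (by positivity)).2 (by linarith)
    _ = ε := mul_one _

lemma mk_kpath_star (f : C0Pair Y Y₀ ℂ) (T : CtrlAlg D (metricFamily X)) :
    CQuot.mk (asymIdeal (KAlg D)) (G.kpath (star f) (star T)) = star (CQuot.mk _ (G.kpath f T)) := by
  rw [← CQuot.mk_star]
  refine CQuot.mk_eq.2 (mem_asymIdeal.2 fun ε hε => eventually_atTop.1 ?_)
  filter_upwards [G.eventually_commutator_le (star f) (star T) hε] with t ht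
  obtain ⟨U, hU, hU'⟩ := G.op_kpath_adj f T t
  obtain ⟨Z, hZ, hZ'⟩ := G.op_kpath_adj (star f) (star T) t
  have e : ((G.kpath (star f) (star T) - star (G.kpath f T)) t).op =
      extOp D G.ι_injective (Z - star U) := by
    rw [map_sub, map_star, ← hU, ← hZ]; rfl
  refine (G.norm_le_of_extOp e).trans ?_
  refine le_of_eq_of_le ?_ ht
  rw [ColOp.sub_adj, ColOp.star_adj, hU', hZ', star_mul, rescOp_star, CtrlAlg.op_star, ColOp.star_adj,
    norm_sub_rev]

end Geometry
end CounitGeometry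

section CounitHom
open scoped ZeroAtInfty BoundedContinuousFunction
variable {Y : Type u} [MetricSpace Y] {Y₀ : Set Y} {δ : ℝ} {X : Set Y}

lemma C0Pair.tens_mul {E : Type*} [NonUnitalCStarAlgebra E] (f g : C0Pair Y Y₀ ℂ) (a b : E) :
    C0Pair.tens (f * g) (a * b) = C0Pair.tens f a * C0Pair.tens g b :=
  C0Pair.ext' fun y => (smul_mul_smul_comm (f.fn y) a (g.fn y) b).symm

lemma C0Pair.tens_star {E : Type*} [NonUnitalCStarAlgebra E] (f : C0Pair Y Y₀ ℂ) (a : E) :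
    C0Pair.tens (star f) (star a) = star (C0Pair.tens f a) :=
  C0Pair.ext' fun y => (star_smul (f.fn y) a).symm

variable [ProperSpace Y]

/-- Homomorphisms are determined by their values on elementary tensors. -/
lemma C0Pair.hom_ext_tens {E Q : Type*} [NonUnitalCStarAlgebra E] [NonUnitalCStarAlgebra Q]
    (hY₀ : IsClosed Y₀) (φ ψ : C0Pair Y Y₀ E →⋆ₙₐ[ℂ] Q)
    (h : ∀ f a, φ (C0Pair.tens f a) = ψ (C0Pair.tens f a)) : φ = ψ := by
  refine hom_eq_of_dense φ ψ {g | φ g = ψ g} ?_ fun a ha => ha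
  refine fun g => Metric.mem_closure_iff.2 fun ε hε => ?_
  obtain ⟨m, f, a, hfa⟩ := C0Pair.exists_tens hY₀ g hε
  refine ⟨∑ j, C0Pair.tens (f j) (a j), ?_, by rwa [dist_eq_norm]⟩
  change φ _ = ψ _
  rw [map_sum, map_sum]
  exact Finset.sum_congr rfl fun j _ => h _ _

namespace Geometry
variable (G : Geometry Y Y₀ δ X) {D D' : Type u} [NonUnitalCStarAlgebra D] [NonUnitalCStarAlgebra D']

lemma op_sum_kpath_adj {n : ℕ} (f : Fin n → C0Pair Y Y₀ ℂ) (T : Fin n → CtrlAlg D (metricFamily X))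
    (s : Finset (Fin n)) (t : ℝ≥0) :
    ∃ S : ColOp X D, ((∑ i ∈ s, G.kpath (f i) (T i)) t).op = extOp D G.ι_injective S ∧
      S.adj = ∑ i ∈ s, G.rescOp D (f i) t * (T i).op.adj := by
  classical
  induction s using Finset.induction_on with
  | empty => exact ⟨0, by rw [map_zero]; rfl, rfl⟩
  | insert i s hi ih =>
    obtain ⟨S, hS, hS'⟩ := ih
    obtain ⟨U, hU, hU'⟩ := G.op_kpath_adj (f i) (T i) t
    refine ⟨U + S, ?_, ?_⟩
    · rw [Finset.sum_insert hi, map_add, ← hS, ← hU]; rfl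
    · rw [Finset.sum_insert hi, ColOp.add_adj, hU', hS']

/-- The norm estimate for the counit. -/
lemma norm_mk_sum_kpath_le {n : ℕ} (f : Fin n → C0Pair Y Y₀ ℂ)
    (T : Fin n → CtrlAlg D (metricFamily X)) :
    ‖CQuot.mk (asymIdeal (KAlg D)) (∑ i, G.kpath (f i) (T i))‖ ≤
      ‖∑ i, C0Pair.tens (f i) (CQuot.mk (roeIdeal D (nearPoints δ X Y₀)) (T i))‖ := by
  set a : C0Pair Y Y₀ (CQuot (roeIdeal D (nearPoints δ X Y₀))) :=
    ∑ i, C0Pair.tens (f i) (CQuot.mk (roeIdeal D (nearPoints δ X Y₀)) (T i)) with ha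
  set M : ℝ := ∑ i, ‖T i‖ with hM
  have hM0 : 0 ≤ M := Finset.sum_nonneg fun i _ => norm_nonneg _
  refine le_of_forall_pos_le_add fun κ hκ => ?_
  set ε : ℝ := κ / (M + 3) with hεdef
  have hε : 0 < ε := by positivity
  obtain ⟨m, ψ, p, hψs, hψ1, hψf⟩ := C0Pair.exists_partition G.isClosed f hε
  have hdec : ∀ j, ∃ S : CtrlAlg D (metricFamily X), ‖S‖ ≤ ‖a‖ + ε ∧
      (∑ i, (f i).fn (p j) • T i) - S ∈ (roeIdeal D (nearPoints δ X Y₀)).alg := by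
    intro j
    obtain ⟨S, hS, hSn⟩ := CQuot.exists_norm_lt
      (CQuot.mk (roeIdeal D (nearPoints δ X Y₀)) (∑ i, (f i).fn (p j) • T i)) hε
    refine ⟨S, hSn.le.trans ?_, CQuot.mk_eq.1 hS.symm⟩
    gcongr
    have e : CQuot.mk (roeIdeal D (nearPoints δ X Y₀)) (∑ i, (f i).fn (p j) • T i) = a.fn (p j) := by
      have e1 := map_sum (CQuot.proj (roeIdeal D (nearPoints δ X Y₀)))
        (fun i => (f i).fn (p j) • T i) Finset.univ
      simp only [CQuot.proj_apply] at e1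
      rw [ha, C0Pair.fn_sum, e1]
      rfl
    rw [e]
    exact norm_fn_le a _
  choose S hS hSn using hdec
  set κ' : ℝ := ε / (m + 1) with hκ'
  have hκ'0 : 0 < κ' := by positivity
  have hev1 : ∀ᶠ t in atTop, ∀ j, ‖(S j).op.adj * G.rescOp D (ψ j) t -
      G.rescOp D (ψ j) t * (S j).op.adj‖ ≤ κ' :=
    eventually_all.2 fun j => G.eventually_commutator_le (ψ j) (S j) hκ'0
  have hev2 : ∀ᶠ t in atTop, ∀ j, ‖G.rescOp D (ψ j) t *
      ((∑ i, (f i).fn (p j) • T i) - S j).op.adj‖ ≤ κ' :=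
    eventually_all.2 fun j => G.eventually_norm_mul_le (ψ j) (hSn j) hκ'0
  refine norm_mk_asym_le (by positivity) ?_
  filter_upwards [hev1, hev2] with t h1 h2
  obtain ⟨V, hV, hV'⟩ := G.op_sum_kpath_adj f T Finset.univ t
  refine (G.norm_le_of_extOp hV).trans ?_
  rw [hV']
  set d : Fin m → Adj X D := fun j => G.rescOp D (ψ j) t with hd
  have hds : ∀ j, star (d j) = d j := fun j => by rw [hd]; simp only; rw [← rescOp_star, hψs]
  have hdn : ∀ j, ‖d j‖ ≤ 1 := fun j => norm_dop_le zero_le_one fun x => by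
    have h3 := (Finset.single_le_sum (f := fun j => ‖(ψ j).fn (G.sc t x)‖ ^ 2)
      (fun i _ => by positivity) (Finset.mem_univ j)).trans (hψ1 (G.sc t x))
    exact (sq_le_one_iff₀ (norm_nonneg _)).1 h3
  have hfin : finNorm Finset.univ d ≤ 1 := by
    have e : ∑ j, star (d j) * d j = dop D (∑ j, (G.resc (ψ j) t * G.resc (ψ j) t)) := by
      rw [dop_sum _ fun j => (G.bdd_resc _ t).mul (G.bdd_resc _ t)]
      refine Finset.sum_congr rfl fun j _ => ?_
      rw [hds, ← dop_mul_dop (G.bdd_resc _ t) (G.bdd_resc _ t)]; rfl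
    rw [finNorm, e, Real.sqrt_le_left zero_le_one, one_pow]
    refine norm_dop_le zero_le_one fun x => ?_
    rw [Finset.sum_apply]
    refine (norm_sum_le _ _).trans (le_of_eq_of_le (Finset.sum_congr rfl fun j _ => ?_)
      (hψ1 (G.sc t x)))
    rw [Pi.mul_apply, norm_mul, sq]; rfl
  let c : Fin n → Adj X D := fun i => G.rescOp D (f i) t - ∑ j, (f i).fn (p j) • (d j * d j)
  have hc : ∀ i, ‖c i‖ ≤ ε := fun i => by
    have hb : ∀ j, Bdd (G.resc (ψ j) t * G.resc (ψ j) t) := fun j =>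
      (G.bdd_resc _ t).mul (G.bdd_resc _ t)
    have e : c i = dop D (G.resc (f i) t -
        ∑ j, (f i).fn (p j) • (G.resc (ψ j) t * G.resc (ψ j) t)) := by
      rw [dop_sub (G.bdd_resc _ t) (Bdd.sum _ fun j => (hb j).smul _),
        dop_sum _ fun j => (hb j).smul _]
      refine congrArg₂ (· - ·) rfl (Finset.sum_congr rfl fun j _ => ?_)
      rw [dop_smul _ (hb j), ← dop_mul_dop (G.bdd_resc _ t) (G.bdd_resc _ t)]; rfl
    rw [e]
    refine norm_dop_le hε.le fun x => ?_
    have h3 := hψf i (G.sc t x)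
    refine le_of_eq_of_le (congrArg norm ?_) h3
    rw [Pi.sub_apply, Finset.sum_apply]
    refine congrArg₂ _ rfl (Finset.sum_congr rfl fun j _ => ?_)
    rw [Pi.smul_apply, Pi.mul_apply, smul_eq_mul, smul_eq_mul, mul_comm, sq]; rfl
  have hTop : ∀ j, (∑ i, (f i).fn (p j) • T i - S j).op.adj =
      ∑ i, (f i).fn (p j) • (T i).op.adj - (S j).op.adj := fun j => by
    rw [CtrlAlg.op_sub, ColOp.sub_adj]
    refine congrArg₂ _ ?_ rfl
    let L : CtrlAlg D (metricFamily X) →ₗ[ℂ] Adj X D :=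
      { toFun := fun T => T.op.adj, map_add' := fun _ _ => rfl, map_smul' := fun _ _ => rfl }
    change L _ = _
    rw [map_sum]
    rfl
  have key : ∑ i, G.rescOp D (f i) t * (T i).op.adj =
      ∑ j, star (d j) * ((S j).op.adj * d j) + ∑ i, c i * (T i).op.adj +
      ∑ j, d j * (d j * (∑ i, (f i).fn (p j) • T i - S j).op.adj) -
      ∑ j, d j * ((S j).op.adj * d j - d j * (S j).op.adj) := by
    simp only [hTop, hds, c, sub_mul, Finset.sum_sub_distrib, mul_sub, Finset.mul_sum,
      Finset.sum_mul, mul_smul_comm, smul_mul_assoc]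
    rw [Finset.sum_comm (s := (Finset.univ : Finset (Fin m)))]
    simp only [mul_assoc]
    abel
  rw [key]
  have b1 := norm_sum_conj_le Finset.univ d (fun j => (S j).op.adj) (C := ‖a‖ + ε) (by positivity)
    hfin hS
  have b2 : ‖∑ i, c i * (T i).op.adj‖ ≤ ε * M := by
    rw [hM, Finset.mul_sum]
    exact norm_sum_le_of_le _ fun i _ =>
      (norm_mul_le _ _).trans (mul_le_mul_of_nonneg_right (hc i) (norm_nonneg _))
  have b3 : ∀ v : Fin m → Adj X D, (∀ j, ‖v j‖ ≤ κ') → ‖∑ j, d j * v j‖ ≤ ε := fun v hv => by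
    refine (norm_sum_le_of_le (f := fun j => d j * v j) (n := fun _ => κ') _ fun j _ =>
      (norm_mul_le _ _).trans ?_).trans ?_
    · calc _ ≤ 1 * κ' := mul_le_mul (hdn j) (hv j) (norm_nonneg _) zero_le_one
        _ = κ' := one_mul _
    · rw [Finset.sum_const, Finset.card_univ, Fintype.card_fin, nsmul_eq_mul, hκ', mul_div_assoc']
      rw [div_le_iff₀ (by positivity)]
      nlinarith
  have hfinal : ‖a‖ + κ = (‖a‖ + ε) + ε * M + ε + ε := by
    rw [hεdef]; field_simp; ring
  rw [hfinal]
  refine (norm_sub_le _ _).trans (add_le_add ((norm_add_le _ _).trans (add_le_add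
    ((norm_add_le _ _).trans (add_le_add b1 b2)) (b3 _ h2))) (b3 _ h1))

/-- The counit exists. -/
lemma exists_counit (D : Type u) [NonUnitalCStarAlgebra D] :
    ∃ e : C0Pair Y Y₀ (CQuot (roeIdeal D (nearPoints δ X Y₀))) →⋆ₙₐ[ℂ] CQuot (asymIdeal (KAlg D)),
      ∀ f T, e (C0Pair.tens f (CQuot.mk _ T)) = CQuot.mk _ (G.kpath f T) := by
  let P : Set (C0Pair Y Y₀ (CQuot (roeIdeal D (nearPoints δ X Y₀))) × CQuot (asymIdeal (KAlg D))) :=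
    Set.range fun q : C0Pair Y Y₀ ℂ × CtrlAlg D (metricFamily X) =>
      (C0Pair.tens q.1 (CQuot.mk _ q.2), CQuot.mk _ (G.kpath q.1 q.2))
  let M := Submodule.span ℂ P
  have hPM : ∀ f T, ((C0Pair.tens f (CQuot.mk _ T), CQuot.mk _ (G.kpath f T)) :
      C0Pair Y Y₀ (CQuot (roeIdeal D (nearPoints δ X Y₀))) × CQuot (asymIdeal (KAlg D))) ∈ M :=
    fun f T => Submodule.subset_span ⟨(f, T), rfl⟩
  have hform : ∀ q ∈ M, ∃ (n : ℕ) (f : Fin n → C0Pair Y Y₀ ℂ) (T : Fin n → CtrlAlg D (metricFamily X)),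
      q = (∑ i, C0Pair.tens (f i) (CQuot.mk _ (T i)), CQuot.mk _ (∑ i, G.kpath (f i) (T i))) := by
    intro q hq
    obtain ⟨n, c, g, rfl⟩ := Submodule.mem_span_set'.1 hq
    choose r hr using fun i => (g i).2
    refine ⟨n, fun i => c i • (r i).1, fun i => (r i).2, ?_⟩
    have e1 := map_sum (CQuot.proj (asymIdeal (KAlg D)))
      (fun i => G.kpath (c i • (r i).1) (r i).2) Finset.univ
    simp only [CQuot.proj_apply] at e1
    rw [e1]
    refine Prod.ext ?_ ?_
    · rw [Prod.fst_sum]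
      refine Finset.sum_congr rfl fun i _ => ?_
      rw [← hr i]
      refine C0Pair.ext' fun y => ?_
      exact (smul_assoc (c i) ((r i).1.fn y) (CQuot.mk (roeIdeal D (nearPoints δ X Y₀)) (r i).2)).symm
    · rw [Prod.snd_sum]
      refine Finset.sum_congr rfl fun i _ => ?_
      rw [← hr i, kpath_smul]
      rfl
  refine (exists_hom_of_rel (fun a b => (a, b) ∈ M) (zero_mem M)
    (fun a b a' b' h h' => add_mem h h') (fun c a b h => Submodule.smul_mem M c h) ?_ ?_ ?_ ?_).imp
    fun e he f T => he _ _ (hPM f T)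
  · intro a b a' b' h h'
    refine Submodule.span_induction (p := fun q _ => q * (a', b') ∈ M) ?_ ?_ ?_ ?_ h
    · rintro _ ⟨⟨f, T⟩, rfl⟩
      refine Submodule.span_induction (p := fun q _ => _ * q ∈ M) ?_ ?_ ?_ ?_ h'
      · rintro _ ⟨⟨g, S⟩, rfl⟩
        have h1 := hPM (f * g) (T * S)
        rw [G.mk_kpath_mul, CQuot.mk_mul, C0Pair.tens_mul] at h1
        exact h1
      · rw [mul_zero]; exact zero_mem M
      · intro x y _ _ hx hy
        rw [mul_add]; exact add_mem hx hy
      · intro c x _ hx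
        rw [mul_smul_comm]; exact Submodule.smul_mem M c hx
    · rw [zero_mul]; exact zero_mem M
    · intro x y _ _ hx hy
      rw [add_mul]; exact add_mem hx hy
    · intro c x _ hx
      rw [smul_mul_assoc]; exact Submodule.smul_mem M c hx
  · intro a b h
    refine Submodule.span_induction (p := fun q _ => star q ∈ M) ?_ ?_ ?_ ?_ h
    · rintro _ ⟨⟨f, T⟩, rfl⟩
      have h1 := hPM (star f) (star T)
      rw [G.mk_kpath_star, CQuot.mk_star, C0Pair.tens_star] at h1
      exact h1
    · rw [star_zero]; exact zero_mem M
    · intro x y _ _ hx hy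
      rw [star_add]; exact add_mem hx hy
    · intro c x _ hx
      rw [star_smul]; exact Submodule.smul_mem M _ hx
  · intro a b h
    obtain ⟨n, f, T, hq⟩ := hform _ h
    obtain ⟨rfl, rfl⟩ := Prod.mk.inj hq
    exact G.norm_mk_sum_kpath_le f T
  · intro a ε hε
    obtain ⟨m, f, v, hv⟩ := C0Pair.exists_tens G.isClosed a hε
    choose T hT using fun j => CQuot.mk_surjective (v j)
    refine ⟨∑ j, C0Pair.tens (f j) (v j), ∑ j, CQuot.mk _ (G.kpath (f j) (T j)), ?_, hv⟩
    have h1 : ∑ j, ((C0Pair.tens (f j) (CQuot.mk _ (T j)), CQuot.mk _ (G.kpath (f j) (T j))) :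
      C0Pair Y Y₀ (CQuot (roeIdeal D (nearPoints δ X Y₀))) × CQuot (asymIdeal (KAlg D))) ∈ M :=
      sum_mem fun j _ => hPM _ _
    refine (congrArg (· ∈ M) (Prod.ext ?_ ?_)).mp h1
    · rw [Prod.fst_sum]
      exact Finset.sum_congr rfl fun j _ => by rw [hT]
    · rw [Prod.snd_sum]

/-- The counit `C₀(Y, Y₀, 𝔑 D) → 𝔄 𝕂 D`. -/
def counit (D : Type u) [NonUnitalCStarAlgebra D] :
    C0Pair Y Y₀ (CQuot (roeIdeal D (nearPoints δ X Y₀))) →⋆ₙₐ[ℂ] CQuot (asymIdeal (KAlg D)) :=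
  (G.exists_counit D).choose

lemma counit_tens (f : C0Pair Y Y₀ ℂ) (T : CtrlAlg D (metricFamily X)) :
    G.counit D (C0Pair.tens f (CQuot.mk _ T)) = CQuot.mk _ (G.kpath f T) :=
  (G.exists_counit D).choose_spec f T

lemma map_kop (r : D →⋆ₙₐ[ℂ] D') (f : C0Pair Y Y₀ ℂ) (T : CtrlAlg D (metricFamily X)) (t : ℝ≥0) :
    CtrlAlg.map _ r (G.kop f T t) = G.kop f (CtrlAlg.map _ r T) t := CtrlAlg.op_injective (by
  rw [CtrlAlg.op_map, op_kop, op_kop, colMap_extOp]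
  refine congrArg _ (entry_ext fun x y => ?_)
  rw [entry_colMap, entry_cut (G.bdd_resc _ t) bdd_one, entry_cut (G.bdd_resc _ t) bdd_one, map_smul,
    CtrlAlg.op_map, entry_colMap])

/-- The counit as a morphism. -/
def counitMor (D : CStarAlg.{u}) :
    (c0Pair Y Y₀).obj ((roeQuot X (nearPoints δ X Y₀)).obj D) ⟶ asym.obj (compact.obj D) :=
  ofHom (A := (c0Pair Y Y₀).obj ((roeQuot X (nearPoints δ X Y₀)).obj D))
    (B := asym.obj (compact.obj D)) (G.counit D)

lemma counitMor_naturality {D D' : CStarAlg.{u}} (r : D ⟶ D') :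
    (c0Pair Y Y₀).map ((roeQuot X (nearPoints δ X Y₀)).map r) ≫ G.counitMor D' =
      G.counitMor D ≫ asym.map (compact.map r) := by
  refine C0Pair.hom_ext_tens G.isClosed (E := CQuot (roeIdeal D (nearPoints δ X Y₀)))
    (Q := CQuot (asymIdeal (KAlg D'))) _ _ fun f T => ?_
  obtain ⟨T, rfl⟩ := CQuot.mk_surjective T
  have h1 : (toHom ((c0Pair Y Y₀).map ((roeQuot X (nearPoints δ X Y₀)).map r)))
      (C0Pair.tens f (CQuot.mk _ T)) =
        C0Pair.tens f (CQuot.mk (roeIdeal D' (nearPoints δ X Y₀)) (CtrlAlg.map _ (toHom r) T)) :=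
    C0Pair.ext' fun y => map_smul (toHom ((roeQuot X (nearPoints δ X Y₀)).map r)) (f.fn y)
      (CQuot.mk (roeIdeal D (nearPoints δ X Y₀)) T)
  have h2 : G.counit D' ((toHom ((c0Pair Y Y₀).map ((roeQuot X (nearPoints δ X Y₀)).map r)))
      (C0Pair.tens f (CQuot.mk _ T))) = asymMap (CtrlAlg.map _ (toHom r))
        (G.counit D (C0Pair.tens f (CQuot.mk _ T))) := by
    rw [h1, counit_tens, counit_tens, asymMap_mk]
    exact congrArg (CQuot.mk _) (BoundedContinuousFunction.ext fun t => (G.map_kop (toHom r) f T t).symm)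
  exact h2

end Geometry
end CounitHom

/-! ### Conjugation by row isometries -/

section ScalarMatrices
variable {D : Type*} [NonUnitalCStarAlgebra D]

variable (D) in
/-- The scalar matrix unit `e_{ij}` as an adjointable operator. -/
def smat (i j : ℕ) : Adj ℕ D := dop D (charFn {i}) * isom D (Equiv.swap i j).injective

lemma smat_op (i j : ℕ) (ξ : L2 ℕ D) : (smat D i j).op ξ = L2.single i (ξ j) :=
  L2.ext_apply fun x => by
    rw [smat, Adj.mul_op, dop_op (bdd_charFn _), isom_op]
    by_cases h : x = i
    · subst h
      rw [charFn_of_mem (Set.mem_singleton x), one_smul, L2.single_same]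
      have := L2.push_apply (Equiv.swap x j).injective ξ j
      rwa [Equiv.swap_apply_right] at this
    · rw [charFn_of_notMem (by simpa using h), zero_smul, L2.single_of_ne h]

lemma star_smat (i j : ℕ) : star (smat D i j) = smat D j i := Adj.star_eq_of fun ξ ζ => by
  rw [smat_op, smat_op, L2.inner_single_left, ← L2.star_inner, L2.inner_single_left, star_mul, star_star]

lemma smat_mul_smat (i j k : ℕ) : smat D i j * smat D j k = smat D i k := Adj.ext_apply fun ξ => by
  rw [Adj.mul_op, smat_op, smat_op, smat_op, L2.single_same]

lemma smat_self (k : ℕ) : smat D k k = dop D (charFn {k}) := Adj.ext_apply fun ξ =>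
  L2.ext_apply fun x => by
    rw [smat_op, dop_op (bdd_charFn _)]
    by_cases h : x = k
    · subst h
      rw [charFn_of_mem (Set.mem_singleton x), one_smul, L2.single_same]
    · rw [charFn_of_notMem (by simpa using h), zero_smul, L2.single_of_ne h]

lemma dop_mul_smat {g : ℕ → ℂ} (hg : Bdd g) {i : ℕ} (h : g i = 0) (j : ℕ) : dop D g * smat D i j = 0 :=
  Adj.ext_apply fun ξ => L2.ext_apply fun x => by
    rw [Adj.mul_op, smat_op, dop_op hg]
    by_cases hx : x = i
    · subst hx; rw [h, zero_smul]; rfl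
    · rw [L2.single_of_ne hx, smul_zero]; rfl

/-- Compression of a matrix to an entry. -/
lemma smat_mul_mul_smat (T : ColOp ℕ D) (i j k l : ℕ) :
    smat D i k * T.adj * smat D l j = (munit i j (entry T k l)).op.adj := by
  refine HasCols.ext (c := col (munit i j (entry T k l)).op) (fun y b => ?_) (hasCols_col _)
  refine L2.ext_apply fun x => ?_
  rw [Adj.mul_op, Adj.mul_op, smat_op, smat_op, hasCols_col T, L2.rmul_apply, L2.rmul_apply]
  change (L2.single i (entry T k l * _)) x = entry (munit i j (entry T k l)).op x y * b
  rw [entry_munit]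
  by_cases hx : x = i
  · subst hx
    rw [L2.single_same]
    by_cases hy : y = j
    · subst hy; simp
    · simp [L2.single_of_ne (Ne.symm hy), hy]
  · simp [L2.single_of_ne hx, hx]

lemma smat_mul_mul_dop (T : ColOp ℕ D) {Q : ℕ → ℂ} (hQ : Bdd Q) (i k : ℕ)
    (h : ∀ n, entry T k n ≠ 0 → Q n = 1) : smat D i k * T.adj * dop D Q = smat D i k * T.adj :=
  Adj.ext_apply fun ξ => by
    rw [Adj.mul_op, Adj.mul_op, Adj.mul_op, smat_op, smat_op]
    congr 1
    refine ((((hasCols_col T).hasSum _).mapL (L2.evalL k)).unique ?_)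
    have h1 := ((hasCols_col T).hasSum ξ).mapL (L2.evalL k)
    refine h1.congr_fun fun n => ?_
    change entry T k n * (dop D Q).op ξ n = entry T k n * ξ n
    rw [dop_op hQ]
    by_cases h0 : entry T k n = 0
    · rw [h0, zero_mul, zero_mul]
    · rw [h n h0, one_smul]

variable (D) in
/-- The representation of the compact operators. -/
def adjHom : KAlg D →⋆ₙₐ[ℂ] Adj ℕ D where
  toFun k := k.op.adj
  map_smul' _ _ := rfl
  map_zero' := rfl
  map_add' _ _ := rfl
  map_mul' _ _ := rfl
  map_star' _ := rfl

lemma adjHom_apply (k : KAlg D) : adjHom D k = k.op.adj := rfl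

lemma adjHom_injective : Function.Injective (adjHom D) := fun _ _ h =>
  CtrlAlg.op_injective (ColOp.adj_injective h)

lemma norm_adjHom (k : KAlg D) : ‖adjHom D k‖ = ‖k‖ := rfl

end ScalarMatrices

section Rows
open scoped BoundedContinuousFunction
variable {Y : Type u} [MetricSpace Y] {Y₀ : Set Y} {δ : ℝ} {X : Set Y}

/-- A continuous family of isometries `ℓ²(X) → ℓ²(X) ⊗ ℓ²(ℕ)`, given by
`e_z ↦ ∑_x a_x(z) e_x ⊗ e_{ι z} + b e_z ⊗ e_0`, with a controlled support. -/
structure Rows (G : Geometry Y Y₀ δ X) (Ω : Type) [TopologicalSpace Ω] where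
  a : Ω → X → X → ℝ
  b : Ω → ℝ
  a_continuous : ∀ x z, Continuous fun ω => a ω x z
  b_continuous : Continuous b
  a_locally : ∀ ω₀ x, ∃ F : Finset X, ∀ᶠ ω in 𝓝 ω₀, ∀ z, a ω x z ≠ 0 → z ∈ F
  a_finite : ∀ ω z, {x | a ω x z ≠ 0}.Finite
  sum_eq : ∀ ω z (s : Finset X), (∀ x, a ω x z ≠ 0 → x ∈ s) → z ∈ s → ∑ x ∈ s, a ω x z ^ 2 + b ω ^ 2 = 1
  p : Ω → X → Y
  C : ℝ
  a_dist : ∀ ω x z, a ω x z ≠ 0 → dist (x : Y) (p ω z) ≤ C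
  b_dist : ∀ ω (z : X), b ω ≠ 0 → dist (z : Y) (p ω z) ≤ C
  p_dist : ∀ R, ∃ R', ∀ ω (z z' : X), dist z z' ≤ R → dist (p ω z) (p ω z') ≤ R'
  p_near : ∀ R, ∃ R', ∀ ω (z : X), (z : Y) ∈ Metric.thickening R Y₀ → p ω z ∈ Metric.thickening R' Y₀

namespace Rows
variable {G : Geometry Y Y₀ δ X} {Ω : Type} [TopologicalSpace Ω] (V : Rows G Ω)
variable {D D' : Type u} [NonUnitalCStarAlgebra D] [NonUnitalCStarAlgebra D']

/-- The coefficients of the row at `x`. -/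
def wt (ω : Ω) (x : X) : Option X → ℝ
  | none => V.b ω
  | some z => V.a ω x z

/-- The sources of the matrix units in the row at `x`. -/
def src (x : X) : Option X → X
  | none => x
  | some z => z

variable (G) in
/-- The targets of the matrix units. -/
def tgt : Option X → ℕ
  | none => 0
  | some z => G.ι z

/-- The diagonal part of the row at `x`. -/
def diag (ω : Ω) (x : X) : ℕ → ℂ := Function.extend G.ι (fun z => ((V.a ω x z : ℝ) : ℂ)) 0

lemma diag_ι (ω : Ω) (x z : X) : V.diag ω x (G.ι z) = ((V.a ω x z : ℝ) : ℂ) :=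
  G.ι_injective.extend_apply _ _ _

lemma diag_of_notMem (ω : Ω) (x : X) {n : ℕ} (h : ¬ ∃ z, G.ι z = n) : V.diag ω x n = 0 :=
  Function.extend_apply' _ _ _ h

lemma diag_zero (ω : Ω) (x : X) : V.diag ω x 0 = 0 :=
  V.diag_of_notMem ω x fun ⟨z, hz⟩ => G.ι_ne_zero z hz

lemma sum_le (ω : Ω) (z : X) (s : Finset X) :
    ∑ x ∈ s, V.a ω x z ^ 2 ≤ 1 - V.b ω ^ 2 := by
  classical
  let s' := s ∪ (V.a_finite ω z).toFinset ∪ {z}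
  have h := V.sum_eq ω z s' (fun x hx => by simp [s', hx]) (by simp [s'])
  have h2 : ∑ x ∈ s, V.a ω x z ^ 2 ≤ ∑ x ∈ s', V.a ω x z ^ 2 :=
    Finset.sum_le_sum_of_subset_of_nonneg (fun x hx => by simp [s', hx]) fun x _ _ => sq_nonneg _
  linarith

lemma abs_a_le (ω : Ω) (x z : X) : |V.a ω x z| ≤ 1 := by
  have h := V.sum_le ω z {x}
  rw [Finset.sum_singleton] at h
  rw [← sq_le_one_iff_abs_le_one]
  nlinarith [sq_nonneg (V.b ω)]

lemma norm_diag_le (ω : Ω) (x : X) (n : ℕ) : ‖V.diag ω x n‖ ≤ 1 := by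
  by_cases h : ∃ z, G.ι z = n
  · obtain ⟨z, rfl⟩ := h
    rw [diag_ι, Complex.norm_real]
    exact V.abs_a_le ω x z
  · rw [V.diag_of_notMem ω x h, norm_zero]; exact zero_le_one

lemma bdd_diag (ω : Ω) (x : X) : Bdd (V.diag ω x) := ⟨1, V.norm_diag_le ω x⟩

variable (D) in
/-- The row at `x`. -/
def row (ω : Ω) (x : X) : Adj ℕ D := dop D (V.diag ω x) + ((V.b ω : ℝ) : ℂ) • smat D 0 (G.ι x)

lemma row_eq_sum (ω : Ω) (x : X) (F : Finset X) (hF : ∀ z, V.a ω x z ≠ 0 → z ∈ F) :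
    V.row D ω x = ∑ p ∈ F.insertNone, ((V.wt ω x p : ℝ) : ℂ) • smat D (tgt G p) (G.ι (src x p)) := by
  rw [Finset.sum_insertNone, row, add_comm]
  refine congrArg₂ (· + ·) rfl ?_
  have h : V.diag ω x = ∑ z ∈ F, ((V.a ω x z : ℝ) : ℂ) • charFn {G.ι z} := by
    classical
    funext n
    rw [Finset.sum_apply]
    simp only [Pi.smul_apply, smul_eq_mul]
    by_cases hn : ∃ z, G.ι z = n
    · obtain ⟨w, rfl⟩ := hn
      rw [Finset.sum_eq_single w]
      · rw [charFn_of_mem (Set.mem_singleton _), mul_one, diag_ι]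
      · intro z _ hz
        rw [charFn_of_notMem (by simpa using fun h => hz (G.ι_injective h).symm), mul_zero]
      · intro hw
        have : V.a ω x w = 0 := by by_contra h0; exact hw (hF w h0)
        simp [this]
    · rw [V.diag_of_notMem ω x hn]
      symm
      refine Finset.sum_eq_zero fun z _ => ?_
      rw [charFn_of_notMem (by simpa using fun h => hn ⟨z, h.symm⟩), mul_zero]
  rw [h, dop_sum _ fun z => (bdd_charFn _).smul _]
  refine Finset.sum_congr rfl fun z _ => ?_
  rw [dop_smul _ (bdd_charFn _), ← smat_self]
  rfl

/-- The weight of the row at `x`. -/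
def sq (ω : Ω) (x : X) : ℕ → ℂ :=
  V.diag ω x * V.diag ω x + ((V.b ω ^ 2 : ℝ) : ℂ) • charFn {G.ι x}

lemma bdd_sq (ω : Ω) (x : X) : Bdd (V.sq ω x) := by
  have h : V.sq ω x = V.diag ω x * V.diag ω x - (-((V.b ω ^ 2 : ℝ) : ℂ)) • charFn {G.ι x} := by
    rw [neg_smul, sub_neg_eq_add]; rfl
  rw [h]
  exact ((V.bdd_diag ω x).mul (V.bdd_diag ω x)).sub ((bdd_charFn _).smul _)

lemma star_row_mul_row (ω : Ω) (x : X) : star (V.row D ω x) * V.row D ω x = dop D (V.sq ω x) := by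
  have hb := V.bdd_diag ω x
  have h1 : star (dop D (V.diag ω x)) = dop D (V.diag ω x) := by
    rw [star_dop hb]
    congr 1
    funext n
    rw [Pi.star_apply]
    by_cases hn : ∃ z, G.ι z = n
    · obtain ⟨w, rfl⟩ := hn
      rw [diag_ι, Complex.star_def, Complex.conj_ofReal]
    · rw [V.diag_of_notMem ω x hn, star_zero]
  have h2 : dop D (V.diag ω x) * smat D 0 (G.ι x) = 0 := dop_mul_smat hb (V.diag_zero ω x) _
  have h3 : smat D (G.ι x) 0 * dop D (V.diag ω x) = 0 := by
    have := congrArg star h2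
    rwa [star_mul, star_smat, h1, star_zero] at this
  have h4 : dop D (V.sq ω x) = dop D (V.diag ω x * V.diag ω x) -
      (-((V.b ω ^ 2 : ℝ) : ℂ)) • dop D (charFn {G.ι x}) := by
    rw [← dop_smul _ (bdd_charFn _), ← dop_sub (hb.mul hb) ((bdd_charFn _).smul _), neg_smul,
      sub_neg_eq_add]
    rfl
  rw [h4, row, star_add, star_smul, star_smat, h1, add_mul, mul_add, mul_add, smul_mul_assoc,
    smul_mul_assoc, mul_smul_comm, mul_smul_comm, h2, h3, smat_mul_smat, smat_self, smul_smul,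
    dop_mul_dop hb hb, smul_zero, smul_zero, add_zero, zero_add, neg_smul, sub_neg_eq_add]
  congr 2
  rw [Complex.star_def, Complex.conj_ofReal]
  push_cast
  ring

lemma sum_sq_ι (ω : Ω) (s : Finset X) (z : X) [Decidable (z ∈ s)] :
    (∑ x ∈ s, V.sq ω x) (G.ι z) =
      ((∑ x ∈ s, V.a ω x z ^ 2 + if z ∈ s then V.b ω ^ 2 else 0 : ℝ) : ℂ) := by
  classical
  rw [Finset.sum_apply]
  simp only [sq, Pi.add_apply, Pi.mul_apply, Pi.smul_apply, diag_ι, Finset.sum_add_distrib]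
  push_cast
  congr 1
  · exact Finset.sum_congr rfl fun x _ => by ring
  · split_ifs with hz
    · rw [Finset.sum_eq_single_of_mem z hz fun x _ hx => by
        rw [charFn_of_notMem (by simpa using fun h => hx (G.ι_injective h).symm), smul_zero],
        charFn_of_mem (Set.mem_singleton _)]
      simp
    · rw [Complex.ofReal_zero]
      refine Finset.sum_eq_zero fun x hx => ?_
      rw [charFn_of_notMem (by
        simpa using fun h => hz (by rw [G.ι_injective h]; exact hx)), smul_zero]

lemma norm_sum_sq_le (ω : Ω) (s : Finset X) (n : ℕ) : ‖(∑ x ∈ s, V.sq ω x) n‖ ≤ 1 := by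
  classical
  by_cases hn : ∃ z, G.ι z = n
  · obtain ⟨z, rfl⟩ := hn
    rw [sum_sq_ι, Complex.norm_real, Real.norm_of_nonneg]
    · have := V.sum_le ω z s
      split_ifs <;> nlinarith [sq_nonneg (V.b ω)]
    · refine add_nonneg (Finset.sum_nonneg fun x _ => sq_nonneg _) ?_
      split_ifs
      · exact sq_nonneg _
      · exact le_rfl
  · rw [Finset.sum_apply, Finset.sum_eq_zero, norm_zero]
    · exact zero_le_one
    intro x _
    simp only [sq, Pi.add_apply, Pi.mul_apply, Pi.smul_apply]
    rw [V.diag_of_notMem ω x hn, charFn_of_notMem (by simpa using fun h => hn ⟨x, h.symm⟩)]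
    simp

lemma sum_star_row_mul_row (ω : Ω) (s : Finset X) :
    ∑ x ∈ s, star (V.row D ω x) * V.row D ω x = dop D (∑ x ∈ s, V.sq ω x) := by
  rw [dop_sum _ fun x => V.bdd_sq ω x]
  exact Finset.sum_congr rfl fun x _ => V.star_row_mul_row ω x

lemma finNorm_row_le (ω : Ω) (s : Finset X) : finNorm s (V.row D ω) ≤ 1 := by
  rw [finNorm, sum_star_row_mul_row, Real.sqrt_le_left zero_le_one, one_pow]
  exact norm_dop_le zero_le_one (V.norm_sum_sq_le ω s)

lemma norm_row_le (ω : Ω) (x : X) : ‖V.row D ω x‖ ≤ 1 :=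
  (norm_apply_le_finNorm (Finset.mem_singleton_self x) _).trans (V.finNorm_row_le ω {x})

variable (G) in
/-- The extension of a matrix over `X` to a matrix over `ℕ`. -/
def ext (T : ColOp X D) : Adj ℕ D := (extOp D G.ι_injective T).adj

lemma norm_ext_le (T : ColOp X D) : ‖ext G T‖ ≤ ‖T‖ :=
  NonUnitalStarAlgHom.norm_apply_le (extOp D G.ι_injective) T

/-- The compressions of a matrix by the rows are finite sums of matrix units. -/
lemma row_mul_mul_row (T : ColOp X D) (ω : Ω) (x x' : X) (F F' : Finset X)
    (hF : ∀ z, V.a ω x z ≠ 0 → z ∈ F) (hF' : ∀ z, V.a ω x' z ≠ 0 → z ∈ F') :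
    V.row D ω x * ext G T * star (V.row D ω x') =
      adjHom D (∑ p ∈ F.insertNone, ∑ q ∈ F'.insertNone, ((V.wt ω x p * V.wt ω x' q : ℝ) : ℂ) •
        munit (tgt G p) (tgt G q) (entry T (src x p) (src x' q))) := by
  rw [V.row_eq_sum ω x F hF, V.row_eq_sum ω x' F' hF', star_sum, Finset.sum_mul, Finset.sum_mul, map_sum]
  refine Finset.sum_congr rfl fun p _ => ?_
  rw [Finset.mul_sum, map_sum]
  refine Finset.sum_congr rfl fun q _ => ?_
  rw [star_smul, star_smat, smul_mul_assoc, smul_mul_assoc, mul_smul_comm, smul_smul, map_smul,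
    adjHom_apply, ext, smat_mul_mul_smat, entry_extOp, Complex.star_def, Complex.conj_ofReal]
  push_cast
  rfl

lemma exists_finset (ω : Ω) (x : X) : ∃ F : Finset X, ∀ z, V.a ω x z ≠ 0 → z ∈ F := by
  obtain ⟨F, hF⟩ := V.a_locally ω x
  exact ⟨F, hF.self_of_nhds⟩

lemma exists_of_row_mul_ne_zero {T : ColOp X D} {ω : Ω} {x x' : X}
    (h : V.row D ω x * ext G T * star (V.row D ω x') ≠ 0) :
    ∃ p q, V.wt ω x p ≠ 0 ∧ V.wt ω x' q ≠ 0 ∧ entry T (src x p) (src x' q) ≠ 0 := by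
  obtain ⟨F, hF⟩ := V.exists_finset ω x
  obtain ⟨F', hF'⟩ := V.exists_finset ω x'
  rw [V.row_mul_mul_row T ω x x' F F' hF hF', map_sum] at h
  obtain ⟨p, -, hp⟩ := Finset.exists_ne_zero_of_sum_ne_zero h
  rw [map_sum] at hp
  obtain ⟨q, -, hq⟩ := Finset.exists_ne_zero_of_sum_ne_zero hp
  rw [map_smul] at hq
  have h1 := left_ne_zero_of_smul hq
  have h2 := right_ne_zero_of_smul hq
  rw [Complex.ofReal_ne_zero] at h1
  refine ⟨p, q, left_ne_zero_of_mul h1, right_ne_zero_of_mul h1, fun h0 => h2 ?_⟩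
  rw [h0, munit_zero, map_zero]

lemma dist_src_le {ω : Ω} {x : X} {p : Option X} (h : V.wt ω x p ≠ 0) :
    dist (x : Y) (V.p ω (src x p)) ≤ V.C := by
  cases p with
  | none => exact V.b_dist ω x h
  | some z => exact V.a_dist ω x z h

lemma exists_dist_le (R : ℝ) : ∃ R', ∀ {D : Type u} [NonUnitalCStarAlgebra D] {T : ColOp X D},
    (∀ z z', entry T z z' ≠ 0 → dist z z' ≤ R) → ∀ ω x x',
      V.row D ω x * ext G T * star (V.row D ω x') ≠ 0 → dist x x' ≤ R' := by
  obtain ⟨R', hR'⟩ := V.p_dist R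
  refine ⟨V.C + R' + V.C, fun hT ω x x' h => ?_⟩
  obtain ⟨p, q, hp, hq, hpq⟩ := V.exists_of_row_mul_ne_zero h
  have h1 := V.dist_src_le hp
  have h2 := V.dist_src_le hq
  have h3 := hR' ω _ _ (hT _ _ hpq)
  have h4 := dist_triangle4 (x : Y) (V.p ω (src x p)) (V.p ω (src x' q)) x'
  rw [dist_comm (V.p ω (src x' q)) (x' : Y)] at h4
  change dist (x : Y) x' ≤ _
  linarith

/-- The compressions of a matrix by the rows form bounded continuous families. -/
lemma exists_entry (T : ColOp X D) (x x' : X) : ∃ m : Ω →ᵇ KAlg D, (∀ ω,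
    adjHom D (m ω) = V.row D ω x * ext G T * star (V.row D ω x')) ∧ ‖m‖ ≤ ‖T‖ := by
  have hk : ∀ ω, ∃ k : KAlg D, adjHom D k = V.row D ω x * ext G T * star (V.row D ω x') := fun ω => by
    obtain ⟨F, hF⟩ := V.exists_finset ω x
    obtain ⟨F', hF'⟩ := V.exists_finset ω x'
    exact ⟨_, (V.row_mul_mul_row T ω x x' F F' hF hF').symm⟩
  choose k hk using hk
  have hn : ∀ ω, ‖k ω‖ ≤ ‖T‖ := fun ω => by
    rw [← norm_adjHom, hk]
    have h1 := V.norm_row_le (D := D) ω x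
    have h2 := V.norm_row_le (D := D) ω x'
    rw [← norm_star] at h2
    have h3 := norm_ext_le (G := G) T
    calc _ ≤ ‖V.row D ω x‖ * ‖ext G T‖ * ‖star (V.row D ω x')‖ :=
          (norm_mul_le _ _).trans (mul_le_mul_of_nonneg_right (norm_mul_le _ _) (norm_nonneg _))
      _ ≤ 1 * ‖T‖ * 1 := by gcongr
      _ = ‖T‖ := by ring
  have hc : Continuous k := by
    rw [continuous_iff_continuousAt]
    intro ω₀
    obtain ⟨F, hF⟩ := V.a_locally ω₀ x
    obtain ⟨F', hF'⟩ := V.a_locally ω₀ x'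
    have he : (fun ω => ∑ p ∈ F.insertNone, ∑ q ∈ F'.insertNone,
        ((V.wt ω x p * V.wt ω x' q : ℝ) : ℂ) •
          munit (tgt G p) (tgt G q) (entry T (src x p) (src x' q))) =ᶠ[𝓝 ω₀] k := by
      filter_upwards [hF, hF'] with ω h h'
      exact adjHom_injective ((V.row_mul_mul_row T ω x x' F F' h h').symm.trans (hk ω).symm)
    have hw : ∀ x p, Continuous fun ω => V.wt ω x p := fun x p => by
      cases p with
      | none => exact V.b_continuous
      | some z => exact V.a_continuous x z
    refine ContinuousAt.congr (Continuous.continuousAt ?_) he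
    refine continuous_finsetSum _ fun p _ => continuous_finsetSum _ fun q _ => ?_
    exact (Complex.continuous_ofReal.comp ((hw x p).mul (hw x' q))).smul continuous_const
  refine ⟨BoundedContinuousFunction.ofNormedAddCommGroup k hc ‖T‖ hn, hk, ?_⟩
  exact BoundedContinuousFunction.norm_ofNormedAddCommGroup_le _ (norm_nonneg _) hn

/-- The rows sum to the identity where it matters. -/
lemma exists_sum_eq_one (T : ColOp X D) (hT : ∀ x, {z | entry T x z ≠ 0}.Finite) (ω : Ω) (x : X)
    (s₀ : Finset X) : ∃ s : Finset X, s₀ ⊆ s ∧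
      V.row D ω x * ext G T * ∑ w ∈ s, star (V.row D ω w) * V.row D ω w =
        V.row D ω x * ext G T := by
  classical
  obtain ⟨F, hF⟩ := V.exists_finset ω x
  let Z : Finset X := F.insertNone.biUnion fun p => (hT (src x p)).toFinset
  let s : Finset X := s₀ ∪ Z ∪ Z.biUnion fun z => (V.a_finite ω z).toFinset
  refine ⟨s, fun w hw => by simp [s, hw], ?_⟩
  have hQ : Bdd (∑ w ∈ s, V.sq ω w) := Bdd.sum _ fun w => V.bdd_sq ω w
  rw [sum_star_row_mul_row, V.row_eq_sum ω x F hF, Finset.sum_mul, Finset.sum_mul]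
  refine Finset.sum_congr rfl fun p hp => ?_
  rw [smul_mul_assoc, smul_mul_assoc]
  congr 1
  refine smat_mul_mul_dop _ hQ _ _ fun n hn => ?_
  obtain ⟨y, z, hy, rfl⟩ := entry_extOp_ne_zero _ hn
  have : y = src x p := G.ι_injective hy
  subst this
  rw [entry_extOp] at hn
  have hz : z ∈ Z := Finset.mem_biUnion.2 ⟨p, hp, by simpa using hn⟩
  have hzs : z ∈ s := by simp [s, hz]
  rw [sum_sq_ι, if_pos hzs, V.sum_eq ω z s _ hzs, Complex.ofReal_one]
  intro w hw
  refine Finset.mem_union_right _ (Finset.mem_biUnion.2 ⟨z, hz, by simpa using hw⟩)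

end Rows
end Rows

/-! ### The homomorphisms defined by families of row isometries -/

section RowsHom
open scoped BoundedContinuousFunction

/-- Evaluation of bounded continuous functions. -/
def bcfEval {Z : Type*} [TopologicalSpace Z] (B : Type*) [NonUnitalCStarAlgebra B] (z : Z) :
    (Z →ᵇ B) →⋆ₙₐ[ℂ] B where
  toFun f := f z
  map_smul' _ _ := rfl
  map_zero' := rfl
  map_add' _ _ := rfl
  map_mul' _ _ := rfl
  map_star' _ := rfl

@[simp] lemma bcfEval_apply {Z : Type*} [TopologicalSpace Z] {B : Type*} [NonUnitalCStarAlgebra B] (z : Z)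
    (f : Z →ᵇ B) : bcfEval B z f = f z := rfl

/-- Homomorphisms on the quotient agree if they agree on matrices of finite propagation. -/
lemma roeQuot_hom_ext {W : Type*} [PseudoMetricSpace W] {W₀ : Set W} {D Q : Type*}
    [NonUnitalCStarAlgebra D] [NonUnitalCStarAlgebra Q] (φ ψ : CQuot (roeIdeal D W₀) →⋆ₙₐ[ℂ] Q)
    (h : ∀ T : CtrlAlg D (metricFamily W), T.op ∈ ctrl D (metricFamily W) →
      φ (CQuot.mk _ T) = ψ (CQuot.mk _ T)) : φ = ψ := by
  have key : φ.comp (CQuot.proj (roeIdeal D W₀)) = ψ.comp (CQuot.proj (roeIdeal D W₀)) := by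
    refine hom_eq_of_dense _ _ {T | T.op ∈ ctrl D (metricFamily W)} (fun T => ?_) h
    refine Metric.mem_closure_iff.2 fun ε hε => ?_
    obtain ⟨S, hS, hTS⟩ := T.exists_ctrl hε
    exact ⟨S, hS, by rwa [dist_eq_norm]⟩
  ext T
  obtain ⟨T, rfl⟩ := CQuot.mk_surjective T
  exact DFunLike.congr_fun key T

namespace Rows
variable {Y : Type u} [MetricSpace Y] {Y₀ : Set Y} {δ : ℝ} {X : Set Y}
variable {G : Geometry Y Y₀ δ X} {Ω : Type} [TopologicalSpace Ω] (V : Rows G Ω)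
variable {D D' : Type u} [NonUnitalCStarAlgebra D] [NonUnitalCStarAlgebra D']

lemma ext_mul (S T : ColOp X D) : ext G (S * T) = ext G S * ext G T :=
  congrArg ColOp.adj (map_mul (extOp D G.ι_injective) S T)

lemma ext_add (S T : ColOp X D) : ext G (S + T) = ext G S + ext G T :=
  congrArg ColOp.adj (map_add (extOp D G.ι_injective) S T)

lemma ext_smul (c : ℂ) (T : ColOp X D) : ext G (c • T) = c • ext G T :=
  congrArg ColOp.adj (map_smul (extOp D G.ι_injective) c T)

lemma ext_star (T : ColOp X D) : ext G (star T) = star (ext G T) :=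
  congrArg ColOp.adj (map_star (extOp D G.ι_injective) T)

lemma ext_zero : ext G (0 : ColOp X D) = 0 :=
  congrArg ColOp.adj (map_zero (extOp D G.ι_injective))

/-- The matrix `M` consists of the compressions of `T` by the rows. -/
def Rel (T : CtrlAlg D (metricFamily X)) (M : CtrlAlg (Ω →ᵇ KAlg D) (metricFamily X)) : Prop :=
  T.op ∈ ctrl D (metricFamily X) ∧
    ∀ x x' ω, adjHom D (entry M.op x x' ω) = V.row D ω x * ext G T.op * star (V.row D ω x')

variable {V}

lemma Rel.entry_ne_zero {T : CtrlAlg D (metricFamily X)} {M : CtrlAlg (Ω →ᵇ KAlg D) (metricFamily X)}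
    (h : V.Rel T M) {x x' : X} (h0 : entry M.op x x' ≠ 0) :
    ∃ ω, V.row D ω x * ext G T.op * star (V.row D ω x') ≠ 0 := by
  by_contra! hne
  refine h0 (BoundedContinuousFunction.ext fun ω => adjHom_injective ?_)
  rw [h.2, hne ω]
  exact (map_zero (adjHom D)).symm

lemma Rel.exists_dist {T : CtrlAlg D (metricFamily X)} {M : CtrlAlg (Ω →ᵇ KAlg D) (metricFamily X)}
    (h : V.Rel T M) : ∃ R, ∀ x x', entry M.op x x' ≠ 0 → dist x x' ≤ R := by
  obtain ⟨R, hR⟩ := mem_ctrl_metric.1 h.1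
  obtain ⟨R', hR'⟩ := V.exists_dist_le R
  refine ⟨R', fun x x' h0 => ?_⟩
  obtain ⟨ω, hω⟩ := h.entry_ne_zero h0
  exact hR' hR ω x x' hω

variable (V) in
lemma exists_rel {T : CtrlAlg D (metricFamily X)} (hT : T.op ∈ ctrl D (metricFamily X)) :
    ∃ M, V.Rel T M := by
  obtain ⟨R, hR⟩ := mem_ctrl_metric.1 hT
  obtain ⟨R', hR'⟩ := V.exists_dist_le R
  choose m hm hn using V.exists_entry T.op
  obtain ⟨N, hN⟩ := G.exists_op R'
  obtain ⟨M, hM, -⟩ := hN m ‖T.op‖ (norm_nonneg _) (fun x x' h0 => by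
    obtain ⟨ω, hω⟩ : ∃ ω, m x x' ω ≠ 0 := by
      by_contra! hne
      exact h0 (BoundedContinuousFunction.ext hne)
    refine hR' hR ω x x' fun h1 => hω (adjHom_injective ?_)
    rw [hm, h1, map_zero]) hn
  exact ⟨M, hT, fun x x' ω => by rw [hM, hm]⟩

lemma Rel.mul {S T : CtrlAlg D (metricFamily X)} {M N : CtrlAlg (Ω →ᵇ KAlg D) (metricFamily X)}
    (hS : V.Rel S M) (hT : V.Rel T N) : V.Rel (S * T) (M * N) := by
  refine ⟨mul_mem hS.1 hT.1, fun x x' ω => ?_⟩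
  have h1 := (hasSum_entry_mul M.op N.op x x').map ((adjHom D).comp (bcfEval _ ω)) (hom_continuous _)
  refine h1.unique ?_
  obtain ⟨R, hR⟩ := hS.exists_dist
  obtain ⟨R', hR'⟩ := mem_ctrl_metric.1 hS.1
  obtain ⟨s, hs, hs'⟩ := V.exists_sum_eq_one S.op
    (fun x => (G.finite_near x R').subset fun z hz => hR' x z hz) ω x (G.finite_near x R).toFinset
  have e : V.row D ω x * ext G (S * T).op * star (V.row D ω x') =
      ∑ w ∈ s, adjHom D (entry M.op x w ω) * adjHom D (entry N.op w x' ω) := by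
    rw [CtrlAlg.op_mul, ext_mul, ← mul_assoc, ← hs', Finset.mul_sum, Finset.sum_mul, Finset.sum_mul]
    refine Finset.sum_congr rfl fun w _ => ?_
    rw [hS.2, hT.2]
    simp only [mul_assoc]
  rw [e]
  have h2 : ((⇑((adjHom D).comp (bcfEval (KAlg D) ω)) ∘ fun z => entry M.op x z * entry N.op z x') : X → Adj ℕ D) =
      fun w => adjHom D (entry M.op x w ω) * adjHom D (entry N.op w x' ω) := by
    funext w
    exact map_mul (adjHom D) _ _
  rw [h2]
  refine hasSum_sum_of_ne_finset_zero fun w hw => ?_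
  have : entry M.op x w = 0 := by
    by_contra h0
    exact hw (hs ((Set.Finite.mem_toFinset _).2 (hR x w h0)))
  rw [this]
  exact (congrArg (· * _) (map_zero (adjHom D))).trans (zero_mul _)

lemma Rel.norm_le {T : CtrlAlg D (metricFamily X)} {M : CtrlAlg (Ω →ᵇ KAlg D) (metricFamily X)}
    (h : V.Rel T M) : ‖M‖ ≤ ‖T‖ := by
  obtain ⟨R, hR⟩ := h.exists_dist
  obtain ⟨S, hS, hn⟩ := exists_colOp_conj (Ω := Ω) (fun ω => (adjHom D).comp (bcfEval (KAlg D) ω))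
    (fun b K hK hb => (BoundedContinuousFunction.norm_le hK).2 hb)
    (fun ω => V.row D ω) (fun ω s => V.finNorm_row_le ω s) (fun ω => ext G T.op) (norm_nonneg T.op)
    (fun ω => norm_ext_le T.op) (entry M.op)
    (fun y => (G.finite_near y R).subset fun x hx => by
      have := hR x y hx
      rwa [dist_comm] at this)
    (fun x => (G.finite_near x R).subset fun y hy => hR x y hy)
    (fun ω x y => h.2 x y ω)
  have : S = M.op := entry_ext hS
  rw [this] at hn
  exact hn

variable (V)

lemma exists_hom : ∃ Θ : CtrlAlg D (metricFamily X) →⋆ₙₐ[ℂ] CtrlAlg (Ω →ᵇ KAlg D) (metricFamily X),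
    ∀ T M, V.Rel T M → Θ T = M := by
  refine exists_hom_of_rel V.Rel ⟨zero_mem _, fun x x' ω => ?_⟩
    (fun S M T N hS hT => ⟨add_mem hS.1 hT.1, fun x x' ω => ?_⟩)
    (fun c T M h => ⟨SMulMemClass.smul_mem c h.1, fun x x' ω => ?_⟩)
    (fun S M T N hS hT => hS.mul hT)
    (fun T M h => ⟨star_mem h.1, fun x x' ω => ?_⟩) (fun T M h => h.norm_le) (fun T ε hε => ?_)
  · rw [CtrlAlg.op_zero, CtrlAlg.op_zero, entry_zero, ext_zero, mul_zero, zero_mul]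
    exact map_zero (adjHom D)
  · rw [CtrlAlg.op_add, CtrlAlg.op_add, entry_add, ext_add, mul_add, add_mul, ← hS.2, ← hT.2]
    exact map_add (adjHom D) _ _
  · rw [CtrlAlg.op_smul, CtrlAlg.op_smul, entry_smul, ext_smul, mul_smul_comm, smul_mul_assoc, ← h.2]
    exact map_smul (adjHom D) _ _
  · rw [CtrlAlg.op_star, CtrlAlg.op_star, entry_star, ext_star]
    refine (map_star (adjHom D) _).trans ?_
    rw [h.2, star_mul, star_mul, star_star, mul_assoc]
  · obtain ⟨S, hS, hTS⟩ := T.exists_ctrl hε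
    obtain ⟨M, hM⟩ := V.exists_rel hS
    exact ⟨S, M, hM, hTS⟩

variable (D) in
/-- Conjugation by the family of isometries. -/
def hom : CtrlAlg D (metricFamily X) →⋆ₙₐ[ℂ] CtrlAlg (Ω →ᵇ KAlg D) (metricFamily X) := V.exists_hom.choose

lemma hom_rel {T : CtrlAlg D (metricFamily X)} (hT : T.op ∈ ctrl D (metricFamily X)) :
    V.Rel T (V.hom D T) := by
  obtain ⟨M, hM⟩ := V.exists_rel hT
  have : V.hom D T = M := V.exists_hom.choose_spec T M hM
  rwa [this]

lemma hom_mem_roeIdeal {T : CtrlAlg D (metricFamily X)}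
    (hT : T ∈ (roeIdeal D (nearPoints δ X Y₀)).alg) :
    V.hom D T ∈ (roeIdeal (Ω →ᵇ KAlg D) (nearPoints δ X Y₀)).alg := by
  refine mem_roeIdeal_of_forall fun ε hε => ?_
  obtain ⟨S, ⟨R, hR⟩, hS, hTS⟩ := exists_ctrl_of_mem_roeIdeal hT hε
  refine ⟨V.hom D S, nearAlg_le_roeIdeal ?_, ?_⟩
  · obtain ⟨R', hR'⟩ := V.p_near (R + δ)
    refine ⟨R' + V.C + δ, fun x x' h => ?_⟩
    obtain ⟨ω, hω⟩ := (V.hom_rel hS).entry_ne_zero h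
    obtain ⟨p, q, hp, hq, hpq⟩ := V.exists_of_row_mul_ne_zero hω
    have key : ∀ (x : X) p, V.wt ω x p ≠ 0 → src x p ∈ Metric.thickening R (nearPoints δ X Y₀) →
        x ∈ Metric.thickening (R' + V.C + δ) (nearPoints δ X Y₀) := fun x p hp h1 => by
      obtain ⟨w, hw, hd⟩ := Metric.mem_thickening_iff.1 (hR' ω _ (Geometry.mem_thickening_of_nearPoints h1))
      refine G.mem_thickening_nearPoints (Metric.mem_thickening_iff.2 ⟨w, hw, ?_⟩)
      have h2 := V.dist_src_le hp
      have h3 := dist_triangle (x : Y) (V.p ω (src x p)) w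
      linarith
    exact ⟨key x p hp (hR _ _ hpq).1, key x' q hq (hR _ _ hpq).2⟩
  · rw [← map_sub]
    exact (NonUnitalStarAlgHom.norm_apply_le _ _).trans_lt hTS

variable (D) in
/-- Conjugation by the family of isometries on the quotients. -/
def quotHom : CQuot (roeIdeal D (nearPoints δ X Y₀)) →⋆ₙₐ[ℂ]
    CQuot (roeIdeal (Ω →ᵇ KAlg D) (nearPoints δ X Y₀)) :=
  CQuot.map (V.hom D) fun _ h => V.hom_mem_roeIdeal h

end Rows
end RowsHom

/-! ### Scaling and rotation of the row isometries -/

section RowFamilies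
open scoped BoundedContinuousFunction
variable {Y : Type u} [MetricSpace Y] {Y₀ : Set Y} {δ : ℝ} {X : Set Y}

namespace Geometry
variable (G : Geometry Y Y₀ δ X)

/-- The isometries `e_z ↦ ∑_x φ_x(sc_t z) e_x ⊗ e_{ι z}`. -/
def scRows : Rows G ℝ≥0 where
  a t x z := G.φ x (G.sc t z)
  b _ := 0
  a_continuous x z := (G.φ x).continuous.comp (G.sc_continuous.comp (Continuous.prodMk_right (z : Y)))
  b_continuous := continuous_const
  a_locally t₀ x := by
    have hb := G.sc_bounded (Metric.closedBall (x : Y) (2 * δ)) Metric.isBounded_closedBall (t₀ + 1)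
      (by positivity)
    obtain ⟨r, hr⟩ := hb.subset_closedBall (x : Y)
    refine ⟨(G.finite_near x r).toFinset, ?_⟩
    filter_upwards [eventually_le_nhds (show t₀ < t₀ + 1 from lt_add_one t₀)] with t ht z hz
    have hz' := G.φ_dist x _ hz
    have : (z : Y) ∈ Metric.closedBall (x : Y) r :=
      hr (Set.mem_iUnion₂.2 ⟨t, ⟨zero_le, ht⟩, Metric.mem_closedBall.2 hz'.le⟩)
    rw [Metric.mem_closedBall, dist_comm] at this
    exact (Set.Finite.mem_toFinset _).2 this
  a_finite t z := G.φ_finite (G.sc t z)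
  sum_eq t z s hs _ := by rw [G.φ_sum _ s hs]; norm_num
  p t z := G.sc t z
  C := 2 * δ
  a_dist t x z h := by rw [dist_comm]; exact (G.φ_dist x _ h).le
  b_dist t z h := absurd rfl h
  p_dist R := (G.exists_sc_dist_le R).imp fun C hC t z z' h => hC t z z' h
  p_near R := by
    obtain ⟨C, hC⟩ := G.exists_sc_dist_le R
    refine ⟨C + 1, fun t z hz => ?_⟩
    obtain ⟨y, hy, hd⟩ := Metric.mem_thickening_iff.1 hz
    exact Metric.mem_thickening_iff.2 ⟨G.sc t y, G.sc_mem t y hy, (hC t z y hd.le).trans_lt (lt_add_one C)⟩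

/-- The isometries `e_z ↦ cos(πs/2) ∑_x φ_x(z) e_x ⊗ e_{ι z} + sin(πs/2) e_z ⊗ e_0`. -/
def rotRows : Rows G unitInterval where
  a s x z := Real.cos (Real.pi / 2 * s) * G.φ x z
  b s := Real.sin (Real.pi / 2 * s)
  a_continuous x z := by fun_prop
  b_continuous := by fun_prop
  a_locally s₀ x := by
    refine ⟨(G.finite_near x (2 * δ)).toFinset, Eventually.of_forall fun s z hz => ?_⟩
    have := (G.φ_dist x _ (right_ne_zero_of_mul hz)).le
    rw [dist_comm] at this
    exact (Set.Finite.mem_toFinset _).2 this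
  a_finite s z := (G.φ_finite z).subset fun x hx => right_ne_zero_of_mul hx
  sum_eq s z t ht hz := by
    by_cases hc : Real.cos (Real.pi / 2 * s) = 0
    · have := Real.sin_sq_add_cos_sq (Real.pi / 2 * s)
      simpa [hc] using this
    · have h1 := G.φ_sum z t fun x hx => ht x (mul_ne_zero hc hx)
      simp only [mul_pow]
      rw [← Finset.mul_sum, h1, mul_one, add_comm]
      exact Real.sin_sq_add_cos_sq _
  p s z := z
  C := 2 * δ
  a_dist s x z h := by rw [dist_comm]; exact (G.φ_dist x _ (right_ne_zero_of_mul h)).le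
  b_dist s z h := by rw [dist_self]; exact mul_nonneg zero_le_two G.pos.le
  p_dist R := ⟨R, fun s z z' h => h⟩
  p_near R := ⟨R, fun s z h => h⟩

variable {D : Type u} [NonUnitalCStarAlgebra D]

lemma scRows_row (t : ℝ≥0) (x : X) : G.scRows.row D t x = dop D (G.scRows.diag t x) := by
  have : ((G.scRows.b t : ℝ) : ℂ) = 0 := Complex.ofReal_zero
  rw [Rows.row, this, zero_smul, add_zero]

lemma scRows_row_zero (x : X) : G.scRows.row D 0 x = G.rotRows.row D 0 x := by
  have h1 : G.scRows.diag 0 x = G.rotRows.diag 0 x := by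
    unfold Rows.diag
    congr 1
    funext z
    simp [scRows, rotRows, G.sc_zero]
  have h2 : G.scRows.b 0 = G.rotRows.b 0 := by simp [scRows, rotRows]
  rw [Rows.row, Rows.row, h1, h2]

lemma rotRows_row_one (x : X) : G.rotRows.row D 1 x = smat D 0 (G.ι x) := by
  have h1 : G.rotRows.diag 1 x = 0 := by
    have : (fun z : X => ((G.rotRows.a 1 x z : ℝ) : ℂ)) = 0 := by
      funext z
      simp [rotRows]
    rw [Rows.diag, this]
    funext n
    by_cases h : ∃ z, G.ι z = n
    · obtain ⟨z, rfl⟩ := h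
      exact G.ι_injective.extend_apply _ _ _
    · exact Function.extend_apply' _ _ _ h
  have h2 : ((G.rotRows.b 1 : ℝ) : ℂ) = 1 := by simp [rotRows]
  rw [Rows.row, h1, h2, dop_zero, zero_add, one_smul]

/-- Scaling and rotation start at the same homomorphism. -/
lemma map_eval_scRows_hom {T : CtrlAlg D (metricFamily X)} (hT : T.op ∈ ctrl D (metricFamily X)) :
    CtrlAlg.map _ (bcfEval (KAlg D) (0 : ℝ≥0)) (G.scRows.hom D T) =
      CtrlAlg.map _ (bcfEval (KAlg D) (0 : unitInterval)) (G.rotRows.hom D T) :=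
  CtrlAlg.entry_ext fun x x' => by
    rw [CtrlAlg.op_map, CtrlAlg.op_map, entry_colMap, entry_colMap]
    refine adjHom_injective ?_
    rw [bcfEval_apply, bcfEval_apply, (G.scRows.hom_rel hT).2, (G.rotRows.hom_rel hT).2,
      scRows_row_zero, scRows_row_zero]

/-- The rotation ends at the stabilization. -/
lemma map_eval_rotRows_hom {T : CtrlAlg D (metricFamily X)} (hT : T.op ∈ ctrl D (metricFamily X)) :
    CtrlAlg.map _ (bcfEval (KAlg D) (1 : unitInterval)) (G.rotRows.hom D T) =
      CtrlAlg.map _ (stab D) T :=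
  CtrlAlg.entry_ext fun x x' => by
    rw [CtrlAlg.op_map, CtrlAlg.op_map, entry_colMap, entry_colMap]
    refine adjHom_injective ?_
    rw [bcfEval_apply, (G.rotRows.hom_rel hT).2, rotRows_row_one, rotRows_row_one, star_smat, Rows.ext,
      smat_mul_mul_smat, entry_extOp, stab_apply]
    rfl

variable [ProperSpace Y]

/-- Away from the subspace, the rows of the scaling family are given by rescaled functions. -/
lemma scRows_row_mul {T : ColOp X D} {x x' : X} (hx : (x : Y) ∉ Metric.thickening (2 * δ) Y₀)
    (hx' : (x' : Y) ∉ Metric.thickening (2 * δ) Y₀) (t : ℝ≥0) :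
    G.scRows.row D t x * Rows.ext G T * star (G.scRows.row D t x') =
      (extOp D G.ι_injective (cut (G.resc (G.ψ x) t) T (G.resc (G.ψ x') t))).adj := by
  have hs : star (G.scRows.diag t x') = G.scRows.diag t x' := by
    funext n
    rw [Pi.star_apply]
    by_cases h : ∃ z, G.ι z = n
    · obtain ⟨z, rfl⟩ := h
      rw [Rows.diag_ι, Complex.star_def, Complex.conj_ofReal]
    · rw [Rows.diag_of_notMem _ _ _ h, star_zero]
  rw [scRows_row, scRows_row, star_dop (Rows.bdd_diag _ _ _), hs, Rows.ext, ← cut_adj]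
  refine congrArg ColOp.adj (entry_ext fun m n => ?_)
  rw [entry_cut (Rows.bdd_diag _ _ _) (Rows.bdd_diag _ _ _)]
  by_cases h : ∃ z z', G.ι z = m ∧ G.ι z' = n
  · obtain ⟨z, z', rfl, rfl⟩ := h
    rw [entry_extOp, entry_extOp, entry_cut (G.bdd_resc _ t) (G.bdd_resc _ t), Rows.diag_ι, Rows.diag_ι,
      resc, resc, G.ψ_of_notMem hx, G.ψ_of_notMem hx']
    rfl
  · have h0 : ∀ S : ColOp X D, entry (extOp D G.ι_injective S) m n = 0 := fun S => by
      by_contra hne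
      exact h (entry_extOp_ne_zero _ hne)
    rw [h0, h0, smul_zero]

/-- Unit followed by counit is the scaling family. -/
lemma entry_scRows_hom {T : CtrlAlg D (metricFamily X)} (hT : T.op ∈ ctrl D (metricFamily X)) {x x' : X}
    (hx : (x : Y) ∉ Metric.thickening (2 * δ) Y₀) (hx' : (x' : Y) ∉ Metric.thickening (2 * δ) Y₀) :
    CQuot.mk (asymIdeal (KAlg D)) (entry (G.scRows.hom D T).op x x') =
      CQuot.mk _ (G.kpath (G.ψ x * G.ψ x') T) := by
  refine CQuot.mk_eq.2 (mem_asymIdeal.2 fun ε hε => eventually_atTop.1 ?_)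
  filter_upwards [G.eventually_commutator_le (G.ψ x') T (ε := ε / (‖G.ψ x‖ + 1)) (by positivity)] with t ht
  obtain ⟨U, hU, hU'⟩ := G.op_kpath_adj (G.ψ x * G.ψ x') T t
  have h1 : (entry (G.scRows.hom D T).op x x' t).op =
      extOp D G.ι_injective (cut (G.resc (G.ψ x) t) T.op (G.resc (G.ψ x') t)) :=
    ColOp.adj_injective (((G.scRows.hom_rel hT).2 x x' t).trans (G.scRows_row_mul hx hx' t))
  have e : ((entry (G.scRows.hom D T).op x x' - G.kpath (G.ψ x * G.ψ x') T) t).op =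
      extOp D G.ι_injective (cut (G.resc (G.ψ x) t) T.op (G.resc (G.ψ x') t) - U) := by
    rw [map_sub, ← h1, ← hU]
    rfl
  refine (G.norm_le_of_extOp e).trans ?_
  rw [ColOp.sub_adj, hU', cut_adj, rescOp_mul, mul_assoc, mul_assoc]
  change ‖G.rescOp D (G.ψ x) t * (T.op.adj * G.rescOp D (G.ψ x') t) -
    G.rescOp D (G.ψ x) t * (G.rescOp D (G.ψ x') t * T.op.adj)‖ ≤ ε
  rw [← mul_sub]
  calc _ ≤ ‖G.ψ x‖ * (ε / (‖G.ψ x‖ + 1)) := (norm_mul_le _ _).trans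
        (mul_le_mul (G.norm_rescOp_le _ t) ht (norm_nonneg _) (norm_nonneg _))
    _ ≤ ε := by
        rw [mul_div_assoc', div_le_iff₀ (by positivity)]
        nlinarith [norm_nonneg (G.ψ x)]

lemma dist_le_of_entry_unitOp {A : Type u} [NonUnitalCStarAlgebra A] {a : A} {x x' : X}
    (h : entry (G.unitOp a).op x x' ≠ 0) : dist x x' ≤ 4 * δ := by
  by_contra hne
  refine h (C0Pair.ext' fun y => ?_)
  rw [entry_unitOp_fn, C0Pair.fn_zero]
  by_contra h0
  have h1 := left_ne_zero_of_smul h0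
  exact hne (G.dist_lt_of_φ (G.φ_ne_zero_of_ψ (left_ne_zero_of_mul h1))
    (G.φ_ne_zero_of_ψ (right_ne_zero_of_mul h1))).le

/-- Unit followed by counit is the scaling family, modulo the ideal. -/
lemma map_counit_unit {T : CtrlAlg D (metricFamily X)} (hT : T.op ∈ ctrl D (metricFamily X)) :
    CQuot.mk (roeIdeal (CQuot (asymIdeal (KAlg D))) (nearPoints δ X Y₀))
      (CtrlAlg.map _ (G.counit D) (G.unitOp (CQuot.mk _ T))) =
        CQuot.mk _ (CtrlAlg.map _ (CQuot.proj (asymIdeal (KAlg D))) (G.scRows.hom D T)) := by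
  obtain ⟨R, hR⟩ := (G.scRows.hom_rel hT).exists_dist
  refine CQuot.mk_eq.2 (nearAlg_le_roeIdeal ⟨2 * δ + max (4 * δ) R + δ, fun x x' h => ?_⟩)
  rw [CtrlAlg.op_sub, entry_sub, CtrlAlg.op_map, CtrlAlg.op_map, entry_colMap, entry_colMap] at h
  have hd : dist (x : Y) x' ≤ max (4 * δ) R := by
    by_cases h0 : entry (G.unitOp (CQuot.mk (roeIdeal D (nearPoints δ X Y₀)) T)).op x x' = 0
    · refine le_max_of_le_right (hR x x' fun h1 => h ?_)
      rw [h0, h1, map_zero, map_zero, sub_zero]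
    · exact le_max_of_le_left (G.dist_le_of_entry_unitOp h0)
  have key : (x : Y) ∈ Metric.thickening (2 * δ) Y₀ ∨ (x' : Y) ∈ Metric.thickening (2 * δ) Y₀ := by
    by_contra hne
    rw [not_or] at hne
    refine h ?_
    rw [entry_unitOp, counit_tens, ← G.entry_scRows_hom hT hne.1 hne.2]
    exact sub_self _
  have hp := G.pos
  have h0 : 0 ≤ max (4 * δ) R := dist_nonneg.trans hd
  have step : ∀ x x' : X, dist (x : Y) x' ≤ max (4 * δ) R → (x : Y) ∈ Metric.thickening (2 * δ) Y₀ →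
      x ∈ Metric.thickening (2 * δ + max (4 * δ) R + δ) (nearPoints δ X Y₀) ∧
        x' ∈ Metric.thickening (2 * δ + max (4 * δ) R + δ) (nearPoints δ X Y₀) := fun x x' hd hx => by
    obtain ⟨w, hw, hxw⟩ := Metric.mem_thickening_iff.1 hx
    refine ⟨G.mem_thickening_nearPoints (Metric.mem_thickening_iff.2 ⟨w, hw, by linarith⟩),
      G.mem_thickening_nearPoints (Metric.mem_thickening_iff.2 ⟨w, hw, ?_⟩)⟩
    have := dist_triangle (x' : Y) x w
    rw [dist_comm (x' : Y) x] at this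
    linarith
  rcases key with hx | hx'
  · exact step x x' hd hx
  · exact (step x' x (by rwa [dist_comm]) hx').symm

end Geometry
end RowFamilies

/-! ### The first triangle identity -/

section UnitCounit
open scoped BoundedContinuousFunction

/-- The algebra of bounded continuous functions. -/
def bcfObj (Z : Type) [TopologicalSpace Z] (D : CStarAlg.{u}) : CStarAlg.{u} := ⟨Z →ᵇ D⟩

/-- Evaluation of bounded continuous functions, as a morphism. -/
def evalMor {Z : Type} [TopologicalSpace Z] (z : Z) (D : CStarAlg.{u}) : bcfObj Z D ⟶ D :=
  ofHom (A := bcfObj Z D) (B := D) (bcfEval D z)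

/-- The projection to the asymptotic algebra, as a morphism. -/
def projMor (D : CStarAlg.{u}) : bcfObj ℝ≥0 D ⟶ asym.obj D :=
  ofHom (A := bcfObj ℝ≥0 D) (B := asym.obj D) (CQuot.proj (asymIdeal D))

/-- The homotopy of bounded functions from their values at `0`, as a morphism. -/
def scaleMor (D : CStarAlg.{u}) : bcfObj ℝ≥0 D ⟶ asym.obj (cyl.obj D) :=
  ofHom (A := bcfObj ℝ≥0 D) (B := asym.obj (cyl.obj D)) (scaleHom D)

lemma scaleMor_one (D : CStarAlg.{u}) : scaleMor D ≫ asym.map ((ev 1).app D) = projMor D :=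
  asymMap_ev_scaleHom_one (B := D)

lemma scaleMor_zero (D : CStarAlg.{u}) :
    scaleMor D ≫ asym.map ((ev 0).app D) = evalMor 0 D ≫ alpha.app D :=
  hom_ext' fun g => asymMap_ev_scaleHom_zero (B := D) g

/-- Bounded continuous functions on the interval are continuous functions. -/
def ofBcf (D : CStarAlg.{u}) : bcfObj unitInterval D ⟶ cyl.obj D :=
  ofHom (A := bcfObj unitInterval D) (B := cyl.obj D)
    { toFun := fun f => f.toContinuousMap
      map_smul' := fun _ _ => rfl
      map_zero' := rfl
      map_add' := fun _ _ => rfl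
      map_mul' := fun _ _ => rfl
      map_star' := fun _ => rfl }

/-- The class of a homomorphism in a stage of the colimit. -/
def stageMk (N : CStarAlg.{u} ⥤ CStarAlg.{u}) [OrthPreserving N] {A B : CStarAlg.{u}} (k : ℕ)
    (ψ : A ⟶ N.obj ((asymPow k).obj (compact.obj B))) : Stage N A B k :=
  GenMor.mk (compact ⋙ (asymPow k ⋙ N)) ψ

/-- A path from `𝔑 D` to functions on the half-line which begins at the stabilization, up to homotopy,
yields the structure maps of the colimit. -/
lemma mk_scale_rot {N : CStarAlg.{u} ⥤ CStarAlg.{u}} [OrthPreserving N] {A B : CStarAlg.{u}} (k : ℕ)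
    (σ : N.obj ((asymPow k).obj (compact.obj B)) ⟶
      N.obj (bcfObj ℝ≥0 (compact.obj ((asymPow k).obj (compact.obj B)))))
    (ρ : N.obj ((asymPow k).obj (compact.obj B)) ⟶
      N.obj (bcfObj unitInterval (compact.obj ((asymPow k).obj (compact.obj B)))))
    (h0 : σ ≫ N.map (evalMor 0 _) = ρ ≫ N.map (evalMor 0 _))
    (h1 : ρ ≫ N.map (evalMor 1 _) = N.map (stabMor _)) (ψ : A ⟶ N.obj ((asymPow k).obj (compact.obj B)))
    (τ : A ⟶ N.obj ((asymPow (k + 1)).obj (compact.obj B)))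
    (hτ : τ = ψ ≫ σ ≫
      N.map (projMor (compact.obj ((asymPow k).obj (compact.obj B))) ≫ asym.map (absorb k B))) :
    stageMk N (k + 1) τ = SumMor.mapNat (stageNat N k) (stageMk N k ψ) := by
  let D := (asymPow k).obj (compact.obj B)
  have e1 : τ =
      (ψ ≫ σ ≫ N.map (scaleMor (compact.obj D) ≫ asym.map (cyl.map (absorb k B)))) ≫
        (asym ⋙ N).map ((ev 1).app D) := by
    have h2 : scaleMor (compact.obj D) ≫ asym.map (cyl.map (absorb k B)) ≫ asym.map ((ev 1).app D) =
        projMor (compact.obj D) ≫ asym.map (absorb k B) := by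
      rw [← asym.map_comp, (ev 1).naturality, ← scaleMor_one, Category.assoc, ← asym.map_comp]
      rfl
    rw [hτ, ← h2, Functor.comp_map, Category.assoc, Category.assoc, ← N.map_comp, Category.assoc]
  have e2 : (ψ ≫ σ ≫ N.map (scaleMor (compact.obj D) ≫ asym.map (cyl.map (absorb k B)))) ≫
        (asym ⋙ N).map ((ev 0).app D) =
      (ψ ≫ ρ ≫ N.map (ofBcf (compact.obj D) ≫ cyl.map (absorb k B ≫ alpha.app D))) ≫
        N.map ((ev 0).app (asym.obj D)) := by
    have h2 : scaleMor (compact.obj D) ≫ asym.map (cyl.map (absorb k B)) ≫ asym.map ((ev 0).app D) =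
        evalMor 0 (compact.obj D) ≫ absorb k B ≫ alpha.app D := by
      rw [← asym.map_comp, (ev 0).naturality, asym.map_comp, ← Category.assoc, scaleMor_zero,
        Category.assoc, ← alpha.naturality]
      rfl
    have h3 : ofBcf (compact.obj D) ≫ cyl.map (absorb k B ≫ alpha.app D) ≫ (ev 0).app (asym.obj D) =
        evalMor 0 (compact.obj D) ≫ absorb k B ≫ alpha.app D := by
      rw [(ev 0).naturality]
      rfl
    simp only [Category.assoc, Functor.comp_map, ← N.map_comp]
    rw [h2, h3, N.map_comp, N.map_comp, ← Category.assoc σ, h0, Category.assoc, ← N.map_comp, ← N.map_comp]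
  have e3 : (ψ ≫ ρ ≫ N.map (ofBcf (compact.obj D) ≫ cyl.map (absorb k B ≫ alpha.app D))) ≫
        N.map ((ev 1).app (asym.obj D)) =
      (ψ ≫ N.map (alpha.app D)) ≫
        (asymPow (k + 1) ⋙ N).map ((conjK pair_zero_injective).app B) := by
    have h3 : ofBcf (compact.obj D) ≫ cyl.map (absorb k B ≫ alpha.app D) ≫ (ev 1).app (asym.obj D) =
        evalMor 1 (compact.obj D) ≫ absorb k B ≫ alpha.app D := by
      rw [(ev 1).naturality]
      rfl
    simp only [Category.assoc, ← N.map_comp]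
    rw [h3, N.map_comp, ← Category.assoc ρ, h1, ← N.map_comp, ← Category.assoc (stabMor D)]
    have h4 : stabMor D ≫ absorb k B = (asymPow k).map ((conjK pair_zero_injective).app B) :=
      stabMor_absorb k B
    rw [h4, N.map_comp]
    exact congrArg (ψ ≫ ·) ((stageNat N k).naturality ((conjK pair_zero_injective).app B))
  refine (congrArg (GenMor.mk (B := B) _) e1).trans ?_
  refine (GenMor.mk_eq_of_cyl (hasSwap_compact.comp (hasSwap_asymPow k)) (asym ⋙ N)
    (ψ ≫ σ ≫ N.map (scaleMor (compact.obj D) ≫ asym.map (cyl.map (absorb k B))))).symm.trans ?_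
  refine (congrArg (GenMor.mk (B := B) _) e2).trans ?_
  refine (GenMor.mk_eq_of_cyl (hasSwap_compact.comp (hasSwap_asymPow (k + 1))) N
    (ψ ≫ ρ ≫ N.map (ofBcf (compact.obj D) ≫ cyl.map (absorb k B ≫ alpha.app D)))).trans ?_
  refine (congrArg (GenMor.mk (B := B) _) e3).trans ?_
  exact GenMor.mk_comp_conjK (asymPow (k + 1) ⋙ N) pair_zero_injective (ψ ≫ N.map (alpha.app D))

variable {Y : Type u} [MetricSpace Y] {Y₀ : Set Y} {δ : ℝ} {X : Set Y}

namespace Geometry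
variable (G : Geometry Y Y₀ δ X)

/-- The scaling family as a morphism. -/
def scMor (D : CStarAlg.{u}) : (roeQuot X (nearPoints δ X Y₀)).obj D ⟶
    (roeQuot X (nearPoints δ X Y₀)).obj (bcfObj ℝ≥0 (compact.obj D)) :=
  ofHom (A := (roeQuot X (nearPoints δ X Y₀)).obj D)
    (B := (roeQuot X (nearPoints δ X Y₀)).obj (bcfObj ℝ≥0 (compact.obj D))) (G.scRows.quotHom D)

/-- The rotation as a morphism. -/
def rotMor (D : CStarAlg.{u}) : (roeQuot X (nearPoints δ X Y₀)).obj D ⟶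
    (roeQuot X (nearPoints δ X Y₀)).obj (bcfObj unitInterval (compact.obj D)) :=
  ofHom (A := (roeQuot X (nearPoints δ X Y₀)).obj D)
    (B := (roeQuot X (nearPoints δ X Y₀)).obj (bcfObj unitInterval (compact.obj D))) (G.rotRows.quotHom D)

lemma scMor_eval (D : CStarAlg.{u}) :
    G.scMor D ≫ (roeQuot X (nearPoints δ X Y₀)).map (evalMor 0 (compact.obj D)) =
      G.rotMor D ≫ (roeQuot X (nearPoints δ X Y₀)).map (evalMor 0 (compact.obj D)) :=
  roeQuot_hom_ext (D := D) (Q := CQuot (roeIdeal (KAlg D) (nearPoints δ X Y₀))) _ _ fun T hT =>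
    congrArg (CQuot.mk _) (G.map_eval_scRows_hom hT)

lemma rotMor_eval (D : CStarAlg.{u}) :
    G.rotMor D ≫ (roeQuot X (nearPoints δ X Y₀)).map (evalMor 1 (compact.obj D)) =
      (roeQuot X (nearPoints δ X Y₀)).map (stabMor D) :=
  roeQuot_hom_ext (D := D) (Q := CQuot (roeIdeal (KAlg D) (nearPoints δ X Y₀))) _ _ fun T hT =>
    congrArg (CQuot.mk _) (G.map_eval_rotRows_hom hT)

variable [ProperSpace Y]

lemma unitMor_counitMor (D : CStarAlg.{u}) :
    G.unitMor ((roeQuot X (nearPoints δ X Y₀)).obj D) ≫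
        (roeQuot X (nearPoints δ X Y₀)).map (G.counitMor D) =
      G.scMor D ≫ (roeQuot X (nearPoints δ X Y₀)).map (projMor (compact.obj D)) :=
  roeQuot_hom_ext (D := D)
    (Q := CQuot (roeIdeal (CQuot (asymIdeal (KAlg D))) (nearPoints δ X Y₀))) _ _ fun T hT =>
    G.map_counit_unit hT

/-- The homomorphism `C₀(Y, Y₀, A) → 𝔄^{k+2} 𝕂 B` adjoint to `A → 𝔑 𝔄^{k+1} 𝕂 B`. -/
def adjoint {A B : CStarAlg.{u}} (k : ℕ)
    (ψ : A ⟶ (roeQuot X (nearPoints δ X Y₀)).obj ((asymPow k).obj (compact.obj B))) :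
    (c0Pair Y Y₀).obj A ⟶ asym.obj ((asymPow k).obj (compact.obj B)) :=
  (c0Pair Y Y₀).map ψ ≫ G.counitMor ((asymPow k).obj (compact.obj B)) ≫ asym.map (absorb k B)

lemma unitMor_adjoint {A B : CStarAlg.{u}} (k : ℕ)
    (ψ : A ⟶ (roeQuot X (nearPoints δ X Y₀)).obj ((asymPow k).obj (compact.obj B))) :
    G.unitMor A ≫ (roeQuot X (nearPoints δ X Y₀)).map (G.adjoint k ψ) =
      ψ ≫ G.scMor ((asymPow k).obj (compact.obj B)) ≫ (roeQuot X (nearPoints δ X Y₀)).map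
        (projMor (compact.obj ((asymPow k).obj (compact.obj B))) ≫ asym.map (absorb k B)) := by
  rw [adjoint, Functor.map_comp, Functor.map_comp, ← Category.assoc, ← G.unitMor_naturality ψ,
    Category.assoc, ← Category.assoc (G.unitMor _), unitMor_counitMor, Category.assoc, ← Functor.map_comp]

theorem mk_unit_adjoint {A B : CStarAlg.{u}} (k : ℕ)
    (ψ : A ⟶ (roeQuot X (nearPoints δ X Y₀)).obj ((asymPow k).obj (compact.obj B))) :
    stageMk (B := B) (roeQuot X (nearPoints δ X Y₀)) (k + 1)
        (G.unitMor A ≫ (roeQuot X (nearPoints δ X Y₀)).map (G.adjoint k ψ)) =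
      SumMor.mapNat (stageNat (roeQuot X (nearPoints δ X Y₀)) k)
        (stageMk (roeQuot X (nearPoints δ X Y₀)) k ψ) :=
  mk_scale_rot (N := roeQuot X (nearPoints δ X Y₀)) (A := A) (B := B) k
    (G.scMor ((asymPow k).obj (compact.obj B))) (G.rotMor ((asymPow k).obj (compact.obj B)))
    (G.scMor_eval ((asymPow k).obj (compact.obj B))) (G.rotMor_eval ((asymPow k).obj (compact.obj B))) ψ
    (G.unitMor A ≫ (roeQuot X (nearPoints δ X Y₀)).map (G.adjoint k ψ)) (G.unitMor_adjoint k ψ)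

end Geometry
end UnitCounit

/-! ### Rank one matrices of partition functions -/

section RankOne
open scoped ZeroAtInfty

/-- The weights `sin(πs/2)` and `cos(πs/2)`. -/
def Geometry.rot {W : Type*} (s : unitInterval) : Option W → ℝ
  | none => Real.sin (Real.pi / 2 * s)
  | some _ => Real.cos (Real.pi / 2 * s)

lemma Geometry.continuous_rot {W : Type*} (p : Option W) : Continuous fun s => rot s p := by
  cases p <;> simp only [rot] <;> fun_prop

variable {Y : Type u} [MetricSpace Y] {Y₀ : Set Y} {δ : ℝ} {X : Set Y}

/-- The product of an element of `C₀(Y, Y₀, E)` and a bounded function. -/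
def C0Pair.bmul {E : Type*} [NonUnitalCStarAlgebra E] (c : C(Y, ℝ)) (hc : ∀ y, |c y| ≤ 1) (h : C0Pair Y Y₀ E) :
    C0Pair Y Y₀ E :=
  ⟨⟨⟨fun y => ((c y : ℝ) : ℂ) • h.fn y, by have := h.fn.continuous; fun_prop⟩, by
    refine squeeze_zero_norm (fun y => ?_) (tendsto_zero_iff_norm_tendsto_zero.1 h.fn.zero_at_infty')
    change ‖((c y : ℝ) : ℂ) • h.fn y‖ ≤ ‖h.fn y‖
    rw [norm_smul, Complex.norm_real]
    exact mul_le_of_le_one_left (norm_nonneg _) (hc y)⟩, fun y hy => by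
    change ((c y : ℝ) : ℂ) • h.fn y = 0
    rw [Geometry.fn_eq_zero h hy, smul_zero]⟩

lemma C0Pair.bmul_fn {E : Type*} [NonUnitalCStarAlgebra E] (c : C(Y, ℝ)) (hc : ∀ y, |c y| ≤ 1)
    (h : C0Pair Y Y₀ E) (y : Y) : (C0Pair.bmul c hc h).fn y = ((c y : ℝ) : ℂ) • h.fn y := rfl

namespace Geometry
variable (G : Geometry Y Y₀ δ X)

lemma tgt_injective : Function.Injective (Rows.tgt G) := fun p q h => by
  cases p with
  | none =>
    cases q with
    | none => rfl
    | some z => exact absurd h.symm (G.ι_ne_zero z)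
  | some z =>
    cases q with
    | none => exact absurd h (G.ι_ne_zero z)
    | some w => exact congrArg some (G.ι_injective h)

/-- The constant function `1` and the partition functions. -/
def part : Option X → C(Y, ℝ)
  | none => 1
  | some x => G.φ x

lemma abs_part_le (p : Option X) (y : Y) : |G.part p y| ≤ 1 := by
  cases p with
  | none => simp [part]
  | some x =>
    change |G.φ x y| ≤ 1
    rw [abs_of_nonneg (G.φ_nonneg x y)]
    exact G.φ_le_one x y

/-- The components of the vector `cos(πs/2) ∑_x φ_x(y) e_{ι x} + sin(πs/2) e_0`. -/
def vec (s : unitInterval) (n : ℕ) (y : Y) : ℝ :=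
  Function.extend (Rows.tgt G) (fun p => rot s p * G.part p y) 0 n

lemma vec_tgt (s : unitInterval) (p : Option X) (y : Y) :
    G.vec s (Rows.tgt G p) y = rot s p * G.part p y := G.tgt_injective.extend_apply _ _ _

lemma vec_of_notMem (s : unitInterval) {n : ℕ} (h : ¬ ∃ p, Rows.tgt G p = n) (y : Y) :
    G.vec s n y = 0 := Function.extend_apply' _ _ _ h

lemma vec_zero_ι (x : X) (y : Y) : G.vec 0 (G.ι x) y = G.φ x y := by
  have := G.vec_tgt 0 (some x) y
  simpa [rot, part, Rows.tgt] using this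

lemma vec_zero_of_notMem {n : ℕ} (h : ¬ ∃ x, G.ι x = n) (y : Y) : G.vec 0 n y = 0 := by
  by_cases hn : ∃ p, Rows.tgt G p = n
  · obtain ⟨p, rfl⟩ := hn
    cases p with
    | none => rw [vec_tgt]; simp [rot]
    | some x => exact absurd ⟨x, rfl⟩ h
  · exact G.vec_of_notMem 0 hn y

lemma vec_one_zero (y : Y) : G.vec 1 0 y = 1 := by
  have := G.vec_tgt 1 none y
  simpa [rot, part, Rows.tgt] using this

lemma vec_one_of_ne {n : ℕ} (h : n ≠ 0) (y : Y) : G.vec 1 n y = 0 := by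
  by_cases hn : ∃ p, Rows.tgt G p = n
  · obtain ⟨p, rfl⟩ := hn
    cases p with
    | none => exact absurd rfl h
    | some x => rw [vec_tgt]; simp [rot]
  · exact G.vec_of_notMem 1 hn y

lemma hasSum_vec_sq (s : unitInterval) (y : Y) : HasSum (fun n => G.vec s n y ^ 2) 1 := by
  rw [← G.tgt_injective.hasSum_iff (fun n hn => by
    rw [G.vec_of_notMem s (fun h => hn h) y]; norm_num)]
  let F := (G.φ_finite y).toFinset
  have hF : ∀ x, G.φ x y ≠ 0 → x ∈ F := fun x hx => (Set.Finite.mem_toFinset _).2 hx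
  have h1 : ∑ p ∈ F.insertNone, ((fun n => G.vec s n y ^ 2) ∘ Rows.tgt G) p = 1 := by
    simp only [Function.comp_apply, vec_tgt, Finset.sum_insertNone]
    simp only [rot, part, ContinuousMap.one_apply, mul_one, mul_pow]
    rw [← Finset.mul_sum, G.φ_sum y F hF, mul_one]
    exact Real.sin_sq_add_cos_sq _
  rw [← h1]
  refine hasSum_sum_of_ne_finset_zero fun p hp => ?_
  cases p with
  | none => exact absurd Finset.none_mem_insertNone hp
  | some x =>
    have : G.φ x y = 0 := by
      by_contra h0
      exact hp (Finset.some_mem_insertNone.2 (hF x h0))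
    simp [vec_tgt, part, this]

lemma sum_vec_sq_le (s : unitInterval) (y : Y) (t : Finset ℕ) : ∑ n ∈ t, G.vec s n y ^ 2 ≤ 1 :=
  sum_le_hasSum t (fun n _ => sq_nonneg _) (G.hasSum_vec_sq s y)

variable {A : Type u} [NonUnitalCStarAlgebra A]

/-- The support of `h` meets the supports of the partition functions at points of `F` only. -/
def Spread (h : C0Pair Y Y₀ A) (F : Finset X) : Prop :=
  ∀ y, h.fn y ≠ 0 → ∀ x, G.φ x y ≠ 0 → x ∈ F

lemma sum_vec {h : C0Pair Y Y₀ A} {F : Finset X} (hF : G.Spread h F) (s : unitInterval) {y : Y}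
    (hy : h.fn y ≠ 0) (n : ℕ) :
    ∑ p ∈ F.insertNone, (if n = Rows.tgt G p then rot s p * G.part p y else 0) = G.vec s n y := by
  classical
  by_cases hn : ∃ p, Rows.tgt G p = n
  · obtain ⟨q, rfl⟩ := hn
    rw [vec_tgt, Finset.sum_eq_single q]
    · rw [if_pos rfl]
    · intro p _ hp
      rw [if_neg fun h => hp (G.tgt_injective h).symm]
    · intro hq
      rw [if_pos rfl]
      cases q with
      | none => exact absurd Finset.none_mem_insertNone hq
      | some x =>
        have : G.φ x y = 0 := by
          by_contra h0
          exact hq (Finset.some_mem_insertNone.2 (hF y hy x h0))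
        rw [part, this, mul_zero]
  · rw [G.vec_of_notMem s hn]
    exact Finset.sum_eq_zero fun p _ => if_neg fun h => hn ⟨p, h.symm⟩

/-- The path of rank one matrices with entries `w_m w_n h`. -/
def RankOne (h : C0Pair Y Y₀ A) (M : C(unitInterval, KAlg (C0Pair Y Y₀ A))) : Prop :=
  (∃ F, G.Spread h F) ∧ ∀ s m n y,
    (entry (M s).op m n).fn y = ((G.vec s m y * G.vec s n y : ℝ) : ℂ) • h.fn y

lemma exists_rankOne {h : C0Pair Y Y₀ A} {F : Finset X} (hF : G.Spread h F) : ∃ M, G.RankOne h M := by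
  let c : Option X → Option X → C0Pair Y Y₀ A := fun p q =>
    C0Pair.bmul (G.part p * G.part q) (fun y => by
      rw [ContinuousMap.mul_apply, abs_mul]
      exact mul_le_one₀ (G.abs_part_le p y) (abs_nonneg _) (G.abs_part_le q y)) h
  let M : C(unitInterval, KAlg (C0Pair Y Y₀ A)) :=
    ⟨fun s => ∑ p ∈ F.insertNone, ∑ q ∈ F.insertNone, ((rot s p * rot s q : ℝ) : ℂ) •
      munit (Rows.tgt G p) (Rows.tgt G q) (c p q), by
      refine continuous_finsetSum _ fun p _ => continuous_finsetSum _ fun q _ => ?_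
      exact (Complex.continuous_ofReal.comp ((continuous_rot p).mul (continuous_rot q))).smul
        continuous_const⟩
  refine ⟨M, ⟨F, hF⟩, fun s m n y => ?_⟩
  change (entry (CtrlAlg.op (∑ p ∈ F.insertNone, ∑ q ∈ F.insertNone, ((rot s p * rot s q : ℝ) : ℂ) •
    munit (Rows.tgt G p) (Rows.tgt G q) (c p q))) m n).fn y = _
  simp only [CtrlAlg.op_sum, entry_sum, CtrlAlg.op_smul, entry_smul, entry_munit, C0Pair.fn_sum,
    C0Pair.fn_smul]
  by_cases hy : h.fn y = 0
  · rw [hy, smul_zero]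
    refine Finset.sum_eq_zero fun p _ => Finset.sum_eq_zero fun q _ => ?_
    split_ifs
    · rw [C0Pair.bmul_fn, hy, smul_zero, smul_zero]
    · rw [C0Pair.fn_zero, smul_zero]
  · rw [← G.sum_vec hF s hy m, ← G.sum_vec hF s hy n, Finset.sum_mul_sum, Complex.ofReal_sum,
      Finset.sum_smul]
    refine Finset.sum_congr rfl fun p _ => ?_
    rw [Complex.ofReal_sum, Finset.sum_smul]
    refine Finset.sum_congr rfl fun q _ => ?_
    by_cases h1 : m = Rows.tgt G p
    · by_cases h2 : n = Rows.tgt G q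
      · rw [if_pos ⟨h1, h2⟩, if_pos h1, if_pos h2, C0Pair.bmul_fn, smul_smul]
        congr 1
        rw [ContinuousMap.mul_apply]
        push_cast
        ring
      · rw [if_neg fun h => h2 h.2, if_neg h2, mul_zero, Complex.ofReal_zero, zero_smul, C0Pair.fn_zero,
          smul_zero]
    · rw [if_neg fun h => h1 h.1, if_neg h1, zero_mul, Complex.ofReal_zero, zero_smul, C0Pair.fn_zero,
        smul_zero]

variable {G}

lemma RankOne.entry_eq_zero {h : C0Pair Y Y₀ A} {M : C(unitInterval, KAlg (C0Pair Y Y₀ A))}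
    (hM : G.RankOne h M) : ∃ E : Finset ℕ, ∀ s m n, entry (M s).op m n ≠ 0 → m ∈ E ∧ n ∈ E := by
  classical
  obtain ⟨⟨F, hF⟩, hM⟩ := hM
  refine ⟨F.insertNone.image (Rows.tgt G), fun s m n hne => ?_⟩
  have key : ∀ m, m ∉ F.insertNone.image (Rows.tgt G) → ∀ y, h.fn y ≠ 0 → G.vec s m y = 0 :=
    fun m hm y hy => by
      rw [← G.sum_vec hF s hy m]
      exact Finset.sum_eq_zero fun p hp => if_neg fun h => hm (Finset.mem_image.2 ⟨p, hp, h.symm⟩)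
  by_contra h0
  rw [not_and_or] at h0
  refine hne (C0Pair.ext' fun y => ?_)
  rw [hM, C0Pair.fn_zero]
  by_cases hy : h.fn y = 0
  · rw [hy, smul_zero]
  · rcases h0 with h0 | h0 <;> rw [key _ h0 y hy] <;> simp

lemma RankOne.norm_le {h : C0Pair Y Y₀ A} {M : C(unitInterval, KAlg (C0Pair Y Y₀ A))}
    (hM : G.RankOne h M) : ‖M‖ ≤ ‖h‖ := by
  refine (ContinuousMap.norm_le _ (norm_nonneg _)).2 fun s => ?_
  obtain ⟨E, hE⟩ := hM.entry_eq_zero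
  have h1 : ‖(1 : Adj ℕ A)‖ ≤ 1 := by
    rw [← dop_one]
    exact norm_dop_le zero_le_one (by simp)
  have hstar : ∀ c : ℝ, star ((c : ℂ) • (1 : Adj ℕ A)) = (c : ℂ) • (1 : Adj ℕ A) := fun c => by
    rw [star_smul, star_one, Complex.star_def, Complex.conj_ofReal]
  obtain ⟨S, hS, hn⟩ := exists_colOp_conj (Ω := Y) (B := C0Pair Y Y₀ A) (C := Adj ℕ A)
    (fun y => (adjHom A).comp ((stab A).comp (C0Pair.evalHom y)))
    (fun b K hK hb => norm_le_of_fn hK fun y => by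
      refine le_trans ?_ (hb y)
      have := (stab A (b.fn y)).norm_entry_le 0 0
      rw [stab_apply, entry_munit, if_pos ⟨rfl, rfl⟩] at this
      exact this)
    (fun y n => ((G.vec s n y : ℝ) : ℂ) • (1 : Adj ℕ A))
    (fun y t => by
      rw [finNorm, Real.sqrt_le_left zero_le_one, one_pow]
      have : ∑ n ∈ t, star (((G.vec s n y : ℝ) : ℂ) • (1 : Adj ℕ A)) * ((G.vec s n y : ℝ) : ℂ) • (1 : Adj ℕ A) =
          ((∑ n ∈ t, G.vec s n y ^ 2 : ℝ) : ℂ) • (1 : Adj ℕ A) := by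
        rw [Complex.ofReal_sum, Finset.sum_smul]
        refine Finset.sum_congr rfl fun n _ => ?_
        rw [hstar, smul_mul_smul_comm, mul_one]
        congr 1
        push_cast
        ring
      rw [this, norm_smul, Complex.norm_real, Real.norm_of_nonneg (Finset.sum_nonneg fun n _ => sq_nonneg _)]
      exact mul_le_one₀ (G.sum_vec_sq_le s y t) (norm_nonneg _) h1)
    (fun y => adjHom A (stab A (h.fn y))) (norm_nonneg h)
    (fun y => (norm_adjHom _).le.trans ((NonUnitalStarAlgHom.norm_apply_le (stab A) _).trans (norm_fn_le h y)))
    (entry (M s).op)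
    (fun n => E.finite_toSet.subset fun m hm => (hE s m n hm).1)
    (fun m => E.finite_toSet.subset fun n hn => (hE s m n hn).2)
    (fun y m n => by
      change adjHom A (stab A ((entry (M s).op m n).fn y)) = _
      rw [hM.2, map_smul, map_smul, hstar, smul_mul_assoc, one_mul, mul_smul_comm, mul_one, smul_smul]
      congr 1
      push_cast
      ring)
  have : S = (M s).op := entry_ext hS
  rw [this] at hn
  exact hn

lemma RankOne.mul {h h' : C0Pair Y Y₀ A} {M M' : C(unitInterval, KAlg (C0Pair Y Y₀ A))}
    (hM : G.RankOne h M) (hM' : G.RankOne h' M') : G.RankOne (h * h') (M * M') := by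
  obtain ⟨⟨F, hF⟩, hM⟩ := hM
  refine ⟨⟨F, fun y hy => hF y fun h0 => hy (by rw [C0Pair.fn_mul, h0, zero_mul])⟩, fun s m n y => ?_⟩
  have h1 := (hasSum_entry_mul (M s).op (M' s).op m n).map (C0Pair.evalHom y) (hom_continuous _)
  simp only [Function.comp_def, map_mul, C0Pair.evalHom_apply, hM, hM'.2] at h1
  refine h1.unique ?_
  have e : ∀ k, ((G.vec s m y * G.vec s k y : ℝ) : ℂ) • h.fn y * ((G.vec s k y * G.vec s n y : ℝ) : ℂ) • h'.fn y =
      ((G.vec s k y ^ 2 : ℝ) : ℂ) • ((G.vec s m y * G.vec s n y : ℝ) : ℂ) • (h.fn y * h'.fn y) := fun k => by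
    rw [smul_mul_smul_comm, smul_smul]
    congr 1
    push_cast
    ring
  simp only [e]
  have h2 : HasSum (fun k => ((G.vec s k y ^ 2 : ℝ) : ℂ)) ((1 : ℝ) : ℂ) :=
    Complex.hasSum_ofReal.2 (G.hasSum_vec_sq s y)
  have h3 := h2.smul_const (((G.vec s m y * G.vec s n y : ℝ) : ℂ) • (h.fn y * h'.fn y))
  rwa [Complex.ofReal_one, one_smul] at h3

variable (G) [ProperSpace Y]

/-- Functions of finite spread are dense. -/
lemma exists_spread (h : C0Pair Y Y₀ A) {ε : ℝ} (hε : 0 < ε) :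
    ∃ (h' : C0Pair Y Y₀ A) (F : Finset X), G.Spread h' F ∧ ‖h - h'‖ < ε := by
  let c : C(Y, ℝ) := ⟨fun y => max 0 (min 1 (4 * ‖h.fn y‖ / ε - 1)), by
    have := h.fn.continuous; fun_prop⟩
  have hc0 : ∀ y, 0 ≤ c y := fun y => le_max_left _ _
  have hc1 : ∀ y, c y ≤ 1 := fun y => max_le zero_le_one (min_le_left _ _)
  have hc : ∀ y, |c y| ≤ 1 := fun y => by rw [abs_of_nonneg (hc0 y)]; exact hc1 y
  obtain ⟨K, hK, hKh⟩ := G.exists_isBounded h 0 (show 0 < ε / 4 by positivity)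
  have hfin : {x : X | ∃ y ∈ K, G.φ x y ≠ 0}.Finite := by
    rcases K.eq_empty_or_nonempty with rfl | ⟨y₀, hy₀⟩
    · simp
    obtain ⟨r, hr⟩ := hK.subset_closedBall y₀
    refine (G.finite_near y₀ (r + 2 * δ)).subset ?_
    rintro x ⟨y, hy, hxy⟩
    have h1 := G.φ_dist x y hxy
    have h2 := Metric.mem_closedBall.1 (hr hy)
    have h3 := dist_triangle_left y₀ (x : Y) y
    exact (show dist y₀ (x : Y) ≤ _ by linarith)
  refine ⟨C0Pair.bmul c hc h, hfin.toFinset, fun y hy x hx => ?_, ?_⟩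
  · refine (Set.Finite.mem_toFinset _).2 ⟨y, ?_, hx⟩
    by_contra hyK
    have h1 := hKh 0 le_rfl y hyK
    rw [G.sc_zero] at h1
    refine hy ?_
    rw [C0Pair.bmul_fn]
    have : c y = 0 := by
      refine max_eq_left ((min_le_right _ _).trans ?_)
      rw [sub_nonpos, div_le_one hε]
      linarith
    rw [this, Complex.ofReal_zero, zero_smul]
  · refine lt_of_le_of_lt (norm_le_of_fn (half_pos hε).le fun y => ?_) (half_lt_self hε)
    have e : (h - C0Pair.bmul c hc h).fn y = ((1 - c y : ℝ) : ℂ) • h.fn y := by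
      rw [C0Pair.fn_sub, C0Pair.bmul_fn, Complex.ofReal_sub, sub_smul, Complex.ofReal_one, one_smul]
    rw [e, norm_smul, Complex.norm_real, Real.norm_of_nonneg (by linarith [hc1 y])]
    rcases le_total (ε / 2) ‖h.fn y‖ with h1 | h1
    · have : c y = 1 := by
        have h2 : 1 ≤ 4 * ‖h.fn y‖ / ε - 1 := by
          rw [le_sub_iff_add_le, le_div_iff₀ hε]; linarith
        change max 0 (min 1 (4 * ‖h.fn y‖ / ε - 1)) = 1
        rw [min_eq_left h2]
        exact max_eq_right zero_le_one
      rw [this, sub_self, zero_mul]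
      exact (half_pos hε).le
    · exact (mul_le_of_le_one_left (norm_nonneg _) (by linarith [hc0 y])).trans h1

lemma exists_rankOneHom (A : Type u) [NonUnitalCStarAlgebra A] :
    ∃ W : C0Pair Y Y₀ A →⋆ₙₐ[ℂ] C(unitInterval, KAlg (C0Pair Y Y₀ A)), ∀ h M, G.RankOne h M → W h = M := by
  classical
  refine exists_hom_of_rel G.RankOne ⟨⟨∅, fun y hy => absurd rfl hy⟩, fun s m n y => ?_⟩ ?_ ?_
    (fun h M h' M' hM hM' => hM.mul hM') ?_ (fun h M hM => hM.norm_le) (fun h ε hε => ?_)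
  · rw [C0Pair.fn_zero, smul_zero, ContinuousMap.zero_apply, CtrlAlg.op_zero, entry_zero]
    rfl
  · rintro h M h' M' ⟨⟨F, hF⟩, hM⟩ ⟨⟨F', hF'⟩, hM'⟩
    refine ⟨⟨F ∪ F', fun y hy x hx => ?_⟩, fun s m n y => ?_⟩
    · by_cases h0 : h.fn y = 0
      · refine Finset.mem_union_right _ (hF' y (fun h1 => hy ?_) x hx)
        rw [C0Pair.fn_add, h0, h1, add_zero]
      · exact Finset.mem_union_left _ (hF y h0 x hx)
    · rw [ContinuousMap.add_apply, CtrlAlg.op_add, entry_add, C0Pair.fn_add, C0Pair.fn_add, smul_add, hM, hM']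
  · rintro c h M ⟨⟨F, hF⟩, hM⟩
    refine ⟨⟨F, fun y hy => hF y fun h0 => hy ?_⟩, fun s m n y => ?_⟩
    · rw [C0Pair.fn_smul, h0, smul_zero]
    · rw [ContinuousMap.smul_apply, CtrlAlg.op_smul, entry_smul, C0Pair.fn_smul, C0Pair.fn_smul, hM, smul_comm]
  · rintro h M ⟨⟨F, hF⟩, hM⟩
    refine ⟨⟨F, fun y hy => hF y fun h0 => hy ?_⟩, fun s m n y => ?_⟩
    · rw [C0Pair.fn_star, h0, star_zero]
    · rw [ContinuousMap.star_apply, CtrlAlg.op_star, entry_star, C0Pair.fn_star, C0Pair.fn_star, hM, star_smul,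
        Complex.star_def, Complex.conj_ofReal, mul_comm]
  · obtain ⟨h', F, hF, hd⟩ := G.exists_spread h hε
    obtain ⟨M, hM⟩ := G.exists_rankOne hF
    exact ⟨h', M, hM, hd⟩

/-- The path of homomorphisms `C₀(Y, Y₀, A) → 𝕂 C₀(Y, Y₀, A)` by rank one matrices. -/
def rankOneHom (A : Type u) [NonUnitalCStarAlgebra A] :
    C0Pair Y Y₀ A →⋆ₙₐ[ℂ] C(unitInterval, KAlg (C0Pair Y Y₀ A)) := (G.exists_rankOneHom A).choose

lemma entry_rankOneHom (h : C0Pair Y Y₀ A) (s : unitInterval) (m n : ℕ) (y : Y) :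
    (entry (G.rankOneHom A h s).op m n).fn y = ((G.vec s m y * G.vec s n y : ℝ) : ℂ) • h.fn y := by
  set c : ℂ := ((G.vec s m y * G.vec s n y : ℝ) : ℂ) with hc
  rw [← sub_eq_zero, ← norm_le_zero_iff]
  refine le_of_forall_pos_le_add fun ε hε => ?_
  rw [zero_add]
  obtain ⟨h', F, hF, hd⟩ := G.exists_spread h (ε := ε / (1 + ‖c‖)) (by positivity)
  obtain ⟨M, hM⟩ := G.exists_rankOne hF
  have hW : G.rankOneHom A h' = M := (G.exists_rankOneHom A).choose_spec h' M hM
  have h1 : (entry (G.rankOneHom A h' s).op m n).fn y = c • h'.fn y := by rw [hW, hM.2]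
  have h2 : (entry (G.rankOneHom A h s).op m n).fn y - c • h.fn y =
      (entry (G.rankOneHom A (h - h') s).op m n).fn y - c • (h - h').fn y := by
    rw [map_sub, ContinuousMap.sub_apply, CtrlAlg.op_sub, entry_sub, C0Pair.fn_sub, h1, C0Pair.fn_sub,
      smul_sub]
    abel
  rw [h2]
  have h3 : ‖(entry (G.rankOneHom A (h - h') s).op m n).fn y‖ ≤ ‖h - h'‖ :=
    (norm_fn_le _ y).trans ((CtrlAlg.norm_entry_le _ m n).trans
      ((ContinuousMap.norm_coe_le_norm _ s).trans (NonUnitalStarAlgHom.norm_apply_le _ _)))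
  have h4 := norm_fn_le (h - h') y
  rw [lt_div_iff₀ (by positivity)] at hd
  refine (norm_sub_le _ _).trans ?_
  rw [norm_smul]
  nlinarith [norm_nonneg c]

lemma rankOneHom_one (h : C0Pair Y Y₀ A) : G.rankOneHom A h 1 = stab (C0Pair Y Y₀ A) h :=
  KAlg.ext fun m n => C0Pair.ext' fun y => by
    rw [entry_rankOneHom, stab_apply, entry_munit]
    by_cases h1 : m = 0
    · by_cases h2 : n = 0
      · rw [if_pos ⟨h1, h2⟩, h1, h2, vec_one_zero, mul_one, Complex.ofReal_one, one_smul]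
      · rw [if_neg fun h => h2 h.2, G.vec_one_of_ne h2, mul_zero, Complex.ofReal_zero, zero_smul]; rfl
    · rw [if_neg fun h => h1 h.1, G.vec_one_of_ne h1, zero_mul, Complex.ofReal_zero, zero_smul]; rfl

/-- The image of the unit under the counit is the matrix of partition functions. -/
lemma counit_tens_unit (f : C0Pair Y Y₀ ℂ) (a : A) :
    G.counit (C0Pair Y Y₀ A) (C0Pair.tens f (G.unit A a)) =
      asymMap ((evHom _ 0).comp (G.rankOneHom A)) (CQuot.mk _ (G.scFun (C0Pair.tens f a))) := by
  change G.counit (C0Pair Y Y₀ A) (C0Pair.tens f (CQuot.mk _ (G.unitOp a))) = _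
  rw [counit_tens, asymMap_mk]
  obtain ⟨N, hN⟩ := G.exists_op (4 * δ)
  refine CQuot.mk_eq.2 (mem_asymIdeal.2 fun ε hε => eventually_atTop.1 ?_)
  have hε' : 0 < ε / ((N + 1) * (‖a‖ + 1)) := by positivity
  filter_upwards [G.eventually_norm_sub_le f (2 * δ) hε', G.eventually_norm_le f (4 * δ) hε'] with t ht ht'
  set η := ε / ((N + 1) * (‖a‖ + 1)) with hη
  let k : KAlg (C0Pair Y Y₀ A) := G.kpath f (G.unitOp a) t -
    G.rankOneHom A (G.scHom t (C0Pair.tens f a)) 0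
  change ‖k‖ ≤ ε
  have hk : ∀ x x' y, (entry k.op (G.ι x) (G.ι x')).fn y =
      (f.fn (G.sc t x) * ((G.ψ x).fn y * (G.ψ x').fn y) -
        ((G.φ x y : ℝ) : ℂ) * ((G.φ x' y : ℝ) : ℂ) * f.fn (G.sc t y)) • a := fun x x' y => by
    rw [CtrlAlg.op_sub, entry_sub, C0Pair.fn_sub, entry_rankOneHom, kpath_apply, op_kop, entry_extOp,
      entry_cut (G.bdd_resc f t) bdd_one, C0Pair.fn_smul, entry_unitOp_fn, vec_zero_ι, vec_zero_ι,
      scHom_apply, C0Pair.tens_fn, smul_smul, smul_smul, sub_smul, Pi.one_apply, mul_one, Complex.ofReal_mul]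
    rfl
  have hk0 : ∀ m n, (¬ ∃ x x', G.ι x = m ∧ G.ι x' = n) → entry k.op m n = 0 := fun m n h => by
    refine C0Pair.ext' fun y => ?_
    have h1 : entry (G.kpath f (G.unitOp a) t).op m n = 0 := by
      rw [kpath_apply, op_kop]
      by_contra h0
      exact h (entry_extOp_ne_zero _ h0)
    rw [CtrlAlg.op_sub, entry_sub, C0Pair.fn_sub, entry_rankOneHom, h1, C0Pair.fn_zero]
    by_cases hm : ∃ x, G.ι x = m
    · have hn : ¬ ∃ x, G.ι x = n := fun ⟨x', hx'⟩ => h ⟨hm.choose, x', hm.choose_spec, hx'⟩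
      rw [G.vec_zero_of_notMem hn, mul_zero, Complex.ofReal_zero, zero_smul, sub_zero]
    · rw [G.vec_zero_of_notMem hm, zero_mul, Complex.ofReal_zero, zero_smul, sub_zero]
  have hψ0 : ∀ x y, G.φ x y = 0 → (G.ψ x).fn y = 0 := fun x y h => by
    by_contra h0
    exact G.φ_ne_zero_of_ψ h0 h
  obtain ⟨S, hS, hn⟩ := hN (fun x x' => entry k.op (G.ι x) (G.ι x')) (η * ‖a‖) (by positivity)
    (fun x x' h => by
      by_contra hne
      refine h (C0Pair.ext' fun y => ?_)
      rw [hk, C0Pair.fn_zero]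
      by_cases h1 : G.φ x y = 0
      · rw [h1, hψ0 x y h1]; simp
      by_cases h2 : G.φ x' y = 0
      · rw [h2, hψ0 x' y h2]; simp
      exact absurd (G.dist_lt_of_φ h1 h2).le hne)
    (fun x x' => norm_le_of_fn (by positivity) fun y => by
      rw [hk, norm_smul]
      refine mul_le_mul_of_nonneg_right ?_ (norm_nonneg _)
      by_cases h1 : G.φ x y = 0
      · rw [h1, hψ0 x y h1]; simpa using hε'.le
      by_cases h2 : G.φ x' y = 0
      · rw [h2, hψ0 x' y h2]; simpa using hε'.le
      have hφ : ∀ z, ‖((G.φ x y : ℝ) : ℂ) * ((G.φ x' y : ℝ) : ℂ) * z‖ ≤ ‖z‖ := fun z => by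
        rw [norm_mul, norm_mul, Complex.norm_real, Complex.norm_real]
        exact mul_le_of_le_one_left (norm_nonneg _)
          (mul_le_one₀ (G.abs_part_le (some x) y) (norm_nonneg _) (G.abs_part_le (some x') y))
      by_cases hx : (x : Y) ∉ Metric.thickening (2 * δ) Y₀ ∧ (x' : Y) ∉ Metric.thickening (2 * δ) Y₀
      · rw [G.ψ_of_notMem hx.1, G.ψ_of_notMem hx.2, mul_comm (f.fn _), ← mul_sub]
        refine (hφ _).trans (ht x y ?_)
        rw [dist_comm]
        exact (G.φ_dist x y h1).le
      · have hz : (G.ψ x).fn y * (G.ψ x').fn y = 0 ∧ y ∈ Metric.thickening (4 * δ) Y₀ := by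
          have step : ∀ z : X, G.φ z y ≠ 0 → (z : Y) ∈ Metric.thickening (2 * δ) Y₀ →
              y ∈ Metric.thickening (4 * δ) Y₀ := fun z hz hz' => by
            obtain ⟨w, hw, hd⟩ := Metric.mem_thickening_iff.1 hz'
            refine Metric.mem_thickening_iff.2 ⟨w, hw, ?_⟩
            have h3 := G.φ_dist z y hz
            have h4 := dist_triangle y (z : Y) w
            linarith
          rw [not_and_or, not_not, not_not] at hx
          rcases hx with hx | hx
          · exact ⟨by rw [G.ψ_of_mem hx, C0Pair.fn_zero, zero_mul], step x h1 hx⟩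
          · exact ⟨by rw [G.ψ_of_mem hx, C0Pair.fn_zero, mul_zero], step x' h2 hx⟩
        rw [hz.1, mul_zero, zero_sub, norm_neg]
        exact (hφ _).trans (ht' y hz.2))
  have hkS : k.op = extOp (C0Pair Y Y₀ A) G.ι_injective S.op := entry_ext fun m n => by
    by_cases h : ∃ x x', G.ι x = m ∧ G.ι x' = n
    · obtain ⟨x, x', rfl, rfl⟩ := h
      rw [entry_extOp, hS]
    · rw [hk0 m n h]
      by_contra h0
      exact h (entry_extOp_ne_zero _ (Ne.symm h0))
  refine (G.norm_le_of_extOp hkS).trans (hn.trans ?_)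
  calc (N : ℝ) * (η * ‖a‖) = ε * ((N / (N + 1)) * (‖a‖ / (‖a‖ + 1))) := by rw [hη]; field_simp
    _ ≤ ε * (1 * 1) := by
        gcongr
        · rw [div_le_one (by positivity)]; linarith
        · rw [div_le_one (by positivity)]; linarith
    _ = ε := by ring

end Geometry
end RankOne

/-! ### The second triangle identity -/

section CounitUnit

/-- The functor `𝔑` is additive on orthogonal morphisms. -/
lemma roeQuot_map_orthAdd {W : Type u} [PseudoMetricSpace W] (W₀ : Set W) {C D : CStarAlg.{u}} (f g : C ⟶ D) (h : Orth f g) :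
    (roeQuot W W₀).map (orthAdd f g h) =
      orthAdd ((roeQuot W W₀).map f) ((roeQuot W W₀).map g)
        (OrthPreserving.orth f g h) := hom_ext' fun a => by
  obtain ⟨T, rfl⟩ := CQuot.mk_surjective a
  refine congrArg (CQuot.mk _) (CtrlAlg.entry_ext (S := CtrlAlg.map _ (toHom (orthAdd f g h)) T)
    (T := CtrlAlg.map _ (toHom f) T + CtrlAlg.map _ (toHom g) T) fun x x' => ?_)
  rw [CtrlAlg.op_add, entry_add, CtrlAlg.op_map, CtrlAlg.op_map, CtrlAlg.op_map, entry_colMap, entry_colMap,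
    entry_colMap]
  rfl

/-- A path from `C` to functions on the half-line which begins at the identity, and a path to the
stabilization, yield the structure maps of the colimit. -/
lemma mk_scale_rank {B C : CStarAlg.{u}} (k : ℕ) (σ : C ⟶ bcfObj ℝ≥0 C) (hσ : σ ≫ evalMor 0 C = 𝟙 C)
    (ρ : C ⟶ cyl.obj (compact.obj C)) (hρ : ρ ≫ (ev 1).app (compact.obj C) = stabMor C)
    (φ : C ⟶ (compact ⋙ (asymPow k ⋙ 𝟭 CStarAlg.{u})).obj B) :
    GenMor.mk (B := B) (compact ⋙ (asymPow (k + 1) ⋙ 𝟭 CStarAlg.{u}))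
      (σ ≫ projMor C ≫ asym.map ((ρ ≫ (ev 0).app (compact.obj C)) ≫
        compact.map (φ : C ⟶ (asymPow k).obj (compact.obj B)) ≫ absorb k B)) =
    GenMor.mapNat (Functor.whiskerLeft compact (stageNat (𝟭 CStarAlg) k))
      (GenMor.mk (compact ⋙ (asymPow k ⋙ 𝟭 CStarAlg.{u})) φ) := by
  let D := (asymPow k).obj (compact.obj B)
  let φ' : C ⟶ D := φ
  let g : C ⟶ D := (ρ ≫ (ev 0).app (compact.obj C)) ≫ compact.map φ' ≫ absorb k B
  have e1 : σ ≫ projMor C ≫ asym.map g =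
      (σ ≫ scaleMor C ≫ asym.map (cyl.map g)) ≫ asym.map ((ev 1).app D) := by
    rw [Category.assoc, Category.assoc, ← asym.map_comp, (ev 1).naturality, ← scaleMor_one, Category.assoc,
      ← asym.map_comp]
    rfl
  have e2 : (σ ≫ scaleMor C ≫ asym.map (cyl.map g)) ≫ asym.map ((ev 0).app D) =
      (ρ ≫ cyl.map (compact.map φ' ≫ absorb k B ≫ alpha.app D)) ≫ (ev 0).app (asym.obj D) := by
    have h1 : (σ ≫ scaleMor C ≫ asym.map (cyl.map g)) ≫ asym.map ((ev 0).app D) = g ≫ alpha.app D := by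
      rw [Category.assoc, Category.assoc, ← asym.map_comp, (ev 0).naturality, asym.map_comp,
        ← Category.assoc (scaleMor C), scaleMor_zero, Category.assoc, ← Category.assoc σ, hσ,
        Category.id_comp]
      exact (alpha.naturality g).symm
    rw [h1, Category.assoc ρ (cyl.map _), (ev 0).naturality]
    rfl
  have e3 : (ρ ≫ cyl.map (compact.map φ' ≫ absorb k B ≫ alpha.app D)) ≫ (ev 1).app (asym.obj D) =
      (φ' ≫ alpha.app D) ≫ (asymPow (k + 1)).map ((conjK pair_zero_injective).app B) := by
    have h1 : stabMor D ≫ absorb k B = (asymPow k).map ((conjK pair_zero_injective).app B) :=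
      stabMor_absorb k B
    have h2 : (ρ ≫ cyl.map (compact.map φ' ≫ absorb k B ≫ alpha.app D)) ≫ (ev 1).app (asym.obj D) =
        (ρ ≫ (ev 1).app (compact.obj C)) ≫ compact.map φ' ≫ absorb k B ≫ alpha.app D := by
      rw [Category.assoc, (ev 1).naturality]
      rfl
    rw [h2, hρ, ← Category.assoc, ← stabMor_naturality, Category.assoc, ← Category.assoc (stabMor D), h1]
    exact (congrArg (φ' ≫ ·) (alpha.naturality ((asymPow k).map ((conjK pair_zero_injective).app B)))).trans
      (Category.assoc _ _ _).symm
  refine (congrArg (GenMor.mk (B := B) _) e1).trans ?_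
  refine (GenMor.mk_eq_of_cyl (hasSwap_compact.comp (hasSwap_asymPow k)) asym
    (σ ≫ scaleMor C ≫ asym.map (cyl.map g))).symm.trans ?_
  refine (congrArg (GenMor.mk (B := B) _) e2).trans ?_
  refine (GenMor.mk_eq_of_cyl (hasSwap_compact.comp (hasSwap_asymPow (k + 1))) (𝟭 CStarAlg.{u})
    (ρ ≫ cyl.map (compact.map φ' ≫ absorb k B ≫ alpha.app D))).trans ?_
  refine (congrArg (GenMor.mk (B := B) _) e3).trans ?_
  exact GenMor.mk_comp_conjK (asymPow (k + 1)) pair_zero_injective (φ' ≫ alpha.app D)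

variable {Y : Type u} [MetricSpace Y] [ProperSpace Y] {Y₀ : Set Y} {δ : ℝ} {X : Set Y}

namespace Geometry
variable (G : Geometry Y Y₀ δ X)

/-- The function `t ↦ f ∘ sc_t`, as a morphism. -/
def scFunMor (A : CStarAlg.{u}) : (c0Pair Y Y₀).obj A ⟶ bcfObj ℝ≥0 ((c0Pair Y Y₀).obj A) :=
  ofHom (A := (c0Pair Y Y₀).obj A) (B := bcfObj ℝ≥0 ((c0Pair Y Y₀).obj A)) (G.scFun (E := A))

/-- The path of rank one matrices, as a morphism. -/
def rankMor (A : CStarAlg.{u}) : (c0Pair Y Y₀).obj A ⟶ cyl.obj (compact.obj ((c0Pair Y Y₀).obj A)) :=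
  ofHom (A := (c0Pair Y Y₀).obj A) (B := cyl.obj (compact.obj ((c0Pair Y Y₀).obj A))) (G.rankOneHom A)

lemma scFunMor_eval (A : CStarAlg.{u}) : G.scFunMor A ≫ evalMor 0 _ = 𝟙 _ :=
  hom_ext' fun f => G.scHom_zero (E := A) f

lemma rankMor_ev (A : CStarAlg.{u}) : G.rankMor A ≫ (ev 1).app _ = stabMor _ :=
  hom_ext' fun h => G.rankOneHom_one (A := A) h

lemma map_unitMor_counitMor (A : CStarAlg.{u}) :
    (c0Pair Y Y₀).map (G.unitMor A) ≫ G.counitMor ((c0Pair Y Y₀).obj A) =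
      G.scFunMor A ≫ projMor _ ≫ asym.map (G.rankMor A ≫ (ev 0).app _) := by
  refine C0Pair.hom_ext_tens G.isClosed (E := A)
    (Q := CQuot (asymIdeal (KAlg (C0Pair Y Y₀ A)))) _ _ fun f a => ?_
  refine Eq.trans ?_ (G.counit_tens_unit f a)
  refine congrArg (G.counit (C0Pair Y Y₀ A)) (C0Pair.ext' fun y => ?_)
  exact map_smul (G.unit A) (f.fn y) a

lemma adjoint_unit {A B : CStarAlg.{u}} (k : ℕ)
    (φ : (c0Pair Y Y₀).obj A ⟶ (asymPow k).obj (compact.obj B)) :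
    G.adjoint k (G.unitMor A ≫ (roeQuot X (nearPoints δ X Y₀)).map φ) =
      G.scFunMor A ≫ projMor _ ≫ asym.map ((G.rankMor A ≫ (ev 0).app _) ≫ compact.map φ ≫ absorb k B) := by
  rw [adjoint, Functor.map_comp, Category.assoc, ← Category.assoc ((c0Pair Y Y₀).map
    ((roeQuot X (nearPoints δ X Y₀)).map φ)), counitMor_naturality, Category.assoc, ← Category.assoc,
    map_unitMor_counitMor, asym.map_comp (G.rankMor A ≫ _), asym.map_comp (compact.map φ)]
  simp only [Category.assoc]

theorem mk_adjoint_unit {A B : CStarAlg.{u}} (k : ℕ)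
    (φ : (c0Pair Y Y₀).obj A ⟶ (compact ⋙ (asymPow k ⋙ 𝟭 CStarAlg)).obj B) :
    GenMor.mk (B := B) (compact ⋙ (asymPow (k + 1) ⋙ 𝟭 CStarAlg))
      (G.adjoint k (G.unitMor A ≫ (roeQuot X (nearPoints δ X Y₀)).map
        (φ : (c0Pair Y Y₀).obj A ⟶ (asymPow k).obj (compact.obj B)))) =
    GenMor.mapNat (Functor.whiskerLeft compact (stageNat (𝟭 CStarAlg) k))
      (GenMor.mk (compact ⋙ (asymPow k ⋙ 𝟭 CStarAlg)) φ) :=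
  (congrArg (GenMor.mk (B := B) (compact ⋙ (asymPow (k + 1) ⋙ 𝟭 CStarAlg))) (G.adjoint_unit k φ)).trans
    (mk_scale_rank k (G.scFunMor A) (G.scFunMor_eval A) (G.rankMor A) (G.rankMor_ev A) φ)

/-! ### The maps between the stages -/

lemma adjoint_comp {A B B' : CStarAlg.{u}} (k : ℕ)
    (ψ : A ⟶ (roeQuot X (nearPoints δ X Y₀)).obj ((asymPow k).obj (compact.obj B))) (g : B ⟶ B') :
    G.adjoint k ψ ≫ asym.map ((asymPow k).map (compact.map g)) =
      G.adjoint k (ψ ≫ (roeQuot X (nearPoints δ X Y₀)).map ((asymPow k).map (compact.map g))) := by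
  rw [adjoint, adjoint, Functor.map_comp, Category.assoc, Category.assoc, Category.assoc, ← asym.map_comp,
    ← absorb_naturality, asym.map_comp, ← Category.assoc ((c0Pair Y Y₀).map
      ((roeQuot X (nearPoints δ X Y₀)).map _)), counitMor_naturality, Category.assoc]

variable (A B : CStarAlg.{u})

/-- The map `[C₀(Y, Y₀, A), 𝔄^{k+1} 𝕂, B] → [A, 𝔑 𝔄^{k+1} 𝕂, B]`. -/
def toRoe (k : ℕ) : Stage (𝟭 CStarAlg) ((c0Pair Y Y₀).obj A) B k → Stage (roeQuot X (nearPoints δ X Y₀)) A B k :=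
  Quot.map (fun φ => G.unitMor A ≫ (roeQuot X (nearPoints δ X Y₀)).map φ) (by
    rintro φ ψ ⟨Φ, rfl, rfl⟩
    refine ⟨G.unitMor A ≫ (roeQuot X (nearPoints δ X Y₀)).map Φ, ?_, ?_⟩ <;>
    · rw [Category.assoc]
      exact congrArg (G.unitMor A ≫ ·) ((roeQuot X (nearPoints δ X Y₀)).map_comp Φ _).symm)

/-- The map `[A, 𝔑 𝔄^{k+1} 𝕂, B] → [C₀(Y, Y₀, A), 𝔄^{k+2} 𝕂, B]`. -/
def ofRoe (k : ℕ) : Stage (roeQuot X (nearPoints δ X Y₀)) A B k → Stage (𝟭 CStarAlg) ((c0Pair Y Y₀).obj A) B (k + 1) :=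
  Quot.map (fun ψ => G.adjoint k ψ) (by
    rintro φ ψ ⟨Φ, rfl, rfl⟩
    exact ⟨G.adjoint k Φ, G.adjoint_comp k Φ _, G.adjoint_comp k Φ _⟩)

lemma toRoe_ofRoe (k : ℕ) (x : Stage (roeQuot X (nearPoints δ X Y₀)) A B k) :
    G.toRoe A B (k + 1) (G.ofRoe A B k x) = SumMor.mapNat (stageNat _ k) x := by
  obtain ⟨ψ⟩ := x
  exact G.mk_unit_adjoint k ψ

lemma ofRoe_toRoe (k : ℕ) (x : Stage (𝟭 CStarAlg) ((c0Pair Y Y₀).obj A) B k) :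
    G.ofRoe A B k (G.toRoe A B k x) = SumMor.mapNat (stageNat _ k) x := by
  obtain ⟨φ⟩ := x
  exact G.mk_adjoint_unit k φ

lemma toRoe_mapNat (k : ℕ) (x : Stage (𝟭 CStarAlg) ((c0Pair Y Y₀).obj A) B k) :
    G.toRoe A B (k + 1) (SumMor.mapNat (stageNat _ k) x) = SumMor.mapNat (stageNat _ k) (G.toRoe A B k x) := by
  obtain ⟨φ⟩ := x
  refine congrArg (GenMor.mk (compact ⋙ (asymPow (k + 1) ⋙ roeQuot X (nearPoints δ X Y₀)))) ?_
  refine Eq.trans ?_ (Category.assoc _ _ _).symm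
  exact congrArg (G.unitMor A ≫ ·) ((roeQuot X (nearPoints δ X Y₀)).map_comp φ _)

lemma toRoe_add (k : ℕ) (x y : Stage (𝟭 CStarAlg) ((c0Pair Y Y₀).obj A) B k) :
    G.toRoe A B k (x + y) = G.toRoe A B k x + G.toRoe A B k y := by
  obtain ⟨φ⟩ := x
  obtain ⟨ψ⟩ := y
  refine congrArg (GenMor.mk (compact ⋙ (asymPow k ⋙ roeQuot X (nearPoints δ X Y₀)))) ?_
  change G.unitMor A ≫ (roeQuot X (nearPoints δ X Y₀)).map (orthAdd
    (φ ≫ (asymPow k).map (inc₀.app B)) (ψ ≫ (asymPow k).map (inc₁.app B)) _) = _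
  rw [roeQuot_map_orthAdd, comp_orthAdd]
  simp only [Functor.map_comp]
  rfl

lemma unitMor_map_comp {A A' D : CStarAlg.{u}} (f : A' ⟶ A) (φ : (c0Pair Y Y₀).obj A ⟶ D) :
    G.unitMor A' ≫ (roeQuot X (nearPoints δ X Y₀)).map ((c0Pair Y Y₀).map f ≫ φ) =
      f ≫ G.unitMor A ≫ (roeQuot X (nearPoints δ X Y₀)).map φ := by
  rw [Functor.map_comp, ← Category.assoc, ← unitMor_naturality, Category.assoc]

lemma unitMor_comp_map {A D D' : CStarAlg.{u}} (φ : (c0Pair Y Y₀).obj A ⟶ D) (g : D ⟶ D') :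
    G.unitMor A ≫ (roeQuot X (nearPoints δ X Y₀)).map (φ ≫ g) =
      (G.unitMor A ≫ (roeQuot X (nearPoints δ X Y₀)).map φ) ≫ (roeQuot X (nearPoints δ X Y₀)).map g := by
  rw [Functor.map_comp, Category.assoc]

end Geometry
end CounitUnit

/-! ### The colimits -/

section Colimits
variable {F F' : CStarAlg.{u} ⥤ CStarAlg.{u}} [OrthPreserving F] [OrthPreserving F'] {A A' B : CStarAlg.{u}}

lemma SumMor.mapNat_zero {G G' : CStarAlg.{u} ⥤ CStarAlg.{u}} [OrthPreserving G] [OrthPreserving G']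
    (η : G ⟶ G') : SumMor.mapNat η (0 : SumMor G A B) = 0 :=
  congrArg (GenMor.mk (compact ⋙ G')) (hom_ext' fun _ => map_zero (toHom (η.app (compact.obj B))))

lemma stageMap_zero (i j : ℕ) (h : i ≤ j) : stageMap F A B i j h 0 = 0 := by
  induction j, h using Nat.le_induction with
  | base => rw [stageMap_self]; rfl
  | succ j h ih => rw [stageMap_succ F A B i j h, AddHom.comp_apply, ih, SumMor.mapNat_zero]

lemma toColim_add (k : ℕ) (x y : Stage F A B k) :
    toColim F A B k (x + y) = toColim F A B k x + toColim F A B k y := (DirectLimit.add_def k x y).symm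

lemma toColim_zero (k : ℕ) : toColim F A B k 0 = 0 :=
  (DirectLimit.map₀_def (stageMap F A B) (fun _ => 0) (fun i j h => stageMap_zero i j h) k).symm

lemma toColim_stage (k : ℕ) (x : Stage F A B k) :
    toColim F A B (k + 1) (SumMor.mapNat (stageNat F k) x) = toColim F A B k x := by
  have h := DirectLimit.mk_apply (f := stageMap F A B) k (k + 1) x k.le_succ
  rw [stageMap_succ F A B k k le_rfl, stageMap_self] at h
  exact h

/-- The colimit is a commutative monoid. -/
theorem AsymMor.isCommMonoid (F : CStarAlg.{u} ⥤ CStarAlg.{u}) [OrthPreserving F] (A B : CStarAlg.{u}) :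
    IsCommMonoid (AsymMor F A B) where
  assoc := DirectLimit.induction₃ _ fun k x y z => by
    change toColim F A B k x + toColim F A B k y + toColim F A B k z =
      toColim F A B k x + (toColim F A B k y + toColim F A B k z)
    rw [← toColim_add, ← toColim_add, ← toColim_add, ← toColim_add, (SumMor.isCommMonoid _ A B).assoc]
  comm := DirectLimit.induction₂ _ fun k x y => by
    change toColim F A B k x + toColim F A B k y = toColim F A B k y + toColim F A B k x
    rw [← toColim_add, ← toColim_add, (SumMor.isCommMonoid _ A B).comm]
  zero_add := DirectLimit.induction _ fun k x => by
    change 0 + toColim F A B k x = toColim F A B k x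
    rw [← toColim_zero k, ← toColim_add, (SumMor.isCommMonoid _ A B).zero_add]

/-- Maps between the stages which are inverse to each other up to the transition maps induce an
isomorphism of the colimits. -/
lemma exists_addEquiv_colim (f : ∀ k, Stage F A B k → Stage F' A' B k)
    (g : ∀ k, Stage F' A' B k → Stage F A B (k + 1))
    (hf : ∀ k x, f (k + 1) (SumMor.mapNat (stageNat F k) x) = SumMor.mapNat (stageNat F' k) (f k x))
    (hadd : ∀ k x y, f k (x + y) = f k x + f k y)
    (hfg : ∀ k x, f (k + 1) (g k x) = SumMor.mapNat (stageNat F' k) x)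
    (hgf : ∀ k x, g k (f k x) = SumMor.mapNat (stageNat F k) x) :
    ∃ e : AsymMor F A B ≃+ AsymMor F' A' B, ∀ k x, e (toColim F A B k x) = toColim F' A' B k (f k x) := by
  have hc : ∀ i j (h : i ≤ j) x, f j (stageMap F A B i j h x) = stageMap F' A' B i j h (f i x) := by
    intro i j h x
    induction j, h using Nat.le_induction with
    | base => rw [stageMap_self, stageMap_self]; rfl
    | succ j h ih =>
      rw [stageMap_succ F A B i j h, stageMap_succ F' A' B i j h, AddHom.comp_apply, AddHom.comp_apply, hf, ih]
  let Φ : AsymMor F A B → AsymMor F' A' B := DirectLimit.map (stageMap F A B) (stageMap F' A' B) f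
    fun i j h x => (hc i j h x).symm
  have hΦ : ∀ k x, Φ (toColim F A B k x) = toColim F' A' B k (f k x) := fun k x => rfl
  have hinj : Function.Injective Φ := by
    refine DirectLimit.induction₂ _ fun k x y h => ?_
    obtain ⟨l, h1, h2, e⟩ := Quotient.exact h
    have e1 : f l (stageMap F A B k l h1 x) = f l (stageMap F A B k l h1 y) := by
      rw [hc, hc]; exact e
    have e2 := congrArg (g l) e1
    rw [hgf, hgf] at e2
    have h3 : ∀ x, toColim F A B k x =
        toColim F A B (l + 1) (SumMor.mapNat (stageNat F l) (stageMap F A B k l h1 x)) := fun x => by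
      rw [toColim_stage]
      exact (DirectLimit.mk_apply (f := stageMap F A B) k l x h1).symm
    exact (h3 x).trans ((congrArg (toColim F A B (l + 1)) e2).trans (h3 y).symm)
  have hsurj : Function.Surjective Φ := DirectLimit.induction _ fun k x => by
    refine ⟨toColim F A B (k + 1) (g k x), ?_⟩
    rw [hΦ, hfg, toColim_stage]
    rfl
  refine ⟨{ Equiv.ofBijective Φ ⟨hinj, hsurj⟩ with map_add' := ?_ }, hΦ⟩
  refine DirectLimit.induction₂ _ fun k x y => ?_
  change Φ (toColim F A B k x + toColim F A B k y) = Φ (toColim F A B k x) + Φ (toColim F A B k y)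
  rw [← toColim_add, hΦ, hΦ, hΦ, hadd, toColim_add]

end Colimits

end

end AsympAdj

theorem theorem3p21 {Y : Type u} [MetricSpace Y] [ProperSpace Y] (Y₀ : Set Y) (hY₀ : IsClosed Y₀)
    (hsc : IsScalable Y Y₀) (δ : ℝ) (hδ : 0 < δ) (X : Set Y) (hX : IsDiscretization δ X)
    (hgeom : BoundedGeometry X) :
    -- the sums make all the sets involved commutative monoids
    (∀ A B : CStarAlg.{u},
      (∀ k : ℕ, IsCommMonoid (Stage (𝟭 CStarAlg) ((c0Pair Y Y₀).obj A) B k) ∧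
        IsCommMonoid (Stage (roeQuot X (nearPoints δ X Y₀)) A B k)) ∧
      IsCommMonoid (AsymMor (𝟭 CStarAlg) ((c0Pair Y Y₀).obj A) B) ∧
      IsCommMonoid (AsymMor (roeQuot X (nearPoints δ X Y₀)) A B)) ∧
    ∃ Φ : ∀ A B : CStarAlg.{u},
        AsymMor (𝟭 CStarAlg) ((c0Pair Y Y₀).obj A) B ≃+
          AsymMor (roeQuot X (nearPoints δ X Y₀)) A B,
      -- naturality in `A`
      (∀ (A A' B : CStarAlg.{u}) (f : A' ⟶ A) (x : AsymMor (𝟭 CStarAlg) ((c0Pair Y Y₀).obj A) B),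
        Φ A' B (AsymMor.pre _ ((c0Pair Y Y₀).map f) x) = AsymMor.pre _ f (Φ A B x)) ∧
      -- naturality in `B`
      (∀ (A B B' : CStarAlg.{u}) (g : B ⟶ B') (x : AsymMor (𝟭 CStarAlg) ((c0Pair Y Y₀).obj A) B),
        Φ A B' (AsymMor.post _ g x) = AsymMor.post _ g (Φ A B x)) ∧
      -- for separable `A`, the first stages already are the colimits
      ∀ A B : CStarAlg.{u}, TopologicalSpace.SeparableSpace A →
        Function.Bijective (toColim (𝟭 CStarAlg) ((c0Pair Y Y₀).obj A) B 0) ∧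
        Function.Bijective (toColim (roeQuot X (nearPoints δ X Y₀)) A B 0) ∧
        ∃ e : Stage (𝟭 CStarAlg) ((c0Pair Y Y₀).obj A) B 0 ≃+
            Stage (roeQuot X (nearPoints δ X Y₀)) A B 0,
          ∀ x, Φ A B (toColim _ _ _ 0 x) = toColim _ _ _ 0 (e x) := by

  obtain ⟨G⟩ := exists_geometry hY₀ hsc hδ hX hgeom
  have he := fun A B : CStarAlg.{u} => exists_addEquiv_colim (B := B) (G.toRoe A B) (G.ofRoe A B)
    (G.toRoe_mapNat A B) (G.toRoe_add A B) (G.toRoe_ofRoe A B) (G.ofRoe_toRoe A B)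
  choose Φ hΦ using he
  refine ⟨fun A B => ⟨fun k => ⟨SumMor.isCommMonoid _ _ _, SumMor.isCommMonoid _ _ _⟩,
    AsymMor.isCommMonoid _ _ _, AsymMor.isCommMonoid _ _ _⟩, Φ, fun A A' B f => ?_, fun A B B' g => ?_,
    fun A B hA => ?_⟩
  · refine DirectLimit.induction _ fun k x => ?_
    refine (hΦ A' B k _).trans (Eq.trans ?_ (congrArg (AsymMor.pre _ f) (hΦ A B k x)).symm)
    refine congrArg (toColim _ _ _ k) ?_
    obtain ⟨φ⟩ := x
    refine congrArg (GenMor.mk (compact ⋙ (asymPow k ⋙ roeQuot X (nearPoints δ X Y₀)))) ?_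
    exact G.unitMor_map_comp f φ
  · refine DirectLimit.induction _ fun k x => ?_
    refine (hΦ A B' k _).trans (Eq.trans ?_ (congrArg (AsymMor.post _ g) (hΦ A B k x)).symm)
    refine congrArg (toColim _ _ _ k) ?_
    obtain ⟨φ⟩ := x
    refine congrArg (GenMor.mk (compact ⋙ (asymPow k ⋙ roeQuot X (nearPoints δ X Y₀)))) ?_
    exact G.unitMor_comp_map φ _
  · have hA' : TopologicalSpace.SeparableSpace ((c0Pair Y Y₀).obj A) := C0Pair.separableSpace (E := A)
    have h1 : Function.Bijective (toColim (𝟭 CStarAlg) ((c0Pair Y Y₀).obj A) B 0) :=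
      toColim_zero_bijective preservesSurj_id countablyDetermined_id
    have h2 : Function.Bijective (toColim (roeQuot X (nearPoints δ X Y₀)) A B 0) :=
      toColim_zero_bijective G.preservesSurj G.countablyDetermined
    have h3 : Function.Bijective (G.toRoe A B 0) := by
      refine (Function.Bijective.of_comp_iff' h2 _).1 ?_
      have : toColim (roeQuot X (nearPoints δ X Y₀)) A B 0 ∘ G.toRoe A B 0 = Φ A B ∘ toColim _ _ _ 0 :=
        funext fun x => (hΦ A B 0 x).symm
      rw [this]
      exact (Φ A B).bijective.comp h1
    exact ⟨h1, h2, { Equiv.ofBijective _ h3 with map_add' := G.toRoe_add A B 0 }, fun x => hΦ A B 0 x⟩
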